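/- \textbf{Theorem (Rouquier).} Let $d\ge 1$, $n\ge 0$, $\zeta=e^{2\pi\sqrt{-1}/d}$, and let $W=G(d,1,n)$ act on $V=\mathbb C^n$ (basis $e_i$, dual basis $x_i$) as the group of monomial matrices whose non-zero entries are $d$-th roots of unity. Its reflecting hyperplanes are $H_i=\operatorname{Ker}x_i$ ($1\le i\le n$; only if $d>1$) and $H_{ij;\alpha}=\operatorname{Ker}(x_i-\zeta^\alpha x_j)$ ($i<j$, $0\le\alpha<d$). For $H=H_i$ put $\alpha_H=x_i$, $v_H=e_i$, $e_H=d$ and let $w_H$ be $e_i\mapsto\zeta e_i$, fixing the other $e_k$; for $H=H_{ij;\alpha}$ put $\alpha_H=x_i-\zeta^\alpha x_j$, $v_H=e_i-\zeta^{-\alpha}e_j$, $e_H=2$ and let $w_H$ be $e_i\mapsto\zeta^{-\alpha}e_j$, $e_j\mapsto\zeta^\alpha e_i$, fixing the other $e_k$. Put $\epsilon_{H,k}=\frac1{e_H}\sum_{a=0}^{e_H-1}e^{2\pi\sqrt{-1}ak/e_H}w_H^a$. Let $R$ be a commutative $\mathbb C$-algebra which is a regular local ring (so its residue field $F$ contains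 $\mathbb C$), and let $\kappa_1,\dots,\kappa_{d-1},h\in R$. Put $\kappa_0=\kappa_d=0$, $h_1=h$, $h_0=h_2=0$, and $c_{H,k}=\kappa_k$ if $H=H_i$, $c_{H,k}=h_k$ if $H=H_{ij;\alpha}$. Let $\gamma_H=e_H\sum_{k=0}^{e_H-1}(c_{H,k+1}-c_{H,k})\epsilon_{H,k}$, $a_H=e_H\sum_{k=1}^{e_H-1}c_{H,k}\epsilon_{H,k}$ and $z=\sum_Ha_H$ in $RW$. The rational Cherednik algebra $H_R(\underline\kappa,h)$ is the quotient of the $R$-algebra $(T(V\oplus V^*)\sharp W)\otimes_{\mathbb C}R$ by the relations $$[y,\xi]=\langle\xi,y\rangle+\sum_{H}\frac{\langle\xi,v_H\rangle\langle\alpha_H,y\rangle}{\langle\alpha_H,v_H\rangle}\gamma_H,\qquad [y,y']=0,\qquad[\xi,\xi']=0\qquad(y,y'\in V,\ \xi,\xi'\in V^*).$$ Let $\mathcal O(R)$ be the full subcategory of $H_R(\underline\kappa,h)$-modules that are finitely generated and on which $S(V)$ acts locally nilpotently (each element is killed by a power of the augmentation ideal of $S(V)$). For $E\in\operatorname{Irr}W$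 (the irreducible complex representations up to isomorphism) let $\Delta(E)=H_R(\underline\kappa,h)\otimes_{(S(V)\sharp W)\otimes_{\mathbb C} R}(E\otimes_{\mathbb C}R)$, where $V$ acts on $E$ by $0$. Let $c_E\in R$ be the scalar by which $z$ acts on $E\otimes_{\mathbb C}R$, $\overline{c_E}$ its image in $F$, and preorder $\operatorname{Irr}W$ by $E_1\le E_2$ iff $-\overline{c_{E_1}}+\mathbb Z_{\ge0}\subseteq-\overline{c_{E_2}}+\mathbb Z_{\ge0}$; write $E_1<E_2$ if $E_1\le E_2$ and $E_2\not\le E_1$. Then $\mathcal O(R)$, with the preordered set $\operatorname{Irr}W$, is a split highest weight category over $R$ with standard objects $\Delta(E)$. That is: $\operatorname{Irr}W$ is finite, all $\Delta(E)$ lie in $\mathcal O(R)$, $\mathcal O(R)$ is an abelian subcategory of $H_R(\underline\kappa,h)\text{-}\mathrm{Mod}$ (it contains zero and is closed under finite products, kernels and cokernels), and \begin{enumerate} \item[(i)] each $\Delta(E)$ is a projective $R$-module; \item[(ii)] if $\operatorname{Hom}(\Delta(E'),\Delta(E''))\ne0$ then $E'\le E''$; \item[(iii)] if $N\in\mathcal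 O(R)$ and $\operatorname{Hom}(\Delta(E),N)=0$ for all $E$, then $N=0$; \item[(iv)] for each $E$ there are a projective object $P(E)$ of $\mathcal O(R)$ and a surjection $P(E)\to\Delta(E)$ whose kernel has a finite filtration with all subquotients isomorphic to modules $\Delta(E')$ with $E'>E$; \item[(v)] $R\to\operatorname{End}(\Delta(E))$ is an isomorphism for each $E$; \item[(vi)] there are an $R$-algebra $A$, finitely generated and projective as an $R$-module, and an $R$-linear equivalence from $\mathcal O(R)$ to the category of finitely generated $A$-modules, under which each $\Delta(E)$ corresponds to an $A$-module that is projective over $R$. \end{enumerate} -/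

import Mathlib

open CategoryTheory TensorProduct

universe u v w

noncomputable section

/-! ## Highest weight categories over a commutative ring -/

namespace HighestWeight

section Linear

variable (R : Type u) [CommRing R] {A : Type v} [Ring A] [Algebra R A]

/-- A module over an `R`-algebra `A`, regarded as an `R`-module along `R → A`. -/
@[reducible]
def restrictModule (M : ModuleCat.{w} A) : Module R M :=
  Module.compHom M (algebraMap R A)

/-- The category of modules over an `R`-algebra is `R`-linear. -/
instance moduleCatLinear : Linear R (ModuleCat.{w} A) :=
  letI (M : ModuleCat.{w} A) : Module R M := restrictModule R M
  haveI (M : ModuleCat.{w} A) : SMulCommClass A R M :=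
    ⟨fun a r m => by
      change a • (algebraMap R A r • m) = algebraMap R A r • (a • m)
      rw [smul_smul, smul_smul, Algebra.commutes]⟩
  { homModule := fun _ _ => inferInstance
    smul_comp := fun X Y Z r f g => by
      ext x
      exact (g.hom.map_smul (algebraMap R A r) (f.hom x) :)
    comp_smul := fun X Y Z f r g => by
      ext x
      rfl }

end Linear

section Filtration

variable {A : Type v} [Ring A] {Λ : Type w}

/-- `M` has a finite filtration `0 = F 0 ⊆ F 1 ⊆ ⋯ ⊆ F m = M` by submodules in which every
subquotient `F (i + 1) / F i` is isomorphic to `Δ μ` for some `μ ∈ S`. -/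
def HasFiniteFiltration (Δ : Λ → ModuleCat.{u} A) (S : Set Λ)
    (M : Type u) [AddCommGroup M] [Module A M] : Prop :=
  ∃ (m : ℕ) (F : ℕ → Submodule A M), Monotone F ∧ F 0 = ⊥ ∧ F m = ⊤ ∧
    ∀ i < m, ∃ μ ∈ S,
      Nonempty ((F (i + 1) ⧸ (F i).submoduleOf (F (i + 1))) ≃ₗ[A] Δ μ)

end Filtration

section HighestWeight

variable (R : Type u) [CommRing R] {A : Type u} [Ring A] [Algebra R A] {Λ : Type w}

/-- `(C, Λ)` is a highest weight category in the weak sense with standard objects `Δ`.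
Here `C` is a full subcategory of the category of modules over the `R`-algebra `A`, and it is
an abelian subcategory: it contains zero and is closed under finite products, kernels and
cokernels, so that exactness in `C` is exactness of modules. (In particular the terms of a
`Δ`-filtration of an object of `C` lie again in `C`, being iterated kernels.) -/
structure IsWeakHighestWeight (C : ObjectProperty (ModuleCat.{u} A)) (ord : Preorder Λ)
    (Δ : Λ → ModuleCat.{u} A) (mem : ∀ l, C (Δ l)) : Prop where
  finite : Finite Λ
  containsZero : C.ContainsZero
  closedProducts : C.IsClosedUnderFiniteProducts
  closedKernels : C.IsClosedUnderKernels
  closedCokernels : C.IsClosedUnderCokernels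
  /-- standard objects are projective over `R` -/
  projective_standard : ∀ l, letI := restrictModule R (Δ l); Module.Projective R (Δ l)
  le_of_hom_ne_zero : ∀ (l₁ l₂ : Λ) (f : Δ l₁ ⟶ Δ l₂), f ≠ 0 → ord.le l₁ l₂
  isZero_of_hom_eq_zero : ∀ N : ModuleCat.{u} A, C N →
    (∀ (l : Λ) (f : Δ l ⟶ N), f = 0) → Limits.IsZero N
  /-- every `Δ l` is a quotient of a projective object of `C` such that the kernel has a finite
  filtration by objects `Δ μ` with `μ > l` -/
  exists_projective : ∀ l : Λ, ∃ (P : C.FullSubcategory)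
    (p : P ⟶ (⟨Δ l, mem l⟩ : C.FullSubcategory)),
    Projective P ∧ Function.Surjective p.hom.hom ∧
      HasFiniteFiltration Δ {μ | ord.lt l μ} (LinearMap.ker p.hom.hom)

/-- `(C, Λ)` is a highest weight category over `R`: it is one in the weak sense, and there is an
`R`-linear equivalence from `C` to the category of finitely generated modules over some `R`-algebra
`B` which is finitely generated and projective as an `R`-module. The standard objects are also
required to be projective over `R` when they are regarded as `B`-modules. -/
structure IsHighestWeight (C : ObjectProperty (ModuleCat.{u} A)) (ord : Preorder Λ)
    (Δ : Λ → ModuleCat.{u} A) (mem : ∀ l, C (Δ l)) : Prop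
    extends IsWeakHighestWeight R C ord Δ mem where
  exists_equivalence : ∃ (B : Type u) (_ : Ring B) (_ : Algebra R B),
    Module.Finite R B ∧ Module.Projective R B ∧
      ∃ e : C.FullSubcategory ≌ FGModuleCat.{u} B, e.functor.Linear R ∧
        ∀ l, letI := restrictModule R (e.functor.obj ⟨Δ l, mem l⟩).obj
          Module.Projective R (e.functor.obj ⟨Δ l, mem l⟩).obj

/-- A highest weight category is split if `R → End(Δ l)` is an isomorphism for all `l`. -/
structure IsSplitHighestWeight (C : ObjectProperty (ModuleCat.{u} A)) (ord : Preorder Λ)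
    (Δ : Λ → ModuleCat.{u} A) (mem : ∀ l, C (Δ l)) : Prop
    extends IsHighestWeight R C ord Δ mem where
  end_standard : ∀ l, Function.Bijective (algebraMap R (End (Δ l)))

end HighestWeight

end HighestWeight

/-! ## Irreducible complex representations of a group -/

namespace IrrepClass

variable (G : Type) [Group G]

/-- Isomorphism of irreducible complex representations. -/
def isoSetoid : Setoid {E : Rep.{0} ℂ G // E.ρ.IsIrreducible} where
  r E E' := Nonempty (E.1 ≅ E'.1)
  iseqv := ⟨fun E => ⟨Iso.refl E.1⟩, fun ⟨f⟩ => ⟨f.symm⟩, fun ⟨f⟩ ⟨g⟩ => ⟨f ≪≫ g⟩⟩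

/-- `Irr G`, the set of isomorphism classes of irreducible complex representations of `G`. -/
def Irr : Type 1 := Quotient (isoSetoid G)

variable {G}

/-- A representation in the given isomorphism class. -/
def Irr.rep (E : Irr G) : Rep.{0} ℂ G := (Quotient.out E).1

end IrrepClass

/-! ## The complex reflection group `G(d,1,n)` -/

namespace Cherednik

open IrrepClass

section Group

variable (d n : ℕ)

/-- `ζ = exp(2π√-1/d)`. -/
def zeta : ℂ := Complex.exp (2 * Real.pi * Complex.I / d)

theorem zeta_ne_zero : zeta d ≠ 0 := Complex.exp_ne_zero _

/-- `V = ℂⁿ`, with standard basis `e k = Pi.single k 1`. -/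
abbrev V : Type := Fin n → ℂ

variable {n}

/-- The linear automorphism of `V` with `e k ↦ ζ ^ (a k) • e (σ k)`. -/
def monomialEquiv (σ : Equiv.Perm (Fin n)) (a : Fin n → ℤ) : V n ≃ₗ[ℂ] V n where
  toFun y l := zeta d ^ a (σ.symm l) * y (σ.symm l)
  invFun y k := zeta d ^ (-a k) * y (σ k)
  map_add' y y' := by ext l; simp [mul_add]
  map_smul' c y := by ext l; simp; ring
  left_inv y := by
    ext k
    simp [zpow_neg, zpow_ne_zero, zeta_ne_zero]
  right_inv y := by
    ext k
    simp [zpow_neg, zpow_ne_zero, zeta_ne_zero]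

theorem monomialEquiv_single (σ : Equiv.Perm (Fin n)) (a : Fin n → ℤ) (k : Fin n) :
    monomialEquiv d σ a (Pi.single k 1) = zeta d ^ a k • (Pi.single (σ k) 1 : V n) := by
  ext l
  by_cases h : l = σ k
  · subst h; simp [monomialEquiv]
  · have h' : σ.symm l ≠ k := fun e => h (by rw [← e]; simp)
    simp [monomialEquiv, h, h']

theorem monomialEquiv_mul (σ τ : Equiv.Perm (Fin n)) (a b : Fin n → ℤ) :
    monomialEquiv d σ a * monomialEquiv d τ b =
      monomialEquiv d (σ * τ) (fun k => b k + a (τ k)) := by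
  ext y l
  simp [monomialEquiv, zpow_add₀ (zeta_ne_zero d), Equiv.Perm.mul_def]
  ring

theorem monomialEquiv_one : monomialEquiv d (1 : Equiv.Perm (Fin n)) 0 = 1 := by
  ext y l
  simp [monomialEquiv, Equiv.Perm.one_def]

variable (n)

/-- `W = G(d,1,n)`, the group of monomial automorphisms of `V` whose non-zero entries are powers
of `ζ`. -/
def W : Subgroup (V n ≃ₗ[ℂ] V n) where
  carrier := {g | ∃ σ a, g = monomialEquiv d σ a}
  mul_mem' := by
    rintro _ _ ⟨σ, a, rfl⟩ ⟨τ, b, rfl⟩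
    exact ⟨_, _, monomialEquiv_mul d σ τ a b⟩
  one_mem' := ⟨1, 0, (monomialEquiv_one d).symm⟩
  inv_mem' := by
    rintro _ ⟨σ, a, rfl⟩
    refine ⟨σ⁻¹, fun k => - a (σ⁻¹ k), ?_⟩
    rw [inv_eq_iff_mul_eq_one, monomialEquiv_mul]
    convert monomialEquiv_one (n := n) d using 2
    · simp
    · ext k; simp

variable {n}

/-- `t i : e i ↦ ζ • e i`, fixing the other basis vectors. -/
def t (i : Fin n) : W d n := ⟨monomialEquiv d 1 (Pi.single i 1), _, _, rfl⟩

/-- `s i j α : e i ↦ ζ⁻ᵅ • e j`, `e j ↦ ζᵅ • e i`, fixing the other basis vectors (`i ≠ j`). -/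
def s (i j : Fin n) (α : ℕ) : W d n :=
  ⟨monomialEquiv d (Equiv.swap i j) (Pi.single i (-(α : ℤ)) + Pi.single j (α : ℤ)), _, _, rfl⟩

variable (n)

/-- The reflecting hyperplanes: `inl i` is `H_i = Ker x_i`, and `inr ((i, j), α)`, with `i < j` and
`0 ≤ α < d`, is `H_{ij;α} = Ker (x_i - ζ ^ α x_j)`. If `d = 1` the `H_i` are not reflecting
hyperplanes, but then their contributions `γ` and `a` below are zero. -/
abbrev Hyp : Type := Fin n ⊕ ({p : Fin n × Fin n // p.1 < p.2} × Fin d)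

variable {d n}

/-- `e_H`, the order of the pointwise stabilizer of `H`. -/
def hypOrder : Hyp d n → ℕ
  | .inl _ => d
  | .inr _ => 2

/-- The root `α_H`. -/
def root : Hyp d n → Module.Dual ℂ (V n)
  | .inl i => LinearMap.proj i
  | .inr (p, α) => LinearMap.proj p.1.1 - zeta d ^ (α : ℕ) • LinearMap.proj p.1.2

/-- The coroot `v_H`. -/
def coroot : Hyp d n → V n
  | .inl i => Pi.single i 1
  | .inr (p, α) => Pi.single p.1.1 1 - (zeta d ^ (α : ℕ))⁻¹ • Pi.single p.1.2 1

/-- The generator `w_H` of the pointwise stabilizer of `H`, of determinant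
`exp(2π√-1/e_H)`. -/
def hypGen : Hyp d n → W d n
  | .inl i => t d i
  | .inr (p, α) => s d p.1.1 p.1.2 α

/-- The action of `W` on `V*`: `w(ξ) = ξ ∘ w⁻¹`. -/
def dualAct (g : W d n) (ξ : Module.Dual ℂ (V n)) : Module.Dual ℂ (V n) :=
  ξ ∘ₗ ((g⁻¹ : W d n) : V n ≃ₗ[ℂ] V n).toLinearMap

end Group

/-! ## The rational Cherednik algebra -/

section Algebra

variable (d n : ℕ) {R : Type u} [CommRing R] [Algebra ℂ R]

variable {d n} in
/-- The parameters `c_{H,k}`. The parameters `κ_k`, for `0 ≠ k ∈ ℤ/dℤ`, and `h` are given; one puts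
`κ_0 = 0`, `h_1 = h` and `h_0 = 0`, with indices in `ℤ/dℤ` and `ℤ/2ℤ` respectively. -/
def cParam (κ : {k : ZMod d // k ≠ 0} → R) (h : R) (H : Hyp d n) (k : ℕ) : R :=
  open Classical in
  match H with
  | .inl _ => if hk : (k : ZMod d) = 0 then 0 else κ ⟨(k : ZMod d), hk⟩
  | .inr _ => if (k : ZMod 2) = 0 then 0 else h

variable {d n} in
/-- `ε_{H,k} = (1/e_H) ∑_{0 ≤ a < e_H} exp(2π√-1 a k / e_H) w_H ^ a`, in the group algebra `RW`. -/
def eps (R : Type u) [CommRing R] [Algebra ℂ R] (H : Hyp d n) (k : ℕ) : MonoidAlgebra R (W d n) :=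
  ∑ a ∈ Finset.range (hypOrder H), MonoidAlgebra.single (hypGen H ^ a)
    (algebraMap ℂ R ((1 / (hypOrder H : ℂ)) *
      Complex.exp (2 * Real.pi * Complex.I * a * k / (hypOrder H : ℂ))))

variable {d n} in
/-- `γ_H = e_H ∑_{0 ≤ k < e_H} (c_{H,k+1} - c_{H,k}) ε_{H,k}`. -/
def gammaElt (κ : {k : ZMod d // k ≠ 0} → R) (h : R) (H : Hyp d n) : MonoidAlgebra R (W d n) :=
  (hypOrder H : R) • ∑ k ∈ Finset.range (hypOrder H),
    (cParam κ h H (k + 1) - cParam κ h H k) • eps R H k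

variable {d n} in
/-- `a_H = e_H ∑_{1 ≤ k < e_H} c_{H,k} ε_{H,k}`. -/
def aElt (κ : {k : ZMod d // k ≠ 0} → R) (h : R) (H : Hyp d n) : MonoidAlgebra R (W d n) :=
  (hypOrder H : R) • ∑ k ∈ Finset.Ico 1 (hypOrder H), cParam κ h H k • eps R H k

/-- `z = ∑_H a_H ∈ RW`. -/
def zElt (κ : {k : ZMod d // k ≠ 0} → R) (h : R) : MonoidAlgebra R (W d n) :=
  ∑ H : Hyp d n, aElt κ h H

/-- Generators of the rational Cherednik algebra. -/
inductive Gen : Type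
  | vec (y : V n)
  | cov (ξ : Module.Dual ℂ (V n))
  | grp (g : W d n)

/-- The free `R`-algebra on the elements of `V`, `V*` and `W`. -/
abbrev FreeAlg (R : Type u) [CommRing R] : Type u := FreeAlgebra R (Gen d n)

/-- The `R`-linear extension to `RW` of the inclusion of `W` in the free algebra. -/
def grpLin (x : MonoidAlgebra R (W d n)) : FreeAlg d n R :=
  x.coeff.sum fun g r => r • FreeAlgebra.ι R (Gen.grp g)

variable {d n} in
/-- The defining relations of the rational Cherednik algebra. The relations from `vec_add` to
`grp_cov` present the algebra `(T(V ⊕ V*) ♯ W) ⊗ R`. -/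
inductive Rel (κ : {k : ZMod d // k ≠ 0} → R) (h : R) : FreeAlg d n R → FreeAlg d n R → Prop
  | vec_add (y y' : V n) : Rel κ h (FreeAlgebra.ι R (Gen.vec (y + y')))
      (FreeAlgebra.ι R (Gen.vec y) + FreeAlgebra.ι R (Gen.vec y'))
  | vec_smul (c : ℂ) (y : V n) : Rel κ h (FreeAlgebra.ι R (Gen.vec (c • y)))
      (algebraMap ℂ R c • FreeAlgebra.ι R (Gen.vec y))
  | cov_add (ξ ξ' : Module.Dual ℂ (V n)) : Rel κ h (FreeAlgebra.ι R (Gen.cov (ξ + ξ')))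
      (FreeAlgebra.ι R (Gen.cov ξ) + FreeAlgebra.ι R (Gen.cov ξ'))
  | cov_smul (c : ℂ) (ξ : Module.Dual ℂ (V n)) : Rel κ h (FreeAlgebra.ι R (Gen.cov (c • ξ)))
      (algebraMap ℂ R c • FreeAlgebra.ι R (Gen.cov ξ))
  | grp_one : Rel κ h (FreeAlgebra.ι R (Gen.grp 1)) 1
  | grp_mul (g g' : W d n) : Rel κ h (FreeAlgebra.ι R (Gen.grp (g * g')))
      (FreeAlgebra.ι R (Gen.grp g) * FreeAlgebra.ι R (Gen.grp g'))
  | grp_vec (g : W d n) (y : V n) : Rel κ h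
      (FreeAlgebra.ι R (Gen.grp g) * FreeAlgebra.ι R (Gen.vec y) * FreeAlgebra.ι R (Gen.grp g⁻¹))
      (FreeAlgebra.ι R (Gen.vec ((g : V n ≃ₗ[ℂ] V n) y)))
  | grp_cov (g : W d n) (ξ : Module.Dual ℂ (V n)) : Rel κ h
      (FreeAlgebra.ι R (Gen.grp g) * FreeAlgebra.ι R (Gen.cov ξ) * FreeAlgebra.ι R (Gen.grp g⁻¹))
      (FreeAlgebra.ι R (Gen.cov (dualAct g ξ)))
  | vec_comm (y y' : V n) : Rel κ h
      (FreeAlgebra.ι R (Gen.vec y) * FreeAlgebra.ι R (Gen.vec y'))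
      (FreeAlgebra.ι R (Gen.vec y') * FreeAlgebra.ι R (Gen.vec y))
  | cov_comm (ξ ξ' : Module.Dual ℂ (V n)) : Rel κ h
      (FreeAlgebra.ι R (Gen.cov ξ) * FreeAlgebra.ι R (Gen.cov ξ'))
      (FreeAlgebra.ι R (Gen.cov ξ') * FreeAlgebra.ι R (Gen.cov ξ))
  | vec_cov (y : V n) (ξ : Module.Dual ℂ (V n)) : Rel κ h
      (FreeAlgebra.ι R (Gen.vec y) * FreeAlgebra.ι R (Gen.cov ξ) -
        FreeAlgebra.ι R (Gen.cov ξ) * FreeAlgebra.ι R (Gen.vec y))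
      (algebraMap R (FreeAlg d n R) (algebraMap ℂ R (ξ y)) +
        ∑ H : Hyp d n, algebraMap ℂ R (ξ (coroot H) * root H y / root H (coroot H)) •
          grpLin d n (gammaElt κ h H))

/-- The rational Cherednik algebra `H_R(κ, h)` of `W = G(d,1,n)`. -/
def Alg (κ : {k : ZMod d // k ≠ 0} → R) (h : R) : Type u :=
  RingQuot (Rel (n := n) κ h)

instance (κ : {k : ZMod d // k ≠ 0} → R) (h : R) : Ring (Alg d n κ h) :=
  inferInstanceAs (Ring (RingQuot (Rel (n := n) κ h)))

instance (κ : {k : ZMod d // k ≠ 0} → R) (h : R) : Algebra R (Alg d n κ h) :=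
  inferInstanceAs (Algebra R (RingQuot (Rel (n := n) κ h)))

variable {d n} in
/-- The image of a generator in the rational Cherednik algebra. -/
def gen (κ : {k : ZMod d // k ≠ 0} → R) (h : R) (g : Gen d n) : Alg d n κ h :=
  RingQuot.mkAlgHom R (Rel κ h) (FreeAlgebra.ι R g)

/-! ## Category `O` and its standard objects -/

/-- Category `O`: the finitely generated `H_R(κ, h)`-modules on which `S(V)` acts locally
nilpotently, i.e. each element is annihilated by some power of the augmentation ideal of `S(V)`. -/
def categoryO (κ : {k : ZMod d // k ≠ 0} → R) (h : R) :
    ObjectProperty (ModuleCat.{u} (Alg d n κ h)) := fun M =>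
  Module.Finite (Alg d n κ h) M ∧
    ∀ m : M, ∃ r : ℕ, ∀ y : Fin r → V n,
      (List.ofFn fun j => gen κ h (Gen.vec (y j))).prod • m = 0

variable {d n}

/-- The `H_R(κ, h)`-submodule of `H_R(κ, h) ⊗_R (R ⊗_ℂ E)` generated by the elements
`w ⊗ m - 1 ⊗ w m` and `y ⊗ m`, for `w ∈ W` and `y ∈ V`. -/
def inductionRel (κ : {k : ZMod d // k ≠ 0} → R) (h : R) (E : Rep.{0} ℂ (W d n)) :
    Submodule (Alg d n κ h) (Alg d n κ h ⊗[R] (R ⊗[ℂ] E.V)) :=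
  Submodule.span (Alg d n κ h)
    ({x | ∃ (g : W d n) (m : R ⊗[ℂ] E.V),
        x = gen κ h (Gen.grp g) ⊗ₜ[R] m - 1 ⊗ₜ[R] (E.ρ g).baseChange R m} ∪
      {x | ∃ (y : V n) (m : R ⊗[ℂ] E.V), x = gen κ h (Gen.vec y) ⊗ₜ[R] m})

/-- The standard module `Δ(E)`, i.e. `E ⊗_ℂ R` induced from `(S(V) ♯ W) ⊗_ℂ R`, where `V` acts on
`E` by zero. As `(S(V) ♯ W) ⊗_ℂ R` is generated by `V` and `W` over `R`, the tensor product over it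
is obtained from that over `R` by imposing the relations above. -/
def standard (κ : {k : ZMod d // k ≠ 0} → R) (h : R) (E : Irr (W d n)) :
    ModuleCat.{u} (Alg d n κ h) :=
  ModuleCat.of (Alg d n κ h)
    ((Alg d n κ h ⊗[R] (R ⊗[ℂ] E.rep.V)) ⧸ inductionRel κ h E.rep)

/-- The action of an element of `RW` on `R ⊗_ℂ E`. -/
def groupAlgAct (E : Rep.{0} ℂ (W d n)) (x : MonoidAlgebra R (W d n)) :
    R ⊗[ℂ] E.V →ₗ[R] R ⊗[ℂ] E.V :=
  x.coeff.sum fun g r => r • (E.ρ g).baseChange R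

/-- `c_E ∈ R`, the scalar by which the central element `z` of `RW` acts on `R ⊗_ℂ E`. -/
def cScalar (κ : {k : ZMod d // k ≠ 0} → R) (h : R) (E : Irr (W d n)) : R :=
  Classical.epsilon fun c : R =>
    ∀ m : R ⊗[ℂ] E.rep.V, groupAlgAct E.rep (zElt d n κ h) m = c • m

/-- The preorder on `Irr W`: `E₁ ≤ E₂` if `a₁ + ℤ_{≥0} ⊆ a₂ + ℤ_{≥0}`, where `a_i` is the image of
`-c_{E_i}` in the residue field of `R`. -/
@[reducible]
def irrPreorder [IsLocalRing R] (κ : {k : ZMod d // k ≠ 0} → R) (h : R) :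
    Preorder (Irr (W d n)) where
  le E₁ E₂ :=
    Set.range (fun k : ℕ => IsLocalRing.residue R (-cScalar κ h E₁) + k) ⊆
      Set.range (fun k : ℕ => IsLocalRing.residue R (-cScalar κ h E₂) + k)
  le_refl _ := subset_rfl
  le_trans _ _ _ h₁ h₂ := h₁.trans h₂

end Algebra

end Cherednik

end

/-!
# Category `O` of the rational Cherednik algebra of `G(d,1,n)`

Write `H` for the rational Cherednik algebra, `R[V]` for the polynomial ring generated by `V*`, and
`F` for the residue field of `R`. Everything rests on one grading device, the Euler element `eu = ∑
x_i y_i - z`. It commutes with `W`, and its commutators with `ξ ∈ V*` and `y ∈ V` are `ξ` and `-y`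
(`euler_mul_cov`, `euler_mul_vec`, `euler_mul_grp`).

*Weights.* On vectors killed by `V` that form a copy of `E ∈ Irr W`, the Euler element acts by
`-c_E`. As `y ∈ V` lowers the eigenvalue by one, on a locally nilpotent module each vector is
annihilated by a product of factors `eu - a` with `a ∈ R` and residue in `{-c_E + j | E ∈ Irr W, j ∈
ℕ} ⊆ F` (`exists_splitPoly_nilpotentPart`). Over a local ring, `X - a` and `X - b` are comaximal as
soon as `a` and `b` have distinct residues, so that the module is the direct sum of generalised
weight spaces indexed by `F`, with projections `weightProj` compatible with all homomorphisms and
with `W`. Below a given weight only finitely many weights are possible, as `Irr W` is finite and `F`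
has characteristic zero; so a vector of weight `a` is killed by `S(V)_{≥ k}` with `k = depth a`
depending on `a` only (`LocallyNilpotent.mem_nilpotentPart_depth`).

*Standard modules.* For a representation `N` of `S(V) ♯ W`, the algebra `H` acts on `R[V] ⊗ N`
through Dunkl operators (`inducedRealisation`): these are defined by dividing the difference of two
actions of `a_H` by `α_H`, and the relations are checked on constants and propagated by the
commutators with `V*`. Hence `Δ(E)` is `R[V] ⊗ E`, free over `R[V]` and so projective over `R`, with
weights `-c_E + j` and lowest weight space `R ⊗ E`. This gives the order condition on homomorphisms
and, with Schur's lemma, `End Δ(E) = R`. A nonzero locally nilpotent module contains a copy of some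
`E` killed by `V`, and so receives a nonzero map from `Δ(E)` (`exists_standard_hom_ne_zero`).

*Projective objects.* The module induced from `S(V)/S(V)_{≥ k} ⊗ E` represents equivariant maps from
`E` to vectors killed by `S(V)_{≥ k}`. For `k = depth (-c_E)`, projecting its generators to the
weight `-c_E` gives an idempotent endomorphism, whose image `P(E)` (`Cover`) represents `M ↦
Hom_W(E, M_{-c_E})`. That functor is exact, as `W` is finite and weight projections commute with
homomorphisms, so that `P(E)` is projective in `O` (`exists_cover_lift`). It maps onto `Δ(E)`.

*The filtration.* The surjection `P(E) → Δ(E)` splits over `R[V]`, and its kernel is a finitely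
generated projective `R[V]`-module which, because `P(E)` is generated by `E` in weight `-c_E` and
`V` lowers weights, is generated in weights strictly below `-c_E`. Reducing such a module `K` modulo
the variables gives finitely generated projective `R`-modules in each weight, on which `W` acts;
each of them is a direct sum of modules `Hom_W(E', -) ⊗ E'`, and the multiplicity spaces are free
because `R` is local. Lifting bases yields equivariant maps `E' → K` that generate `K`, and jointly
freely so because a surjection from a finite free `R[V]`-module to a projective one is injective
once it is so modulo the variables (`injective_of_injective_mod_vars`). Ordering the maps by
increasing weight filters `K`: since `V` lowers weights, the span over `R[V]` of an initial segment
is stable under `H`, and the quotients are the `Δ(E')` (`hasFiniteFiltration`). A lower weight means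
a larger element of the preorder.

*The equivalence.* The sum `P` of the `P(E)` is a projective generator: the quotient of `M ∈ O` by
the images of the maps from `P` receives no nonzero map from a `Δ(E)`, hence vanishes. Objects of
`O` are finitely generated over `R[V]`, so that their weight spaces are finitely generated over the
noetherian ring `R`, and projective if the object is. Therefore `Hom(P, M)`, a sum of the modules
`Hom_W(E, M_{-c_E})`, is a finitely generated `R`-module and is projective if `M` is; this applies
to `M = P` and to `M = Δ(E)`. The equivalence with finitely generated modules over `A = End(P)ᵒᵖ` is
then formal (`ProjectiveGenerator.exists_equivalence`).
-/

noncomputable section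

/-! ### Generalised weight spaces over a local ring -/

namespace WeightSpace

open Polynomial IsLocalRing

section

variable {R : Type*} [CommRing R]

/-- The monic polynomial with the given multiset of roots. -/
def splitPoly (s : Multiset R) : R[X] := (s.map fun r => X - C r).prod

@[simp] theorem splitPoly_zero : splitPoly (0 : Multiset R) = 1 := by simp [splitPoly]

theorem splitPoly_cons (r : R) (s : Multiset R) :
    splitPoly (r ::ₘ s) = (X - C r) * splitPoly s := by simp [splitPoly]

theorem splitPoly_add (s t : Multiset R) : splitPoly (s + t) = splitPoly s * splitPoly t := by
  simp [splitPoly]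

variable {M M' : Type*} [AddCommGroup M] [Module R M] [AddCommGroup M'] [Module R M']

/-- `T` is locally annihilated by polynomials that split over `R`. -/
def LocallySplit (T : Module.End R M) : Prop :=
  ∀ m, ∃ s : Multiset R, aeval T (splitPoly s) m = 0

/-- A map intertwining `T` with `T' - c` shifts the roots of annihilating polynomials by `c`. -/
theorem aeval_splitPoly_shift {T : Module.End R M} {T' : Module.End R M'} {f : M →ₗ[R] M'} {c : R}
    (hf : ∀ m, T' (f m) = f (T m) + c • f m) (s : Multiset R) (m : M) :
    aeval T' (splitPoly (s.map (· + c))) (f m) = f (aeval T (splitPoly s) m) := by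
  induction s using Multiset.induction generalizing m with
  | empty => simp
  | cons r s ih =>
    rw [Multiset.map_cons, splitPoly_cons, splitPoly_cons, mul_comm, mul_comm (X - C r)]
    rw [map_mul, map_mul, Module.End.mul_apply, Module.End.mul_apply, ← ih]
    congr 1
    simp only [map_sub, aeval_X, aeval_C, LinearMap.sub_apply, hf,
      Module.algebraMap_end_apply, map_smul, add_smul]
    abel

theorem LocallySplit.of_surjective {T : Module.End R M} {T' : Module.End R M'}
    (hT : LocallySplit T) (f : M →ₗ[R] M') (hf : ∀ m, T' (f m) = f (T m))
    (hs : Function.Surjective f) : LocallySplit T' := by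
  intro m'
  obtain ⟨m, rfl⟩ := hs m'
  obtain ⟨s, hs⟩ := hT m
  refine ⟨s.map (· + 0), ?_⟩
  rw [aeval_splitPoly_shift (T := T) (c := 0) (by simpa using hf), hs, map_zero]

end

variable {R : Type*} [CommRing R] [IsLocalRing R]
variable {M M' : Type*} [AddCommGroup M] [Module R M] [AddCommGroup M'] [Module R M']

/-- Over a local ring, `X - r` and `X - r'` are comaximal as soon as `r` and `r'` have distinct
residues, since `r - r'` is then a unit. This is why weights are taken in the residue field. -/
theorem isCoprime_splitPoly {s t : Multiset R}
    (h : ∀ r ∈ s, ∀ r' ∈ t, residue R r ≠ residue R r') :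
    IsCoprime (splitPoly s) (splitPoly t) := by
  induction s using Multiset.induction with
  | empty => simpa using isCoprime_one_left
  | cons r s ih =>
    rw [splitPoly_cons]
    refine IsCoprime.mul_left ?_ (ih fun a ha => h a (Multiset.mem_cons_of_mem ha))
    replace h := h r (Multiset.mem_cons_self r s)
    clear ih
    induction t using Multiset.induction with
    | empty => simpa using isCoprime_one_right
    | cons r' t ih =>
      rw [splitPoly_cons]
      refine IsCoprime.mul_right ?_ (ih fun a ha => h a (Multiset.mem_cons_of_mem ha))
      refine isCoprime_X_sub_C_of_isUnit_sub ?_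
      rw [← residue_ne_zero_iff_isUnit, map_sub, sub_ne_zero]
      exact h r' (Multiset.mem_cons_self _ _)

/-- The generalised weight space of `T` for an element `a` of the residue field: the elements
annihilated by a product of factors `T - r` with every `r` lifting `a`. -/
def weightSpace (T : Module.End R M) (a : ResidueField R) : Submodule R M where
  carrier := {m | ∃ s : Multiset R, (∀ r ∈ s, residue R r = a) ∧ aeval T (splitPoly s) m = 0}
  zero_mem' := ⟨0, by simp, by simp⟩
  add_mem' := by
    rintro m m' ⟨s, hs, hm⟩ ⟨s', hs', hm'⟩
    refine ⟨s + s', fun r hr => ?_, ?_⟩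
    · rcases Multiset.mem_add.1 hr with h | h
      exacts [hs r h, hs' r h]
    · rw [map_add]
      nth_rewrite 1 [add_comm s s']
      rw [splitPoly_add, splitPoly_add, map_mul, map_mul, Module.End.mul_apply,
        Module.End.mul_apply, hm, hm', map_zero, map_zero, add_zero]
  smul_mem' := by
    rintro c m ⟨s, hs, hm⟩
    exact ⟨s, hs, by rw [map_smul, hm, smul_zero]⟩

/-- A map intertwining `T` with `T' - c` shifts weights by the residue of `c`. -/
theorem map_mem_weightSpace_add {T : Module.End R M} {T' : Module.End R M'} {f : M →ₗ[R] M'}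
    {c : R} (hf : ∀ m, T' (f m) = f (T m) + c • f m) {a : ResidueField R} {m : M}
    (hm : m ∈ weightSpace T a) : f m ∈ weightSpace T' (a + residue R c) := by
  obtain ⟨s, hs, hm⟩ := hm
  refine ⟨s.map (· + c), ?_, by rw [aeval_splitPoly_shift hf, hm, map_zero]⟩
  intro r hr
  obtain ⟨r', hr', rfl⟩ := Multiset.mem_map.1 hr
  rw [map_add, hs r' hr']

theorem map_mem_weightSpace {T : Module.End R M} {T' : Module.End R M'} {f : M →ₗ[R] M'}
    (hf : ∀ m, T' (f m) = f (T m)) {a : ResidueField R} {m : M}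
    (hm : m ∈ weightSpace T a) : f m ∈ weightSpace T' a := by
  have := map_mem_weightSpace_add (T' := T') (f := f) (c := 0) (by simpa using hf) hm
  simpa using this

theorem mem_weightSpace_of_eigen {T : Module.End R M} {r : R} {m : M} (h : T m = r • m) :
    m ∈ weightSpace T (residue R r) :=
  ⟨{r}, by simp, by simp [splitPoly, h]⟩

theorem mem_of_aeval_splitPoly (T : Module.End R M) (N : Submodule R M) (s : Multiset R)
    (hN : ∀ r ∈ s, weightSpace T (residue R r) ≤ N) {m : M}
    (hm : aeval T (splitPoly s) m = 0) : m ∈ N := by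
  classical
  induction hc : s.card using Nat.strong_induction_on generalizing s m with
  | _ k ih =>
  rcases Multiset.empty_or_exists_mem s with rfl | ⟨r, hr⟩
  · simp at hm; simp [hm]
  · set s₁ := s.filter fun t => residue R t = residue R r
    set s₂ := s.filter fun t => ¬ residue R t = residue R r
    have hs : s₁ + s₂ = s := Multiset.filter_add_not _ _
    have hcop : IsCoprime (splitPoly s₁) (splitPoly s₂) := by
      refine isCoprime_splitPoly fun t ht t' ht' => ?_
      rw [(Multiset.mem_filter.1 ht).2]
      exact fun h => (Multiset.mem_filter.1 ht').2 h.symm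
    have hmem : m ∈ LinearMap.ker (aeval T (splitPoly s₁ * splitPoly s₂)) := by
      rw [← splitPoly_add, hs]; exact hm
    rw [← sup_ker_aeval_eq_ker_aeval_mul_of_coprime T hcop] at hmem
    obtain ⟨m₁, h₁, m₂, h₂, rfl⟩ := Submodule.mem_sup.1 hmem
    refine N.add_mem (hN r hr ⟨s₁, fun t ht => (Multiset.mem_filter.1 ht).2, h₁⟩) ?_
    refine ih s₂.card ?_ s₂ (fun t ht => hN t (Multiset.mem_of_mem_filter ht)) h₂ rfl
    rw [← hc, ← hs, Multiset.card_add]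
    have : 0 < s₁.card := Multiset.card_pos_iff_exists_mem.2 ⟨r, Multiset.mem_filter.2 ⟨hr, rfl⟩⟩
    omega

theorem iSup_weightSpace {T : Module.End R M} (hT : LocallySplit T) :
    ⨆ a, weightSpace T a = ⊤ := by
  refine eq_top_iff.2 fun m _ => ?_
  obtain ⟨s, hs⟩ := hT m
  exact mem_of_aeval_splitPoly T _ s (fun r _ => le_iSup (weightSpace T) (residue R r)) hs

theorem exists_splitPoly_of_mem_iSup {T : Module.End R M} {S : Set (ResidueField R)} {m : M}
    (hm : m ∈ ⨆ b ∈ S, weightSpace T b) :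
    ∃ s : Multiset R, (∀ r ∈ s, residue R r ∈ S) ∧ aeval T (splitPoly s) m = 0 := by
  induction hm using Submodule.iSup_induction' with
  | mem b m hm =>
    by_cases hb : b ∈ S
    · simp only [hb, iSup_pos] at hm
      obtain ⟨s, hs, h⟩ := hm
      exact ⟨s, fun r hr => by rw [hs r hr]; exact hb, h⟩
    · simp only [hb, iSup_neg, not_false_eq_true, Submodule.mem_bot] at hm
      exact ⟨0, by simp, by simp [hm]⟩
  | zero => exact ⟨0, by simp, by simp⟩
  | add m m' _ _ hm hm' =>
    obtain ⟨s, hs, h⟩ := hm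
    obtain ⟨s', hs', h'⟩ := hm'
    refine ⟨s + s', fun r hr => (Multiset.mem_add.1 hr).elim (hs r) (hs' r), ?_⟩
    rw [map_add]
    nth_rewrite 1 [add_comm s s']
    rw [splitPoly_add, splitPoly_add, map_mul, map_mul, Module.End.mul_apply,
      Module.End.mul_apply, h, h', map_zero, map_zero, add_zero]

/-- A weight vector annihilated by a split polynomial none of whose roots has the right residue
is zero. -/
theorem eq_zero_of_mem_weightSpace {T : Module.End R M} {a : ResidueField R} {m : M}
    (hm : m ∈ weightSpace T a) {s : Multiset R} (hs : ∀ r ∈ s, residue R r ≠ a)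
    (h : aeval T (splitPoly s) m = 0) : m = 0 := by
  obtain ⟨s', hs', h'⟩ := hm
  have := Polynomial.disjoint_ker_aeval_of_isCoprime T
    (isCoprime_splitPoly (s := s) (t := s') fun r hr r' hr' => by
      rw [hs' r' hr']; exact hs r hr)
  exact (Submodule.disjoint_def.1 this) m h h'

/-- The weight space decomposition, in the form needed to define the projections to the weight
spaces. -/
theorem isCompl_weightSpace {T : Module.End R M} (hT : LocallySplit T) (a : ResidueField R) :
    IsCompl (weightSpace T a) (⨆ b ∈ {b | b ≠ a}, weightSpace T b) := by
  refine ⟨Submodule.disjoint_def.2 fun m hm hm' => ?_, codisjoint_iff.2 ?_⟩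
  · obtain ⟨s, hs, h⟩ := exists_splitPoly_of_mem_iSup hm'
    exact eq_zero_of_mem_weightSpace hm hs h
  · rw [← top_le_iff, ← iSup_weightSpace hT]
    refine iSup_le fun b => ?_
    by_cases hb : b = a
    · rw [hb]; exact le_sup_left
    · exact le_trans (le_iSup₂_of_le b hb le_rfl) le_sup_right

/-- The projection onto a weight space along the others. -/
def weightProj {T : Module.End R M} (hT : LocallySplit T) (a : ResidueField R) : M →ₗ[R] M :=
  (weightSpace T a).projection _ (isCompl_weightSpace hT a)

theorem weightProj_mem {T : Module.End R M} (hT : LocallySplit T) (a : ResidueField R) (m : M) :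
    weightProj hT a m ∈ weightSpace T a :=
  Submodule.projection_apply_mem _ _

theorem weightProj_of_mem {T : Module.End R M} (hT : LocallySplit T) {a : ResidueField R} {m : M}
    (hm : m ∈ weightSpace T a) : weightProj hT a m = m :=
  Submodule.projection_apply_of_mem_left _ hm

theorem weightProj_of_mem_ne {T : Module.End R M} (hT : LocallySplit T) {a b : ResidueField R}
    (hab : b ≠ a) {m : M} (hm : m ∈ weightSpace T b) : weightProj hT a m = 0 :=
  (Submodule.projection_apply_eq_zero_iff _).2
    ((le_iSup₂_of_le (f := fun b (_ : b ∈ {b | b ≠ a}) => weightSpace T b) b hab le_rfl) hm)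

theorem map_weightProj_add {T : Module.End R M} {T' : Module.End R M'} (hT : LocallySplit T)
    (hT' : LocallySplit T') {f : M →ₗ[R] M'} {c : R}
    (hf : ∀ m, T' (f m) = f (T m) + c • f m) (a : ResidueField R) (m : M) :
    f (weightProj hT a m) = weightProj hT' (a + residue R c) (f m) := by
  have hm : m ∈ ⨆ a, weightSpace T a := by rw [iSup_weightSpace hT]; trivial
  induction hm using Submodule.iSup_induction' with
  | mem b m hm =>
    have := map_mem_weightSpace_add hf hm
    by_cases hb : b = a
    · subst hb
      rw [weightProj_of_mem hT hm, weightProj_of_mem hT' this]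
    · rw [weightProj_of_mem_ne hT hb hm, map_zero, weightProj_of_mem_ne hT' _ this]
      simpa using hb
  | zero => simp
  | add m m' _ _ h h' => simp only [map_add, h, h']

theorem map_weightProj {T : Module.End R M} {T' : Module.End R M'} (hT : LocallySplit T)
    (hT' : LocallySplit T') {f : M →ₗ[R] M'}
    (hf : ∀ m, T' (f m) = f (T m)) (a : ResidueField R) (m : M) :
    f (weightProj hT a m) = weightProj hT' a (f m) := by
  have := map_weightProj_add hT hT' (f := f) (c := 0) (by simpa using hf) a m
  simpa using this

end WeightSpace

/-! ### Categories with a projective generator -/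

namespace ProjectiveGenerator

open HighestWeight

variable {R : Type u} [CommRing R] {H : Type u} [Ring H] [Algebra R H]

/-- `P` generates the objects of `C`: each is a finite sum of images of maps from `P`. -/
def Generates (C : ObjectProperty (ModuleCat.{u} H)) (P : ModuleCat.{u} H) : Prop :=
  ∀ X : ModuleCat.{u} H, C X → ∃ (n : ℕ) (s : Fin n → (P →ₗ[H] X)), ∀ x : X,
    ∃ p : Fin n → P, x = ∑ i, s i (p i)

/-- Maps from `P` lift through surjections between objects of `C`. -/
def LiftsThrough (C : ObjectProperty (ModuleCat.{u} H)) (P : ModuleCat.{u} H) : Prop :=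
  ∀ (X Y : ModuleCat.{u} H), C X → C Y → ∀ f : X →ₗ[H] Y, Function.Surjective f →
    ∀ g : P →ₗ[H] Y, ∃ g' : P →ₗ[H] X, f ∘ₗ g' = g

section

variable {C : ObjectProperty (ModuleCat.{u} H)} {P : ModuleCat.{u} H}

theorem algebraMap_smul_coyoneda {X : ModuleCat.{u} H} (r : R)
    (g : (preadditiveCoyonedaObj P).obj X) :
    algebraMap R (End P)ᵐᵒᵖ r • g = (show (preadditiveCoyonedaObj P).obj X from
      (r • (show P ⟶ X from g))) := by
  apply ModuleCat.hom_ext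
  ext p
  change ModuleCat.Hom.hom (show P ⟶ X from g) (algebraMap R H r • p) =
    algebraMap R H r • ModuleCat.Hom.hom (show P ⟶ X from g) p
  rw [map_smul]

/-- The two `R`-module structures on `Hom(P, X)`, through `X` and through `End(P)ᵒᵖ`, agree. -/
def coyonedaLinearEquiv (P X : ModuleCat.{u} H) :
    letI := restrictModule R ((preadditiveCoyonedaObj P).obj X)
    (P ⟶ X) ≃ₗ[R] (preadditiveCoyonedaObj P).obj X :=
  letI := restrictModule R ((preadditiveCoyonedaObj P).obj X)
  { toFun := fun g => g
    invFun := fun g => g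
    left_inv := fun _ => rfl
    right_inv := fun _ => rfl
    map_add' := fun _ _ => rfl
    map_smul' := fun r g => (algebraMap_smul_coyoneda (P := P) (X := X) r g).symm }

theorem finite_coyonedaObj {X : ModuleCat.{u} H} (h : Module.Finite R (P ⟶ X)) :
    Module.Finite (End P)ᵐᵒᵖ ((preadditiveCoyonedaObj P).obj X) := by
  let := restrictModule R ((preadditiveCoyonedaObj P).obj X)
  have : IsScalarTower R (End P)ᵐᵒᵖ ((preadditiveCoyonedaObj P).obj X) :=
    ⟨fun r b g => by rw [Algebra.smul_def, mul_smul]; rfl⟩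
  have : Module.Finite R ((preadditiveCoyonedaObj P).obj X) :=
    Module.Finite.equiv (coyonedaLinearEquiv (R := R) P X)
  exact Module.Finite.of_restrictScalars_finite R _ _

/-- The map `P ^ n → X` with the given components. -/
def sumMap {X : Type*} [AddCommGroup X] [Module H X] {n : ℕ} (s : Fin n → (P →ₗ[H] X)) :
    (Fin n → P) →ₗ[H] X :=
  ∑ i, s i ∘ₗ LinearMap.proj i

theorem sumMap_apply {X : Type*} [AddCommGroup X] [Module H X] {n : ℕ}
    (s : Fin n → (P →ₗ[H] X)) (p : Fin n → P) : sumMap s p = ∑ i, s i (p i) := by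
  simp [sumMap]

variable (P) in
/-- `Hom(P, -)` as a functor to finitely generated modules over `End(P)ᵒᵖ`. -/
def homFunctor (hfin : ∀ X, C X → Module.Finite (End P)ᵐᵒᵖ ((preadditiveCoyonedaObj P).obj X)) :
    C.FullSubcategory ⥤ FGModuleCat.{u} (End P)ᵐᵒᵖ :=
  (ModuleCat.isFG _).lift (C.ι ⋙ preadditiveCoyonedaObj P) fun X => hfin X.obj X.property

variable (hfin : ∀ X, C X → Module.Finite (End P)ᵐᵒᵖ ((preadditiveCoyonedaObj P).obj X))

theorem homFunctor_faithful (hgen : Generates C P) : (homFunctor P hfin).Faithful where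
  map_injective {X Y f f'} hff' := by
    obtain ⟨n, s, hs⟩ := hgen X.obj X.property
    apply ObjectProperty.hom_ext
    apply ModuleCat.hom_ext
    ext x
    obtain ⟨p, rfl⟩ := hs x
    simp only [map_sum]
    refine Finset.sum_congr rfl fun i _ => ?_
    have h1 := congrArg (fun φ => (φ.hom.hom : _ → _) (ModuleCat.ofHom (s i))) hff'
    exact congrArg (fun φ : P ⟶ Y.obj => φ.hom (p i)) h1

/-- A map `Hom(P, X) → Hom(P, Y)` of `End(P)ᵒᵖ`-modules is induced by a map `X → Y`: a presentation
of `X` by powers of `P` reduces this to `X = P ^ n`. -/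
theorem homFunctor_full (hgen : Generates C P) (hlift : LiftsThrough C P)
    (hsub : ∀ X Y : ModuleCat.{u} H, C Y → ∀ f : X →ₗ[H] Y, Function.Injective f → C X)
    (hpow : ∀ n : ℕ, C (ModuleCat.of H (Fin n → P))) :
    (homFunctor P hfin).Full where
  map_surjective {X Y} θ := by
    obtain ⟨n, s, hs⟩ := hgen X.obj X.property
    let θ' : (P →ₗ[H] X.obj) → (P →ₗ[H] Y.obj) := fun g =>
      ModuleCat.Hom.hom (show P ⟶ Y.obj from θ.hom.hom (ModuleCat.ofHom g))
    have hadd : ∀ g g', θ' (g + g') = θ' g + θ' g' := fun g g' =>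
      congrArg ModuleCat.Hom.hom (θ.hom.hom.map_add (ModuleCat.ofHom g) (ModuleCat.ofHom g'))
    have hzero : θ' 0 = 0 := congrArg ModuleCat.Hom.hom θ.hom.hom.map_zero
    have hcomp : ∀ g (b : P →ₗ[H] P), θ' (g ∘ₗ b) = θ' g ∘ₗ b := fun g b =>
      congrArg ModuleCat.Hom.hom (θ.hom.hom.map_smul (MulOpposite.op (ModuleCat.ofHom b : End P))
        (ModuleCat.ofHom g))
    have hsum : ∀ (m : ℕ) (g : Fin m → (P →ₗ[H] X.obj)), θ' (∑ i, g i) = ∑ i, θ' (g i) :=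
      fun m g => map_sum (⟨⟨θ', hzero⟩, hadd⟩ : (P →ₗ[H] X.obj) →+ (P →ₗ[H] Y.obj)) g _
    let S := sumMap s
    let T := sumMap fun i => θ' (s i)
    have hS : Function.Surjective S := fun x => by
      obtain ⟨p, rfl⟩ := hs x; exact ⟨p, sumMap_apply _ _⟩
    have hTc : ∀ κ : P →ₗ[H] (Fin n → P), T ∘ₗ κ = θ' (S ∘ₗ κ) := by
      intro κ
      have h1 : S ∘ₗ κ = ∑ i, s i ∘ₗ (LinearMap.proj i ∘ₗ κ) := by
        ext p; simp [S, sumMap_apply]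
      have h2 : T ∘ₗ κ = ∑ i, θ' (s i) ∘ₗ (LinearMap.proj i ∘ₗ κ) := by
        ext p; simp [T, sumMap_apply]
      rw [h1, h2, hsum]
      simp_rw [hcomp]
    have hker : LinearMap.ker S ≤ LinearMap.ker T := by
      intro k hk
      obtain ⟨m, κ, hκ⟩ := hgen (ModuleCat.of H (LinearMap.ker S))
        (hsub _ _ (hpow n) (LinearMap.ker S).subtype (Submodule.injective_subtype _))
      obtain ⟨p, hp⟩ := hκ ⟨k, hk⟩
      have hk' : k = ∑ j, ((κ j (p j) : LinearMap.ker S) : Fin n → P) := by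
        have := congrArg (LinearMap.ker S).subtype hp
        simpa using this
      rw [LinearMap.mem_ker, hk', map_sum]
      refine Finset.sum_eq_zero fun j _ => ?_
      have h0 : S ∘ₗ ((LinearMap.ker S).subtype ∘ₗ κ j) = 0 := by
        ext q; exact (κ j q).2
      have := hTc ((LinearMap.ker S).subtype ∘ₗ κ j)
      rw [h0, hzero] at this
      exact LinearMap.congr_fun this (p j)
    let f : X.obj →ₗ[H] Y.obj := (LinearMap.ker S).liftQ T hker ∘ₗ
      (S.quotKerEquivOfSurjective hS).symm.toLinearMap
    have hf : ∀ p, f (S p) = T p := by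
      intro p
      have : (S.quotKerEquivOfSurjective hS).symm (S p) = Submodule.Quotient.mk p := by
        rw [LinearEquiv.symm_apply_eq]; rfl
      simp only [f, LinearMap.comp_apply, LinearEquiv.coe_coe, this]
      rfl
    refine ⟨ObjectProperty.homMk (ModuleCat.ofHom f), ?_⟩
    apply ObjectProperty.hom_ext
    apply ModuleCat.hom_ext
    refine LinearMap.ext fun g => ?_
    obtain ⟨g', hg'⟩ := hlift (ModuleCat.of H (Fin n → P)) X.obj (hpow n) X.property S hS
      (ModuleCat.Hom.hom (show P ⟶ X.obj from g))
    apply ModuleCat.hom_ext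
    change f ∘ₗ ModuleCat.Hom.hom (show P ⟶ X.obj from g) =
      θ' (ModuleCat.Hom.hom (show P ⟶ X.obj from g))
    rw [← hg']
    erw [← hTc g']
    ext p
    exact hf (g' p)

/-- A presentation of an `End(P)ᵒᵖ`-module by free modules lifts to a map between powers of `P`,
whose cokernel corresponds to the given module. -/
theorem homFunctor_essSurj (hlift : LiftsThrough C P)
    (hsub : ∀ X Y : ModuleCat.{u} H, C Y → ∀ f : X →ₗ[H] Y, Function.Injective f → C X)
    (hquot : ∀ X Y : ModuleCat.{u} H, C X → ∀ f : X →ₗ[H] Y, Function.Surjective f → C Y)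
    (hpow : ∀ n : ℕ, C (ModuleCat.of H (Fin n → P))) [IsNoetherianRing (End P)ᵐᵒᵖ] :
    (homFunctor P hfin).EssSurj where
  mem_essImage X := by
    let B := (End P)ᵐᵒᵖ
    have : Module.Finite B X.obj := X.property
    obtain ⟨n, φ, hφ⟩ := Module.Finite.exists_fin' B X.obj
    let hat : (Fin n → B) → (P →ₗ[H] (Fin n → P)) := fun z =>
      LinearMap.pi fun i => ModuleCat.Hom.hom (z i).unop
    obtain ⟨m, z, hz⟩ := Submodule.fg_iff_exists_fin_generating_family.1
      (IsNoetherian.noetherian (LinearMap.ker φ))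
    let K : Submodule H (Fin n → P) := LinearMap.range (sumMap fun j => hat (z j))
    let M : ModuleCat.{u} H := ModuleCat.of H ((Fin n → P) ⧸ K)
    have hM : C M := hquot _ _ (hpow n) K.mkQ (Submodule.mkQ_surjective K)
    have hK : C (ModuleCat.of H K) := hsub _ _ (hpow n) K.subtype (Submodule.injective_subtype _)
    -- the map `B ^ n = Hom(P, P ^ n) → Hom(P, M)`
    let Ψ : (Fin n → B) →ₗ[B] (preadditiveCoyonedaObj P).obj M :=
      { toFun := fun b => (show (preadditiveCoyonedaObj P).obj M from
          (ModuleCat.ofHom (K.mkQ ∘ₗ hat b) : P ⟶ M))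
        map_add' := fun b b' => by
          apply ModuleCat.hom_ext
          ext p
          exact K.mkQ.map_add (hat b p) (hat b' p)
        map_smul' := fun c b => rfl }
    have hΨ : Function.Surjective Ψ := by
      intro g
      obtain ⟨g', hg'⟩ := hlift _ M (hpow n) hM K.mkQ (Submodule.mkQ_surjective K)
        (ModuleCat.Hom.hom (show P ⟶ M from g))
      refine ⟨fun i => MulOpposite.op (ModuleCat.ofHom (LinearMap.proj i ∘ₗ g') : End P), ?_⟩
      apply ModuleCat.hom_ext
      exact hg'
    have hker : LinearMap.ker Ψ = LinearMap.ker φ := by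
      apply le_antisymm
      · intro b hb
        have hb' : ∀ p, hat b p ∈ K := fun p => by
          have h1 : K.mkQ ∘ₗ hat b = 0 := congrArg ModuleCat.Hom.hom hb
          exact (Submodule.Quotient.mk_eq_zero K).1 (LinearMap.congr_fun h1 p)
        obtain ⟨β, hβ⟩ := hlift (ModuleCat.of H (Fin m → P)) (ModuleCat.of H K) (hpow m) hK
          (LinearMap.rangeRestrict (sumMap fun j => hat (z j)))
          (LinearMap.surjective_rangeRestrict _) (LinearMap.codRestrict K (hat b) hb')
        have : b = ∑ j, (show B from
            MulOpposite.op (ModuleCat.ofHom (LinearMap.proj j ∘ₗ β) : End P)) • z j := by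
          ext i
          apply MulOpposite.unop_injective
          apply ModuleCat.hom_ext
          ext p
          have h2 := congrArg (fun q : K => (q : Fin n → P) i) (LinearMap.congr_fun hβ p)
          simp only [LinearMap.comp_apply, LinearMap.codRestrict_apply] at h2
          change ModuleCat.Hom.hom (b i).unop p = _
          change _ = ModuleCat.Hom.hom (b i).unop p at h2
          rw [← h2]
          change (sumMap (fun j => hat (z j)) (β p)) i = _
          rw [sumMap_apply, Finset.sum_apply, Finset.sum_apply]
          let ev : B →+ P :=
            { toFun := fun c => ModuleCat.Hom.hom c.unop p
              map_zero' := rfl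
              map_add' := fun _ _ => rfl }
          exact (map_sum ev (fun j => ((show B from
            MulOpposite.op (ModuleCat.ofHom (LinearMap.proj j ∘ₗ β) : End P)) • z j) i)
              Finset.univ).symm
        rw [this]
        refine Submodule.sum_mem _ fun j _ => Submodule.smul_mem _ _ ?_
        rw [← hz]
        exact Submodule.subset_span ⟨j, rfl⟩
      · rw [← hz, Submodule.span_le]
        rintro _ ⟨j, rfl⟩
        apply ModuleCat.hom_ext
        ext p
        refine (Submodule.Quotient.mk_eq_zero K).2 ⟨Pi.single j p, ?_⟩
        rw [sumMap_apply, Finset.sum_eq_single j]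
        · simp
        · intro k _ hk; simp [hk]
        · simp
    refine ⟨⟨M, hM⟩, ⟨?_⟩⟩
    refine ObjectProperty.isoMk _ (LinearEquiv.toModuleIso ?_)
    exact ((Ψ.quotKerEquivOfSurjective hΨ).symm.trans
      (Submodule.quotEquivOfEq _ _ hker)).trans (φ.quotKerEquivOfSurjective hφ)

end

variable {C : ObjectProperty (ModuleCat.{u} H)} {P : ModuleCat.{u} H}

/-- A full subcategory of modules that is closed under submodules and quotients, and has a
projective generator `P` with `Hom(P, -)` finite over the noetherian ring `R`, is equivalent to
the finitely generated modules over `End(P)ᵒᵖ`. -/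
theorem exists_equivalence [IsNoetherianRing R] {Λ : Type*} (Δ : Λ → ModuleCat.{u} H)
    (mem : ∀ l, C (Δ l)) (hgen : Generates C P) (hlift : LiftsThrough C P) (hP : C P)
    (hsub : ∀ X Y : ModuleCat.{u} H, C Y → ∀ f : X →ₗ[H] Y, Function.Injective f → C X)
    (hquot : ∀ X Y : ModuleCat.{u} H, C X → ∀ f : X →ₗ[H] Y, Function.Surjective f → C Y)
    (hpow : ∀ n : ℕ, C (ModuleCat.of H (Fin n → P)))
    (hfin : ∀ X, C X → Module.Finite R (P ⟶ X))
    (hPproj : Module.Projective R (P ⟶ P)) (hΔproj : ∀ l, Module.Projective R (P ⟶ Δ l)) :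
    ∃ (B : Type u) (_ : Ring B) (_ : Algebra R B),
    Module.Finite R B ∧ Module.Projective R B ∧
      ∃ e : C.FullSubcategory ≌ FGModuleCat.{u} B, e.functor.Linear R ∧
        ∀ l, letI := restrictModule R (e.functor.obj ⟨Δ l, mem l⟩).obj
          Module.Projective R (e.functor.obj ⟨Δ l, mem l⟩).obj := by
  let B := (End P)ᵐᵒᵖ
  have : Module.Finite R (End P) := hfin P hP
  have : Module.Projective R (End P) := hPproj
  let e₀ : End P ≃ₗ[R] B := MulOpposite.opLinearEquiv R
  have hBfin : Module.Finite R B := Module.Finite.equiv e₀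
  have hBproj : Module.Projective R B := Module.Projective.of_equiv e₀
  have : IsNoetherian R B := isNoetherian_of_isNoetherianRing_of_finite R B
  have : IsNoetherianRing (End P)ᵐᵒᵖ := isNoetherian_of_tower R (inferInstance : IsNoetherian R B)
  have hBX : ∀ X, C X → Module.Finite (End P)ᵐᵒᵖ ((preadditiveCoyonedaObj P).obj X) := by
    intro X hX
    exact finite_coyonedaObj (hfin X hX)
  let F := homFunctor P hBX
  have : F.Faithful := homFunctor_faithful hBX hgen
  have : F.Full := homFunctor_full hBX hgen hlift hsub hpow
  have : F.EssSurj := homFunctor_essSurj hBX hlift hsub hquot hpow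
  have : F.IsEquivalence := {}
  refine ⟨B, inferInstance, inferInstance, hBfin, hBproj, F.asEquivalence, ?_, fun l => ?_⟩
  · refine ⟨fun {X Y} f r => ?_⟩
    apply ObjectProperty.hom_ext
    apply ModuleCat.hom_ext
    refine LinearMap.ext fun g => ?_
    apply ModuleCat.hom_ext
    ext p
    change algebraMap R H r • f.hom.hom (ModuleCat.Hom.hom (show P ⟶ X.obj from g) p) =
      f.hom.hom (ModuleCat.Hom.hom (show P ⟶ X.obj from g) (algebraMap R H r • p))
    rw [map_smul, map_smul]
  · let := restrictModule R (F.obj ⟨Δ l, mem l⟩).obj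
    have := hΔproj l
    exact (Module.Projective.of_equiv (coyonedaLinearEquiv (R := R) P (Δ l)) :
      Module.Projective R (F.obj ⟨Δ l, mem l⟩).obj)

end ProjectiveGenerator

/-! ### Projective modules over a polynomial ring -/

namespace MvPolynomial

variable {σ R : Type*} [CommRing R]

theorem sub_C_constantCoeff_mem (p : MvPolynomial σ R) :
    p - C (constantCoeff p) ∈ idealOfVars σ R := by
  induction p using MvPolynomial.induction_on with
  | C a => simp
  | add p q hp hq =>
    rw [map_add, map_add, add_sub_add_comm]
    exact Ideal.add_mem _ hp hq
  | mul_X p i _ =>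
    simpa using (idealOfVars σ R).mul_mem_left p
      (Ideal.subset_span (Set.mem_range_self i))

theorem mem_idealOfVars_iff {p : MvPolynomial σ R} :
    p ∈ idealOfVars σ R ↔ constantCoeff p = 0 := by
  constructor
  · intro hp
    have : idealOfVars σ R ≤ RingHom.ker (constantCoeff (σ := σ) (R := R)) := by
      rw [Ideal.span_le]
      rintro _ ⟨i, rfl⟩
      simp [RingHom.mem_ker]
    exact this hp
  · intro hp
    simpa [hp] using sub_C_constantCoeff_mem p

theorem mul_eq_zero_of_constantCoeff_eq_one {p q : MvPolynomial σ R}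
    (hp : constantCoeff p = 1) (h : p * q = 0) : q = 0 := by
  have hu : IsUnit (p : MvPowerSeries σ R) := by
    rw [MvPowerSeries.isUnit_iff_constantCoeff]
    have : MvPowerSeries.constantCoeff (p : MvPowerSeries σ R) = 1 := by
      rw [← hp]; rfl
    rw [this]; exact isUnit_one
  apply MvPolynomial.coe_injective σ R
  rw [coe_zero, ← hu.mul_right_eq_zero, ← coe_mul, h, coe_zero]

theorem mem_idealOfVars_smul_top_iff [Finite σ] {M : Type*} [AddCommGroup M]
    [Module (MvPolynomial σ R) M] {m : M} :
    m ∈ idealOfVars σ R • (⊤ : Submodule (MvPolynomial σ R) M) ↔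
      m ∈ ⨆ i : σ, LinearMap.range (LinearMap.lsmul (MvPolynomial σ R) M (X i)) := by
  constructor
  · intro hm
    induction hm using Submodule.smul_induction_on' with
    | smul r hr n _ =>
      induction hr using Submodule.span_induction generalizing n with
      | mem x hx =>
        obtain ⟨i, rfl⟩ := hx
        exact Submodule.mem_iSup_of_mem i ⟨n, rfl⟩
      | zero => simp
      | add x y _ _ hx hy => rw [add_smul]; exact Submodule.add_mem _ (hx n trivial) (hy n trivial)
      | smul a x _ hx => rw [smul_assoc]; exact Submodule.smul_mem _ _ (hx n trivial)
    | add x _ y _ hx hy => exact Submodule.add_mem _ hx hy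
  · intro hm
    refine (iSup_le fun i => ?_ : _ ≤ idealOfVars σ R • (⊤ : Submodule _ M)) hm
    rintro _ ⟨n, rfl⟩
    exact Submodule.smul_mem_smul (Ideal.subset_span ⟨i, rfl⟩) trivial

theorem exists_sum_of_mem_idealOfVars_smul_top [Fintype σ] {M : Type*} [AddCommGroup M]
    [Module (MvPolynomial σ R) M] {m : M}
    (hm : m ∈ idealOfVars σ R • (⊤ : Submodule (MvPolynomial σ R) M)) :
    ∃ f : σ → M, m = ∑ i, (X i : MvPolynomial σ R) • f i := by
  rw [mem_idealOfVars_smul_top_iff, Submodule.mem_iSup_iff_exists_finsupp] at hm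
  obtain ⟨f, hf, rfl⟩ := hm
  choose g hg using fun i => hf i
  refine ⟨g, ?_⟩
  rw [Finsupp.sum_fintype _ _ (by simp)]
  exact Finset.sum_congr rfl fun i _ => (hg i).symm

/-- A graded form of Nakayama's lemma without gradings: a surjection from a finite free module onto
a projective one which is injective modulo the variables is injective. The kernel `K` is a direct
summand with `K = I K`, so it is annihilated by a polynomial of constant term `1`. -/
theorem injective_of_injective_mod_vars {Y M : Type*} [Finite σ] [AddCommGroup Y] [AddCommGroup M]
    [Module (MvPolynomial σ R) Y] [Module (MvPolynomial σ R) M]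
    [Module.Free (MvPolynomial σ R) Y] [Module.Finite (MvPolynomial σ R) Y]
    [Module.Projective (MvPolynomial σ R) M] (Ψ : Y →ₗ[MvPolynomial σ R] M)
    (hs : Function.Surjective Ψ)
    (h : ∀ y, Ψ y ∈ idealOfVars σ R • (⊤ : Submodule (MvPolynomial σ R) M) →
      y ∈ idealOfVars σ R • (⊤ : Submodule (MvPolynomial σ R) Y)) :
    Function.Injective Ψ := by
  obtain ⟨τ, hτ⟩ := Module.projective_lifting_property Ψ LinearMap.id hs
  let ρ : Y →ₗ[MvPolynomial σ R] Y := LinearMap.id - τ ∘ₗ Ψ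
  have hτ' : ∀ m, Ψ (τ m) = m := fun m => LinearMap.congr_fun hτ m
  have hρ : LinearMap.range ρ = LinearMap.ker Ψ := by
    apply le_antisymm
    · rintro _ ⟨y, rfl⟩
      simp [ρ, hτ']
    · intro y hy
      exact ⟨y, by simp [ρ, LinearMap.mem_ker.1 hy]⟩
  have hfg : (LinearMap.ker Ψ).FG := by
    rw [← hρ, LinearMap.range_eq_map]
    exact (Module.Finite.fg_top).map ρ
  have hle : LinearMap.ker Ψ ≤ idealOfVars σ R • LinearMap.ker Ψ := by
    intro y hy
    have h1 : y ∈ idealOfVars σ R • (⊤ : Submodule (MvPolynomial σ R) Y) :=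
      h y (by rw [LinearMap.mem_ker.1 hy]; exact Submodule.zero_mem _)
    have h2 : ρ y ∈ (idealOfVars σ R • (⊤ : Submodule (MvPolynomial σ R) Y)).map ρ := ⟨y, h1, rfl⟩
    rw [Submodule.map_smul'', ← LinearMap.range_eq_map, hρ] at h2
    simpa [ρ, LinearMap.mem_ker.1 hy] using h2
  obtain ⟨r, hr, hr'⟩ := Submodule.exists_sub_one_mem_and_smul_eq_zero_of_fg_of_le_smul
    _ _ hfg hle
  have hr1 : constantCoeff r = 1 := by
    have := mem_idealOfVars_iff.1 hr
    rwa [map_sub, map_one, sub_eq_zero] at this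
  rw [← LinearMap.ker_eq_bot, eq_bot_iff]
  intro y hy
  let b := Module.Free.chooseBasis (MvPolynomial σ R) Y
  rw [Submodule.mem_bot, ← b.repr.map_eq_zero_iff]
  ext1 i
  refine mul_eq_zero_of_constantCoeff_eq_one hr1 ?_
  have := congrArg (fun z => b.repr z i) (hr' y hy)
  simpa using this

end MvPolynomial

/-! ### Representations of finite groups over local algebras -/

namespace FiniteGroupRep

open IrrepClass Representation
open scoped MonoidAlgebra

variable {G : Type} [Group G]

theorem neZero_natCard_complex (G : Type*) [Group G] [Finite G] : NeZero (Nat.card G : ℂ) :=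
  ⟨by exact_mod_cast Nat.card_pos.ne'⟩

theorem isIrreducible_rep (E : Irr G) : E.rep.ρ.IsIrreducible := (Quotient.out E).2

instance (E : Irr G) : E.rep.ρ.IsIrreducible := isIrreducible_rep E

instance (E : Irr G) : Nontrivial E.rep.V := by
  have : IsSimpleModule ℂ[G] E.rep.ρ.asModule := inferInstance
  exact IsSimpleModule.nontrivial ℂ[G] E.rep.ρ.asModule

instance [Finite G] (E : Irr G) : FiniteDimensional ℂ E.rep.V := by
  have : Module.Finite ℂ[G] E.rep.ρ.asModule := inferInstance
  have h : Module.Finite ℂ ℂ[G] := inferInstance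
  have : Module.Finite ℂ E.rep.ρ.asModule := Module.Finite.trans ℂ[G] _
  exact Module.Finite.equiv E.rep.ρ.asModuleEquiv

/-- Each irreducible representation is isomorphic to the chosen representative of its class. -/
theorem exists_rep_iso (E' : Rep.{0} ℂ G) (h : E'.ρ.IsIrreducible) :
    ∃ E : Irr G, Nonempty (E.rep ≅ E') :=
  ⟨Quotient.mk (isoSetoid G) ⟨E', h⟩, Quotient.mk_out (s := isoSetoid G) _⟩

theorem eq_of_rep_iso {E E' : Irr G} (h : Nonempty (E.rep ≅ E'.rep)) : E = E' := by
  rw [← Quotient.out_eq E, ← Quotient.out_eq E']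
  exact Quotient.sound h

/-- Equivariance of a linear map from a complex representation `E` to a module with an action
of `G`. -/
def IsEquivariant {M : Type*} [AddCommGroup M] [Module ℂ M] (σ : Representation ℂ G M)
    (E : Rep.{0} ℂ G) (f : E.V →ₗ[ℂ] M) : Prop :=
  ∀ g e, f (E.ρ g e) = σ g (f e)

section

variable {M : Type*} [AddCommGroup M] [Module ℂ M] {σ : Representation ℂ G M}

/-- An equivariant map as a map of modules over the group algebra. -/
def IsEquivariant.asModuleHom {E : Rep.{0} ℂ G} {f : E.V →ₗ[ℂ] M} (hf : IsEquivariant σ E f) :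
    E.ρ.asModule →ₗ[ℂ[G]] σ.asModule :=
  IntertwiningMap.equivLinearMapAsModule E.ρ σ (f.intertwiningMap_of_isIntertwiningMap _ _ hf)

/-- Every simple submodule of a representation is the image of some irreducible `E`. -/
theorem exists_equivariant_of_isSimpleModule [Finite G] (S : Submodule ℂ[G] σ.asModule)
    (hS : IsSimpleModule ℂ[G] S) :
    ∃ (E : Irr G) (f : E.rep.V →ₗ[ℂ] M), IsEquivariant σ E.rep f ∧ Function.Injective f ∧
      ∀ x : σ.asModule, x ∈ S ↔ ∃ e, f e = σ.asModuleEquiv x := by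
  have hfin : Module.Finite ℂ S := Module.Finite.trans ℂ[G] S
  let b := Module.finBasis ℂ S
  let N := Fin (Module.finrank ℂ S) → ℂ
  let e : S ≃ₗ[ℂ] N := b.equivFun
  let act : G →* Module.End ℂ S :=
    { toFun := fun g =>
        { toFun := fun x => MonoidAlgebra.of ℂ G g • x
          map_add' := smul_add _
          map_smul' := fun c x => by
            simp only [RingHom.id_apply]
            rw [← algebraMap_smul ℂ[G] c x, ← algebraMap_smul ℂ[G] c, smul_smul, smul_smul,
              Algebra.commutes] }
      map_one' := by ext1 x; simp [MonoidAlgebra.one_def.symm]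
      map_mul' := fun g g' => by
        ext1 x
        simp only [map_mul, mul_smul, Module.End.mul_apply, LinearMap.coe_mk, AddHom.coe_mk] }
  let τ : Representation ℂ G N := (e.conjRingEquiv : Module.End ℂ S →* Module.End ℂ N).comp act
  have hτ : ∀ g x, τ g x = e (MonoidAlgebra.of ℂ G g • e.symm x) := fun g x => rfl
  let f₀ : N →ₗ[ℂ] M := σ.asModuleEquiv.toLinearMap ∘ₗ
    ((S.subtype.restrictScalars ℂ) ∘ₗ e.symm.toLinearMap)
  have hf₀ : IsEquivariant σ (Rep.of τ) f₀ := by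
    intro g x
    change σ.asModuleEquiv ((e.symm (τ g x) : S) : σ.asModule) = _
    rw [hτ, LinearEquiv.symm_apply_apply, Submodule.coe_smul, asModuleEquiv_map_smul,
      MonoidAlgebra.of_apply, asAlgebraHom_single, one_smul]
    rfl
  have hinj₀ : Function.Injective f₀ :=
    σ.asModuleEquiv.injective.comp ((Submodule.injective_subtype S).comp e.symm.injective)
  have hmem₀ : ∀ x : σ.asModule, x ∈ S ↔ ∃ y, f₀ y = σ.asModuleEquiv x := by
    intro x
    constructor
    · intro hx
      exact ⟨e ⟨x, hx⟩, by simp [f₀]⟩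
    · rintro ⟨y, hy⟩
      have : ((e.symm y : S) : σ.asModule) = x := σ.asModuleEquiv.injective hy
      rw [← this]; exact (e.symm y).2
  have hirr : (Rep.of τ).ρ.IsIrreducible := by
    rw [irreducible_iff_isSimpleModule_asModule]
    let F := hf₀.asModuleHom
    have hF : ∀ x, F x ∈ S := fun x => (hmem₀ _).2 ⟨x, rfl⟩
    let F' : (Rep.of τ).ρ.asModule →ₗ[ℂ[G]] S := LinearMap.codRestrict S F hF
    have hb : Function.Bijective F' := by
      constructor
      · intro x y hxy
        exact hinj₀ (congrArg Subtype.val hxy)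
      · rintro ⟨x, hx⟩
        obtain ⟨y, hy⟩ := (hmem₀ x).1 hx
        exact ⟨y, Subtype.ext (σ.asModuleEquiv.injective hy)⟩
    exact IsSimpleModule.congr (LinearEquiv.ofBijective F' hb)
  obtain ⟨E, ⟨i⟩⟩ := exists_rep_iso (Rep.of τ) hirr
  refine ⟨E, f₀ ∘ₗ i.hom.hom.toLinearMap, ?_, ?_, ?_⟩
  · intro g x
    change f₀ (i.hom.hom (E.rep.ρ g x)) = σ g (f₀ (i.hom.hom x))
    rw [Rep.hom_comm_apply]
    exact hf₀ g _
  · refine hinj₀.comp (Function.LeftInverse.injective (g := i.inv.hom) fun x => ?_)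
    exact congrArg (fun φ : E.rep ⟶ E.rep => φ.hom x) i.hom_inv_id
  · intro x
    rw [hmem₀]
    constructor
    · rintro ⟨y, hy⟩
      refine ⟨i.inv.hom y, ?_⟩
      rw [← hy]
      change f₀ (i.hom.hom (i.inv.hom y)) = f₀ y
      congr 1
      exact congrArg (fun φ : Rep.of τ ⟶ Rep.of τ => φ.hom y) i.inv_hom_id
    · rintro ⟨y, hy⟩
      exact ⟨i.hom.hom y, hy⟩

/-- Every nonzero representation contains an irreducible one. -/
theorem exists_equivariant_injective [Finite G] [Nontrivial M] (σ : Representation ℂ G M) :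
    ∃ (E : Irr G) (f : E.rep.V →ₗ[ℂ] M), IsEquivariant σ E.rep f ∧ Function.Injective f := by
  have : Nontrivial σ.asModule := inferInstanceAs (Nontrivial M)
  have := neZero_natCard_complex G
  obtain ⟨S, -, hS⟩ := (IsSemisimpleModule.eq_bot_or_exists_simple_le
    (⊤ : Submodule ℂ[G] σ.asModule)).resolve_left top_ne_bot
  obtain ⟨E, f, hf, hinj, -⟩ := exists_equivariant_of_isSimpleModule S hS
  exact ⟨E, f, hf, hinj⟩

/-- Every representation is spanned by the images of irreducible ones. -/
theorem eq_top_of_forall_equivariant [Finite G] (σ : Representation ℂ G M) (N : Submodule ℂ M)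
    (hN : ∀ (E : Irr G) (f : E.rep.V →ₗ[ℂ] M), IsEquivariant σ E.rep f → ∀ e, f e ∈ N) :
    N = ⊤ := by
  have := neZero_natCard_complex G
  rw [eq_top_iff]
  rintro m -
  have hm : σ.asModuleEquiv.symm m ∈ sSup {S : Submodule ℂ[G] σ.asModule | IsSimpleModule ℂ[G] S} := by
    rw [IsSemisimpleModule.sSup_simples_eq_top]; trivial
  rw [sSup_eq_iSup] at hm
  have key : ∀ x ∈ ⨆ S ∈ {S : Submodule ℂ[G] σ.asModule | IsSimpleModule ℂ[G] S}, S,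
      σ.asModuleEquiv x ∈ N := by
    intro x hx
    induction hx using Submodule.iSup_induction' with
    | mem S x hx =>
      by_cases hS : IsSimpleModule ℂ[G] S
      · simp only [Set.mem_ofPred_eq, hS, iSup_pos] at hx
        obtain ⟨E, f, hf, -, h⟩ := exists_equivariant_of_isSimpleModule S hS
        obtain ⟨e, he⟩ := (h x).1 hx
        rw [← he]; exact hN E f hf e
      · simp only [Set.mem_ofPred_eq, hS, iSup_false, Submodule.mem_bot] at hx
        rw [hx, map_zero]; exact N.zero_mem
    | zero => rw [map_zero]; exact N.zero_mem
    | add x y _ _ hx hy => rw [map_add]; exact N.add_mem hx hy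
  simpa using key _ hm

/-- Equivariant maps from a representation lift through equivariant surjections. -/
theorem exists_equivariant_lift [Finite G] {M' : Type*} [AddCommGroup M'] [Module ℂ M']
    {σ' : Representation ℂ G M'} (p : M →ₗ[ℂ] M') (hp : ∀ g m, p (σ g m) = σ' g (p m))
    (hs : Function.Surjective p) {E : Rep.{0} ℂ G} {f : E.V →ₗ[ℂ] M'}
    (hf : IsEquivariant σ' E f) :
    ∃ f' : E.V →ₗ[ℂ] M, IsEquivariant σ E f' ∧ ∀ e, p (f' e) = f e := by
  have := neZero_natCard_complex G
  let P : σ.asModule →ₗ[ℂ[G]] σ'.asModule :=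
    IntertwiningMap.equivLinearMapAsModule σ σ' (p.intertwiningMap_of_isIntertwiningMap _ _ hp)
  have : Module.Projective ℂ[G] E.ρ.asModule := Module.projective_of_isSemisimpleRing _ _
  obtain ⟨F, hF⟩ := Module.projective_lifting_property P hf.asModuleHom hs
  let F' := (IntertwiningMap.equivLinearMapAsModule E.ρ σ).symm F
  exact ⟨F'.toLinearMap, fun g e => LinearMap.congr_fun (F'.isIntertwining' g) e,
    fun e => LinearMap.congr_fun hF e⟩

end

theorem finite_irr [Finite G] : Finite (Irr G) := by
  have := neZero_natCard_complex G
  have : Module.Finite ℂ ℂ[G] := inferInstance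
  have : IsNoetherian ℂ[G] ℂ[G] := isNoetherian_of_tower ℂ inferInstance
  have hex : ∀ E : Irr G, ∃ S : Submodule ℂ[G] ℂ[G], Nonempty (E.rep.ρ.asModule ≃ₗ[ℂ[G]] S) := by
    intro E
    have : IsSimpleModule ℂ[G] E.rep.ρ.asModule := inferInstance
    have := Module.projective_of_isSemisimpleRing ℂ[G] E.rep.ρ.asModule
    have := IsSimpleModule.nontrivial ℂ[G] E.rep.ρ.asModule
    obtain ⟨x, hx⟩ := exists_ne (0 : E.rep.ρ.asModule)
    obtain ⟨t, ht⟩ := Module.projective_lifting_property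
      (LinearMap.toSpanSingleton ℂ[G] E.rep.ρ.asModule x) LinearMap.id
      (IsSimpleModule.toSpanSingleton_surjective ℂ[G] hx)
    have hinj : Function.Injective t :=
      Function.LeftInverse.injective (g := LinearMap.toSpanSingleton ℂ[G] E.rep.ρ.asModule x)
        fun y => LinearMap.congr_fun ht y
    exact ⟨LinearMap.range t, ⟨LinearEquiv.ofInjective t hinj⟩⟩
  choose S hS using hex
  have hsimple : ∀ E, IsSimpleModule ℂ[G] (S E) := fun E => IsSimpleModule.congr (hS E).some.symm
  let F : Irr G → isotypicComponents ℂ[G] ℂ[G] := fun E =>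
    ⟨isotypicComponent ℂ[G] ℂ[G] (S E), S E, hsimple E, rfl⟩
  refine Finite.of_injective F fun E E' h => ?_
  have h' : isotypicComponent ℂ[G] ℂ[G] (S E) = isotypicComponent ℂ[G] ℂ[G] (S E') :=
    congrArg Subtype.val h
  have := hsimple E
  have := hsimple E'
  have ⟨e⟩ := isIsotypicOfType_submodule_iff.mp (.isotypicComponent ℂ[G] ℂ[G] (S E')) (S E)
    (h' ▸ (S E).le_isotypicComponent)
  let e' : E.rep.ρ.asModule ≃ₗ[ℂ[G]] E'.rep.ρ.asModule :=
    (hS E).some.trans (e.trans (hS E').some.symm)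
  let φ := (IntertwiningMap.equivLinearMapAsModule E.rep.ρ E'.rep.ρ).symm e'.toLinearMap
  let ψ := (IntertwiningMap.equivLinearMapAsModule E'.rep.ρ E.rep.ρ).symm e'.symm.toLinearMap
  refine eq_of_rep_iso ⟨⟨Rep.ofHom φ, Rep.ofHom ψ, ?_, ?_⟩⟩
  · apply Rep.hom_ext
    ext x
    exact e'.symm_apply_apply x
  · apply Rep.hom_ext
    ext x
    exact e'.apply_symm_apply x

end FiniteGroupRep

namespace FiniteGroupRep

open IrrepClass Representation
open scoped MonoidAlgebra

variable {G : Type} [Group G]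

/-- Schur's lemma for the chosen representatives. -/
theorem exists_scalar_of_equivariant [Finite G] {E : Irr G} {f : E.rep.V →ₗ[ℂ] E.rep.V}
    (hf : IsEquivariant E.rep.ρ E.rep f) : ∃ c : ℂ, ∀ e, f e = c • e := by
  let φ : IntertwiningMap E.rep.ρ E.rep.ρ := f.intertwiningMap_of_isIntertwiningMap _ _ hf
  obtain ⟨c, hc⟩ := (IsIrreducible.algebraMap_intertwiningMap_bijective_of_isAlgClosed
    (k := ℂ) (ρ := E.rep.ρ)).2 φ
  exact ⟨c, fun e => (congrArg (fun ψ : IntertwiningMap E.rep.ρ E.rep.ρ => ψ e) hc).symm⟩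

theorem eq_zero_of_equivariant_of_ne {E E' : Irr G} (h : E ≠ E') {f : E.rep.V →ₗ[ℂ] E'.rep.V}
    (hf : IsEquivariant E'.rep.ρ E.rep f) : f = 0 := by
  let φ : IntertwiningMap E.rep.ρ E'.rep.ρ := f.intertwiningMap_of_isIntertwiningMap _ _ hf
  rcases IsIrreducible.bijective_or_eq_zero φ with hb | h0
  · exfalso
    refine h (eq_of_rep_iso ?_)
    let e := LinearEquiv.ofBijective f hb
    have hinv : IsEquivariant E.rep.ρ E'.rep e.symm.toLinearMap := by
      intro g x
      apply hb.1
      have := hf g (e.symm x)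
      change e (e.symm (E'.rep.ρ g x)) = f (E.rep.ρ g (e.symm x))
      rw [this, e.apply_symm_apply]
      change _ = E'.rep.ρ g (e (e.symm x))
      rw [e.apply_symm_apply]
    refine ⟨⟨Rep.ofHom φ, Rep.ofHom (LinearMap.intertwiningMap_of_isIntertwiningMap _ _ _ hinv),
      ?_, ?_⟩⟩
    · apply Rep.hom_ext
      ext x
      exact e.symm_apply_apply x
    · apply Rep.hom_ext
      ext x
      exact e.apply_symm_apply x
  · ext x
    exact congrArg (fun ψ : IntertwiningMap E.rep.ρ E'.rep.ρ => ψ x) h0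

section Schur

variable {R : Type*} [CommRing R] [Algebra ℂ R]

/-- The component of an equivariant map `E → R ⊗ E'` along a linear form on `R`. -/
theorem isEquivariant_rTensor {E E' : Irr G} {f : E.rep.V →ₗ[ℂ] R ⊗[ℂ] E'.rep.V}
    (hf : ∀ g e, f (E.rep.ρ g e) = (E'.rep.ρ g).baseChange R (f e)) (l : R →ₗ[ℂ] ℂ) :
    IsEquivariant E'.rep.ρ E.rep
      ((TensorProduct.lid ℂ E'.rep.V).toLinearMap ∘ₗ l.rTensor E'.rep.V ∘ₗ f) := by
  intro g e
  simp only [LinearMap.comp_apply, hf]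
  generalize f e = x
  induction x using TensorProduct.induction_on with
  | zero => simp
  | tmul r y => simp
  | add x y hx hy => simp only [map_add, hx, hy]

theorem eq_zero_of_forall_rTensor {N : Type*} [AddCommGroup N] [Module ℂ N] {x : R ⊗[ℂ] N}
    (h : ∀ l : R →ₗ[ℂ] ℂ, TensorProduct.lid ℂ N (l.rTensor N x) = 0) : x = 0 := by
  classical
  let b := Module.Basis.ofVectorSpace ℂ R
  rw [← LinearEquiv.map_eq_zero_iff (TensorProduct.equivFinsuppOfBasisLeft (N := N) b)]
  ext i
  have := h (b.coord i)
  rw [Finsupp.coe_zero, Pi.zero_apply, ← this]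
  clear h this
  induction x using TensorProduct.induction_on with
  | zero => simp
  | tmul r y => simp
  | add x y hx hy => simp only [map_add, Finsupp.add_apply, hx, hy]

/-- Schur's lemma over a complex algebra, for distinct irreducible representations. -/
theorem eq_zero_of_equivariant_baseChange {E E' : Irr G} (h : E ≠ E')
    {f : E.rep.V →ₗ[ℂ] R ⊗[ℂ] E'.rep.V}
    (hf : ∀ g e, f (E.rep.ρ g e) = (E'.rep.ρ g).baseChange R (f e)) (e : E.rep.V) : f e = 0 :=
  eq_zero_of_forall_rTensor fun l =>
    LinearMap.congr_fun (eq_zero_of_equivariant_of_ne h (isEquivariant_rTensor hf l)) e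

/-- Schur's lemma over a complex algebra. -/
theorem exists_scalar_of_equivariant_baseChange [Finite G] {E : Irr G} {f : E.rep.V →ₗ[ℂ] R ⊗[ℂ] E.rep.V}
    (hf : ∀ g e, f (E.rep.ρ g e) = (E.rep.ρ g).baseChange R (f e)) :
    ∃ r : R, ∀ e, f e = r ⊗ₜ e := by
  choose c hc using fun l => exists_scalar_of_equivariant (isEquivariant_rTensor hf l)
  -- `l ↦ c l` is evaluation at the element `r` of `R` obtained by pairing `f e₀` with a linear
  -- form on `E` taking the value `1` at `e₀`.
  obtain ⟨e₀, he₀⟩ := exists_ne (0 : E.rep.V)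
  obtain ⟨μ, hμ⟩ : ∃ μ : E.rep.V →ₗ[ℂ] ℂ, μ e₀ = 1 := by
    obtain ⟨μ, hμ⟩ := LinearMap.exists_leftInverse_of_injective
      (LinearMap.toSpanSingleton ℂ E.rep.V e₀) (by
        rw [LinearMap.ker_eq_bot]; exact smul_left_injective ℂ he₀)
    exact ⟨μ, by simpa using LinearMap.congr_fun hμ 1⟩
  refine ⟨TensorProduct.rid ℂ R (μ.lTensor R (f e₀)), fun e => ?_⟩
  rw [← sub_eq_zero]
  refine eq_zero_of_forall_rTensor fun l => ?_
  have h1 : ∀ x : R ⊗[ℂ] E.rep.V, l (TensorProduct.rid ℂ R (μ.lTensor R x)) =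
      μ (TensorProduct.lid ℂ _ (l.rTensor _ x)) := by
    intro x
    induction x using TensorProduct.induction_on with
    | zero => simp
    | tmul r y => simp [mul_comm]
    | add x y hx hy => simp only [map_add, hx, hy]
  have h2 := hc l e
  have h3 := hc l e₀
  simp only [LinearMap.comp_apply, LinearEquiv.coe_coe] at h2 h3
  rw [map_sub, map_sub, h2, LinearMap.rTensor_tmul, TensorProduct.lid_tmul, h1, h3, map_smul, hμ,
    smul_eq_mul, mul_one, sub_self]

end Schur

section Decomposition

variable {R : Type u} [CommRing R] [Algebra ℂ R]
variable {X : Type v} [AddCommGroup X] [Module R X] [Module ℂ X] [IsScalarTower ℂ R X]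

/-- The `R`-module of equivariant maps from `E` to an `R`-module with an action of `G`. -/
def equivariantHom (σ : Representation ℂ G X) (hσ : ∀ g (r : R) x, σ g (r • x) = r • σ g x)
    (E : Rep.{0} ℂ G) : Submodule R (E.V →ₗ[ℂ] X) where
  carrier := {f | IsEquivariant σ E f}
  zero_mem' := fun g e => by simp
  add_mem' := fun {f f'} hf hf' g e => by
    rw [LinearMap.add_apply, LinearMap.add_apply, hf, hf', map_add]
  smul_mem' := fun r f hf g e => by
    rw [LinearMap.smul_apply, LinearMap.smul_apply, hf, hσ]

/-- Averaging over the group, a retraction onto the equivariant maps. -/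
def averaging [Fintype G] (σ : Representation ℂ G X) (hσ : ∀ g (r : R) x, σ g (r • x) = r • σ g x)
    (E : Rep.{0} ℂ G) : (E.V →ₗ[ℂ] X) →ₗ[R] equivariantHom σ hσ E where
  toFun f := ⟨(Fintype.card G : ℂ)⁻¹ • ∑ g, σ g ∘ₗ f ∘ₗ E.ρ g⁻¹, fun g e => by
    simp only [LinearMap.smul_apply, LinearMap.sum_apply, LinearMap.comp_apply, map_smul, map_sum]
    congr 1
    refine Fintype.sum_equiv (Equiv.mulLeft g⁻¹) _ _ fun x => ?_
    simp only [Equiv.coe_mulLeft, ← Module.End.mul_apply, ← map_mul]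
    simp⟩
  map_add' f f' := by
    ext e
    simp [Finset.sum_add_distrib]
  map_smul' r f := by
    ext e
    simp only [LinearMap.smul_apply, LinearMap.sum_apply, LinearMap.comp_apply, hσ,
      ← Finset.smul_sum, RingHom.id_apply, Submodule.coe_smul]
    rw [smul_comm]

theorem averaging_apply [Fintype G] {σ : Representation ℂ G X}
    {hσ : ∀ g (r : R) x, σ g (r • x) = r • σ g x} {E : Rep.{0} ℂ G}
    (f : equivariantHom σ hσ E) : averaging σ hσ E f = f := by
  ext e
  change (Fintype.card G : ℂ)⁻¹ • (∑ g, σ g ∘ₗ f.1 ∘ₗ E.ρ g⁻¹) e = f.1 e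
  have : ∀ g, (σ g ∘ₗ f.1 ∘ₗ E.ρ g⁻¹) e = f.1 e := by
    intro g
    have := f.2 g⁻¹ e
    simp only [LinearMap.comp_apply, this, ← Module.End.mul_apply, ← map_mul]
    simp
  rw [LinearMap.sum_apply, Finset.sum_congr rfl fun g _ => this g, Finset.sum_const,
    Finset.card_univ, ← Nat.cast_smul_eq_nsmul ℂ, smul_smul, inv_mul_cancel₀ (by simp), one_smul]

variable (R) in
theorem projective_linearMap [Module.Projective R X] (N : Type*) [AddCommGroup N] [Module ℂ N]
    [FiniteDimensional ℂ N] : Module.Projective R (N →ₗ[ℂ] X) :=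
  have : Module.Projective R (Fin (Module.finrank ℂ N) → X) :=
    Module.Projective.of_equiv
      (DirectSum.linearEquivFunOnFintype R (Fin (Module.finrank ℂ N)) fun _ => X)
  Module.Projective.of_equiv ((Module.finBasis ℂ N).constr R (M' := X))

variable (R) in
theorem finite_linearMap [Module.Finite R X] (N : Type*) [AddCommGroup N] [Module ℂ N]
    [FiniteDimensional ℂ N] : Module.Finite R (N →ₗ[ℂ] X) :=
  Module.Finite.equiv ((Module.finBasis ℂ N).constr R (M' := X))

theorem projective_equivariantHom [Finite G] [Module.Projective R X] (σ : Representation ℂ G X)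
    (hσ : ∀ g (r : R) x, σ g (r • x) = r • σ g x) (E : Irr G) :
    Module.Projective R (equivariantHom σ hσ E.rep) := by
  have := Fintype.ofFinite G
  have := projective_linearMap R (X := X) E.rep.V
  exact Module.Projective.of_split (equivariantHom σ hσ E.rep).subtype (averaging σ hσ E.rep)
    (LinearMap.ext averaging_apply)

theorem finite_equivariantHom [Finite G] [Module.Finite R X] (σ : Representation ℂ G X)
    (hσ : ∀ g (r : R) x, σ g (r • x) = r • σ g x) (E : Irr G) :
    Module.Finite R (equivariantHom σ hσ E.rep) := by
  have := Fintype.ofFinite G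
  have := finite_linearMap R (X := X) E.rep.V
  exact Module.Finite.of_surjective (averaging σ hσ E.rep) fun f => ⟨f, averaging_apply f⟩

/-- A finitely generated projective module over a local complex algebra with an action of a finite
group is a direct sum of modules `R ⊗ E`, with `E` irreducible over `ℂ`. -/
theorem exists_decomposition [Finite G] [IsLocalRing R] [Module.Finite R X] [Module.Projective R X]
    (σ : Representation ℂ G X) (hσ : ∀ g (r : R) x, σ g (r • x) = r • σ g x) :
    ∃ (m : ℕ) (E : Fin m → Irr G) (f : ∀ i, (E i).rep.V →ₗ[ℂ] X),
      (∀ i, IsEquivariant σ (E i).rep (f i)) ∧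
      (∀ x, ∃ c : ∀ i, R ⊗[ℂ] (E i).rep.V, x = ∑ i, (f i).liftBaseChange R (c i)) ∧
      ∀ c : ∀ i, R ⊗[ℂ] (E i).rep.V, ∑ i, (f i).liftBaseChange R (c i) = 0 → ∀ i, c i = 0 := by
  classical
  have hirr := finite_irr (G := G)
  have := Fintype.ofFinite (Irr G)
  have hproj := fun E => projective_equivariantHom σ hσ E
  have hfin := fun E => finite_equivariantHom σ hσ E
  have hfree : ∀ E : Irr G, Module.Free R (equivariantHom σ hσ E.rep) :=
    fun E => Module.free_of_flat_of_isLocalRing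
  let b := fun E : Irr G => Module.finBasis R (equivariantHom σ hσ E.rep)
  let ι := Σ E : Irr G, Fin (Module.finrank R (equivariantHom σ hσ E.rep))
  let ε : Fin (Fintype.card ι) ≃ ι := (Fintype.equivFin ι).symm
  let F : ∀ j : ι, j.1.rep.V →ₗ[ℂ] X := fun j => (b j.1 j.2).1
  have hF : ∀ j : ι, IsEquivariant σ j.1.rep (F j) := fun j => (b j.1 j.2).2
  have hact : ∀ (j : ι) g (y : R ⊗[ℂ] j.1.rep.V),
      (F j).liftBaseChange R ((j.1.rep.ρ g).baseChange R y) = σ g ((F j).liftBaseChange R y) := by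
    intro j g y
    induction y using TensorProduct.induction_on with
    | zero => simp
    | tmul r y => simp [hF j g y, hσ]
    | add x y hx hy => simp only [map_add, hx, hy]
  -- it suffices to treat the index set `ι`
  suffices h : (∀ x, ∃ c : ∀ j : ι, R ⊗[ℂ] j.1.rep.V, x = ∑ j, (F j).liftBaseChange R (c j)) ∧
      ∀ c : ∀ j : ι, R ⊗[ℂ] j.1.rep.V, ∑ j, (F j).liftBaseChange R (c j) = 0 → ∀ j, c j = 0 by
    refine ⟨Fintype.card ι, fun i => (ε i).1, fun i => F (ε i), fun i => hF (ε i),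
      fun x => ?_, fun c hc i => ?_⟩
    · obtain ⟨c, hc⟩ := h.1 x
      refine ⟨fun i => c (ε i), hc.trans ?_⟩
      exact (ε.sum_comp fun j => (F j).liftBaseChange R (c j)).symm
    · let c' : ∀ j : ι, R ⊗[ℂ] j.1.rep.V := ε.piCongrLeft (fun j => R ⊗[ℂ] j.1.rep.V) c
      have hc' : ∀ i, c' (ε i) = c i := fun i => Equiv.piCongrLeft_apply_apply _ _ _ _
      rw [← hc' i]
      refine h.2 c' ?_ (ε i)
      rw [← ε.sum_comp fun j => (F j).liftBaseChange R (c' j), ← hc]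
      exact Finset.sum_congr rfl fun i _ => by rw [hc']
  constructor
  · let N : Submodule ℂ X :=
      { carrier := {x | ∃ c : ∀ j : ι, R ⊗[ℂ] j.1.rep.V, x = ∑ j, (F j).liftBaseChange R (c j)}
        zero_mem' := ⟨0, by simp⟩
        add_mem' := by
          rintro _ _ ⟨c, rfl⟩ ⟨c', rfl⟩
          exact ⟨c + c', by simp [Finset.sum_add_distrib]⟩
        smul_mem' := by
          rintro a _ ⟨c, rfl⟩
          refine ⟨algebraMap ℂ R a • c, ?_⟩
          simp [Finset.smul_sum] }
    have hN : N = ⊤ := by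
      refine eq_top_of_forall_equivariant σ N fun E f hf e => ?_
      let φ : equivariantHom σ hσ E.rep := ⟨f, hf⟩
      have hφ := (b E).sum_repr φ
      refine ⟨fun j => if h : E = j.1 then
        (b j.1).repr (h ▸ φ) j.2 ⊗ₜ (h ▸ e) else 0, ?_⟩
      rw [Fintype.sum_sigma, Finset.sum_eq_single E]
      · have h2 := congrArg (fun ψ : equivariantHom σ hσ E.rep => ψ.1 e) hφ
        simp only [Submodule.coe_sum, Submodule.coe_smul, LinearMap.sum_apply,
          LinearMap.smul_apply] at h2
        change f e = _
        simp only [dite_true, LinearMap.liftBaseChange_tmul]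
        exact h2.symm
      · intro E' _ hE'
        refine Finset.sum_eq_zero fun i _ => ?_
        beta_reduce
        rw [dif_neg (Ne.symm hE'), map_zero]
      · simp
    intro x
    have : x ∈ N := by rw [hN]; trivial
    exact this
  · -- the kernel of `⨁ R ⊗ E → X` is a representation; an irreducible `E` inside it would give a
    -- linear relation between the basis elements of `Hom(E, X)`
    let Ψ : (∀ j : ι, R ⊗[ℂ] j.1.rep.V) →ₗ[ℂ] X :=
      ∑ j, ((F j).liftBaseChange R).restrictScalars ℂ ∘ₗ LinearMap.proj j
    have hΨ : ∀ c, Ψ c = ∑ j, (F j).liftBaseChange R (c j) := fun c => by simp [Ψ]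
    let K := LinearMap.ker Ψ
    let act : G → (∀ j : ι, R ⊗[ℂ] j.1.rep.V) →ₗ[ℂ] (∀ j : ι, R ⊗[ℂ] j.1.rep.V) := fun g =>
      LinearMap.pi fun j => ((j.1.rep.ρ g).baseChange R).restrictScalars ℂ ∘ₗ LinearMap.proj j
    have hactK : ∀ g, ∀ c ∈ K, act g c ∈ K := by
      intro g c hc
      rw [LinearMap.mem_ker, hΨ] at hc ⊢
      have : ∀ j, (F j).liftBaseChange R (act g c j) = σ g ((F j).liftBaseChange R (c j)) :=
        fun j => hact j g (c j)
      rw [Finset.sum_congr rfl fun j _ => this j, ← map_sum, hc, map_zero]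
    let τ : Representation ℂ G K :=
      { toFun := fun g => (act g).restrict (hactK g)
        map_one' := by
          ext c j
          change (act 1 c.1) j = c.1 j
          simp [act]
        map_mul' := fun g g' => by
          ext c j
          change ((j.1.rep.ρ (g * g')).baseChange R) (c.1 j) =
            ((j.1.rep.ρ g).baseChange R) (((j.1.rep.ρ g').baseChange R) (c.1 j))
          rw [map_mul, LinearMap.baseChange_mul]; rfl }
    by_contra hcon
    push Not at hcon
    obtain ⟨c, hc, j₀, hj₀⟩ := hcon
    have hnt : Nontrivial K := ⟨⟨⟨c, by rw [LinearMap.mem_ker, hΨ, hc]⟩, 0, fun h => hj₀ (by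
      have := congrFun (congrArg Subtype.val h) j₀
      exact this)⟩⟩
    obtain ⟨E, f, hf, hinj⟩ := exists_equivariant_injective (M := K) τ
    have hfj : ∀ j g e, (f (E.rep.ρ g e)).1 j = (j.1.rep.ρ g).baseChange R ((f e).1 j) := by
      intro j g e
      rw [hf]; rfl
    let comp : ∀ j : ι, E.rep.V →ₗ[ℂ] R ⊗[ℂ] j.1.rep.V := fun j =>
      LinearMap.proj j ∘ₗ K.subtype ∘ₗ f
    have h0 : ∀ j : ι, E ≠ j.1 → ∀ e, (f e).1 j = 0 := fun j hj e =>
      eq_zero_of_equivariant_baseChange hj (f := comp j) (hfj j) e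
    choose r hr using fun i => exists_scalar_of_equivariant_baseChange (f := comp ⟨E, i⟩)
      (hfj ⟨E, i⟩)
    have hrel : ∑ i, r i • b E i = 0 := by
      ext e
      have h1 : Ψ (f e).1 = 0 := (f e).2
      rw [hΨ, Fintype.sum_sigma, Finset.sum_eq_single E] at h1
      · simp only [Submodule.coe_sum, Submodule.coe_smul, LinearMap.sum_apply,
          LinearMap.smul_apply]
        refine Eq.trans (Finset.sum_congr rfl fun i _ => ?_) h1
        have : (f e).1 ⟨E, i⟩ = r i ⊗ₜ e := hr i e
        rw [this, LinearMap.liftBaseChange_tmul]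
      · intro E' _ hE'
        refine Finset.sum_eq_zero fun i _ => ?_
        rw [h0 ⟨E', i⟩ hE'.symm, map_zero]
      · simp
    have hr0 := Fintype.linearIndependent_iff.1 (b E).linearIndependent r hrel
    obtain ⟨e, he⟩ := exists_ne (0 : E.rep.V)
    refine he (hinj ?_)
    rw [map_zero]
    ext ⟨E', i⟩
    by_cases hE : E = E'
    · subst hE
      have : (f e).1 ⟨E, i⟩ = r i ⊗ₜ e := hr i e
      rw [this, hr0, zero_tmul]; rfl
    · exact h0 ⟨E', i⟩ hE e

end Decomposition

end FiniteGroupRep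

/-! ### The reflections of `G(d,1,n)` -/

namespace Cherednik

open IrrepClass

section Reflections

variable {d n : ℕ}

theorem zeta_pow_eq_one [NeZero d] : zeta d ^ d = 1 := by
  have := (Complex.isPrimitiveRoot_exp d (NeZero.ne d)).pow_eq_one
  simpa [zeta] using this

theorem zeta_zpow_emod [NeZero d] (b : ℤ) : zeta d ^ (b % d) = zeta d ^ b := by
  conv_rhs => rw [← Int.emod_add_mul_ediv b d, zpow_add₀ (zeta_ne_zero d), zpow_mul, zpow_natCast,
    zeta_pow_eq_one, one_zpow, mul_one]

theorem monomialEquiv_congr {σ : Equiv.Perm (Fin n)} {a b : Fin n → ℤ}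
    (h : ∀ k, zeta d ^ a k = zeta d ^ b k) : monomialEquiv d σ a = monomialEquiv d σ b := by
  ext y l
  simp [monomialEquiv, h]

theorem monomialEquiv_injective {σ τ : Equiv.Perm (Fin n)} {a b : Fin n → ℤ}
    (h : monomialEquiv d σ a = monomialEquiv d τ b) :
    σ = τ ∧ ∀ k, zeta d ^ a k = zeta d ^ b k := by
  have key : ∀ k, σ k = τ k ∧ zeta d ^ a k = zeta d ^ b k := by
    intro k
    have h1 : zeta d ^ a k • (Pi.single (σ k) 1 : V n) = zeta d ^ b k • Pi.single (τ k) 1 := by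
      rw [← monomialEquiv_single, ← monomialEquiv_single, h]
    have h2 := congrFun h1 (σ k)
    by_cases hk : σ k = τ k
    · refine ⟨hk, ?_⟩
      simpa [hk] using h2
    · simp [hk, zpow_ne_zero, zeta_ne_zero] at h2
  exact ⟨Equiv.ext fun k => (key k).1, fun k => (key k).2⟩

instance finite_W [NeZero d] : Finite (W d n) := by
  let f : Equiv.Perm (Fin n) × (Fin n → ZMod d) → W d n := fun p =>
    ⟨monomialEquiv d p.1 fun k => (p.2 k).val, _, _, rfl⟩
  refine Finite.of_surjective f ?_
  rintro ⟨_, σ, a, rfl⟩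
  refine ⟨(σ, fun k => (a k : ZMod d)), Subtype.ext ?_⟩
  have : monomialEquiv d σ (fun k => (((a k : ℤ) : ZMod d).val : ℤ)) = monomialEquiv d σ a := ?_
  · exact this
  refine monomialEquiv_congr fun k => ?_
  rw [← zeta_zpow_emod (a k), ← ZMod.val_intCast]

/-- The reflection attached to `x_i - ζ ^ β x_j`, with an exponent in `ℤ` and no order imposed on
the indices. -/
def sInt (d : ℕ) (i j : Fin n) (β : ℤ) : V n ≃ₗ[ℂ] V n :=
  monomialEquiv d (Equiv.swap i j) (Pi.single i (-β) + Pi.single j β)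

theorem sInt_swap (i j : Fin n) (β : ℤ) : sInt d i j β = sInt d j i (-β) := by
  rw [sInt, sInt, Equiv.swap_comm, neg_neg, add_comm]

theorem exists_inr_of_sInt [NeZero d] {i j : Fin n} (hij : i ≠ j) (β : ℤ) :
    ∃ q : {p : Fin n × Fin n // p.1 < p.2} × Fin d,
      ((hypGen (Sum.inr q : Hyp d n) : W d n) : V n ≃ₗ[ℂ] V n) = sInt d i j β := by
  wlog hlt : i < j generalizing i j β
  · obtain ⟨q, hq⟩ := this hij.symm (-β) (lt_of_le_of_ne (not_lt.1 hlt) hij.symm)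
    exact ⟨q, hq.trans (sInt_swap i j β).symm⟩
  · have hd : (0 : ℤ) < d := by exact_mod_cast Nat.pos_of_ne_zero (NeZero.ne d)
    have h0 : 0 ≤ β % d := Int.emod_nonneg _ hd.ne'
    have h1 : β % d < d := Int.emod_lt_of_pos _ hd
    refine ⟨(⟨(i, j), hlt⟩, ⟨(β % d).toNat, by omega⟩), ?_⟩
    refine monomialEquiv_congr fun k => ?_
    have h2 : ((β % d).toNat : ℤ) = β % d := Int.toNat_of_nonneg h0
    simp only [Pi.add_apply, h2]
    rw [zpow_add₀ (zeta_ne_zero d), zpow_add₀ (zeta_ne_zero d)]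
    congr 1
    · by_cases hk : k = i
      · subst hk; simp only [Pi.single_eq_same, zpow_neg, zeta_zpow_emod]
      · simp [hk]
    · by_cases hk : k = j
      · subst hk; simp only [Pi.single_eq_same, zeta_zpow_emod]
      · simp [hk]

theorem hypGen_inr (q : {p : Fin n × Fin n // p.1 < p.2} × Fin d) :
    ((hypGen (Sum.inr q : Hyp d n) : W d n) : V n ≃ₗ[ℂ] V n) =
      sInt d q.1.1.1 q.1.1.2 ((q.2 : ℕ) : ℤ) := rfl

theorem hypGen_inr_injective [NeZero d] {q q' : {p : Fin n × Fin n // p.1 < p.2} × Fin d}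
    (h : hypGen (Sum.inr q : Hyp d n) = hypGen (Sum.inr q')) : q = q' := by
  obtain ⟨⟨⟨i, j⟩, hij⟩, α⟩ := q
  obtain ⟨⟨⟨i', j'⟩, hij'⟩, β⟩ := q'
  obtain ⟨h1, h2⟩ := monomialEquiv_injective (congrArg Subtype.val h)
  dsimp only at hij hij' h1 h2
  have h3 := Equiv.congr_fun h1 i
  rw [Equiv.swap_apply_left] at h3
  have hi : i = i' := by
    by_contra hne
    by_cases hj : i = j'
    · subst hj
      rw [Equiv.swap_apply_right] at h3
      subst h3
      exact lt_asymm hij hij'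
    · rw [Equiv.swap_apply_of_ne_of_ne hne hj] at h3
      exact hij.ne h3.symm
  subst hi
  rw [Equiv.swap_apply_left] at h3
  subst h3
  have h4 := h2 j
  simp only [Pi.add_apply, Pi.single_eq_same, Pi.single_eq_of_ne hij.ne', zero_add,
    zpow_natCast] at h4
  have h5 : (α : ℕ) = β :=
    (Complex.isPrimitiveRoot_exp d (NeZero.ne d)).pow_inj α.2 β.2 h4
  have : α = β := Fin.ext h5
  subst this
  rfl

/-- The determinant `exp(2π√-1/e_H)` of the generator `w_H`. -/
def hypDet (H : Hyp d n) : ℂ := Complex.exp (2 * Real.pi * Complex.I / (hypOrder H : ℂ))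

theorem hypDet_ne_zero (H : Hyp d n) : hypDet H ≠ 0 := Complex.exp_ne_zero _

theorem hypDet_inr (q : {p : Fin n × Fin n // p.1 < p.2} × Fin d) :
    hypDet (Sum.inr q : Hyp d n) = -1 := by
  rw [hypDet, ← Complex.exp_pi_mul_I]
  congr 1
  simp only [hypOrder]
  push_cast
  ring

theorem root_coroot_inr (q : {p : Fin n × Fin n // p.1 < p.2} × Fin d) :
    root (Sum.inr q : Hyp d n) (coroot (Sum.inr q)) = 2 := by
  obtain ⟨⟨⟨i, j⟩, hij⟩, α⟩ := q
  have hij : i < j := hij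
  simp [root, coroot, hij.ne, hij.ne', zeta_ne_zero]
  norm_num

theorem root_coroot_ne_zero (H : Hyp d n) : root H (coroot H) ≠ 0 := by
  rcases H with i | q
  · simp [root, coroot]
  · rw [root_coroot_inr]; norm_num

/-- The coefficient of the commutation relations: `y ↦ pairing H · y` is, up to the evaluation of
`ξ`, the projection onto the line of `v_H` along `H`. -/
def pairing (H : Hyp d n) (ξ : Module.Dual ℂ (V n)) (y : V n) : ℂ :=
  ξ (coroot H) * root H y / root H (coroot H)

/-- The generator of the pointwise stabiliser of a hyperplane is a reflection. -/
theorem hypGen_apply (H : Hyp d n) (y : V n) :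
    ((hypGen H : W d n) : V n ≃ₗ[ℂ] V n) y =
      y + ((hypDet H - 1) * (root H y / root H (coroot H))) • coroot H := by
  rcases H with i | q
  · have hz : hypDet (Sum.inl i : Hyp d n) = zeta d := rfl
    ext l
    rw [hz]
    by_cases h : l = i
    · subst h
      simp [hypGen, t, monomialEquiv, root, coroot, Equiv.Perm.one_def]
      ring
    · simp [hypGen, t, monomialEquiv, root, coroot, h, Equiv.Perm.one_def]
  · rw [hypDet_inr, root_coroot_inr, hypGen_inr]
    obtain ⟨⟨⟨i, j⟩, hij⟩, α⟩ := q
    have hij : i < j := hij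
    ext l
    by_cases h : l = i
    · subst h
      simp [sInt, monomialEquiv, root, coroot, hij.ne, hij.ne']
      ring
    · by_cases h' : l = j
      · subst h'
        have hz : zeta d ^ (α : ℕ) ≠ 0 := pow_ne_zero _ (zeta_ne_zero d)
        simp [sInt, monomialEquiv, root, coroot, hij.ne, hij.ne']
        field_simp
        ring
      · simp [sInt, monomialEquiv, root, coroot, h, h', Equiv.swap_apply_of_ne_of_ne]

theorem dualAct_apply (g : W d n) (ξ : Module.Dual ℂ (V n)) (y : V n) :
    dualAct g ξ ((g : V n ≃ₗ[ℂ] V n) y) = ξ y := by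
  change ξ (((g⁻¹ : W d n) : V n ≃ₗ[ℂ] V n) ((g : V n ≃ₗ[ℂ] V n) y)) = ξ y
  congr 1
  rw [← LinearEquiv.mul_apply, ← Subgroup.coe_mul, inv_mul_cancel]
  rfl

theorem dualAct_ext {g : W d n} {ξ ξ' : Module.Dual ℂ (V n)}
    (h : ∀ y, ξ y = ξ' ((g : V n ≃ₗ[ℂ] V n) y)) : dualAct g ξ = ξ' := by
  refine LinearMap.ext fun y => ?_
  obtain ⟨y, rfl⟩ := (g : V n ≃ₗ[ℂ] V n).surjective y
  rw [dualAct_apply, h]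

theorem dualAct_root (H : Hyp d n) :
    dualAct (hypGen H) (root H) = (hypDet H)⁻¹ • root H := by
  refine dualAct_ext fun y => ?_
  rw [hypGen_apply, LinearMap.smul_apply, map_add, map_smul, smul_eq_mul, smul_eq_mul]
  have h1 := root_coroot_ne_zero H
  have h2 := hypDet_ne_zero H
  field_simp
  ring

theorem dualAct_of_apply_coroot_eq_zero (H : Hyp d n) {ξ : Module.Dual ℂ (V n)}
    (h : ξ (coroot H) = 0) : dualAct (hypGen H) ξ = ξ := by
  refine dualAct_ext fun y => ?_
  rw [hypGen_apply, map_add, map_smul, h, smul_zero, add_zero]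

theorem hypGen_coroot (H : Hyp d n) :
    ((hypGen H : W d n) : V n ≃ₗ[ℂ] V n) (coroot H) = hypDet H • coroot H := by
  rw [hypGen_apply, div_self (root_coroot_ne_zero H), mul_one, sub_smul, one_smul]
  abel

theorem hypGen_of_root_eq_zero (H : Hyp d n) {y : V n} (h : root H y = 0) :
    ((hypGen H : W d n) : V n ≃ₗ[ℂ] V n) y = y := by
  rw [hypGen_apply, h, zero_div, mul_zero, zero_smul, add_zero]

/-- The coefficient of `γ_H` in `[y, ξ]`, for a reflection of order two, as a difference of values
of `ξ`. -/
theorem pairing_inr (q : {p : Fin n × Fin n // p.1 < p.2} × Fin d) (ξ : Module.Dual ℂ (V n))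
    (y : V n) : pairing (Sum.inr q : Hyp d n) ξ y =
      (ξ y - ξ (((hypGen (Sum.inr q : Hyp d n) : W d n) : V n ≃ₗ[ℂ] V n) y)) / 2 := by
  rw [hypGen_apply, hypDet_inr, map_add, map_smul, pairing, smul_eq_mul]
  ring

theorem monomialEquiv_apply (σ : Equiv.Perm (Fin n)) (a : Fin n → ℤ) (y : V n) (i : Fin n) :
    monomialEquiv d σ a y (σ i) = zeta d ^ a i * y i := by
  simp [monomialEquiv]

/-- `W` permutes the reflecting hyperplanes, compatibly with all the data attached to them. -/
theorem exists_hyp_perm [NeZero d] (g : W d n) : ∃ τ : Equiv.Perm (Hyp d n),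
    (∀ H, hypOrder (τ H) = hypOrder H) ∧
    (∀ H, hypGen (τ H) = g * hypGen H * g⁻¹) ∧
    (∀ H ξ y, pairing (τ H) (dualAct g ξ) ((g : V n ≃ₗ[ℂ] V n) y) = pairing H ξ y) ∧
    (∀ (R : Type u) [CommRing R] [Algebra ℂ R] (κ : {k : ZMod d // k ≠ 0} → R) (h : R) H k,
      cParam κ h (τ H) k = cParam κ h H k) := by
  obtain ⟨_, σ, a, rfl⟩ := g
  set g : W d n := ⟨monomialEquiv d σ a, σ, a, rfl⟩ with hg
  have hconj : ∀ q : {p : Fin n × Fin n // p.1 < p.2} × Fin d,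
      ∃ q' : {p : Fin n × Fin n // p.1 < p.2} × Fin d,
        hypGen (Sum.inr q' : Hyp d n) = g * hypGen (Sum.inr q) * g⁻¹ := by
    rintro ⟨⟨⟨i, j⟩, hij⟩, α⟩
    have hij : i < j := hij
    obtain ⟨q', hq'⟩ := exists_inr_of_sInt (d := d) (σ.injective.ne hij.ne) ((α : ℕ) + a i - a j)
    refine ⟨q', ?_⟩
    rw [eq_mul_inv_iff_mul_eq]
    apply Subtype.ext
    rw [Subgroup.coe_mul, Subgroup.coe_mul, hq', hypGen_inr]
    simp only [hg, sInt, monomialEquiv_mul]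
    rw [Equiv.swap_apply_apply, inv_mul_cancel_right]
    congr 1
    ext k
    by_cases hi : k = i
    · subst hi
      simp [hij.ne]
      ring
    · by_cases hj : k = j
      · subst hj
        simp [hij.ne']
      · simp [hi, hj, Equiv.swap_apply_of_ne_of_ne]
  choose f hf using hconj
  have hfinj : Function.Injective f := fun q q' h => hypGen_inr_injective (by
    have := (hf q).symm.trans ((congrArg (fun x => hypGen (Sum.inr x : Hyp d n)) h).trans (hf q'))
    simpa using this)
  let τ : Equiv.Perm (Hyp d n) := Equiv.sumCongr σ
    (Equiv.ofBijective f (Finite.injective_iff_bijective.1 hfinj))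
  have hinl : ∀ i, τ (Sum.inl i) = Sum.inl (σ i) := fun i => rfl
  have hinr : ∀ q, τ (Sum.inr q) = Sum.inr (f q) := fun i => rfl
  refine ⟨τ, ?_, ?_, ?_, ?_⟩
  · rintro (i | q) <;> rfl
  · rintro (i | q)
    · rw [hinl, eq_mul_inv_iff_mul_eq]
      apply Subtype.ext
      rw [Subgroup.coe_mul, Subgroup.coe_mul]
      simp only [hg, hypGen, t, monomialEquiv_mul, one_mul, mul_one]
      congr 1
      ext k
      simp only [Equiv.Perm.one_apply]
      by_cases hk : k = i
      · subst hk; simp; ring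
      · simp [hk]
    · rw [hinr, hf]
  · rintro (i | q) ξ y
    · rw [hinl]
      have h1 : (Pi.single (σ i) 1 : V n) =
          (g : V n ≃ₗ[ℂ] V n) ((zeta d ^ a i)⁻¹ • Pi.single i 1) := by
        rw [map_smul]
        change _ = _ • monomialEquiv d σ a _
        rw [monomialEquiv_single, smul_smul, inv_mul_cancel₀ (zpow_ne_zero _ (zeta_ne_zero d)),
          one_smul]
      have h2 : ((g : V n ≃ₗ[ℂ] V n) y) (σ i) = zeta d ^ a i * y i := monomialEquiv_apply σ a y i
      have h3 : zeta d ^ a i ≠ 0 := zpow_ne_zero _ (zeta_ne_zero d)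
      simp only [pairing, root, coroot, LinearMap.proj_apply, h2, h1, dualAct_apply]
      rw [← h1]
      simp only [Pi.single_eq_same, map_smul, smul_eq_mul]
      field_simp
    · rw [hinr, pairing_inr, pairing_inr, dualAct_apply, hf]
      congr 2
      rw [← dualAct_apply g ξ]
      congr 1
      rw [Subgroup.coe_mul, Subgroup.coe_mul, LinearEquiv.mul_apply, LinearEquiv.mul_apply]
      congr 2
      rw [← LinearEquiv.mul_apply, ← Subgroup.coe_mul, inv_mul_cancel]
      rfl
  · intro R _ _ κ h H k
    rcases H with i | q <;> rfl

end Reflections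

end Cherednik

namespace Cherednik

open IrrepClass

/-! ### Commutators with `a_H` -/

section Commutators

variable {d n : ℕ} {R : Type u} [CommRing R] [Algebra ℂ R]
variable {B : Type*} [Ring B] [Algebra R B] [Algebra ℂ B] [IsScalarTower ℂ R B]

/-- The extension to the group algebra of a multiplicative map from `W`. -/
abbrev grpLift (G : W d n →* B) : MonoidAlgebra R (W d n) →ₐ[R] B :=
  MonoidAlgebra.lift R B (W d n) G

theorem grpLift_eps (G : W d n →* B) (H : Hyp d n) (k : ℕ) :
    grpLift G (eps R H k) = ∑ a ∈ Finset.range (hypOrder H),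
      ((1 / (hypOrder H : ℂ)) * Complex.exp (2 * Real.pi * Complex.I * a * k / (hypOrder H : ℂ))) •
        G (hypGen H) ^ a := by
  rw [eps, map_sum]
  refine Finset.sum_congr rfl fun a _ => ?_
  rw [MonoidAlgebra.lift_single, map_pow, algebraMap_smul]

variable {G : W d n →* B} {H : Hyp d n}

theorem pow_mul_of_twisted {c : ℂ} {g x : B} (h : g * x = c • (x * g)) (a : ℕ) :
    g ^ a * x = c ^ a • (x * g ^ a) := by
  induction a with
  | zero => simp
  | succ a ih =>
    rw [pow_succ', mul_assoc, ih, mul_smul_comm, ← mul_assoc, h, smul_mul_assoc, smul_smul,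
      mul_assoc, ← pow_succ]

theorem exp_shift (H : Hyp d n) (a k : ℕ) :
    Complex.exp (2 * Real.pi * Complex.I * a * ((k + 1 : ℕ) : ℂ) / (hypOrder H : ℂ)) =
      Complex.exp (2 * Real.pi * Complex.I * a * k / (hypOrder H : ℂ)) * hypDet H ^ a := by
  rw [hypDet, ← Complex.exp_nat_mul, ← Complex.exp_add]
  congr 1
  push_cast
  ring

/-- Moving an eigenvector of the reflection, of the same eigenvalue as the root, past the
idempotents `ε_{H,k}` shifts their index. -/
theorem grpLift_eps_mul_of_root {x : B}
    (h : G (hypGen H) * x = (hypDet H)⁻¹ • (x * G (hypGen H))) (k : ℕ) :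
    grpLift G (eps R H (k + 1)) * x = x * grpLift G (eps R H k) := by
  rw [grpLift_eps, grpLift_eps, Finset.sum_mul, Finset.mul_sum]
  refine Finset.sum_congr rfl fun a _ => ?_
  rw [smul_mul_assoc, pow_mul_of_twisted h, smul_smul, mul_smul_comm, exp_shift]
  congr 1
  have := pow_ne_zero a (hypDet_ne_zero H)
  rw [inv_pow]
  field_simp

/-- Moving an eigenvector of the reflection, of the same eigenvalue as the coroot, past the
idempotents `ε_{H,k}` shifts their index in the opposite direction. -/
theorem grpLift_eps_mul_of_coroot {y : B}
    (h : G (hypGen H) * y = hypDet H • (y * G (hypGen H))) (k : ℕ) :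
    grpLift G (eps R H k) * y = y * grpLift G (eps R H (k + 1)) := by
  rw [grpLift_eps, grpLift_eps, Finset.sum_mul, Finset.mul_sum]
  refine Finset.sum_congr rfl fun a _ => ?_
  rw [smul_mul_assoc, pow_mul_of_twisted h, smul_smul, mul_smul_comm, exp_shift]
  congr 1
  ring

theorem grpLift_eps_comm {x : B} (h : Commute (G (hypGen H)) x) (k : ℕ) :
    Commute (grpLift G (eps R H k)) x := by
  rw [grpLift_eps]
  exact Commute.sum_left _ _ _ fun a _ => (h.pow_left a).smul_left _

variable (κ : {k : ZMod d // k ≠ 0} → R) (h : R)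

omit [Algebra ℂ R] in
theorem cParam_zero (H : Hyp d n) : cParam κ h H 0 = 0 := by
  rcases H with i | q <;> simp [cParam]

omit [Algebra ℂ R] in
theorem cParam_hypOrder (H : Hyp d n) : cParam κ h H (hypOrder H) = 0 := by
  rcases H with i | q
  · simp [cParam, hypOrder]
  · exact if_pos (by decide : ((2 : ℕ) : ZMod 2) = 0)

theorem aElt_eq (hd : 0 < hypOrder H) : aElt κ h H =
    (hypOrder H : R) • ∑ k ∈ Finset.range (hypOrder H), cParam κ h H k • eps R H k := by
  rw [aElt, ← Finset.sum_range_add_sum_Ico _ (show 1 ≤ hypOrder H from hd)]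
  simp [cParam_zero]

theorem aElt_eq_shift (hd : 0 < hypOrder H) : aElt κ h H = (hypOrder H : R) •
    ∑ k ∈ Finset.range (hypOrder H), cParam κ h H (k + 1) • eps R H (k + 1) := by
  rw [aElt_eq κ h hd]
  congr 1
  have h1 := Finset.sum_range_succ (fun k => cParam κ h H k • eps R H k) (hypOrder H)
  have h2 := Finset.sum_range_succ' (fun k => cParam κ h H k • eps R H k) (hypOrder H)
  rw [cParam_zero, zero_smul, add_zero] at h2
  rw [cParam_hypOrder, zero_smul, add_zero] at h1
  rw [← h1, h2]

theorem hypOrder_pos [NeZero d] (H : Hyp d n) : 0 < hypOrder H := by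
  rcases H with i | q
  · exact Nat.pos_of_ne_zero (NeZero.ne d)
  · exact Nat.zero_lt_two

/-- Since `a_H = e_H ∑ c_{H,k} ε_{H,k}` and the root shifts `k`, its commutator with `a_H` has the
differences `c_{H,k+1} - c_{H,k}` as coefficients, which are those of `γ_H`. -/
theorem grpLift_aElt_mul_of_root [NeZero d] {x : B}
    (hx : G (hypGen H) * x = (hypDet H)⁻¹ • (x * G (hypGen H))) :
    grpLift G (aElt κ h H) * x - x * grpLift G (aElt κ h H) =
      x * grpLift G (gammaElt κ h H) := by
  nth_rewrite 1 [aElt_eq_shift κ h (hypOrder_pos H)]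
  rw [aElt_eq κ h (hypOrder_pos H), gammaElt]
  simp only [map_smul, map_sum, map_sub, smul_mul_assoc, mul_smul_comm, Finset.sum_mul,
    Finset.mul_sum, mul_sub, grpLift_eps_mul_of_root hx, sub_smul, Finset.sum_sub_distrib, smul_sub]

/-- The analogue for the coroot of the commutator of the root with `a_H`. -/
theorem grpLift_aElt_mul_of_coroot [NeZero d] {y : B}
    (hy : G (hypGen H) * y = hypDet H • (y * G (hypGen H))) :
    grpLift G (aElt κ h H) * y - y * grpLift G (aElt κ h H) =
      -(grpLift G (gammaElt κ h H) * y) := by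
  nth_rewrite 2 [aElt_eq_shift κ h (hypOrder_pos H)]
  rw [aElt_eq κ h (hypOrder_pos H), gammaElt]
  simp only [map_smul, map_sum, map_sub, smul_mul_assoc, mul_smul_comm, Finset.sum_mul,
    Finset.mul_sum, sub_mul, grpLift_eps_mul_of_coroot hy, sub_smul, Finset.sum_sub_distrib,
    smul_sub, neg_sub]

theorem grpLift_aElt_comm {x : B} (hx : Commute (G (hypGen H)) x) :
    Commute (grpLift G (aElt κ h H)) x := by
  rw [aElt, map_smul, map_sum]
  refine Commute.smul_left (Commute.sum_left _ _ _ fun k _ => ?_) _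
  rw [map_smul]
  exact (grpLift_eps_comm hx k).smul_left _

/-- Conjugation by `g` carries the elements attached to `H` to those attached to `g(H)`. -/
theorem grpLift_eps_conj {H' : Hyp d n} {g : W d n} (ho : hypOrder H' = hypOrder H)
    (hg : hypGen H' = g * hypGen H * g⁻¹) (k : ℕ) :
    G g * grpLift G (eps R H k) = grpLift G (eps R H' k) * G g := by
  rw [grpLift_eps, grpLift_eps, ho, Finset.sum_mul, Finset.mul_sum]
  refine Finset.sum_congr rfl fun a _ => ?_
  rw [mul_smul_comm, smul_mul_assoc, ← map_pow, ← map_pow, ← map_mul, ← map_mul, hg, conj_pow,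
    inv_mul_cancel_right]

theorem grpLift_aElt_conj {H' : Hyp d n} {g : W d n} (ho : hypOrder H' = hypOrder H)
    (hg : hypGen H' = g * hypGen H * g⁻¹) (hc : ∀ k, cParam κ h H' k = cParam κ h H k) :
    G g * grpLift G (aElt κ h H) = grpLift G (aElt κ h H') * G g := by
  rw [aElt, aElt, ho]
  simp only [map_smul, map_sum, smul_mul_assoc, mul_smul_comm, Finset.sum_mul, Finset.mul_sum,
    grpLift_eps_conj ho hg, hc]

theorem grpLift_gammaElt_conj {H' : Hyp d n} {g : W d n} (ho : hypOrder H' = hypOrder H)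
    (hg : hypGen H' = g * hypGen H * g⁻¹) (hc : ∀ k, cParam κ h H' k = cParam κ h H k) :
    G g * grpLift G (gammaElt κ h H) = grpLift G (gammaElt κ h H') * G g := by
  rw [gammaElt, gammaElt, ho]
  simp only [map_smul, map_sum, smul_mul_assoc, mul_smul_comm, Finset.sum_mul, Finset.mul_sum,
    grpLift_eps_conj ho hg, hc]

/-- The element `z` is central. -/
theorem grpLift_zElt_comm [NeZero d] (g : W d n) :
    G g * grpLift G (zElt d n κ h) = grpLift G (zElt d n κ h) * G g := by
  obtain ⟨τ, ho, hg, -, hc⟩ := exists_hyp_perm.{u} g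
  rw [zElt, map_sum, Finset.mul_sum, Finset.sum_mul]
  exact Fintype.sum_equiv τ _ _ fun H =>
    grpLift_aElt_conj κ h (ho H) (hg H) (hc R κ h H)

/-- For a `W`-equivariant map from `V*`, the commutator `[a_H, ξ]`. -/
theorem commutator_aElt_dual [NeZero d] {X : Module.Dual ℂ (V n) →ₗ[ℂ] B}
    (hX : ∀ g ξ, G g * X ξ = X (dualAct g ξ) * G g) (ξ : Module.Dual ℂ (V n)) :
    grpLift G (aElt κ h H) * X ξ - X ξ * grpLift G (aElt κ h H) =
      (ξ (coroot H) / root H (coroot H)) • (X (root H) * grpLift G (gammaElt κ h H)) := by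
  set c := ξ (coroot H) / root H (coroot H)
  set ξ' := ξ - c • root H
  have h0 : ξ' (coroot H) = 0 := by
    simp [ξ', c, root_coroot_ne_zero]
  have h1 : Commute (grpLift G (aElt κ h H)) (X ξ') := by
    refine grpLift_aElt_comm κ h ?_
    have := hX (hypGen H) ξ'
    rwa [dualAct_of_apply_coroot_eq_zero H h0] at this
  have h2 := grpLift_aElt_mul_of_root (H := H) κ h (G := G) (x := X (root H)) (by
    rw [hX, dualAct_root, map_smul, smul_mul_assoc])
  have h3 : X ξ = X ξ' + c • X (root H) := by simp [ξ']
  rw [h3, mul_add, add_mul, h1.eq, mul_smul_comm, smul_mul_assoc, add_sub_add_left_eq_sub,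
    ← smul_sub, h2]

/-- For a `W`-equivariant map from `V`, the commutator `[a_H, y]`. -/
theorem commutator_aElt_vec [NeZero d] {Y : V n →ₗ[ℂ] B}
    (hY : ∀ (g : W d n) y, G g * Y y = Y ((g : V n ≃ₗ[ℂ] V n) y) * G g) (y : V n) :
    grpLift G (aElt κ h H) * Y y - Y y * grpLift G (aElt κ h H) =
      -((root H y / root H (coroot H)) • (grpLift G (gammaElt κ h H) * Y (coroot H))) := by
  set c := root H y / root H (coroot H)
  set y' := y - c • coroot H
  have h0 : root H y' = 0 := by
    simp [y', c, root_coroot_ne_zero]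
  have h1 : Commute (grpLift G (aElt κ h H)) (Y y') := by
    refine grpLift_aElt_comm κ h ?_
    have := hY (hypGen H) y'
    rwa [hypGen_of_root_eq_zero H h0] at this
  have h2 := grpLift_aElt_mul_of_coroot (H := H) κ h (G := G) (y := Y (coroot H)) (by
    rw [hY, hypGen_coroot, map_smul, smul_mul_assoc])
  have h3 : Y y = Y y' + c • Y (coroot H) := by simp [y']
  rw [h3, mul_add, add_mul, h1.eq, mul_smul_comm, smul_mul_assoc, add_sub_add_left_eq_sub,
    ← smul_sub, h2, smul_neg]

end Commutators

/-! ### Realisations of the rational Cherednik algebra -/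

section Realisation

variable {d n : ℕ} {R : Type u} [CommRing R] [Algebra ℂ R]
variable (κ : {k : ZMod d // k ≠ 0} → R) (h : R)

/-- Elements of an `R`-algebra satisfying the defining relations of `H_R(κ, h)`. -/
structure Realisation (B : Type*) [Ring B] [Algebra R B] [Algebra ℂ B] where
  /-- the elements of `W` -/
  G : W d n →* B
  /-- the elements of `V*` -/
  X : Module.Dual ℂ (V n) →ₗ[ℂ] B
  /-- the elements of `V` -/
  Y : V n →ₗ[ℂ] B
  grp_vec : ∀ (g : W d n) y, G g * Y y = Y ((g : V n ≃ₗ[ℂ] V n) y) * G g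
  grp_cov : ∀ g ξ, G g * X ξ = X (dualAct g ξ) * G g
  vec_comm : ∀ y y', Commute (Y y) (Y y')
  cov_comm : ∀ ξ ξ', Commute (X ξ) (X ξ')
  vec_cov : ∀ y ξ, Y y * X ξ - X ξ * Y y = algebraMap ℂ B (ξ y) +
    ∑ H : Hyp d n, pairing H ξ y • grpLift G (gammaElt κ h H)

section lift

variable {κ h} {B : Type*} [Ring B] [Algebra R B] [Algebra ℂ B]

/-- The image of a generator under a realisation. -/
def Realisation.genFun (ρ : Realisation κ h (d := d) (n := n) B) : Gen d n → B
  | .vec y => ρ.Y y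
  | .cov ξ => ρ.X ξ
  | .grp g => ρ.G g

theorem Realisation.lift_grpLin (ρ : Realisation κ h (d := d) (n := n) B)
    (x : MonoidAlgebra R (W d n)) :
    FreeAlgebra.lift R ρ.genFun (grpLin d n x) = grpLift ρ.G x := by
  rw [grpLin, MonoidAlgebra.lift_apply, Finsupp.sum, map_sum]
  refine Finset.sum_congr rfl fun g _ => ?_
  rw [map_smul, FreeAlgebra.lift_ι_apply]
  rfl

variable [IsScalarTower ℂ R B]

/-- The homomorphism from `H_R(κ, h)` given by a realisation. -/
def Realisation.lift (ρ : Realisation κ h (d := d) (n := n) B) : Alg d n κ h →ₐ[R] B :=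
  RingQuot.liftAlgHom R ⟨FreeAlgebra.lift R ρ.genFun, by
    intro x y hxy
    have hinv : ∀ g : W d n, ρ.G g * ρ.G g⁻¹ = 1 := fun g => by
      rw [← map_mul, mul_inv_cancel, map_one]
    induction hxy with
    | vec_add y y' => simp [Realisation.genFun]
    | vec_smul c y =>
      rw [map_smul, FreeAlgebra.lift_ι_apply, FreeAlgebra.lift_ι_apply, algebraMap_smul]
      exact map_smul ρ.Y _ _
    | cov_add ξ ξ' => simp [Realisation.genFun]
    | cov_smul c ξ =>
      rw [map_smul, FreeAlgebra.lift_ι_apply, FreeAlgebra.lift_ι_apply, algebraMap_smul]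
      exact map_smul ρ.X _ _
    | grp_one => simp [Realisation.genFun]
    | grp_mul g g' => simp [Realisation.genFun]
    | grp_vec g y =>
      simp only [map_mul, FreeAlgebra.lift_ι_apply, Realisation.genFun]
      rw [ρ.grp_vec, mul_assoc, hinv, mul_one]
    | grp_cov g ξ =>
      simp only [map_mul, FreeAlgebra.lift_ι_apply, Realisation.genFun]
      rw [ρ.grp_cov, mul_assoc, hinv, mul_one]
    | vec_comm y y' =>
      simp only [map_mul, FreeAlgebra.lift_ι_apply, Realisation.genFun]
      exact ρ.vec_comm y y'
    | cov_comm ξ ξ' =>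
      simp only [map_mul, FreeAlgebra.lift_ι_apply, Realisation.genFun]
      exact ρ.cov_comm ξ ξ'
    | vec_cov y ξ =>
      simp only [map_mul, map_sub, map_add, map_sum, map_smul, FreeAlgebra.lift_ι_apply,
        AlgHom.commutes, Realisation.lift_grpLin]
      simp only [Realisation.genFun]
      rw [ρ.vec_cov, IsScalarTower.algebraMap_apply ℂ R B]
      simp only [algebraMap_smul]
      rfl⟩

theorem Realisation.lift_gen (ρ : Realisation κ h (d := d) (n := n) B) (x : Gen d n) :
    ρ.lift (gen κ h x) = ρ.genFun x := by
  rw [gen, Realisation.lift]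
  exact (RingQuot.liftAlgHom_mkAlgHom_apply R _ _ _).trans (FreeAlgebra.lift_ι_apply _ _)

end lift

instance algebraComplexAlg : Algebra ℂ (Alg d n κ h) :=
  Algebra.compHom (Alg d n κ h) (algebraMap ℂ R)

instance : IsScalarTower ℂ R (Alg d n κ h) :=
  IsScalarTower.of_algebraMap_eq fun _ => rfl

variable {κ h} in
theorem mk_eq_of_rel {a b : FreeAlg d n R} (hab : Rel κ h a b) :
    (RingQuot.mkAlgHom R (Rel κ h) a : Alg d n κ h) = RingQuot.mkAlgHom R (Rel κ h) b :=
  RingQuot.mkAlgHom_rel R hab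

/-- The tautological homomorphism from `W`. -/
def grpHom : W d n →* Alg d n κ h where
  toFun g := gen κ h (Gen.grp g)
  map_one' := (mk_eq_of_rel Rel.grp_one).trans (map_one (RingQuot.mkAlgHom R (Rel κ h)))
  map_mul' g g' := (mk_eq_of_rel (Rel.grp_mul g g')).trans
    (map_mul (RingQuot.mkAlgHom R (Rel κ h)) _ _)

theorem mk_grpLin (x : MonoidAlgebra R (W d n)) :
    (RingQuot.mkAlgHom R (Rel κ h) (grpLin d n x) : Alg d n κ h) = grpLift (grpHom κ h) x := by
  rw [grpLin, MonoidAlgebra.lift_apply, Finsupp.sum]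
  refine (map_sum (RingQuot.mkAlgHom R (Rel κ h)) _ _).trans ?_
  exact Finset.sum_congr rfl fun g _ => map_smul (RingQuot.mkAlgHom R (Rel κ h)) _ _

/-- The tautological realisation of `H_R(κ, h)` in itself. -/
def tautological : Realisation κ h (d := d) (n := n) (Alg d n κ h) where
  G := grpHom κ h
  X :=
    { toFun := fun ξ => gen κ h (Gen.cov ξ)
      map_add' := fun ξ ξ' => (mk_eq_of_rel (Rel.cov_add ξ ξ')).trans
        (map_add (RingQuot.mkAlgHom R (Rel κ h)) _ _)
      map_smul' := fun c ξ => (mk_eq_of_rel (Rel.cov_smul c ξ)).trans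
        (map_smul (RingQuot.mkAlgHom R (Rel κ h)) _ _) }
  Y :=
    { toFun := fun y => gen κ h (Gen.vec y)
      map_add' := fun y y' => (mk_eq_of_rel (Rel.vec_add y y')).trans
        (map_add (RingQuot.mkAlgHom R (Rel κ h)) _ _)
      map_smul' := fun c y => (mk_eq_of_rel (Rel.vec_smul c y)).trans
        (map_smul (RingQuot.mkAlgHom R (Rel κ h)) _ _) }
  grp_vec g y := by
    have h1 : grpHom κ h g * gen κ h (Gen.vec y) * grpHom κ h g⁻¹ =
        gen κ h (Gen.vec ((g : V n ≃ₗ[ℂ] V n) y)) := by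
      have := mk_eq_of_rel (Rel.grp_vec (κ := κ) (h := h) g y)
      rw [map_mul, map_mul] at this
      exact this
    change grpHom κ h g * gen κ h (Gen.vec y) =
      gen κ h (Gen.vec ((g : V n ≃ₗ[ℂ] V n) y)) * grpHom κ h g
    rw [← h1, mul_assoc, ← map_mul, inv_mul_cancel, map_one, mul_one]
  grp_cov g ξ := by
    have h1 : grpHom κ h g * gen κ h (Gen.cov ξ) * grpHom κ h g⁻¹ =
        gen κ h (Gen.cov (dualAct g ξ)) := by
      have := mk_eq_of_rel (Rel.grp_cov (κ := κ) (h := h) g ξ)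
      rw [map_mul, map_mul] at this
      exact this
    change grpHom κ h g * gen κ h (Gen.cov ξ) = gen κ h (Gen.cov (dualAct g ξ)) * grpHom κ h g
    rw [← h1, mul_assoc, ← map_mul, inv_mul_cancel, map_one, mul_one]
  vec_comm y y' := by
    have := mk_eq_of_rel (Rel.vec_comm (κ := κ) (h := h) y y')
    rw [map_mul, map_mul] at this
    exact this
  cov_comm ξ ξ' := by
    have := mk_eq_of_rel (Rel.cov_comm (κ := κ) (h := h) ξ ξ')
    rw [map_mul, map_mul] at this
    exact this
  vec_cov y ξ := by
    have := mk_eq_of_rel (Rel.vec_cov (κ := κ) (h := h) y ξ)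
    rw [map_sub, map_mul, map_mul, map_add, map_sum, AlgHom.commutes] at this
    refine this.trans ?_
    congr 1
    refine Finset.sum_congr rfl fun H _ => ?_
    rw [map_smul]
    erw [mk_grpLin]
    rfl

/-- The quotient map from the free algebra. -/
def mk : FreeAlg d n R →ₐ[R] Alg d n κ h := RingQuot.mkAlgHom R (Rel κ h)

theorem mk_surjective : Function.Surjective (mk (d := d) (n := n) κ h) :=
  RingQuot.mkAlgHom_surjective R (Rel κ h)

/-- An `R`-submodule of an `H_R(κ, h)`-module is a submodule if it is stable under the
generators. -/
def submoduleOfStable {M : Type*} [AddCommGroup M] [Module R M] [Module (Alg d n κ h) M]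
    [IsScalarTower R (Alg d n κ h) M] (N : Submodule R M)
    (hX : ∀ ξ, ∀ m ∈ N, (tautological (d := d) (n := n) κ h).X ξ • m ∈ N)
    (hY : ∀ y, ∀ m ∈ N, (tautological (d := d) (n := n) κ h).Y y • m ∈ N)
    (hG : ∀ g, ∀ m ∈ N, (tautological (d := d) (n := n) κ h).G g • m ∈ N) :
    Submodule (Alg d n κ h) M :=
  { N with
    smul_mem' := by
      intro x m hm
      obtain ⟨x, rfl⟩ := mk_surjective κ h x
      change mk κ h x • m ∈ N
      replace hm : m ∈ N := hm
      induction x using FreeAlgebra.induction generalizing m with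
      | grade0 r =>
        rw [AlgHom.commutes, algebraMap_smul]
        exact N.smul_mem r hm
      | grade1 x =>
        rcases x with y | ξ | g
        exacts [hY y m hm, hX ξ m hm, hG g m hm]
      | mul x y hx hy =>
        rw [map_mul, mul_smul]
        exact hx (hy hm)
      | add x y hx hy =>
        rw [map_add, add_smul]
        exact N.add_mem (hx hm) (hy hm) }

end Realisation

end Cherednik

/-! ### Polynomials in commuting elements -/

namespace MvPolynomial

variable {S : Type*} [CommRing S] {B : Type*} [Ring B] [Algebra S B] {n : ℕ}

open scoped IsMulCommutative in
/-- Evaluation of polynomials at pairwise commuting elements of a possibly noncommutative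
algebra. -/
def commAeval (b : Fin n → B) (hb : ∀ i j, Commute (b i) (b j)) : MvPolynomial (Fin n) S →ₐ[S] B :=
  haveI : IsMulCommutative (Algebra.adjoin S (Set.range b)) :=
    Algebra.isMulCommutative_adjoin S (by rintro _ ⟨i, rfl⟩ _ ⟨j, rfl⟩; exact hb i j)
  (Algebra.adjoin S (Set.range b)).val.comp
    (MvPolynomial.aeval fun i => ⟨b i, Algebra.subset_adjoin ⟨i, rfl⟩⟩)

open scoped IsMulCommutative in
theorem commAeval_X (b : Fin n → B) (hb : ∀ i j, Commute (b i) (b j)) (i : Fin n) :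
    commAeval (S := S) b hb (X i) = b i := by
  have : IsMulCommutative (Algebra.adjoin S (Set.range b)) :=
    Algebra.isMulCommutative_adjoin S (by rintro _ ⟨i, rfl⟩ _ ⟨j, rfl⟩; exact hb i j)
  change ((MvPolynomial.aeval (fun i => (⟨b i, Algebra.subset_adjoin ⟨i, rfl⟩⟩ :
    Algebra.adjoin S (Set.range b))) (X i) : Algebra.adjoin S (Set.range b)) : B) = b i
  rw [aeval_X]

end MvPolynomial

namespace Cherednik

open IrrepClass

section Polynomials

variable {d n : ℕ} {R : Type u} [CommRing R] [Algebra ℂ R]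

/-- The linear forms, as polynomials. -/
def linearForm (R : Type u) [CommRing R] [Algebra ℂ R] :
    Module.Dual ℂ (V n) →ₗ[ℂ] MvPolynomial (Fin n) R :=
  ∑ i, (LinearMap.toSpanSingleton ℂ (MvPolynomial (Fin n) R) (MvPolynomial.X i)) ∘ₗ
    Module.Dual.eval ℂ (V n) (Pi.single i 1)

theorem linearForm_apply (ξ : Module.Dual ℂ (V n)) :
    linearForm R ξ = ∑ i, ξ (Pi.single i 1) • MvPolynomial.X i := by
  simp [linearForm]

theorem linearForm_proj (i : Fin n) :
    linearForm R (LinearMap.proj i : Module.Dual ℂ (V n)) = MvPolynomial.X i := by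
  rw [linearForm_apply, Finset.sum_eq_single i]
  · simp
  · intro j _ hj
    simp [hj.symm]
  · simp

theorem dual_eq_sum (ξ : Module.Dual ℂ (V n)) :
    ξ = ∑ i, ξ (Pi.single i 1) • (LinearMap.proj i : Module.Dual ℂ (V n)) := by
  refine LinearMap.pi_ext' fun i => LinearMap.ext_ring ?_
  simp [Pi.single_apply]

theorem vec_eq_sum (y : V n) : y = ∑ i, y i • (Pi.single i 1 : V n) := by
  ext j
  simp [Pi.single_apply]

variable (κ : {k : ZMod d // k ≠ 0} → R) (h : R)

/-- The homomorphism `R[V] → H_R(κ, h)`. -/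
def polyHom : MvPolynomial (Fin n) R →ₐ[R] Alg d n κ h :=
  MvPolynomial.commAeval (fun i => (tautological κ h).X (LinearMap.proj i))
    fun _ _ => (tautological κ h).cov_comm _ _

/-- `H_R(κ, h)` as a module over `R[V]`. -/
instance : Module (MvPolynomial (Fin n) R) (Alg d n κ h) :=
  Module.compHom (Alg d n κ h) (polyHom (d := d) (n := n) κ h).toRingHom

variable {κ h}

theorem poly_smul_def (p : MvPolynomial (Fin n) R) (x : Alg d n κ h) :
    p • x = polyHom κ h p * x := rfl

theorem polyHom_linearForm (ξ : Module.Dual ℂ (V n)) :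
    polyHom κ h (linearForm R ξ) = (tautological (d := d) κ h).X ξ := by
  conv_rhs => rw [dual_eq_sum ξ]
  rw [linearForm_apply, map_sum, map_sum]
  refine Finset.sum_congr rfl fun i _ => ?_
  rw [← algebraMap_smul R (ξ _) (MvPolynomial.X i : MvPolynomial (Fin n) R), map_smul,
    algebraMap_smul, map_smul, polyHom, MvPolynomial.commAeval_X]

variable {M : Type*} [AddCommGroup M] [Module (Alg d n κ h) M]
  [Module (MvPolynomial (Fin n) R) M] [IsScalarTower (MvPolynomial (Fin n) R) (Alg d n κ h) M]

theorem poly_smul_eq (p : MvPolynomial (Fin n) R) (m : M) :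
    p • m = (polyHom κ h p : Alg d n κ h) • m := by
  rw [← one_smul (Alg d n κ h) m, ← smul_assoc, poly_smul_def, mul_one, one_smul]

theorem linearForm_smul (ξ : Module.Dual ℂ (V n)) (m : M) :
    linearForm R ξ • m = (tautological (d := d) κ h).X ξ • m := by
  rw [poly_smul_eq (d := d) (κ := κ) (h := h), polyHom_linearForm]

theorem X_smul (i : Fin n) (m : M) :
    (MvPolynomial.X i : MvPolynomial (Fin n) R) • m =
      (tautological (d := d) κ h).X (LinearMap.proj i) • m := by
  rw [← linearForm_smul, linearForm_proj]

/-- The submodule over `R[V]` generated by an `R`-submodule stable under `W` and `V` modulo itself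
is a submodule. -/
theorem span_poly_stable [Module R M] [IsScalarTower R (Alg d n κ h) M]
    [IsScalarTower R (MvPolynomial (Fin n) R) M] {U : Set M}
    {P : Submodule (MvPolynomial (Fin n) R) M} (hP : P = Submodule.span _ U)
    (hY : ∀ y, ∀ m ∈ U, (tautological (d := d) (n := n) κ h).Y y • m ∈ P)
    (hG : ∀ g, ∀ m ∈ U, (tautological (d := d) (n := n) κ h).G g • m ∈ P) :
    ∃ N : Submodule (Alg d n κ h) M, ∀ m, m ∈ N ↔ m ∈ P := by
  set T := tautological (d := d) (n := n) κ h with hT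
  have hX' : ∀ ξ, ∀ m ∈ P, T.X ξ • m ∈ P := fun ξ m hm => by
    rw [hT, ← linearForm_smul]
    exact P.smul_mem _ hm
  have hG' : ∀ g, ∀ m ∈ P, T.G g • m ∈ P := by
    intro g m hm
    rw [hP] at hm
    induction hm using Submodule.span_induction with
    | mem m hm => exact hG g m hm
    | zero => rw [smul_zero]; exact P.zero_mem
    | add m m' _ _ hm hm' => rw [smul_add]; exact P.add_mem hm hm'
    | smul p m _ hm =>
      induction p using MvPolynomial.induction_on generalizing m with
      | C r =>
        rw [← MvPolynomial.algebraMap_eq, algebraMap_smul, ← algebraMap_smul (Alg d n κ h) r m,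
          ← mul_smul, ← Algebra.commutes, mul_smul, algebraMap_smul]
        exact P.smul_of_tower_mem r hm
      | add p q hp hq => rw [add_smul, smul_add]; exact P.add_mem (hp m ‹_› hm) (hq m ‹_› hm)
      | mul_X p i hp =>
        rw [mul_smul]
        refine hp _ (Submodule.smul_mem _ _ ‹_›) ?_
        rw [X_smul (d := d) (κ := κ) (h := h), ← mul_smul, ← hT, T.grp_cov, mul_smul]
        exact hX' _ _ hm
  have hGam : ∀ x : MonoidAlgebra R (W d n), ∀ m ∈ P, grpLift T.G x • m ∈ P := by
    intro x m hm
    rw [MonoidAlgebra.lift_apply, Finsupp.sum, Finset.sum_smul]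
    refine P.sum_mem fun g _ => ?_
    rw [smul_assoc]
    exact P.smul_of_tower_mem _ (hG' g m hm)
  have hR : ∀ r : R, ∀ m ∈ P, r • m ∈ P := fun r m hm => P.smul_of_tower_mem r hm
  have hC : ∀ c : ℂ, ∀ x : Alg d n κ h, ∀ m : M, (c • x) • m = algebraMap ℂ R c • x • m := by
    intro c x m
    rw [← algebraMap_smul R c x, smul_assoc]
  have hY' : ∀ y, ∀ m ∈ P, T.Y y • m ∈ P := by
    intro y m hm
    rw [hP] at hm
    induction hm using Submodule.span_induction with
    | mem m hm => exact hY y m hm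
    | zero => rw [smul_zero]; exact P.zero_mem
    | add m m' _ _ hm hm' => rw [smul_add]; exact P.add_mem hm hm'
    | smul p m hm' hm =>
      induction p using MvPolynomial.induction_on generalizing m with
      | C r =>
        rw [← MvPolynomial.algebraMap_eq, algebraMap_smul, ← algebraMap_smul (Alg d n κ h) r m,
          ← mul_smul, ← Algebra.commutes, mul_smul, algebraMap_smul]
        exact P.smul_of_tower_mem r hm
      | add p q hp hq => rw [add_smul, smul_add]; exact P.add_mem (hp m ‹_› hm) (hq m ‹_› hm)
      | mul_X p i hp =>
        rw [mul_smul]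
        refine hp _ (Submodule.smul_mem _ _ ‹_›) ?_
        have hm' : m ∈ P := by rwa [hP]
        rw [X_smul (d := d) (κ := κ) (h := h), ← mul_smul, ← hT,
          sub_eq_iff_eq_add.1 (T.vec_cov y (LinearMap.proj i)), add_smul, add_smul, mul_smul,
          Algebra.algebraMap_eq_smul_one, hC, one_smul, Finset.sum_smul]
        refine P.add_mem (P.add_mem (hR _ _ hm') (P.sum_mem fun H _ => ?_)) (hX' _ _ hm)
        rw [hC]
        exact hR _ _ (hGam _ _ hm')
  exact ⟨submoduleOfStable κ h (P.restrictScalars R) hX' hY' hG', fun m => Iff.rfl⟩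

/-- A submodule generated over `R[V]` by a set stable under `W` and `V` is everything as soon as it
contains generators. -/
theorem span_poly_eq_top [Module R M] [IsScalarTower R (Alg d n κ h) M]
    [IsScalarTower R (MvPolynomial (Fin n) R) M] {U : Set M}
    (hY : ∀ y, ∀ m ∈ U, (tautological (d := d) (n := n) κ h).Y y • m ∈
      Submodule.span (MvPolynomial (Fin n) R) U)
    (hG : ∀ g, ∀ m ∈ U, (tautological (d := d) (n := n) κ h).G g • m ∈
      Submodule.span (MvPolynomial (Fin n) R) U)
    {S : Set M} (hS : S ⊆ Submodule.span (MvPolynomial (Fin n) R) U)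
    (hS' : Submodule.span (Alg d n κ h) S = ⊤) :
    Submodule.span (MvPolynomial (Fin n) R) U = ⊤ := by
  obtain ⟨N, hN⟩ := span_poly_stable rfl hY hG
  have h1 : Submodule.span (Alg d n κ h) S ≤ N :=
    Submodule.span_le.2 fun m hm => (hN m).2 (hS hm)
  rw [hS', top_le_iff] at h1
  rw [eq_top_iff]
  intro m _
  rw [← hN, h1]
  trivial

/-- An `R`-linear map commuting with the generators is linear. -/
def linearMapOfCommutes {M M' : Type*} [AddCommGroup M] [Module R M] [Module (Alg d n κ h) M]
    [IsScalarTower R (Alg d n κ h) M] [AddCommGroup M'] [Module R M'] [Module (Alg d n κ h) M']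
    [IsScalarTower R (Alg d n κ h) M'] (f : M →ₗ[R] M')
    (hX : ∀ ξ m, f ((tautological (d := d) (n := n) κ h).X ξ • m) =
      (tautological (d := d) (n := n) κ h).X ξ • f m)
    (hY : ∀ y m, f ((tautological (d := d) (n := n) κ h).Y y • m) =
      (tautological (d := d) (n := n) κ h).Y y • f m)
    (hG : ∀ g m, f ((tautological (d := d) (n := n) κ h).G g • m) =
      (tautological (d := d) (n := n) κ h).G g • f m) : M →ₗ[Alg d n κ h] M' where
  toFun := f
  map_add' := map_add f
  map_smul' a m := by
    let N : Submodule (Alg d n κ h) (M × M') := submoduleOfStable κ h (LinearMap.graph f)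
      (by rintro ξ ⟨m, m'⟩ hm; rw [LinearMap.mem_graph_iff] at hm ⊢
          change _ = f (_ • m); rw [hX, ← show m' = f m from hm]; rfl)
      (by rintro ξ ⟨m, m'⟩ hm; rw [LinearMap.mem_graph_iff] at hm ⊢
          change _ = f (_ • m); rw [hY, ← show m' = f m from hm]; rfl)
      (by rintro ξ ⟨m, m'⟩ hm; rw [LinearMap.mem_graph_iff] at hm ⊢
          change _ = f (_ • m); rw [hG, ← show m' = f m from hm]; rfl)
    have h1 : (m, f m) ∈ N := (LinearMap.mem_graph_iff f (m, f m)).2 rfl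
    exact ((LinearMap.mem_graph_iff f _).1 (N.smul_mem a h1)).symm

end Polynomials

/-! ### The Euler element -/

section Euler

variable {d n : ℕ} {R : Type u} [CommRing R] [Algebra ℂ R]
variable (κ : {k : ZMod d // k ≠ 0} → R) (h : R)

/-- The element `∑ x_i y_i - z`, which induces the grading of `H_R(κ, h)`. -/
def euler : Alg d n κ h :=
  ∑ i, (tautological κ h).X (LinearMap.proj i) * (tautological κ h).Y (Pi.single i 1) -
    grpLift (tautological κ h).G (zElt d n κ h)

/-- The Euler element raises degrees on `V*`: the correction `z` cancels the group algebra terms of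
the commutators `[y_i, ξ]`. -/
theorem euler_mul_cov [NeZero d] (ξ : Module.Dual ℂ (V n)) :
    euler κ h * (tautological κ h).X ξ =
      (tautological κ h).X ξ * euler κ h + (tautological κ h).X ξ := by
  set T := tautological (d := d) (n := n) κ h with hT
  have h1 : ∀ i, T.X (LinearMap.proj i) * T.Y (Pi.single i 1) * T.X ξ =
      T.X ξ * (T.X (LinearMap.proj i) * T.Y (Pi.single i 1)) +
      (ξ (Pi.single i 1) • T.X (LinearMap.proj i) + ∑ H : Hyp d n,
        pairing H ξ (Pi.single i 1) • (T.X (LinearMap.proj i) *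
          grpLift T.G (gammaElt κ h H))) := by
    intro i
    rw [mul_assoc, sub_eq_iff_eq_add'.1 (T.vec_cov (Pi.single i 1) ξ), mul_add, ← mul_assoc,
      (T.cov_comm _ ξ).eq, mul_assoc, mul_add, Finset.mul_sum, Algebra.algebraMap_eq_smul_one]
    simp only [mul_smul_comm, mul_one]
  have h2 : grpLift T.G (zElt d n κ h) * T.X ξ = T.X ξ * grpLift T.G (zElt d n κ h) +
      ∑ H : Hyp d n, (ξ (coroot H) / root H (coroot H)) •
        (T.X (root H) * grpLift T.G (gammaElt κ h H)) := by
    rw [zElt, map_sum, Finset.sum_mul, Finset.mul_sum, ← Finset.sum_add_distrib]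
    exact Finset.sum_congr rfl fun H _ =>
      sub_eq_iff_eq_add'.1 (commutator_aElt_dual κ h T.grp_cov ξ)
  have h3 : ∑ i, ξ (Pi.single i 1) • T.X (LinearMap.proj i) = T.X ξ := by
    conv_rhs => rw [dual_eq_sum ξ]
    simp only [map_sum, map_smul]
  have h4 : ∑ i, ∑ H : Hyp d n, pairing H ξ (Pi.single i 1) • (T.X (LinearMap.proj i) *
        grpLift T.G (gammaElt κ h H)) = ∑ H : Hyp d n, (ξ (coroot H) / root H (coroot H)) •
        (T.X (root H) * grpLift T.G (gammaElt κ h H)) := by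
    rw [Finset.sum_comm]
    refine Finset.sum_congr rfl fun H _ => ?_
    conv_rhs => rw [dual_eq_sum (root H)]
    simp only [map_sum, map_smul, Finset.sum_mul, Finset.smul_sum, smul_mul_assoc, smul_smul]
    refine Finset.sum_congr rfl fun i _ => ?_
    rw [← dual_eq_sum]
    congr 1
    rw [pairing]; ring
  rw [euler, sub_mul, ← hT, h2, Finset.sum_mul, Finset.sum_congr rfl fun i _ => h1 i,
    Finset.sum_add_distrib, Finset.sum_add_distrib, h3, h4, mul_sub, Finset.mul_sum]
  abel

/-- The Euler element lowers degrees on `V`. -/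
theorem euler_mul_vec [NeZero d] (y : V n) :
    euler κ h * (tautological κ h).Y y =
      (tautological κ h).Y y * euler κ h - (tautological κ h).Y y := by
  set T := tautological (d := d) (n := n) κ h with hT
  have h1 : ∀ i, T.X (LinearMap.proj i) * T.Y (Pi.single i 1) * T.Y y =
      T.Y y * (T.X (LinearMap.proj i) * T.Y (Pi.single i 1)) -
      (y i • T.Y (Pi.single i 1) + ∑ H : Hyp d n,
        pairing H (LinearMap.proj i) y • (grpLift T.G (gammaElt κ h H) * T.Y (Pi.single i 1))) := by
    intro i
    rw [mul_assoc, (T.vec_comm _ y).eq, ← mul_assoc, ← mul_assoc,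
      sub_eq_iff_eq_add'.1 (T.vec_cov y (LinearMap.proj i)), Algebra.algebraMap_eq_smul_one]
    simp only [add_mul, smul_mul_assoc, one_mul, Finset.sum_mul, LinearMap.proj_apply]
    abel
  have h2 : grpLift T.G (zElt d n κ h) * T.Y y = T.Y y * grpLift T.G (zElt d n κ h) -
      ∑ H : Hyp d n, (root H y / root H (coroot H)) •
        (grpLift T.G (gammaElt κ h H) * T.Y (coroot H)) := by
    rw [zElt, map_sum, Finset.sum_mul, Finset.mul_sum, ← Finset.sum_sub_distrib]
    refine Finset.sum_congr rfl fun H _ => ?_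
    rw [sub_eq_iff_eq_add'.1 (commutator_aElt_vec κ h T.grp_vec y), sub_eq_add_neg]
  have h3 : ∑ i, y i • T.Y (Pi.single i 1) = T.Y y := by
    conv_rhs => rw [vec_eq_sum y]
    simp only [map_sum, map_smul]
  have h4 : ∑ i, ∑ H : Hyp d n, pairing H (LinearMap.proj i) y •
        (grpLift T.G (gammaElt κ h H) * T.Y (Pi.single i 1)) =
      ∑ H : Hyp d n, (root H y / root H (coroot H)) •
        (grpLift T.G (gammaElt κ h H) * T.Y (coroot H)) := by
    rw [Finset.sum_comm]
    refine Finset.sum_congr rfl fun H _ => ?_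
    have h5 : T.Y (coroot H) = ∑ i, coroot H i • T.Y (Pi.single i 1) := by
      conv_lhs => rw [vec_eq_sum (coroot H)]
      simp only [map_sum, map_smul]
    rw [h5]
    simp only [Finset.mul_sum, Finset.smul_sum, mul_smul_comm, smul_smul]
    refine Finset.sum_congr rfl fun i _ => ?_
    congr 1
    rw [pairing, LinearMap.proj_apply]; ring
  rw [euler, sub_mul, ← hT, h2, Finset.sum_mul, Finset.sum_congr rfl fun i _ => h1 i,
    Finset.sum_sub_distrib, Finset.sum_add_distrib, h3, h4, mul_sub, Finset.mul_sum]
  abel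

theorem euler_mul_grp [NeZero d] (g : W d n) :
    euler κ h * (tautological κ h).G g = (tautological κ h).G g * euler κ h := by
  set T := tautological (d := d) (n := n) κ h with hT
  have h1 : ∀ i, T.G g * (T.X (LinearMap.proj i) * T.Y (Pi.single i 1)) =
      ∑ k, T.X (LinearMap.proj k) *
        T.Y ((((g⁻¹ : W d n) : V n ≃ₗ[ℂ] V n) (Pi.single k 1)) i •
          (g : V n ≃ₗ[ℂ] V n) (Pi.single i 1)) * T.G g := by
    intro i
    rw [← mul_assoc, T.grp_cov, mul_assoc, T.grp_vec, dual_eq_sum (dualAct g (LinearMap.proj i)),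
      map_sum, Finset.sum_mul]
    refine Finset.sum_congr rfl fun k _ => ?_
    rw [map_smul, map_smul, smul_mul_assoc, mul_smul_comm, smul_mul_assoc, ← mul_assoc]
    rfl
  rw [euler, sub_mul, mul_sub, ← hT, grpLift_zElt_comm, Finset.mul_sum,
    Finset.sum_congr rfl fun i _ => h1 i, Finset.sum_comm, Finset.sum_mul]
  congr 1
  refine Finset.sum_congr rfl fun k _ => ?_
  rw [← Finset.sum_mul, ← Finset.mul_sum, ← map_sum]
  congr 3
  simp only [← map_smul, ← map_sum]
  rw [← vec_eq_sum]
  change _ = ((g * g⁻¹ : W d n) : V n ≃ₗ[ℂ] V n) (Pi.single k 1)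
  rw [mul_inv_cancel]
  rfl

end Euler

end Cherednik

namespace Cherednik

open IrrepClass

/-! ### The action of `W` on polynomials -/

section PolynomialAction

variable {d n : ℕ} (R : Type u) [CommRing R] [Algebra ℂ R]

theorem dualAct_eq_dualMap (g : W d n) (ξ : Module.Dual ℂ (V n)) :
    dualAct g ξ = ((g⁻¹ : W d n) : V n ≃ₗ[ℂ] V n).toLinearMap.dualMap ξ := rfl

theorem dualAct_mul (g g' : W d n) (ξ : Module.Dual ℂ (V n)) :
    dualAct (g * g') ξ = dualAct g (dualAct g' ξ) := by
  refine LinearMap.ext fun y => ?_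
  simp [dualAct, mul_inv_rev]

theorem dualAct_one (ξ : Module.Dual ℂ (V n)) : dualAct (1 : W d n) ξ = ξ := by
  refine LinearMap.ext fun y => ?_
  simp [dualAct]

/-- The action of `g ∈ W` on `R[V]`. -/
def polyAct (g : W d n) : MvPolynomial (Fin n) R →ₐ[R] MvPolynomial (Fin n) R :=
  MvPolynomial.aeval fun i => linearForm R (dualAct g (LinearMap.proj i))

theorem polyAct_linearForm (g : W d n) (ξ : Module.Dual ℂ (V n)) :
    polyAct R g (linearForm R ξ) = linearForm R (dualAct g ξ) := by
  conv_rhs => rw [dual_eq_sum ξ, dualAct_eq_dualMap]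
  rw [linearForm_apply, map_sum, map_sum, map_sum]
  refine Finset.sum_congr rfl fun i _ => ?_
  rw [← algebraMap_smul R (ξ _) (MvPolynomial.X i : MvPolynomial (Fin n) R), map_smul,
    algebraMap_smul, map_smul, map_smul, polyAct, MvPolynomial.aeval_X]
  rfl

theorem polyAct_mul (g g' : W d n) : polyAct R (g * g') = (polyAct R g).comp (polyAct R g') := by
  refine MvPolynomial.algHom_ext fun i => ?_
  rw [AlgHom.comp_apply, ← linearForm_proj, polyAct_linearForm, polyAct_linearForm,
    polyAct_linearForm, dualAct_mul]

theorem polyAct_one : polyAct R (1 : W d n) = AlgHom.id R _ := by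
  refine MvPolynomial.algHom_ext fun i => ?_
  rw [← linearForm_proj, polyAct_linearForm, dualAct_one]
  rfl

/-- The difference of a polynomial and its image under the reflection of `H` is divisible by `α_H`,
which makes divided differences possible. -/
theorem linearForm_root_dvd (H : Hyp d n) (f : MvPolynomial (Fin n) R) :
    linearForm R (root H) ∣ polyAct R (hypGen H) f - f := by
  rw [← Ideal.mem_span_singleton, ← Ideal.Quotient.mk_eq_mk_iff_sub_mem]
  set I := Ideal.span {linearForm R (root H)}
  have h1 : (Ideal.Quotient.mkₐ R I).comp (polyAct R (hypGen H)) = Ideal.Quotient.mkₐ R I := by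
    refine MvPolynomial.algHom_ext fun i => ?_
    rw [AlgHom.comp_apply, ← linearForm_proj, polyAct_linearForm]
    refine (Ideal.Quotient.mk_eq_mk_iff_sub_mem _ _).2 ?_
    set ξ : Module.Dual ℂ (V n) := LinearMap.proj i
    set c := ξ (coroot H) / root H (coroot H)
    set ξ' := ξ - c • root H with hξ'
    have h0 : ξ' (coroot H) = 0 := by
      simp [ξ', c, root_coroot_ne_zero]
    have h3 : ξ = ξ' + c • root H := by simp [ξ']
    rw [h3, dualAct_eq_dualMap, map_add, map_smul, ← dualAct_eq_dualMap, ← dualAct_eq_dualMap,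
      dualAct_of_apply_coroot_eq_zero H h0, dualAct_root, ← map_sub, add_sub_add_left_eq_sub,
      smul_smul, ← sub_smul, map_smul, Algebra.smul_def]
    exact I.mul_mem_left _ (Ideal.mem_span_singleton_self _)
  exact DFunLike.congr_fun h1 f

theorem linearForm_root_dvd_pow (H : Hyp d n) (a : ℕ) (f : MvPolynomial (Fin n) R) :
    linearForm R (root H) ∣ polyAct R (hypGen H ^ a) f - f := by
  induction a with
  | zero => rw [pow_zero, polyAct_one]; simp
  | succ a ih =>
    rw [pow_succ', polyAct_mul, AlgHom.comp_apply, ← sub_add_sub_cancel]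
    exact dvd_add (linearForm_root_dvd R H _) ih

theorem isRegular_linearForm_root (H : Hyp d n) : IsRegular (linearForm R (root H)) := by
  rcases H with i | ⟨⟨⟨i, j⟩, hij⟩, α⟩
  · exact (linearForm_proj (R := R) i).symm ▸ MvPolynomial.isRegular_X
  · -- after the substitution `X i ↦ X i + ζ ^ α X j` the root becomes a variable
    have hij' : j ≠ i := (ne_of_lt hij).symm
    set c : MvPolynomial (Fin n) R := algebraMap ℂ _ (zeta d ^ (α : ℕ))
    let φ (c : MvPolynomial (Fin n) R) : MvPolynomial (Fin n) R →ₐ[R] MvPolynomial (Fin n) R :=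
      MvPolynomial.aeval fun k =>
        MvPolynomial.X k + if k = i then c * MvPolynomial.X j else 0
    have hc : ∀ a, φ a c = c := fun a => by
      change φ a (algebraMap ℂ _ (zeta d ^ (α : ℕ))) = _
      rw [IsScalarTower.algebraMap_apply ℂ R, AlgHom.commutes, ← IsScalarTower.algebraMap_apply]
    have h1 : linearForm R (root (.inr (⟨(i, j), hij⟩, α) : Hyp d n)) =
        MvPolynomial.X i - c * MvPolynomial.X j := by
      rw [root, map_sub, map_smul, linearForm_proj, linearForm_proj, Algebra.smul_def]
    have h2 : (φ (-c)).comp (φ c) = AlgHom.id R _ := by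
      refine MvPolynomial.algHom_ext fun k => ?_
      by_cases hk : k = i
      · subst hk
        simp only [AlgHom.comp_apply, φ, MvPolynomial.aeval_X, if_true, map_add, map_mul, hij',
          if_false, add_zero]
        rw [show (MvPolynomial.aeval _) c = c from hc (-c)]
        simp
      · simp [φ, hk]
    have h3 : φ c (MvPolynomial.X i - c * MvPolynomial.X j) = MvPolynomial.X i := by
      rw [map_sub, map_mul, hc]
      simp [φ, hij']
    rw [h1]
    refine isLeftRegular_iff_isRegular.1 ?_
    intro f g hfg
    have h4 := congrArg (φ c) hfg
    simp only [map_mul, h3] at h4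
    have h5 := congrArg (φ (-c)) (MvPolynomial.isRegular_X.left h4)
    rwa [← AlgHom.comp_apply, ← AlgHom.comp_apply, h2] at h5

end PolynomialAction

/-! ### Induction from `S(V) ♯ W` -/

section Abstract

variable {d n : ℕ} {B : Type*} [Ring B] [Algebra ℂ B]

/-- If `D` is the quotient of `A - A₀` by `α`, the commutator of `D` with `x` is the quotient by
`α` of the commutator of `A` with `x`; here multiplied by `α`. -/
theorem mul_commutator_of_quotient {α D A A₀ x γ : B} {c : ℂ} (hD : α * D = A - A₀)
    (hA : A * x - x * A = c • (α * γ)) (hA₀ : Commute A₀ x) (hx : Commute α x) :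
    α * (D * x) = α * (x * D + c • γ) := by
  rw [← mul_assoc, hD, mul_add, ← mul_assoc, hx.eq, mul_assoc, hD, mul_smul_comm, ← hA, sub_mul,
    mul_sub, hA₀.eq]
  abel

omit [Algebra ℂ B] in
/-- If `g` carries `x` and the commutator of `T` with `x` to `x'` and the commutator of `T'` with
`x'`, then `g T - T' g` intertwines `x` and `x'`. -/
theorem conj_commutator {g T T' x x' u u' : B} (e1 : T * x = x * T + u)
    (e2 : T' * x' = x' * T' + u') (e3 : g * u = u' * g) (e4 : g * x = x' * g) :
    (g * T - T' * g) * x = x' * (g * T - T' * g) := by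
  rw [sub_mul, mul_assoc, e1, mul_add, e3, ← mul_assoc, e4, mul_assoc T', e4, ← mul_assoc T', e2]
  noncomm_ring

/-- If the commutators of the `T y` with `x` are as in a rational Cherednik algebra then `x`
commutes with `[T y, T y']`. -/
theorem commutator_commutes {T : V n →ₗ[ℂ] B} {x : B} {γ : Hyp d n → B} {ξ : Module.Dual ℂ (V n)}
    (e : ∀ y, T y * x = x * T y + (algebraMap ℂ B (ξ y) + ∑ H, pairing H ξ y • γ H))
    (hc : ∀ H y, root H y = 0 → Commute (γ H) (T y)) (y y' : V n) :
    (T y' * T y - T y * T y') * x = x * (T y' * T y - T y * T y') := by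
  -- the commutator of `γ_H` with `y` only depends on `α_H(y)`
  have e2 : ∀ (H : Hyp d n) y, γ H * T y - T y * γ H =
      (root H y / root H (coroot H)) • (γ H * T (coroot H) - T (coroot H) * γ H) := by
    intro H y
    set c := root H y / root H (coroot H)
    have h0 : root H (y - c • coroot H) = 0 := by
      simp [c, root_coroot_ne_zero]
    have h1 := (hc H _ h0).eq
    rw [map_sub, map_smul, mul_sub, sub_mul, mul_smul_comm, smul_mul_assoc] at h1
    rw [smul_sub, sub_eq_sub_iff_add_eq_add]
    rw [sub_eq_sub_iff_add_eq_add] at h1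
    rw [h1, add_comm]
  have e3 : ∀ y y', T y * ∑ H, pairing H ξ y' • γ H - (∑ H, pairing H ξ y' • γ H) * T y =
      -∑ H, (ξ (coroot H) * root H y' * root H y / (root H (coroot H)) ^ 2) •
        (γ H * T (coroot H) - T (coroot H) * γ H) := by
    intro y y'
    rw [Finset.mul_sum, Finset.sum_mul, ← Finset.sum_sub_distrib, ← Finset.sum_neg_distrib]
    refine Finset.sum_congr rfl fun H _ => ?_
    rw [mul_smul_comm, smul_mul_assoc, ← smul_sub, ← neg_sub, e2, smul_neg, smul_smul, pairing]
    congr 2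
    have := root_coroot_ne_zero H
    field_simp
  have a1 : ∀ y y', T y' * T y * x = x * (T y' * T y) + (algebraMap ℂ _ (ξ y') +
      ∑ H, pairing H ξ y' • γ H) * T y + T y' * (algebraMap ℂ _ (ξ y) +
        ∑ H, pairing H ξ y • γ H) := by
    intro y y'
    rw [mul_assoc, e, mul_add, ← mul_assoc, e]; noncomm_ring
  have b1 := e3 y y'
  have b3 : ∑ H, (ξ (coroot H) * root H y' * root H y / (root H (coroot H)) ^ 2) •
      (γ H * T (coroot H) - T (coroot H) * γ H) =
      ∑ H, (ξ (coroot H) * root H y * root H y' / (root H (coroot H)) ^ 2) •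
      (γ H * T (coroot H) - T (coroot H) * γ H) :=
    Finset.sum_congr rfl fun H _ => by congr 1; ring
  rw [b3, ← e3 y' y, sub_eq_iff_eq_add] at b1
  rw [sub_mul, a1, a1, add_mul, add_mul, mul_add, mul_add, Algebra.commutes (ξ y'),
    Algebra.commutes (ξ y), mul_sub, b1]
  abel

end Abstract

/-- A complex representation of `W` with an action of `S(V)` compatible with that of `W`. -/
structure VRep (d n : ℕ) (N : Type w) [AddCommGroup N] [Module ℂ N] where
  /-- the action of `W` -/
  ρ : Representation ℂ (W d n) N
  /-- the action of `V` -/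
  act : V n →ₗ[ℂ] Module.End ℂ N
  act_comm : ∀ y y', Commute (act y) (act y')
  ρ_act : ∀ (g : W d n) y, ρ g * act y = act ((g : V n ≃ₗ[ℂ] V n) y) * ρ g

section Operators

variable {d n : ℕ} (R : Type u) [CommRing R] [Algebra ℂ R] {N : Type w} [AddCommGroup N]
  [Module ℂ N] (S : VRep d n N)

/-- Multiplication by a linear form. -/
def covOp (n : ℕ) (N : Type w) [AddCommGroup N] [Module ℂ N] :
    Module.Dual ℂ (V n) →ₗ[ℂ] Module.End R (MvPolynomial (Fin n) R ⊗[ℂ] N) :=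
  (Algebra.lsmul R R (MvPolynomial (Fin n) R ⊗[ℂ] N) :
    MvPolynomial (Fin n) R →ₐ[R] _).toLinearMap.restrictScalars ℂ ∘ₗ linearForm R

theorem covOp_apply (ξ : Module.Dual ℂ (V n)) (m : MvPolynomial (Fin n) R ⊗[ℂ] N) :
    covOp R n N ξ m = linearForm R ξ • m := rfl

/-- The diagonal action of `W`. -/
def diagOp : W d n →* Module.End R (MvPolynomial (Fin n) R ⊗[ℂ] N) where
  toFun g := TensorProduct.AlgebraTensorModule.map (polyAct R g).toLinearMap (S.ρ g)
  map_one' := TensorProduct.AlgebraTensorModule.ext fun f x => by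
    rw [TensorProduct.AlgebraTensorModule.map_tmul, polyAct_one, map_one]
    rfl
  map_mul' g g' := TensorProduct.AlgebraTensorModule.ext fun f x => by
    rw [TensorProduct.AlgebraTensorModule.map_tmul, polyAct_mul, map_mul]
    rfl

/-- The action of `W` on the coefficients. -/
def coeffOp : W d n →* Module.End R (MvPolynomial (Fin n) R ⊗[ℂ] N) where
  toFun g := TensorProduct.AlgebraTensorModule.map LinearMap.id (S.ρ g)
  map_one' := TensorProduct.AlgebraTensorModule.ext fun f x => by
    rw [TensorProduct.AlgebraTensorModule.map_tmul, map_one]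
    rfl
  map_mul' g g' := TensorProduct.AlgebraTensorModule.ext fun f x => by
    rw [TensorProduct.AlgebraTensorModule.map_tmul, map_mul]
    rfl

@[simp] theorem diagOp_tmul (g : W d n) (f : MvPolynomial (Fin n) R) (x : N) :
    diagOp R S g (f ⊗ₜ x) = polyAct R g f ⊗ₜ S.ρ g x := rfl

@[simp] theorem coeffOp_tmul (g : W d n) (f : MvPolynomial (Fin n) R) (x : N) :
    coeffOp R S g (f ⊗ₜ x) = f ⊗ₜ S.ρ g x := rfl

theorem diagOp_mul_covOp (g : W d n) (ξ : Module.Dual ℂ (V n)) :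
    diagOp R S g * covOp R n N ξ = covOp R n N (dualAct g ξ) * diagOp R S g := by
  refine TensorProduct.AlgebraTensorModule.ext fun f x => ?_
  simp only [Module.End.mul_apply, covOp_apply, TensorProduct.smul_tmul', diagOp_tmul, smul_eq_mul,
    map_mul, polyAct_linearForm]

theorem coeffOp_comm_covOp (g : W d n) (ξ : Module.Dual ℂ (V n)) :
    Commute (coeffOp R S g) (covOp R n N ξ) := by
  refine TensorProduct.AlgebraTensorModule.ext fun f x => ?_
  simp only [Module.End.mul_apply, covOp_apply, TensorProduct.smul_tmul', coeffOp_tmul]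

theorem covOp_root_injective (H : Hyp d n) : Function.Injective (covOp R n N (root H)) :=
  Module.Flat.isSMulRegular_of_isRegular (isRegular_linearForm_root R H)

/-- The extension of the diagonal action to the group algebra. -/
abbrev diagAlg : MonoidAlgebra R (W d n) →ₐ[R] Module.End R (MvPolynomial (Fin n) R ⊗[ℂ] N) :=
  grpLift (B := Module.End R (MvPolynomial (Fin n) R ⊗[ℂ] N)) (diagOp R S)

/-- The extension of the action on coefficients to the group algebra. -/
abbrev coeffAlg : MonoidAlgebra R (W d n) →ₐ[R] Module.End R (MvPolynomial (Fin n) R ⊗[ℂ] N) :=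
  grpLift (B := Module.End R (MvPolynomial (Fin n) R ⊗[ℂ] N)) (coeffOp R S)

variable (κ : {k : ZMod d // k ≠ 0} → R) (h : R)

/-- The actions of `a_H` on `R[V] ⊗ N`, diagonally and on the coefficients alone, agree modulo
`α_H`. -/
theorem aElt_sub_mem_range (H : Hyp d n) (m : MvPolynomial (Fin n) R ⊗[ℂ] N) :
    diagAlg R S (aElt κ h H) m - coeffAlg R S (aElt κ h H) m ∈
      LinearMap.range (covOp R n N (root H)) := by
  have h1 : ∀ a (m : MvPolynomial (Fin n) R ⊗[ℂ] N),
      (diagOp R S (hypGen H) ^ a) m - (coeffOp R S (hypGen H) ^ a) m ∈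
        LinearMap.range (covOp R n N (root H)) := by
    intro a m
    rw [← map_pow, ← map_pow]
    induction m with
    | zero => simp
    | add m m' hm hm' => rw [map_add, map_add, add_sub_add_comm]; exact add_mem hm hm'
    | tmul f x =>
      obtain ⟨q, hq⟩ := linearForm_root_dvd_pow R H a f
      refine ⟨q ⊗ₜ S.ρ (hypGen H ^ a) x, ?_⟩
      rw [diagOp_tmul, coeffOp_tmul, ← TensorProduct.sub_tmul, hq, covOp_apply,
        TensorProduct.smul_tmul', smul_eq_mul]
  rw [aElt, map_smul, map_smul, map_sum, map_sum, LinearMap.smul_apply, LinearMap.smul_apply,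
    ← smul_sub, LinearMap.sum_apply, LinearMap.sum_apply, ← Finset.sum_sub_distrib]
  refine Submodule.smul_mem _ _ (Submodule.sum_mem _ fun k _ => ?_)
  rw [map_smul, map_smul, LinearMap.smul_apply, LinearMap.smul_apply, ← smul_sub, grpLift_eps,
    grpLift_eps, LinearMap.sum_apply, LinearMap.sum_apply, ← Finset.sum_sub_distrib]
  refine Submodule.smul_mem _ _ (Submodule.sum_mem _ fun a _ => ?_)
  rw [LinearMap.smul_apply, LinearMap.smul_apply, ← smul_sub, ← algebraMap_smul R]
  exact Submodule.smul_mem _ _ (h1 a m)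

/-- The difference of the two actions of `a_H` can be divided by `α_H`, as multiplication by `α_H`
is injective. -/
theorem exists_dunklPart (H : Hyp d n) :
    ∃ D : Module.End R (MvPolynomial (Fin n) R ⊗[ℂ] N), covOp R n N (root H) * D =
      diagAlg R S (aElt κ h H) - coeffAlg R S (aElt κ h H) := by
  refine ⟨(LinearEquiv.ofInjective _ (covOp_root_injective R (N := N) H)).symm.toLinearMap ∘ₗ
    LinearMap.codRestrict _ (diagAlg R S (aElt κ h H) -
      coeffAlg R S (aElt κ h H))
      (fun m => aElt_sub_mem_range R S κ h H m), LinearMap.ext fun m => ?_⟩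
  exact congrArg Subtype.val ((LinearEquiv.ofInjective _
    (covOp_root_injective R (N := N) H)).apply_symm_apply _)

/-- The part of the Dunkl operators attached to a hyperplane, a combination of divided
differences. -/
def dunklPart (H : Hyp d n) : Module.End R (MvPolynomial (Fin n) R ⊗[ℂ] N) :=
  (exists_dunklPart R S κ h H).choose

theorem covOp_mul_dunklPart (H : Hyp d n) : covOp R n N (root H) * dunklPart R S κ h H =
    diagAlg R S (aElt κ h H) - coeffAlg R S (aElt κ h H) :=
  (exists_dunklPart R S κ h H).choose_spec

theorem dunklPart_one_tmul (H : Hyp d n) (x : N) : dunklPart R S κ h H (1 ⊗ₜ x) = 0 := by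
  have h0 : ∀ z : MonoidAlgebra R (W d n), diagAlg R S z (1 ⊗ₜ x) =
      coeffAlg R S z (1 ⊗ₜ x) := by
    intro z
    rw [MonoidAlgebra.lift_apply, MonoidAlgebra.lift_apply, Finsupp.sum, Finsupp.sum,
      LinearMap.sum_apply, LinearMap.sum_apply]
    refine Finset.sum_congr rfl fun g _ => ?_
    rw [LinearMap.smul_apply, LinearMap.smul_apply, diagOp_tmul, coeffOp_tmul, map_one]
  apply covOp_root_injective R H
  rw [map_zero, ← Module.End.mul_apply, covOp_mul_dunklPart, LinearMap.sub_apply, h0, sub_self]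

/-- The part of a Dunkl operator attached to `H` accounts for the term of `γ_H` in the commutation
relation with `ξ`. -/
theorem dunklPart_mul_covOp [NeZero d] (H : Hyp d n) (ξ : Module.Dual ℂ (V n)) :
    dunklPart R S κ h H * covOp R n N ξ = covOp R n N ξ * dunklPart R S κ h H +
      (ξ (coroot H) / root H (coroot H)) • diagAlg R S (gammaElt κ h H) := by
  have h1 := mul_commutator_of_quotient (covOp_mul_dunklPart R S κ h H)
    (commutator_aElt_dual (B := Module.End R (MvPolynomial (Fin n) R ⊗[ℂ] N)) (H := H) κ h
      (diagOp_mul_covOp R S) ξ)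
    (grpLift_aElt_comm κ h (coeffOp_comm_covOp R S _ _))
    (LinearMap.ext fun m => smul_comm (linearForm R (root H)) (linearForm R ξ) m)
  refine LinearMap.ext fun m => covOp_root_injective R H ?_
  exact LinearMap.congr_fun h1 m

/-- Partial derivatives of the polynomial factor. -/
def derivOp (N : Type w) [AddCommGroup N] [Module ℂ N] (i : Fin n) :
    Module.End R (MvPolynomial (Fin n) R ⊗[ℂ] N) :=
  TensorProduct.AlgebraTensorModule.map (MvPolynomial.pderiv i).toLinearMap LinearMap.id

/-- The action of a basis vector on the coefficients. -/
def actOp (i : Fin n) : Module.End R (MvPolynomial (Fin n) R ⊗[ℂ] N) :=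
  TensorProduct.AlgebraTensorModule.map LinearMap.id (S.act (Pi.single i 1))

@[simp] theorem derivOp_tmul (i : Fin n) (f : MvPolynomial (Fin n) R) (x : N) :
    derivOp R N i (f ⊗ₜ x) = MvPolynomial.pderiv i f ⊗ₜ x := rfl

@[simp] theorem actOp_tmul (i : Fin n) (f : MvPolynomial (Fin n) R) (x : N) :
    actOp R S i (f ⊗ₜ x) = f ⊗ₜ S.act (Pi.single i 1) x := rfl

/-- The Dunkl operators: the sum of the derivative along `y`, the action of `y` on the coefficients
and the terms `α_H(y)` times the divided differences attached to `H`. -/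
def vecOp : V n →ₗ[ℂ] Module.End R (MvPolynomial (Fin n) R ⊗[ℂ] N) :=
  ∑ i, (LinearMap.proj i : Module.Dual ℂ (V n)).smulRight
      (derivOp R N i) +
    ∑ i, (LinearMap.proj i : Module.Dual ℂ (V n)).smulRight (actOp R S i) +
    ∑ H : Hyp d n, (root H).smulRight (dunklPart R S κ h H)

theorem vecOp_one_tmul (y : V n) (x : N) : vecOp R S κ h y (1 ⊗ₜ x) = 1 ⊗ₜ S.act y x := by
  conv_rhs => rw [vec_eq_sum y]
  simp [vecOp, LinearMap.sum_apply, dunklPart_one_tmul, TensorProduct.tmul_sum]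

/-- The operators satisfy the commutation relation between `V` and `V*` that defines the rational
Cherednik algebra. -/
theorem vecOp_mul_covOp [NeZero d] (y : V n) (ξ : Module.Dual ℂ (V n)) :
    vecOp R S κ h y * covOp R n N ξ - covOp R n N ξ * vecOp R S κ h y =
      algebraMap ℂ _ (ξ y) +
        ∑ H : Hyp d n, pairing H ξ y • diagAlg R S (gammaElt κ h H) := by
  have h1 : ∀ i, derivOp R N i * covOp R n N ξ = covOp R n N ξ * derivOp R N i +
      ξ (Pi.single i 1) • 1 := by
    intro i
    have h2 : MvPolynomial.pderiv i (linearForm R ξ) =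
        ξ (Pi.single i 1) • (1 : MvPolynomial (Fin n) R) := by
      rw [linearForm_apply, map_sum, Finset.sum_eq_single i]
      · rw [← algebraMap_smul R (ξ _) (MvPolynomial.X i : MvPolynomial (Fin n) R),
          Derivation.map_smul, MvPolynomial.pderiv_X_self, algebraMap_smul]
      · intro j _ hj
        rw [← algebraMap_smul R (ξ _) (MvPolynomial.X j : MvPolynomial (Fin n) R),
          Derivation.map_smul, MvPolynomial.pderiv_X_of_ne hj, smul_zero]
      · simp
    refine TensorProduct.AlgebraTensorModule.ext fun f x => ?_
    rw [Module.End.mul_apply, LinearMap.add_apply, Module.End.mul_apply, covOp_apply, covOp_apply,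
      derivOp_tmul, TensorProduct.smul_tmul', TensorProduct.smul_tmul', derivOp_tmul, smul_eq_mul,
      smul_eq_mul, Derivation.leibniz, h2, LinearMap.smul_apply, Module.End.one_apply,
      TensorProduct.smul_tmul', ← TensorProduct.add_tmul, smul_eq_mul, smul_eq_mul, mul_smul_comm,
      mul_one]
  have h3 : ∀ i, actOp R S i * covOp R n N ξ = covOp R n N ξ * actOp R S i := by
    intro i
    refine TensorProduct.AlgebraTensorModule.ext fun f x => ?_
    rw [Module.End.mul_apply, Module.End.mul_apply, covOp_apply, covOp_apply, actOp_tmul,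
      TensorProduct.smul_tmul', TensorProduct.smul_tmul', actOp_tmul]
  have h4 : ξ y = ∑ i, y i * ξ (Pi.single i 1) := by
    conv_lhs => rw [vec_eq_sum y]
    simp
  simp only [vecOp, LinearMap.add_apply, LinearMap.sum_apply, LinearMap.smulRight_apply,
    LinearMap.proj_apply, add_mul, mul_add, Finset.sum_mul, Finset.mul_sum, smul_mul_assoc,
    mul_smul_comm, h1, h3, dunklPart_mul_covOp, smul_add, Finset.sum_add_distrib, smul_smul]
  rw [← Finset.sum_smul, ← h4, ← Algebra.algebraMap_eq_smul_one]
  have h5 : ∀ H : Hyp d n, root H y * (ξ (coroot H) / root H (coroot H)) = pairing H ξ y :=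
    fun H => by rw [pairing]; ring
  simp only [h5]
  abel

theorem vecOp_mul_covOp' [NeZero d] (y : V n) (ξ : Module.Dual ℂ (V n)) :
    vecOp R S κ h y * covOp R n N ξ = covOp R n N ξ * vecOp R S κ h y +
      (algebraMap ℂ _ (ξ y) +
        ∑ H : Hyp d n, pairing H ξ y • diagAlg R S (gammaElt κ h H)) := by
  rw [← vecOp_mul_covOp]
  abel

variable {R}

/-- An operator vanishing on the constants, with kernel stable under multiplication by linear forms,
vanishes. -/
theorem op_eq_zero {Z : Type*} [AddCommGroup Z] [Module R Z]
    {L : MvPolynomial (Fin n) R ⊗[ℂ] N →ₗ[R] Z}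
    (h1 : ∀ x, L (1 ⊗ₜ x) = 0) (h2 : ∀ ξ m, L m = 0 → L (covOp R n N ξ m) = 0) : L = 0 := by
  refine LinearMap.ext fun m => ?_
  rw [LinearMap.zero_apply]
  induction m with
  | zero => exact map_zero L
  | add m m' hm hm' => rw [map_add, hm, hm', add_zero]
  | tmul f x =>
  induction f using MvPolynomial.induction_on with
  | C r =>
    rw [← MvPolynomial.algebraMap_eq, Algebra.algebraMap_eq_smul_one, ← TensorProduct.smul_tmul',
      map_smul, h1, smul_zero]
  | add p q hp hq => rw [TensorProduct.add_tmul, map_add, hp, hq, add_zero]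
  | mul_X p i hp =>
    have := h2 (LinearMap.proj i) _ hp
    rwa [covOp_apply, linearForm_proj, TensorProduct.smul_tmul', smul_eq_mul, mul_comm] at this

/-- The Dunkl operators are equivariant: both sides agree on constants, and their difference is
compatible with multiplication by linear forms. -/
theorem diagOp_mul_vecOp [NeZero d] (g : W d n) (y : V n) :
    diagOp R S g * vecOp R S κ h y =
      vecOp R S κ h ((g : V n ≃ₗ[ℂ] V n) y) * diagOp R S g := by
  rw [← sub_eq_zero]
  refine op_eq_zero (fun x => ?_) fun ξ m hm => ?_
  · simp only [LinearMap.sub_apply, Module.End.mul_apply, vecOp_one_tmul, diagOp_tmul, map_one]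
    rw [sub_eq_zero]
    congr 1
    exact LinearMap.congr_fun (S.ρ_act g y) x
  · obtain ⟨τ, ho, hg, hp, hc⟩ := exists_hyp_perm.{u} g
    have e1 := vecOp_mul_covOp' R S κ h y ξ
    have e2 := vecOp_mul_covOp' R S κ h ((g : V n ≃ₗ[ℂ] V n) y) (dualAct g ξ)
    have e3 : diagOp R S g * (algebraMap ℂ _ (ξ y) +
        ∑ H : Hyp d n, pairing H ξ y • diagAlg R S (gammaElt κ h H)) =
      (algebraMap ℂ _ (dualAct g ξ ((g : V n ≃ₗ[ℂ] V n) y)) +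
        ∑ H : Hyp d n, pairing H (dualAct g ξ) ((g : V n ≃ₗ[ℂ] V n) y) •
          diagAlg R S (gammaElt κ h H)) * diagOp R S g := by
      rw [mul_add, add_mul, ← Algebra.commutes, Finset.mul_sum, Finset.sum_mul, dualAct_apply]
      congr 1
      refine Fintype.sum_equiv τ _ _ fun H => ?_
      rw [hp, mul_smul_comm, smul_mul_assoc]
      exact congrArg (_ • ·) (grpLift_gammaElt_conj
        (B := Module.End R (MvPolynomial (Fin n) R ⊗[ℂ] N)) κ h (ho H) (hg H) (hc R κ h H))
    have e4 := LinearMap.congr_fun (conj_commutator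
      (B := Module.End R (MvPolynomial (Fin n) R ⊗[ℂ] N)) e1 e2 e3 (diagOp_mul_covOp R S g ξ)) m
    exact e4.trans ((congrArg (covOp R n N (dualAct g ξ)) hm).trans (map_zero _))

/-- The Dunkl operators commute: the commutator vanishes on constants and commutes with
multiplication by linear forms. -/
theorem vecOp_comm [NeZero d] (y y' : V n) : Commute (vecOp R S κ h y) (vecOp R S κ h y') := by
  rw [← Commute.symm_iff, commute_iff_eq, ← sub_eq_zero]
  refine op_eq_zero (fun x => ?_) fun ξ m hm => ?_
  · simp only [LinearMap.sub_apply, Module.End.mul_apply, vecOp_one_tmul]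
    rw [sub_eq_zero]
    congr 1
    exact LinearMap.congr_fun (S.act_comm y' y) x
  · have hc : ∀ (H : Hyp d n) y, root H y = 0 →
        Commute (diagAlg R S (gammaElt κ h H)) (vecOp R S κ h y) := by
      intro H y h0
      have h2 : Commute (diagOp R S (hypGen H)) (vecOp R S κ h y) := by
        have := diagOp_mul_vecOp S κ h (hypGen H) y
        rwa [hypGen_of_root_eq_zero H h0] at this
      simp only [gammaElt, map_smul, map_sum]
      refine Commute.smul_left (Commute.sum_left _ _ _ fun k _ => ?_) _
      exact (grpLift_eps_comm h2 k).smul_left _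
    have e4 := LinearMap.congr_fun (commutator_commutes
      (B := Module.End R (MvPolynomial (Fin n) R ⊗[ℂ] N))
      (γ := fun H => diagAlg R S (gammaElt κ h H))
      (fun y => vecOp_mul_covOp' R S κ h y ξ) hc y y') m
    exact e4.trans ((congrArg (covOp R n N ξ) hm).trans (map_zero _))

/-- The action of `H_R(κ, h)` on `R[V] ⊗ N` by multiplication and Dunkl operators. -/
def inducedRealisation [NeZero d] :
    Realisation κ h (d := d) (n := n) (Module.End R (MvPolynomial (Fin n) R ⊗[ℂ] N)) where
  G := diagOp R S
  X := covOp R n N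
  Y := vecOp R S κ h
  grp_vec := diagOp_mul_vecOp S κ h
  grp_cov := diagOp_mul_covOp R S
  vec_comm := vecOp_comm S κ h
  cov_comm ξ ξ' := LinearMap.ext fun m => smul_comm (linearForm R ξ) (linearForm R ξ') m
  vec_cov y ξ := vecOp_mul_covOp R S κ h y ξ

end Operators

end Cherednik

namespace Cherednik

open IrrepClass FiniteGroupRep

/-! ### Induced modules -/

section Ind

variable {d n : ℕ} [NeZero d] {R : Type u} [CommRing R] [Algebra ℂ R]
  (κ : {k : ZMod d // k ≠ 0} → R) (h : R) {N : Type w} [AddCommGroup N] [Module ℂ N]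
  (S : VRep d n N)

/-- The `H_R(κ, h)`-module induced from a complex representation of `S(V) ♯ W`, realised on
`R[V] ⊗ N`. -/
@[nolint unusedArguments]
def Ind (_ : {k : ZMod d // k ≠ 0} → R) (_ : R) (_ : VRep d n N) : Type (max u w) :=
  MvPolynomial (Fin n) R ⊗[ℂ] N

instance : AddCommGroup (Ind κ h S) := inferInstanceAs (AddCommGroup (_ ⊗[ℂ] _))
instance : Module (MvPolynomial (Fin n) R) (Ind κ h S) :=
  inferInstanceAs (Module _ (MvPolynomial (Fin n) R ⊗[ℂ] N))
instance : Module R (Ind κ h S) := inferInstanceAs (Module R (MvPolynomial (Fin n) R ⊗[ℂ] N))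
instance : Module ℂ (Ind κ h S) := inferInstanceAs (Module ℂ (MvPolynomial (Fin n) R ⊗[ℂ] N))
instance : IsScalarTower R (MvPolynomial (Fin n) R) (Ind κ h S) :=
  inferInstanceAs (IsScalarTower _ _ (MvPolynomial (Fin n) R ⊗[ℂ] N))
instance : IsScalarTower ℂ R (Ind κ h S) :=
  inferInstanceAs (IsScalarTower _ _ (MvPolynomial (Fin n) R ⊗[ℂ] N))
instance : IsScalarTower ℂ (MvPolynomial (Fin n) R) (Ind κ h S) :=
  inferInstanceAs (IsScalarTower _ _ (MvPolynomial (Fin n) R ⊗[ℂ] N))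
instance : Module.Free (MvPolynomial (Fin n) R) (Ind κ h S) :=
  inferInstanceAs (Module.Free _ (MvPolynomial (Fin n) R ⊗[ℂ] N))

/-- The action of `H_R(κ, h)` on an induced module. -/
def indAction : Alg d n κ h →ₐ[R] Module.End R (Ind κ h S) :=
  (inducedRealisation S κ h).lift

instance : Module (Alg d n κ h) (Ind κ h S) :=
  Module.compHom (Ind κ h S) (indAction κ h S).toRingHom

variable {κ h S}

theorem ind_smul_def (a : Alg d n κ h) (m : Ind κ h S) : a • m = indAction κ h S a m := rfl

theorem ind_cov_smul (ξ : Module.Dual ℂ (V n)) (m : Ind κ h S) :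
    (tautological (d := d) κ h).X ξ • m = covOp R n N ξ m :=
  LinearMap.congr_fun ((inducedRealisation S κ h).lift_gen (Gen.cov ξ)) m

theorem ind_vec_smul (y : V n) (m : Ind κ h S) :
    (tautological (d := d) κ h).Y y • m = vecOp R S κ h y m :=
  LinearMap.congr_fun ((inducedRealisation S κ h).lift_gen (Gen.vec y)) m

theorem ind_grp_smul (g : W d n) (m : Ind κ h S) :
    (tautological (d := d) κ h).G g • m = diagOp R S g m :=
  LinearMap.congr_fun ((inducedRealisation S κ h).lift_gen (Gen.grp g)) m

instance : IsScalarTower R (Alg d n κ h) (Ind κ h S) :=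
  ⟨fun r a m => by rw [ind_smul_def, map_smul, LinearMap.smul_apply, ind_smul_def]⟩

instance : IsScalarTower ℂ (Alg d n κ h) (Ind κ h S) :=
  ⟨fun r a m => by rw [← algebraMap_smul R, smul_assoc, algebraMap_smul]⟩

theorem indAction_comp_polyHom (p : MvPolynomial (Fin n) R) (m : Ind κ h S) :
    indAction κ h S (polyHom κ h p) m = p • m := by
  have : (indAction κ h S).comp (polyHom κ h) =
      (Algebra.lsmul R R (Ind κ h S) : MvPolynomial (Fin n) R →ₐ[R] _) := by
    refine MvPolynomial.algHom_ext fun i => LinearMap.ext fun m => ?_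
    rw [AlgHom.comp_apply, ← linearForm_proj, polyHom_linearForm]
    exact ind_cov_smul _ m
  exact LinearMap.congr_fun (DFunLike.congr_fun this p) m

instance : IsScalarTower (MvPolynomial (Fin n) R) (Alg d n κ h) (Ind κ h S) :=
  ⟨fun p a m => by
    rw [ind_smul_def, poly_smul_def, map_mul, Module.End.mul_apply, indAction_comp_polyHom,
      ind_smul_def]⟩

variable (κ h S) in
/-- The inclusion of the coefficients in an induced module. -/
def indIncl : N →ₗ[ℂ] Ind κ h S :=
  TensorProduct.mk ℂ (MvPolynomial (Fin n) R) N 1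

theorem vec_smul_indIncl (y : V n) (x : N) :
    (tautological (d := d) κ h).Y y • indIncl κ h S x = indIncl κ h S (S.act y x) := by
  rw [ind_vec_smul]
  exact vecOp_one_tmul R S κ h y x

theorem grp_smul_indIncl (g : W d n) (x : N) :
    (tautological (d := d) κ h).G g • indIncl κ h S x = indIncl κ h S (S.ρ g x) := by
  rw [ind_grp_smul]
  exact (diagOp_tmul R S g 1 x).trans (by rw [map_one]; rfl)

omit [NeZero d] in
theorem ind_poly_induction {p : Ind κ h S → Prop} (h0 : p 0) (ha : ∀ x y, p x → p y → p (x + y))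
    (hm : ∀ (f : MvPolynomial (Fin n) R) x, p (f • indIncl κ h S x)) (m : Ind κ h S) : p m := by
  induction m using TensorProduct.induction_on with
  | zero => exact h0
  | add x y hx hy => exact ha x y hx hy
  | tmul f x =>
    have : (f ⊗ₜ[ℂ] x : MvPolynomial (Fin n) R ⊗[ℂ] N) = f • ((1 : MvPolynomial (Fin n) R) ⊗ₜ x) := by
      rw [TensorProduct.smul_tmul', smul_eq_mul, mul_one]
    rw [this]
    exact hm f x

/-- An `R`-linear map on an induced module vanishes if it vanishes on the generators and its kernel
is stable under `V*`. -/
theorem ind_op_eq_zero {Z : Type*} [AddCommGroup Z] [Module R Z] {L : Ind κ h S →ₗ[R] Z}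
    (h1 : ∀ x, L (indIncl κ h S x) = 0)
    (h2 : ∀ ξ m, L m = 0 → L ((tautological (d := d) (n := n) κ h).X ξ • m) = 0) : L = 0 :=
  op_eq_zero h1 fun ξ m hm => (congrArg L (ind_cov_smul (S := S) ξ m)).symm.trans (h2 ξ m hm)

section UniversalProperty

variable {M : Type*} [AddCommGroup M] [Module (Alg d n κ h) M] [Module R M]
  [IsScalarTower R (Alg d n κ h) M] [Module ℂ M] [IsScalarTower ℂ R M]
  [IsScalarTower ℂ (Alg d n κ h) M]
  [Module (MvPolynomial (Fin n) R) M] [IsScalarTower (MvPolynomial (Fin n) R) (Alg d n κ h) M]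
  [IsScalarTower R (MvPolynomial (Fin n) R) M]

/-- The homomorphism out of an induced module given by a homomorphism on coefficients. -/
def indLift (f : N →ₗ[ℂ] M)
    (hG : ∀ g x, f (S.ρ g x) = (tautological (d := d) (n := n) κ h).G g • f x)
    (hY : ∀ y x, f (S.act y x) = (tautological (d := d) (n := n) κ h).Y y • f x) :
    Ind κ h S →ₗ[Alg d n κ h] M :=
  haveI : IsScalarTower ℂ (MvPolynomial (Fin n) R) M :=
    ⟨fun c p m => by rw [← algebraMap_smul R c p, smul_assoc, algebraMap_smul]⟩
  let φ : Ind κ h S →ₗ[MvPolynomial (Fin n) R] M := f.liftBaseChange (MvPolynomial (Fin n) R)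
  have h1 : ∀ x : N, φ (indIncl κ h S x) = f x := fun x => by
    change f.liftBaseChange (MvPolynomial (Fin n) R) (1 ⊗ₜ[ℂ] x) = _
    rw [LinearMap.liftBaseChange_tmul, one_smul]
  have hX : ∀ ξ m, φ ((tautological (d := d) (n := n) κ h).X ξ • m) =
      (tautological (d := d) (n := n) κ h).X ξ • φ m := fun ξ m => by
    rw [← linearForm_smul, map_smul, linearForm_smul (d := d) (κ := κ) (h := h)]
  have hG' : ∀ g m, φ ((tautological (d := d) (n := n) κ h).G g • m) =
      (tautological (d := d) (n := n) κ h).G g • φ m := fun g => by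
    have : (φ.restrictScalars R ∘ₗ Algebra.lsmul R R (Ind κ h S)
          ((tautological (d := d) (n := n) κ h).G g) -
        Algebra.lsmul R R M ((tautological (d := d) (n := n) κ h).G g) ∘ₗ φ.restrictScalars R) =
        0 := by
      refine ind_op_eq_zero (fun x => ?_) fun ξ m hm => ?_
      · have := grp_smul_indIncl (κ := κ) (h := h) (S := S) g x
        refine sub_eq_zero.2 ((congrArg φ this).trans ?_)
        exact (h1 _).trans ((hG g x).trans (congrArg _ (h1 x).symm))
      · replace hm := sub_eq_zero.1 hm
        refine sub_eq_zero.2 ?_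
        change φ ((tautological (d := d) (n := n) κ h).G g •
          (tautological (d := d) (n := n) κ h).X ξ • m) =
          (tautological (d := d) (n := n) κ h).G g •
            φ ((tautological (d := d) (n := n) κ h).X ξ • m)
        rw [hX, ← mul_smul, ← mul_smul, (tautological (d := d) (n := n) κ h).grp_cov, mul_smul,
          mul_smul, hX]
        exact congrArg _ hm
    exact fun m => sub_eq_zero.1 (LinearMap.congr_fun this m)
  have hA : ∀ (z : MonoidAlgebra R (W d n)) m,
      φ (grpLift (tautological (d := d) (n := n) κ h).G z • m) =
      grpLift (tautological (d := d) (n := n) κ h).G z • φ m := fun z m => by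
    rw [MonoidAlgebra.lift_apply, Finsupp.sum, Finset.sum_smul, Finset.sum_smul, map_sum]
    refine Finset.sum_congr rfl fun g _ => ?_
    rw [smul_assoc, smul_assoc, LinearMap.map_smul_of_tower, hG']
  have hC : ∀ (c : ℂ) m, φ (c • m) = c • φ m := fun c m => LinearMap.map_smul_of_tower φ c m
  linearMapOfCommutes (φ.restrictScalars R) hX
    (fun y => by
      have : (φ.restrictScalars R ∘ₗ Algebra.lsmul R R (Ind κ h S)
            ((tautological (d := d) (n := n) κ h).Y y) -
          Algebra.lsmul R R M ((tautological (d := d) (n := n) κ h).Y y) ∘ₗ φ.restrictScalars R) =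
          0 := by
        refine ind_op_eq_zero (fun x => ?_) fun ξ m hm => ?_
        · have := vec_smul_indIncl (κ := κ) (h := h) (S := S) y x
          refine sub_eq_zero.2 ((congrArg φ this).trans ?_)
          exact (h1 _).trans ((hY y x).trans (congrArg _ (h1 x).symm))
        · replace hm := sub_eq_zero.1 hm
          refine sub_eq_zero.2 ?_
          change φ ((tautological (d := d) (n := n) κ h).Y y •
            (tautological (d := d) (n := n) κ h).X ξ • m) =
            (tautological (d := d) (n := n) κ h).Y y •
              φ ((tautological (d := d) (n := n) κ h).X ξ • m)
          replace hm : φ ((tautological (d := d) (n := n) κ h).Y y • m) =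
            (tautological (d := d) (n := n) κ h).Y y • φ m := hm
          rw [hX, ← mul_smul, ← mul_smul,
            sub_eq_iff_eq_add'.1 ((tautological (d := d) (n := n) κ h).vec_cov y ξ)]
          simp only [add_smul, mul_smul, map_add, hX, hm, algebraMap_smul, hC, Finset.sum_smul,
            map_sum, smul_assoc, hA]
      exact fun m => sub_eq_zero.1 (LinearMap.congr_fun this m)) hG'

theorem indLift_indIncl (f : N →ₗ[ℂ] M)
    (hG : ∀ g x, f (S.ρ g x) = (tautological (d := d) (n := n) κ h).G g • f x)
    (hY : ∀ y x, f (S.act y x) = (tautological (d := d) (n := n) κ h).Y y • f x) (x : N) :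
    indLift f hG hY (indIncl κ h S x) = f x := by
  have : IsScalarTower ℂ (MvPolynomial (Fin n) R) M :=
    ⟨fun c p m => by rw [← algebraMap_smul R c p, smul_assoc, algebraMap_smul]⟩
  change f.liftBaseChange (MvPolynomial (Fin n) R) (1 ⊗ₜ[ℂ] x) = _
  rw [LinearMap.liftBaseChange_tmul, one_smul]

omit [NeZero d] [Module R M] [IsScalarTower R (Alg d n κ h) M] [Module ℂ M]
  [IsScalarTower ℂ R M] [IsScalarTower ℂ (Alg d n κ h) M]
  [IsScalarTower R (MvPolynomial (Fin n) R) M] in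
theorem map_poly_smul {M' : Type*} [AddCommGroup M'] [Module (Alg d n κ h) M']
    [Module (MvPolynomial (Fin n) R) M'] [IsScalarTower (MvPolynomial (Fin n) R) (Alg d n κ h) M']
    (f : M →ₗ[Alg d n κ h] M') (p : MvPolynomial (Fin n) R) (m : M) : f (p • m) = p • f m := by
  rw [poly_smul_eq (κ := κ) (h := h), map_smul, ← poly_smul_eq]

omit [Module R M] [IsScalarTower R (Alg d n κ h) M] [Module ℂ M] [IsScalarTower ℂ R M]
  [IsScalarTower ℂ (Alg d n κ h) M] [Module (MvPolynomial (Fin n) R) M]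
  [IsScalarTower (MvPolynomial (Fin n) R) (Alg d n κ h) M]
  [IsScalarTower R (MvPolynomial (Fin n) R) M] in
theorem indLift_ext {f g : Ind κ h S →ₗ[Alg d n κ h] M}
    (hfg : ∀ x, f (indIncl κ h S x) = g (indIncl κ h S x)) : f = g := by
  let _ : Module (MvPolynomial (Fin n) R) M := Module.compHom M (polyHom κ h).toRingHom
  have : IsScalarTower (MvPolynomial (Fin n) R) (Alg d n κ h) M :=
    ⟨fun p a m => by rw [poly_smul_def, mul_smul]; rfl⟩
  refine LinearMap.ext fun m => ?_
  induction m using ind_poly_induction with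
  | h0 => rw [map_zero, map_zero]
  | ha x y hx hy => rw [map_add, map_add, hx, hy]
  | hm p x => rw [map_poly_smul, map_poly_smul, hfg]

end UniversalProperty

end Ind

/-! ### Module structures on objects of the module category -/

section ModuleCat

variable {d n : ℕ} {R : Type u} [CommRing R] [Algebra ℂ R]
  {κ : {k : ZMod d // k ≠ 0} → R} {h : R}

instance moduleCatModule (M : ModuleCat.{v} (Alg d n κ h)) : Module R M :=
  HighestWeight.restrictModule R M

instance moduleCatComplexModule (M : ModuleCat.{v} (Alg d n κ h)) : Module ℂ M :=
  Module.compHom M (algebraMap ℂ (Alg d n κ h))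

instance moduleCatPolyModule (M : ModuleCat.{v} (Alg d n κ h)) :
    Module (MvPolynomial (Fin n) R) M :=
  Module.compHom M (polyHom κ h).toRingHom

instance (M : ModuleCat.{v} (Alg d n κ h)) : IsScalarTower R (Alg d n κ h) M :=
  ⟨fun r a m => by rw [Algebra.smul_def, mul_smul]; rfl⟩

instance (M : ModuleCat.{v} (Alg d n κ h)) : IsScalarTower ℂ (Alg d n κ h) M :=
  ⟨fun r a m => by rw [Algebra.smul_def, mul_smul]; rfl⟩

instance (M : ModuleCat.{v} (Alg d n κ h)) :
    IsScalarTower (MvPolynomial (Fin n) R) (Alg d n κ h) M :=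
  ⟨fun p a m => by rw [poly_smul_def, mul_smul]; rfl⟩

instance (M : ModuleCat.{v} (Alg d n κ h)) : IsScalarTower ℂ R M :=
  ⟨fun c r m => by
    change algebraMap R (Alg d n κ h) (c • r) • m =
      algebraMap ℂ (Alg d n κ h) c • algebraMap R (Alg d n κ h) r • m
    rw [← mul_smul, Algebra.smul_def, map_mul]
    rfl⟩

instance (M : ModuleCat.{v} (Alg d n κ h)) : IsScalarTower R (MvPolynomial (Fin n) R) M :=
  ⟨fun c p m => by
    change polyHom κ h (c • p) • m = algebraMap R (Alg d n κ h) c • polyHom κ h p • m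
    rw [← mul_smul, map_smul, Algebra.smul_def]⟩

end ModuleCat

/-! ### Standard modules as induced modules -/

section Standard

variable {d n : ℕ} [NeZero d] {R : Type u} [CommRing R] [Algebra ℂ R]
  (κ : {k : ZMod d // k ≠ 0} → R) (h : R) (E : Irr (W d n))

/-- A representation of `W` with trivial action of `V`. -/
def trivialVRep (E : Rep.{0} ℂ (W d n)) : VRep d n E.V where
  ρ := E.ρ
  act := 0
  act_comm _ _ := Commute.zero_left _
  ρ_act _ _ := (mul_zero _).trans (zero_mul _).symm

/-- The defining quotient map of `Δ(E)`. -/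
def standardMk : Alg d n κ h ⊗[R] (R ⊗[ℂ] E.rep.V) →ₗ[Alg d n κ h] standard κ h E :=
  (inductionRel κ h E.rep).mkQ

/-- The inclusion of `E` in the standard module `Δ(E)`. -/
def standardIncl : E.rep.V →ₗ[ℂ] standard κ h E where
  toFun e := standardMk κ h E ((1 : Alg d n κ h) ⊗ₜ[R] ((1 : R) ⊗ₜ[ℂ] e))
  map_add' e e' := by
    rw [← map_add, ← TensorProduct.tmul_add, ← TensorProduct.tmul_add]
  map_smul' c e := by
    have h1 : ((1 : R) ⊗ₜ[ℂ] (c • e) : R ⊗[ℂ] E.rep.V) = algebraMap ℂ R c • ((1 : R) ⊗ₜ[ℂ] e) := by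
      rw [algebraMap_smul, TensorProduct.tmul_smul]
    have h2 : (1 : Alg d n κ h) ⊗ₜ[R] ((1 : R) ⊗ₜ[ℂ] (c • e)) =
        algebraMap ℂ (Alg d n κ h) c • ((1 : Alg d n κ h) ⊗ₜ[R] ((1 : R) ⊗ₜ[ℂ] e)) := by
      rw [h1, ← TensorProduct.smul_tmul, TensorProduct.smul_tmul', smul_eq_mul, mul_one,
        ← Algebra.algebraMap_eq_smul_one]
      rfl
    rw [h2, map_smul]
    rfl

omit [NeZero d] in
theorem standardMk_tmul (a : Alg d n κ h) (r : R) (e : E.rep.V) :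
    standardMk κ h E (a ⊗ₜ[R] (r ⊗ₜ[ℂ] e)) = (r • a) • standardIncl κ h E e := by
  have h1 : (r ⊗ₜ[ℂ] e : R ⊗[ℂ] E.rep.V) = r • ((1 : R) ⊗ₜ[ℂ] e) := by
    rw [TensorProduct.smul_tmul', smul_eq_mul, mul_one]
  have h2 : a ⊗ₜ[R] (r ⊗ₜ[ℂ] e) = (r • a) • ((1 : Alg d n κ h) ⊗ₜ[R] ((1 : R) ⊗ₜ[ℂ] e)) := by
    rw [h1, ← TensorProduct.smul_tmul, TensorProduct.smul_tmul', smul_eq_mul, mul_one]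
  rw [h2, map_smul]
  rfl

omit [NeZero d] in
theorem standardIncl_rep (g : W d n) (e : E.rep.V) :
    standardIncl κ h E (E.rep.ρ g e) =
      (tautological κ h).G g • standardIncl κ h E e := by
  have h1 : gen κ h (Gen.grp g) ⊗ₜ[R] ((1 : R) ⊗ₜ[ℂ] e) -
      (1 : Alg d n κ h) ⊗ₜ[R] (E.rep.ρ g).baseChange R ((1 : R) ⊗ₜ[ℂ] e) ∈
        inductionRel κ h E.rep := Submodule.subset_span (Or.inl ⟨g, _, rfl⟩)
  have h2 : standardMk κ h E (gen κ h (Gen.grp g) ⊗ₜ[R] ((1 : R) ⊗ₜ[ℂ] e) -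
      (1 : Alg d n κ h) ⊗ₜ[R] (E.rep.ρ g).baseChange R ((1 : R) ⊗ₜ[ℂ] e)) = 0 :=
    (Submodule.Quotient.mk_eq_zero _).2 h1
  rw [map_sub, sub_eq_zero, standardMk_tmul, one_smul, LinearMap.baseChange_tmul, standardMk_tmul,
    one_smul, one_smul] at h2
  exact h2.symm

omit [NeZero d] in
theorem vec_smul_standardIncl (y : V n) (e : E.rep.V) :
    (tautological κ h).Y y • standardIncl κ h E e = 0 := by
  have h1 : gen κ h (Gen.vec y) ⊗ₜ[R] ((1 : R) ⊗ₜ[ℂ] e) ∈ inductionRel κ h E.rep :=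
    Submodule.subset_span (Or.inr ⟨y, _, rfl⟩)
  have h2 : standardMk κ h E (gen κ h (Gen.vec y) ⊗ₜ[R] ((1 : R) ⊗ₜ[ℂ] e)) = 0 :=
    (Submodule.Quotient.mk_eq_zero _).2 h1
  rw [standardMk_tmul, one_smul] at h2
  exact h2

omit [NeZero d] in
variable {κ h E} in
/-- Homomorphisms from `Δ(E)` are determined by their restrictions to `E`. -/
theorem standard_ext {M : Type*} [AddCommGroup M] [Module (Alg d n κ h) M]
    {f g : standard κ h E →ₗ[Alg d n κ h] M}
    (hfg : ∀ e, f (standardIncl κ h E e) = g (standardIncl κ h E e)) : f = g := by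
  refine LinearMap.ext fun m => ?_
  obtain ⟨t, rfl⟩ : ∃ t, standardMk κ h E t = m := Submodule.mkQ_surjective _ m
  induction t with
  | zero => rw [map_zero, map_zero, map_zero]
  | add t t' ht ht' => rw [map_add, map_add, map_add, ht, ht']
  | tmul a x =>
    induction x with
    | zero => rw [TensorProduct.tmul_zero, map_zero, map_zero, map_zero]
    | add x x' hx hx' => rw [TensorProduct.tmul_add, map_add, map_add, map_add, hx, hx']
    | tmul r e => rw [standardMk_tmul, map_smul, map_smul, hfg]

/-- The homomorphism out of `Δ(E)` given by an equivariant map with image killed by `V`. -/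
def standardLift {M : Type*} [AddCommGroup M] [Module (Alg d n κ h) M] [Module R M]
    [IsScalarTower R (Alg d n κ h) M] [Module ℂ M] [IsScalarTower ℂ R M] (f : E.rep.V →ₗ[ℂ] M)
    (hG : ∀ g e, f (E.rep.ρ g e) = (tautological (d := d) (n := n) κ h).G g • f e)
    (hY : ∀ y e, (tautological (d := d) (n := n) κ h).Y y • f e = 0) :
    standard κ h E →ₗ[Alg d n κ h] M :=
  let φ : R ⊗[ℂ] E.rep.V →ₗ[R] M := f.liftBaseChange R
  let ψ : Alg d n κ h ⊗[R] (R ⊗[ℂ] E.rep.V) →ₗ[Alg d n κ h] M :=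
    TensorProduct.AlgebraTensorModule.lift (LinearMap.toSpanSingleton (Alg d n κ h) _ φ)
  have hψ : ∀ a x, ψ (a ⊗ₜ[R] x) = a • φ x := fun a x => rfl
  Submodule.liftQ _ ψ (by
    rw [inductionRel, Submodule.span_le]
    rintro _ (⟨g, m, rfl⟩ | ⟨y, m, rfl⟩)
    · rw [SetLike.mem_coe, LinearMap.mem_ker, map_sub, sub_eq_zero, hψ, hψ, one_smul]
      induction m with
      | zero => simp
      | add m m' hm hm' => rw [map_add, map_add, map_add, smul_add, hm, hm']
      | tmul r e =>
        rw [LinearMap.liftBaseChange_tmul, LinearMap.baseChange_tmul,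
          LinearMap.liftBaseChange_tmul, smul_comm, hG]
        rfl
    · rw [SetLike.mem_coe, LinearMap.mem_ker, hψ]
      induction m with
      | zero => simp
      | add m m' hm hm' => rw [map_add, smul_add, hm, hm', add_zero]
      | tmul r e =>
        rw [LinearMap.liftBaseChange_tmul, smul_comm]
        exact (congrArg _ (hY y e)).trans (smul_zero r))

omit [NeZero d] in
theorem standardLift_standardIncl {M : Type*} [AddCommGroup M] [Module (Alg d n κ h) M]
    [Module R M] [IsScalarTower R (Alg d n κ h) M] [Module ℂ M] [IsScalarTower ℂ R M]
    (f : E.rep.V →ₗ[ℂ] M)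
    (hG : ∀ g e, f (E.rep.ρ g e) = (tautological (d := d) (n := n) κ h).G g • f e)
    (hY : ∀ y e, (tautological (d := d) (n := n) κ h).Y y • f e = 0) (e : E.rep.V) :
    standardLift κ h E f hG hY (standardIncl κ h E e) = f e := by
  change (1 : Alg d n κ h) • f.liftBaseChange R ((1 : R) ⊗ₜ[ℂ] e) = f e
  rw [one_smul, LinearMap.liftBaseChange_tmul, one_smul]

/-- The homomorphism from the induced module to `Δ(E)`. -/
def standardOfInd : Ind κ h (trivialVRep E.rep) →ₗ[Alg d n κ h] standard κ h E :=
  indLift (standardIncl κ h E) (standardIncl_rep κ h E)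
    (fun y e => by rw [vec_smul_standardIncl]; exact map_zero _)

theorem standardOfInd_indIncl (e : E.rep.V) :
    standardOfInd κ h E (indIncl κ h (trivialVRep E.rep) e) = standardIncl κ h E e :=
  indLift_indIncl _ _ _ _

/-- The homomorphism from `Δ(E)` to the induced module. -/
def indOfStandard : standard κ h E →ₗ[Alg d n κ h] Ind κ h (trivialVRep E.rep) :=
  standardLift κ h E (indIncl κ h (trivialVRep E.rep)) (fun g e => (grp_smul_indIncl g e).symm)
    fun y e => (vec_smul_indIncl y e).trans (map_zero _)

theorem indOfStandard_standardIncl (e : E.rep.V) :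
    indOfStandard κ h E (standardIncl κ h E e) = indIncl κ h (trivialVRep E.rep) e :=
  standardLift_standardIncl _ _ _ _ _ _ _

/-- `Δ(E)` is induced from `E`. -/
def standardEquiv : Ind κ h (trivialVRep E.rep) ≃ₗ[Alg d n κ h] standard κ h E :=
  LinearEquiv.ofLinearMap (standardOfInd κ h E) (indOfStandard κ h E)
    (standard_ext fun e => by
      rw [LinearMap.comp_apply, indOfStandard_standardIncl, standardOfInd_indIncl,
        LinearMap.id_apply])
    (indLift_ext fun e => by
      rw [LinearMap.comp_apply, standardOfInd_indIncl, indOfStandard_standardIncl,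
        LinearMap.id_apply])

theorem standardEquiv_indIncl (e : E.rep.V) :
    standardEquiv κ h E (indIncl κ h (trivialVRep E.rep) e) = standardIncl κ h E e :=
  standardOfInd_indIncl _ _ _ _

end Standard

end Cherednik

namespace Cherednik

open IrrepClass FiniteGroupRep WeightSpace IsLocalRing

/-! ### Locally nilpotent modules -/

section Action

variable {d n : ℕ} {R : Type u} [CommRing R] [Algebra ℂ R]
  (κ : {k : ZMod d // k ≠ 0} → R) (h : R)
  (M : Type v) [AddCommGroup M] [Module (Alg d n κ h) M]

variable (n) in
/-- The action of `W` on a module over the rational Cherednik algebra. -/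
def moduleRep [Module ℂ M] [IsScalarTower ℂ (Alg d n κ h) M] : Representation ℂ (W d n) M :=
  ((Algebra.lsmul ℂ ℂ M : Alg d n κ h →ₐ[ℂ] Module.End ℂ M) : Alg d n κ h →* _).comp
    (tautological κ h).G

variable [Module R M] [IsScalarTower R (Alg d n κ h) M]

variable (n) in
/-- The elements killed by all products of `r` elements of `V`. -/
def nilpotentPart : ℕ → Submodule R M
  | 0 => ⊥
  | r + 1 => ⨅ y : V n, (nilpotentPart r).comap (Algebra.lsmul R R M ((tautological κ h).Y y))

variable (n) in
/-- Each element is killed by a power of the augmentation ideal of `S(V)`. -/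
def LocallyNilpotent : Prop := ∀ m : M, ∃ r, m ∈ nilpotentPart n κ h M r

variable (n) in
/-- The action of the Euler element. -/
abbrev eulerEnd : Module.End R M := Algebra.lsmul R R M (euler (d := d) (n := n) κ h)

variable {κ h M}

theorem mem_nilpotentPart_zero {m : M} : m ∈ nilpotentPart n κ h M 0 ↔ m = 0 := Submodule.mem_bot R

theorem mem_nilpotentPart_succ {r : ℕ} {m : M} : m ∈ nilpotentPart n κ h M (r + 1) ↔
    ∀ y : V n, (tautological κ h).Y y • m ∈ nilpotentPart n κ h M r :=
  Submodule.mem_iInf _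

theorem mem_nilpotentPart_one {m : M} : m ∈ nilpotentPart n κ h M 1 ↔
    ∀ y : V n, (tautological κ h).Y y • m = 0 := by
  rw [mem_nilpotentPart_succ]
  exact Iff.rfl

/-- Nilpotency in terms of words in the basis vectors, as in the definition of category `O`. -/
theorem mem_nilpotentPart_iff {r : ℕ} {m : M} : m ∈ nilpotentPart n κ h M r ↔
    ∀ y : Fin r → V n, (List.ofFn fun j => gen κ h (Gen.vec (y j))).prod • m = 0 := by
  induction r generalizing m with
  | zero => simp [mem_nilpotentPart_zero]
  | succ r ih =>
    rw [mem_nilpotentPart_succ]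
    constructor
    · intro hm y
      rw [List.ofFn_succ', List.concat_eq_append, List.prod_append, List.prod_singleton, mul_smul]
      exact ih.1 (hm (y (Fin.last r))) _
    · intro hm y
      refine ih.2 fun z => ?_
      have := hm (Fin.snoc z y)
      rw [List.ofFn_succ', List.concat_eq_append, List.prod_append, List.prod_singleton,
        mul_smul] at this
      simp only [Fin.snoc_castSucc, Fin.snoc_last] at this
      exact this

theorem nilpotentPart_le_succ (r : ℕ) :
    nilpotentPart n κ h M r ≤ nilpotentPart n κ h M (r + 1) := by
  induction r with
  | zero => exact bot_le
  | succ r ih =>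
    intro m hm
    rw [mem_nilpotentPart_succ] at hm ⊢
    exact fun y => ih (hm y)

theorem nilpotentPart_mono : Monotone (nilpotentPart n κ h M) :=
  monotone_nat_of_le_succ nilpotentPart_le_succ

theorem vec_smul_mem_nilpotentPart {r : ℕ} {m : M} (hm : m ∈ nilpotentPart n κ h M r) (y : V n) :
    (tautological κ h).Y y • m ∈ nilpotentPart n κ h M r :=
  mem_nilpotentPart_succ.1 (nilpotentPart_le_succ r hm) y

theorem grp_smul_mem_nilpotentPart {r : ℕ} {m : M} (hm : m ∈ nilpotentPart n κ h M r) (g : W d n) :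
    (tautological κ h).G g • m ∈ nilpotentPart n κ h M r := by
  induction r generalizing m with
  | zero => rw [mem_nilpotentPart_zero] at hm ⊢; rw [hm, smul_zero]
  | succ r ih =>
    rw [mem_nilpotentPart_succ] at hm ⊢
    intro y
    have h1 : (tautological κ h).Y y * (tautological κ h).G g =
        (tautological κ h).G g *
          (tautological κ h).Y (((g⁻¹ : W d n) : V n ≃ₗ[ℂ] V n) y) := by
      rw [(tautological κ h).grp_vec]
      congr 2
      exact (((g : W d n) : V n ≃ₗ[ℂ] V n).apply_symm_apply y).symm
    rw [← mul_smul, h1, mul_smul]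
    exact ih (hm _)

theorem grpLift_smul_mem {P : Submodule R M} {m : M}
    (hP : ∀ g : W d n, (tautological κ h).G g • m ∈ P) (x : MonoidAlgebra R (W d n)) :
    grpLift (tautological κ h).G x • m ∈ P := by
  rw [MonoidAlgebra.lift_apply, Finsupp.sum, Finset.sum_smul]
  refine P.sum_mem fun g _ => ?_
  rw [smul_assoc]
  exact P.smul_mem _ (hP g)

theorem complex_smul_smul (c : ℂ) (x : Alg d n κ h) (m : M) :
    (c • x) • m = algebraMap ℂ R c • x • m := by
  rw [← algebraMap_smul R c x, smul_assoc]

theorem vec_smul_cov_smul (y : V n) (ξ : Module.Dual ℂ (V n)) (m : M) :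
    (tautological (d := d) κ h).Y y • (tautological (d := d) κ h).X ξ • m =
      (tautological (d := d) κ h).X ξ • (tautological (d := d) κ h).Y y • m +
      (algebraMap ℂ R (ξ y) • m + ∑ H : Hyp d n, algebraMap ℂ R (pairing H ξ y) •
        grpLift (tautological κ h).G (gammaElt κ h H) • m) := by
  rw [← mul_smul, sub_eq_iff_eq_add'.1 ((tautological (d := d) κ h).vec_cov y ξ)]
  simp only [add_smul, mul_smul, Finset.sum_smul, complex_smul_smul,
    Algebra.algebraMap_eq_smul_one (A := Alg d n κ h), one_smul]

theorem cov_smul_mem_nilpotentPart {r : ℕ} {m : M} (hm : m ∈ nilpotentPart n κ h M r)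
    (ξ : Module.Dual ℂ (V n)) :
    (tautological (d := d) κ h).X ξ • m ∈ nilpotentPart n κ h M (r + 1) := by
  induction r generalizing m with
  | zero =>
    rw [mem_nilpotentPart_zero] at hm
    rw [hm, smul_zero]
    exact Submodule.zero_mem _
  | succ r ih =>
    have hm' := hm
    rw [mem_nilpotentPart_succ] at hm ⊢
    intro y
    rw [vec_smul_cov_smul]
    refine add_mem (ih (hm y)) (add_mem (Submodule.smul_mem _ _ hm') (sum_mem fun H _ => ?_))
    exact Submodule.smul_mem _ _ (grpLift_smul_mem (grp_smul_mem_nilpotentPart hm') _)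

/-- The elements killed by a power of the augmentation ideal of `S(V)` form a submodule, so local
nilpotence can be tested on generators. -/
theorem LocallyNilpotent.of_span {S : Set M} (hS : Submodule.span (Alg d n κ h) S = ⊤)
    (h' : ∀ m ∈ S, ∃ r, m ∈ nilpotentPart n κ h M r) : LocallyNilpotent n κ h M := by
  have hdir : Directed (· ≤ ·) (nilpotentPart n κ h M) := nilpotentPart_mono.directed_le
  let N : Submodule (Alg d n κ h) M := submoduleOfStable κ h (⨆ r, nilpotentPart n κ h M r)
    (fun ξ m hm => by
      obtain ⟨r, hr⟩ := (Submodule.mem_iSup_of_directed _ hdir).1 hm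
      exact (Submodule.mem_iSup_of_directed _ hdir).2 ⟨r + 1, cov_smul_mem_nilpotentPart hr ξ⟩)
    (fun y m hm => by
      obtain ⟨r, hr⟩ := (Submodule.mem_iSup_of_directed _ hdir).1 hm
      exact (Submodule.mem_iSup_of_directed _ hdir).2 ⟨r, vec_smul_mem_nilpotentPart hr y⟩)
    (fun g m hm => by
      obtain ⟨r, hr⟩ := (Submodule.mem_iSup_of_directed _ hdir).1 hm
      exact (Submodule.mem_iSup_of_directed _ hdir).2 ⟨r, grp_smul_mem_nilpotentPart hr g⟩)
  have h1 : Submodule.span (Alg d n κ h) S ≤ N :=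
    Submodule.span_le.2 fun m hm => (Submodule.mem_iSup_of_directed _ hdir).2 (h' m hm)
  intro m
  refine (Submodule.mem_iSup_of_directed _ hdir).1 (h1 ?_)
  rw [hS]
  trivial

section Maps

variable {M' : Type w} [AddCommGroup M'] [Module (Alg d n κ h) M'] [Module R M']
  [IsScalarTower R (Alg d n κ h) M']

theorem map_mem_nilpotentPart (f : M →ₗ[Alg d n κ h] M') {r : ℕ} {m : M}
    (hm : m ∈ nilpotentPart n κ h M r) : f m ∈ nilpotentPart n κ h M' r := by
  induction r generalizing m with
  | zero => rw [mem_nilpotentPart_zero] at hm ⊢; rw [hm, map_zero]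
  | succ r ih =>
    rw [mem_nilpotentPart_succ] at hm ⊢
    intro y
    rw [← map_smul]
    exact ih (hm y)

theorem mem_nilpotentPart_of_injective (f : M →ₗ[Alg d n κ h] M') (hf : Function.Injective f)
    {r : ℕ} {m : M} (hm : f m ∈ nilpotentPart n κ h M' r) : m ∈ nilpotentPart n κ h M r := by
  induction r generalizing m with
  | zero =>
    rw [mem_nilpotentPart_zero] at hm ⊢
    exact hf (hm.trans (map_zero f).symm)
  | succ r ih =>
    rw [mem_nilpotentPart_succ] at hm ⊢
    intro y
    refine ih ?_
    rw [map_smul]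
    exact hm y

theorem LocallyNilpotent.of_injective (hM : LocallyNilpotent n κ h M')
    (f : M →ₗ[Alg d n κ h] M') (hf : Function.Injective f) : LocallyNilpotent n κ h M := fun m =>
  let ⟨r, hr⟩ := hM (f m)
  ⟨r, mem_nilpotentPart_of_injective f hf hr⟩

theorem LocallyNilpotent.of_surjective (hM : LocallyNilpotent n κ h M)
    (f : M →ₗ[Alg d n κ h] M') (hf : Function.Surjective f) : LocallyNilpotent n κ h M' := fun m' =>
  let ⟨m, hm⟩ := hf m'
  let ⟨r, hr⟩ := hM m
  ⟨r, hm ▸ map_mem_nilpotentPart f hr⟩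

end Maps

/-! ### Weights of the Euler element -/

theorem eulerEnd_apply (m : M) : eulerEnd n κ h M m = euler (d := d) (n := n) κ h • m := rfl

section Weights

variable [NeZero d]

theorem eulerEnd_cov (ξ : Module.Dual ℂ (V n)) (m : M) :
    eulerEnd n κ h M (Algebra.lsmul R R M ((tautological (d := d) κ h).X ξ) m) =
      Algebra.lsmul R R M ((tautological (d := d) κ h).X ξ) (eulerEnd n κ h M m) +
        (1 : R) • Algebra.lsmul R R M ((tautological (d := d) κ h).X ξ) m := by
  change euler (d := d) (n := n) κ h • (tautological (d := d) (n := n) κ h).X ξ • m =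
    (tautological (d := d) (n := n) κ h).X ξ • euler (d := d) (n := n) κ h • m +
      (1 : R) • (tautological (d := d) (n := n) κ h).X ξ • m
  rw [one_smul, ← mul_smul, ← mul_smul, ← add_smul, euler_mul_cov]

theorem eulerEnd_vec (y : V n) (m : M) :
    eulerEnd n κ h M (Algebra.lsmul R R M ((tautological (d := d) κ h).Y y) m) =
      Algebra.lsmul R R M ((tautological (d := d) κ h).Y y) (eulerEnd n κ h M m) +
        (-1 : R) • Algebra.lsmul R R M ((tautological (d := d) κ h).Y y) m := by
  change euler (d := d) (n := n) κ h • (tautological (d := d) (n := n) κ h).Y y • m =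
    (tautological (d := d) (n := n) κ h).Y y • euler (d := d) (n := n) κ h • m +
      (-1 : R) • (tautological (d := d) (n := n) κ h).Y y • m
  rw [neg_smul, one_smul, ← mul_smul, ← mul_smul, ← sub_eq_add_neg, ← sub_smul, euler_mul_vec]

theorem eulerEnd_grp (g : W d n) (m : M) :
    eulerEnd n κ h M (Algebra.lsmul R R M ((tautological (d := d) κ h).G g) m) =
      Algebra.lsmul R R M ((tautological (d := d) κ h).G g) (eulerEnd n κ h M m) := by
  change euler (d := d) (n := n) κ h • (tautological (d := d) (n := n) κ h).G g • m =
    (tautological (d := d) (n := n) κ h).G g • euler (d := d) (n := n) κ h • m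
  rw [← mul_smul, ← mul_smul, euler_mul_grp]

variable [IsLocalRing R]

theorem cov_smul_mem_weightSpace {a : ResidueField R} {m : M}
    (hm : m ∈ weightSpace (eulerEnd n κ h M) a) (ξ : Module.Dual ℂ (V n)) :
    (tautological (d := d) κ h).X ξ • m ∈ weightSpace (eulerEnd n κ h M) (a + 1) := by
  rw [← map_one (residue R)]
  exact map_mem_weightSpace_add (f := Algebra.lsmul R R M ((tautological (d := d) κ h).X ξ))
    (eulerEnd_cov ξ) hm

theorem vec_smul_mem_weightSpace {a : ResidueField R} {m : M}
    (hm : m ∈ weightSpace (eulerEnd n κ h M) a) (y : V n) :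
    (tautological (d := d) κ h).Y y • m ∈ weightSpace (eulerEnd n κ h M) (a - 1) := by
  rw [sub_eq_add_neg, ← map_one (residue R), ← map_neg]
  exact map_mem_weightSpace_add (f := Algebra.lsmul R R M ((tautological (d := d) κ h).Y y))
    (eulerEnd_vec y) hm

theorem grp_smul_mem_weightSpace {a : ResidueField R} {m : M}
    (hm : m ∈ weightSpace (eulerEnd n κ h M) a) (g : W d n) :
    (tautological (d := d) κ h).G g • m ∈ weightSpace (eulerEnd n κ h M) a :=
  map_mem_weightSpace (f := Algebra.lsmul R R M ((tautological (d := d) κ h).G g))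
    (eulerEnd_grp g) hm

end Weights

theorem map_mem_eulerWeightSpace [IsLocalRing R] {M' : Type w} [AddCommGroup M']
    [Module (Alg d n κ h) M'] [Module R M'] [IsScalarTower R (Alg d n κ h) M']
    (f : M →ₗ[Alg d n κ h] M') {a : ResidueField R} {m : M}
    (hm : m ∈ weightSpace (eulerEnd n κ h M) a) : f m ∈ weightSpace (eulerEnd n κ h M') a :=
  map_mem_weightSpace (f := f.restrictScalars R)
    (fun m => (f.map_smul (euler (d := d) (n := n) κ h) m).symm) hm

end Action

/-! ### The scalars `c_E` -/

section Scalars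

variable {d n : ℕ} [NeZero d] {R : Type u} [CommRing R] [Algebra ℂ R]
  (κ : {k : ZMod d // k ≠ 0} → R) (h : R)

/-- The action of `W` on `R ⊗ E`. -/
def baseChangeHom (R : Type u) [CommRing R] [Algebra ℂ R] (E : Rep.{0} ℂ (W d n)) :
    W d n →* Module.End R (R ⊗[ℂ] E.V) :=
  (Module.End.baseChangeHom ℂ R E.V : Module.End ℂ E.V →* _).comp E.ρ

omit [NeZero d] in
theorem baseChangeHom_apply (E : Rep.{0} ℂ (W d n)) (g : W d n) :
    baseChangeHom R E g = (E.ρ g).baseChange R := rfl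

omit [NeZero d] in
theorem groupAlgAct_eq (E : Rep.{0} ℂ (W d n)) (x : MonoidAlgebra R (W d n)) :
    groupAlgAct E x = grpLift (B := Module.End R (R ⊗[ℂ] E.V)) (baseChangeHom R E) x := by
  rw [MonoidAlgebra.lift_apply]
  rfl

/-- The central element `z` acts on `E` by `c_E`. -/
theorem groupAlgAct_zElt (E : Irr (W d n)) (m : R ⊗[ℂ] E.rep.V) :
    groupAlgAct E.rep (zElt d n κ h) m = cScalar κ h E • m := by
  have hex : ∃ c : R, ∀ m : R ⊗[ℂ] E.rep.V, groupAlgAct E.rep (zElt d n κ h) m = c • m := by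
    let f : E.rep.V →ₗ[ℂ] R ⊗[ℂ] E.rep.V :=
      (groupAlgAct E.rep (zElt d n κ h)).restrictScalars ℂ ∘ₗ TensorProduct.mk ℂ R E.rep.V 1
    obtain ⟨r, hr⟩ := exists_scalar_of_equivariant_baseChange (f := f) (fun g e => by
      have h1 := LinearMap.congr_fun (grpLift_zElt_comm (B := Module.End R (R ⊗[ℂ] E.rep.V))
        (G := baseChangeHom R E.rep) κ h g) ((1 : R) ⊗ₜ e)
      rw [← groupAlgAct_eq] at h1
      refine Eq.trans ?_ h1.symm
      change _ = groupAlgAct E.rep (zElt d n κ h) ((E.rep.ρ g).baseChange R (1 ⊗ₜ e))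
      rw [LinearMap.baseChange_tmul]
      rfl)
    refine ⟨r, fun m => ?_⟩
    induction m with
    | zero => rw [map_zero, smul_zero]
    | add m m' hm hm' => rw [map_add, smul_add, hm, hm']
    | tmul s e =>
      have h1 : (s ⊗ₜ[ℂ] e : R ⊗[ℂ] E.rep.V) = s • ((1 : R) ⊗ₜ[ℂ] e) := by
        rw [TensorProduct.smul_tmul', smul_eq_mul, mul_one]
      have h2 : groupAlgAct E.rep (zElt d n κ h) ((1 : R) ⊗ₜ[ℂ] e) = r ⊗ₜ e := hr e
      rw [h1, map_smul, h2, TensorProduct.smul_tmul', TensorProduct.smul_tmul', TensorProduct.smul_tmul',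
        smul_eq_mul, smul_eq_mul, smul_eq_mul, mul_one, mul_comm]
  exact Classical.epsilon_spec hex m

variable {κ h} {M : Type v} [AddCommGroup M] [Module (Alg d n κ h) M] [Module R M]
  [IsScalarTower R (Alg d n κ h) M] [Module ℂ M] [IsScalarTower ℂ R M]
  [IsScalarTower ℂ (Alg d n κ h) M]

/-- The Euler element acts on singular vectors in an `E`-isotypic component by `-c_E`. -/
theorem euler_smul_of_singular {E : Irr (W d n)} {f : E.rep.V →ₗ[ℂ] M}
    (hf : IsEquivariant (moduleRep n κ h M) E.rep f) {e : E.rep.V}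
    (hY : ∀ y : V n, (tautological κ h).Y y • f e = 0) :
    euler (d := d) (n := n) κ h • f e = -cScalar κ h E • f e := by
  have h1 : ∀ (x : MonoidAlgebra R (W d n)) m, f.liftBaseChange R (groupAlgAct E.rep x m) =
      grpLift (tautological κ h).G x • f.liftBaseChange R m := by
    intro x m
    rw [groupAlgAct_eq, MonoidAlgebra.lift_apply, MonoidAlgebra.lift_apply, Finsupp.sum,
      Finsupp.sum, Finset.sum_smul, LinearMap.sum_apply, map_sum]
    refine Finset.sum_congr rfl fun g _ => ?_
    rw [LinearMap.smul_apply, map_smul, smul_assoc]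
    congr 1
    induction m with
    | zero => rw [map_zero, map_zero, smul_zero]
    | add m m' hm hm' => rw [map_add, map_add, map_add, smul_add, hm, hm']
    | tmul s e =>
      rw [baseChangeHom_apply, LinearMap.baseChange_tmul, LinearMap.liftBaseChange_tmul,
        LinearMap.liftBaseChange_tmul, hf, smul_comm]
      rfl
  have h2 := h1 (zElt d n κ h) ((1 : R) ⊗ₜ e)
  rw [groupAlgAct_zElt, map_smul, LinearMap.liftBaseChange_tmul, one_smul] at h2
  rw [euler, sub_smul, ← h2, Finset.sum_smul, Finset.sum_eq_zero, zero_sub, neg_smul]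
  intro i _
  rw [mul_smul, hY, smul_zero]

end Scalars

/-! ### Weights of locally nilpotent modules -/

section LocallySplit

variable {d n : ℕ} [NeZero d] {R : Type u} [CommRing R] [Algebra ℂ R] [IsLocalRing R]
  (κ : {k : ZMod d // k ≠ 0} → R) (h : R)

/-- The weight of the lowest weight space of `Δ(E)`. -/
def lowestWeight (E : Irr (W d n)) : ResidueField R := residue R (-cScalar κ h E)

/-- The possible weights of the Euler element on locally nilpotent modules. -/
def possibleWeights (d n : ℕ) [NeZero d] {R : Type u} [CommRing R] [Algebra ℂ R] [IsLocalRing R]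
    (κ : {k : ZMod d // k ≠ 0} → R) (h : R) : Set (ResidueField R) :=
  {a | ∃ (E : Irr (W d n)) (j : ℕ), a = lowestWeight κ h E + j}

variable (M : Type v) [AddCommGroup M] [Module (Alg d n κ h) M] [Module R M]
  [IsScalarTower R (Alg d n κ h) M] [Module ℂ M] [IsScalarTower ℂ R M]
  [IsScalarTower ℂ (Alg d n κ h) M]

variable (n) in
/-- The vectors killed by `V`. -/
abbrev singularPart : Submodule ℂ M := (nilpotentPart n κ h M 1).restrictScalars ℂ

variable (n) in
/-- The action of `W` on the vectors killed by `V`. -/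
def singularRep : Representation ℂ (W d n) (singularPart n κ h M) where
  toFun g := (moduleRep n κ h M g).restrict fun _ hm => grp_smul_mem_nilpotentPart hm g
  map_one' := by
    ext m
    exact congrArg (fun φ => φ m.1) (map_one (moduleRep n κ h M))
  map_mul' g g' := by
    ext m
    exact congrArg (fun φ => φ m.1) (map_mul (moduleRep n κ h M) g g')

/-- On vectors killed by `S(V)_{≥ r}` the Euler element is annihilated by a product of factors `X -
a` with all residues of the `a` in the possible weights. For `r = 1` these vectors are a sum of
copies of irreducible representations of `W`, and `V` lowers `r` as well as the weight by one. -/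
theorem exists_splitPoly_nilpotentPart (r : ℕ) : ∃ s : Multiset R,
    (∀ a ∈ s, residue R a ∈ possibleWeights d n κ h) ∧
    ∀ m ∈ nilpotentPart n κ h M r, Polynomial.aeval (eulerEnd n κ h M) (splitPoly s) m = 0 := by
  induction r with
  | zero =>
    refine ⟨0, by simp, fun m hm => ?_⟩
    rw [mem_nilpotentPart_zero.1 hm, map_zero]
  | succ r ih =>
    obtain ⟨s, hs, hm⟩ := ih
    have := finite_irr (G := W d n)
    have := Fintype.ofFinite (Irr (W d n))
    let s₀ : Multiset R := Finset.univ.val.map fun E : Irr (W d n) => -cScalar κ h E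
    have h0 : ∀ m ∈ nilpotentPart n κ h M 1,
        Polynomial.aeval (eulerEnd n κ h M) (splitPoly s₀) m = 0 := by
      let N := singularPart n κ h M
      have h1 := eq_top_of_forall_equivariant (singularRep n κ h M)
        ((LinearMap.ker ((Polynomial.aeval (eulerEnd n κ h M) (splitPoly s₀)).restrictScalars ℂ)).comap
          N.subtype) (fun E f hf e => by
          have h2 : euler (d := d) (n := n) κ h • (f e : M) = -cScalar κ h E • (f e : M) :=
            euler_smul_of_singular (f := N.subtype ∘ₗ f)
              (fun g e => congrArg Subtype.val (hf g e)) (mem_nilpotentPart_one.1 (f e).2)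
          have h3 : -cScalar κ h E ∈ s₀ := Multiset.mem_map.2 ⟨E, Finset.mem_univ _, rfl⟩
          obtain ⟨s', hs'⟩ := Multiset.exists_cons_of_mem h3
          change Polynomial.aeval (eulerEnd n κ h M) (splitPoly s₀) (f e : M) = 0
          rw [hs', splitPoly_cons, mul_comm, map_mul, Module.End.mul_apply]
          have h4 : Polynomial.aeval (eulerEnd n κ h M)
              (Polynomial.X - Polynomial.C (-cScalar κ h E)) (f e : M) = 0 := by
            rw [map_sub, Polynomial.aeval_X, Polynomial.aeval_C, LinearMap.sub_apply,
              Module.algebraMap_end_apply, eulerEnd_apply, h2, sub_self]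
          rw [h4, map_zero])
      intro m hm
      have : (⟨m, hm⟩ : N) ∈ (⊤ : Submodule ℂ N) := trivial
      rw [← h1] at this
      exact this
    refine ⟨s₀ + s.map (· + 1), ?_, fun m hm' => ?_⟩
    · intro a ha
      rcases Multiset.mem_add.1 ha with ha | ha
      · obtain ⟨E, -, rfl⟩ := Multiset.mem_map.1 ha
        exact ⟨E, 0, by simp [lowestWeight]⟩
      · obtain ⟨b, hb, rfl⟩ := Multiset.mem_map.1 ha
        obtain ⟨E, j, hE⟩ := hs b hb
        exact ⟨E, j + 1, by rw [map_add, hE, map_one]; push_cast; ring⟩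
    · rw [splitPoly_add, map_mul, Module.End.mul_apply]
      refine h0 _ (mem_nilpotentPart_one.2 fun y => ?_)
      have h5 := aeval_splitPoly_shift (T := eulerEnd n κ h M) (T' := eulerEnd n κ h M)
        (f := Algebra.lsmul R R M ((tautological (d := d) κ h).Y y)) (c := (-1 : R))
        (eulerEnd_vec y) (s.map (· + 1)) m
      rw [Multiset.map_map] at h5
      simp only [Function.comp_def, add_neg_cancel_right, Multiset.map_id'] at h5
      exact h5.symm.trans (hm _ (mem_nilpotentPart_succ.1 hm' y))

variable {κ h M}

theorem LocallyNilpotent.locallySplit (hM : LocallyNilpotent n κ h M) :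
    LocallySplit (eulerEnd n κ h M) := fun m =>
  let ⟨r, hr⟩ := hM m
  let ⟨s, _, hs⟩ := exists_splitPoly_nilpotentPart (n := n) κ h M r
  ⟨s, hs m hr⟩

/-- The weights of a locally nilpotent module are among the possible weights. -/
theorem LocallyNilpotent.eq_zero_of_mem_weightSpace (hM : LocallyNilpotent n κ h M)
    {a : ResidueField R} (ha : a ∉ possibleWeights d n κ h) {m : M}
    (hm : m ∈ weightSpace (eulerEnd n κ h M) a) : m = 0 := by
  obtain ⟨r, hr⟩ := hM m
  obtain ⟨s, hs, hs'⟩ := exists_splitPoly_nilpotentPart (n := n) κ h M r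
  exact WeightSpace.eq_zero_of_mem_weightSpace hm
    (fun b hb hba => ha (hba ▸ hs b hb)) (hs' m hr)

end LocallySplit

end Cherednik

set_option linter.unusedSectionVars false

namespace WeightSpace

open IsLocalRing

variable {R : Type*} [CommRing R] [IsLocalRing R] {M : Type*} [AddCommGroup M] [Module R M]

/-- If `M` is spanned by weight vectors, each weight space is spanned by those of that weight. -/
theorem mem_span_of_mem_weightSpace {T : Module.End R M} (hT : LocallySplit T) {ι : Type*}
    {u : ι → M} {a : ι → ResidueField R} (hu : ∀ i, u i ∈ weightSpace T (a i))
    {b : ResidueField R} {m : M} (hm : m ∈ weightSpace T b)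
    (hs : m ∈ Submodule.span R (Set.range u)) :
    m ∈ Submodule.span R (u '' {i | a i = b}) := by
  rw [← weightProj_of_mem hT hm]
  have h1 := Submodule.mem_map_of_mem (f := weightProj hT b) hs
  rw [Submodule.map_span] at h1
  refine Submodule.span_le.2 ?_ h1
  rintro _ ⟨_, ⟨i, rfl⟩, rfl⟩
  by_cases hi : a i = b
  · rw [weightProj_of_mem hT (hi ▸ hu i)]
    exact Submodule.subset_span ⟨i, hi, rfl⟩
  · rw [weightProj_of_mem_ne hT hi (hu i)]
    exact Submodule.zero_mem _

theorem eq_of_mem_weightSpace {T : Module.End R M} {a b : ResidueField R} {m : M} (h0 : m ≠ 0)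
    (ha : m ∈ weightSpace T a) (hb : m ∈ weightSpace T b) : a = b := by
  by_contra hab
  obtain ⟨s, hs, hm⟩ := hb
  exact h0 (eq_zero_of_mem_weightSpace ha (fun r hr h => hab (h.symm.trans (hs r hr))) hm)

/-- Weight spaces are direct summands. -/
theorem projective_weightSpace {T : Module.End R M} (hT : LocallySplit T) [Module.Projective R M]
    (a : ResidueField R) : Module.Projective R (weightSpace T a) :=
  Module.Projective.of_split (weightSpace T a).subtype
    ((weightProj hT a).codRestrict (weightSpace T a) (weightProj_mem hT a))
    (LinearMap.ext fun m => Subtype.ext (weightProj_of_mem hT m.2))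

theorem finite_weightSpace {T : Module.End R M} (hT : LocallySplit T) [Module.Finite R M]
    (a : ResidueField R) : Module.Finite R (weightSpace T a) :=
  Module.Finite.of_surjective
    ((weightProj hT a).codRestrict (weightSpace T a) (weightProj_mem hT a))
    fun m => ⟨m, Subtype.ext (weightProj_of_mem hT m.2)⟩

theorem exists_finset_weightVectors {T : Module.End R M} (hT : LocallySplit T) (m : M) :
    ∃ s : Finset M, (∀ x ∈ s, ∃ a, x ∈ weightSpace T a) ∧ m ∈ Submodule.span R (s : Set M) := by
  classical
  have hm : m ∈ ⨆ a, weightSpace T a := by rw [iSup_weightSpace hT]; trivial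
  induction hm using Submodule.iSup_induction' with
  | mem a m hm => exact ⟨{m}, by simpa using ⟨a, hm⟩, Submodule.subset_span (by simp)⟩
  | zero => exact ⟨∅, by simp, Submodule.zero_mem _⟩
  | add m m' _ _ h h' =>
    obtain ⟨s, hs, hm⟩ := h
    obtain ⟨s', hs', hm'⟩ := h'
    refine ⟨s ∪ s', fun x hx => (Finset.mem_union.1 hx).elim (hs x) (hs' x), ?_⟩
    rw [Finset.coe_union]
    exact add_mem (Submodule.span_mono Set.subset_union_left hm)
      (Submodule.span_mono Set.subset_union_right hm')

theorem mem_weightSpace_of_injective {M' : Type*} [AddCommGroup M'] [Module R M']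
    {T : Module.End R M} {T' : Module.End R M'} {f : M →ₗ[R] M'}
    (hf : ∀ m, T' (f m) = f (T m)) (hinj : Function.Injective f) {a : ResidueField R} {m : M}
    (hm : f m ∈ weightSpace T' a) : m ∈ weightSpace T a := by
  obtain ⟨s, hs, hm⟩ := hm
  have h1 := aeval_splitPoly_shift (T := T) (T' := T') (f := f) (c := 0) (by simpa using hf) s m
  simp only [add_zero, Multiset.map_id'] at h1
  exact ⟨s, hs, hinj (by rw [← h1, hm, map_zero])⟩

end WeightSpace

namespace Cherednik

open IrrepClass FiniteGroupRep WeightSpace IsLocalRing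

theorem charZero_residueField (R : Type*) [CommRing R] [Algebra ℂ R] [IsLocalRing R] :
    CharZero (ResidueField R) :=
  charZero_of_injective_ringHom ((residue R).comp (algebraMap ℂ R)).injective

/-! ### Modules finitely generated over the polynomial ring -/

section Finiteness

variable {d n : ℕ} {R : Type u} [CommRing R] [Algebra ℂ R]
  {κ : {k : ZMod d // k ≠ 0} → R} {h : R}
  {M : Type v} [AddCommGroup M] [Module (Alg d n κ h) M] [Module R M]
  [IsScalarTower R (Alg d n κ h) M]

/-- A vector killed by a power of the augmentation ideal of `S(V)` lies in a finitely generated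
`R`-submodule stable under `V` and `W`. -/
theorem exists_fg_stable [Finite (W d n)] {r : ℕ} {m : M} (hm : m ∈ nilpotentPart n κ h M r) :
    ∃ U : Submodule R M, U.FG ∧ m ∈ U ∧
      (∀ y, ∀ x ∈ U, (tautological (d := d) (n := n) κ h).Y y • x ∈ U) ∧
      ∀ g, ∀ x ∈ U, (tautological (d := d) (n := n) κ h).G g • x ∈ U := by
  set T := tautological (d := d) (n := n) κ h with hT
  induction r generalizing m with
  | zero =>
    rw [mem_nilpotentPart_zero] at hm
    refine ⟨⊥, Submodule.fg_bot, hm, fun y x hx => ?_, fun g x hx => ?_⟩ <;>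
    · rw [Submodule.mem_bot] at hx ⊢
      rw [hx, smul_zero]
  | succ r ih =>
    choose U hfg hmem hY hG using fun i : Fin n => ih (mem_nilpotentPart_succ.1 hm (Pi.single i 1))
    have hYU : ∀ y, T.Y y • m ∈ ⨆ i, U i := by
      intro y
      rw [vec_eq_sum y, map_sum, Finset.sum_smul]
      refine Submodule.sum_mem _ fun i _ => ?_
      rw [map_smul, complex_smul_smul]
      exact Submodule.smul_mem _ _ (Submodule.mem_iSup_of_mem i (hmem i))
    have hst : ∀ a : Alg d n κ h, (∀ i, ∀ x ∈ U i, a • x ∈ U i) →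
        ∀ x ∈ ⨆ i, U i, a • x ∈ ⨆ i, U i := fun a ha => by
      have h1 : (⨆ i, U i) ≤ (⨆ i, U i).comap (Algebra.lsmul R R M a) :=
        iSup_le fun i x hx => Submodule.mem_iSup_of_mem i (ha i x hx)
      exact fun x hx => h1 hx
    let S : Submodule R M := Submodule.span R (Set.range fun g => T.G g • m)
    have hS : ∀ {P : Submodule R M} (a : Alg d n κ h), (∀ g, a • T.G g • m ∈ P) →
        ∀ x ∈ S, a • x ∈ P := fun {P} a ha => by
      have h1 : S ≤ P.comap (Algebra.lsmul R R M a) := by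
        refine Submodule.span_le.2 ?_
        rintro _ ⟨g, rfl⟩
        exact ha g
      exact fun x hx => h1 hx
    refine ⟨(⨆ i, U i) ⊔ S, (Submodule.fg_iSup _ hfg).sup (Submodule.fg_span (Set.finite_range _)),
      ?_, fun y x hx => ?_, fun g x hx => ?_⟩
    · refine Submodule.mem_sup_right (Submodule.subset_span ⟨1, ?_⟩)
      change T.G 1 • m = m
      rw [map_one, one_smul]
    · obtain ⟨x₁, hx₁, x₂, hx₂, rfl⟩ := Submodule.mem_sup.1 hx
      rw [smul_add]
      refine add_mem (Submodule.mem_sup_left (hst _ (fun i => hY i y) _ hx₁))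
        (Submodule.mem_sup_left (hS _ (fun g => ?_) _ hx₂))
      have h1 : T.Y y * T.G g = T.G g * T.Y (((g⁻¹ : W d n) : V n ≃ₗ[ℂ] V n) y) := by
        rw [T.grp_vec]
        congr 2
        exact (((g : W d n) : V n ≃ₗ[ℂ] V n).apply_symm_apply y).symm
      rw [← mul_smul, h1, mul_smul]
      exact hst _ (fun i => hG i g) _ (hYU _)
    · obtain ⟨x₁, hx₁, x₂, hx₂, rfl⟩ := Submodule.mem_sup.1 hx
      rw [smul_add]
      refine add_mem (Submodule.mem_sup_left (hst _ (fun i => hG i g) _ hx₁))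
        (Submodule.mem_sup_right (hS _ (fun g' => ?_) _ hx₂))
      refine Submodule.subset_span ⟨g * g', ?_⟩
      change T.G (g * g') • m = _
      rw [map_mul, mul_smul]

variable [Module (MvPolynomial (Fin n) R) M]
  [IsScalarTower (MvPolynomial (Fin n) R) (Alg d n κ h) M]
  [IsScalarTower R (MvPolynomial (Fin n) R) M]

/-- Finitely generated locally nilpotent modules are finitely generated over `R[V]`: the generators
lie in a finitely generated `R`-submodule stable under `V` and `W`, and by the commutation relations
`R[V]` times it is stable under the whole algebra. -/
theorem finite_poly_of_locallyNilpotent [NeZero d] (hM : LocallyNilpotent n κ h M)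
    (hfin : Module.Finite (Alg d n κ h) M) : Module.Finite (MvPolynomial (Fin n) R) M := by
  have := finite_W (d := d) (n := n)
  obtain ⟨S, hS⟩ := hfin.fg_top
  choose U hfg hmem hY hG using fun m : S => exists_fg_stable (hM m.1).choose_spec
  obtain ⟨t, ht⟩ := Submodule.fg_iSup _ hfg
  have hst : ∀ a : Alg d n κ h, (∀ i, ∀ x ∈ U i, a • x ∈ U i) →
      ∀ x ∈ ⨆ i, U i, a • x ∈ ⨆ i, U i := fun a ha => by
    have h1 : (⨆ i, U i) ≤ (⨆ i, U i).comap (Algebra.lsmul R R M a) :=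
      iSup_le fun i x hx => Submodule.mem_iSup_of_mem i (ha i x hx)
    exact fun x hx => h1 hx
  have h1 : Submodule.span (MvPolynomial (Fin n) R) ((⨆ i, U i : Submodule R M) : Set M) = ⊤ := by
    refine span_poly_eq_top (κ := κ) (h := h)
      (fun y m hm => Submodule.subset_span (hst _ (fun i => hY i y) m hm))
      (fun g m hm => Submodule.subset_span (hst _ (fun i => hG i g) m hm)) (fun m hm => ?_) hS
    exact Submodule.subset_span (Submodule.mem_iSup_of_mem ⟨m, hm⟩ (hmem ⟨m, hm⟩))
  refine ⟨⟨t, ?_⟩⟩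
  rw [← top_le_iff, ← h1]
  refine Submodule.span_le.2 fun m hm => ?_
  rw [← ht] at hm
  have h2 : Submodule.span R (t : Set M) ≤
      (Submodule.span (MvPolynomial (Fin n) R) (t : Set M)).restrictScalars R :=
    Submodule.span_le.2 Submodule.subset_span
  exact h2 hm

theorem isNoetherian_of_locallyNilpotent [NeZero d] [IsNoetherianRing R]
    (hM : LocallyNilpotent n κ h M) (hfin : Module.Finite (Alg d n κ h) M) :
    IsNoetherian (Alg d n κ h) M := by
  have := finite_poly_of_locallyNilpotent hM hfin
  have : IsNoetherian (MvPolynomial (Fin n) R) M := isNoetherian_of_isNoetherianRing_of_finite _ _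
  exact isNoetherian_of_tower (MvPolynomial (Fin n) R) this

/-! ### Weight spaces of modules generated by weight vectors -/

theorem span_poly_eq_span_monomial {S : Set M} {m : M}
    (hm : m ∈ Submodule.span (MvPolynomial (Fin n) R) S) :
    m ∈ Submodule.span R (Set.range fun p : (Fin n →₀ ℕ) × S =>
      (MvPolynomial.monomial p.1 (1 : R) • p.2.1 : M)) := by
  induction hm using Submodule.closure_induction with
  | zero => exact Submodule.zero_mem _
  | add m m' _ _ hm hm' => exact Submodule.add_mem _ hm hm'
  | smul_mem p m hm =>
    rw [p.as_sum, Finset.sum_smul]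
    refine Submodule.sum_mem _ fun μ _ => ?_
    rw [← mul_one (MvPolynomial.coeff μ p), ← smul_eq_mul, ← MvPolynomial.smul_monomial, smul_assoc]
    exact Submodule.smul_mem _ _ (Submodule.subset_span ⟨(μ, ⟨m, hm⟩), rfl⟩)

variable [NeZero d] [IsLocalRing R]

theorem monomial_smul_mem_weightSpace {a : ResidueField R} {m : M}
    (hm : m ∈ weightSpace (eulerEnd n κ h M) a) (μ : Fin n →₀ ℕ) :
    (MvPolynomial.monomial μ (1 : R) • m : M) ∈
      weightSpace (eulerEnd n κ h M) (a + (μ.degree : ℕ)) := by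
  induction μ using Finsupp.induction_linear generalizing a m with
  | zero =>
    rw [map_zero, Nat.cast_zero, add_zero, MvPolynomial.monomial_zero', map_one, one_smul]
    exact hm
  | add μ ν hμ hν =>
    rw [← mul_one (1 : R), ← MvPolynomial.monomial_mul, mul_smul, map_add, add_comm (μ.degree),
      Nat.cast_add, ← add_assoc]
    exact hμ (hν hm)
  | single i k =>
    rw [← MvPolynomial.X_pow_eq_monomial, Finsupp.degree_single]
    induction k with
    | zero =>
      rw [pow_zero, one_smul, Nat.cast_zero, add_zero]
      exact hm
    | succ k ih =>
      rw [pow_succ', mul_smul, X_smul (d := d) (κ := κ) (h := h), Nat.cast_succ, ← add_assoc]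
      exact cov_smul_mem_weightSpace ih _

/-- If `M` is generated over `R[V]` by weight vectors, its weight spaces are spanned by the products
of a monomial and a generator that have the given weight. -/
theorem mem_span_monomial_of_mem_weightSpace (hT : LocallySplit (eulerEnd n κ h M)) {S : Set M}
    {a : S → ResidueField R} (hS : ∀ s, s.1 ∈ weightSpace (eulerEnd n κ h M) (a s))
    {b : ResidueField R} {m : M} (hm : m ∈ weightSpace (eulerEnd n κ h M) b)
    (hmS : m ∈ Submodule.span (MvPolynomial (Fin n) R) S) :
    m ∈ Submodule.span R ((fun p : (Fin n →₀ ℕ) × S =>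
      (MvPolynomial.monomial p.1 (1 : R) • p.2.1 : M)) '' {p | a p.2 + (p.1.degree : ℕ) = b}) :=
  mem_span_of_mem_weightSpace (a := fun p : (Fin n →₀ ℕ) × S => a p.2 + (p.1.degree : ℕ)) hT
    (fun p => monomial_smul_mem_weightSpace (hS p.2) p.1) hm (span_poly_eq_span_monomial hmS)

/-- In an `R[V]`-module generated in weight `a`, all weights are of the form `a + j`. -/
theorem exists_nat_add_of_mem_weightSpace (hT : LocallySplit (eulerEnd n κ h M)) {S : Set M}
    {a b : ResidueField R} (hS : ∀ s ∈ S, s ∈ weightSpace (eulerEnd n κ h M) a)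
    {m : M} (hm : m ∈ weightSpace (eulerEnd n κ h M) b)
    (hmS : m ∈ Submodule.span (MvPolynomial (Fin n) R) S) (h0 : m ≠ 0) :
    ∃ j : ℕ, b = a + j := by
  by_contra hab
  have h1 := mem_span_monomial_of_mem_weightSpace hT (a := fun _ => a) (fun s => hS s.1 s.2) hm hmS
  rw [Set.eq_empty_of_forall_notMem (s := {p : (Fin n →₀ ℕ) × S | a + (p.1.degree : ℕ) = b})
    fun p hp => hab ⟨_, hp.symm⟩, Set.image_empty, Submodule.span_empty, Submodule.mem_bot] at h1
  exact h0 h1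

/-- In an `R[V]`-module generated in weight `a`, the weight space of `a` is spanned over `R` by the
generators: monomials of positive degree raise the weight, and the residue field has characteristic
zero. -/
theorem mem_span_of_mem_lowest_weightSpace (hT : LocallySplit (eulerEnd n κ h M)) {S : Set M}
    {a : ResidueField R} (hS : ∀ s ∈ S, s ∈ weightSpace (eulerEnd n κ h M) a)
    {m : M} (hm : m ∈ weightSpace (eulerEnd n κ h M) a)
    (hmS : m ∈ Submodule.span (MvPolynomial (Fin n) R) S) : m ∈ Submodule.span R S := by
  have := charZero_residueField R
  have h1 := mem_span_monomial_of_mem_weightSpace hT (a := fun _ => a) (fun s => hS s.1 s.2) hm hmS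
  refine Submodule.span_mono ?_ h1
  rintro _ ⟨⟨μ, s⟩, hμ, rfl⟩
  have h2 : μ = 0 := by
    rw [Set.mem_ofPred_eq, add_eq_left, Nat.cast_eq_zero] at hμ
    exact (Finsupp.degree_eq_zero_iff μ).1 hμ
  change MvPolynomial.monomial μ (1 : R) • s.1 ∈ S
  rw [h2, MvPolynomial.monomial_zero', map_one, one_smul]
  exact s.2

/-- For generators which are weight vectors, a weight space is spanned over `R` by monomials times
generators, and only one degree contributes for each generator. -/
theorem finite_weightSpace_of_finite_poly (hT : LocallySplit (eulerEnd n κ h M))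
    [Module.Finite (MvPolynomial (Fin n) R) M] (b : ResidueField R) :
    Module.Finite R (weightSpace (eulerEnd n κ h M) b) := by
  classical
  have := charZero_residueField R
  obtain ⟨t, ht⟩ := Module.Finite.fg_top (R := MvPolynomial (Fin n) R) (M := M)
  choose s hs hs' using exists_finset_weightVectors hT
  let S : Finset M := t.biUnion s
  have hS : ∀ x : (S : Set M), ∃ a, x.1 ∈ weightSpace (eulerEnd n κ h M) a := fun x => by
    obtain ⟨m, _, hm⟩ := Finset.mem_biUnion.1 x.2
    exact hs m x.1 hm
  choose a ha using hS
  have hspan : Submodule.span (MvPolynomial (Fin n) R) (S : Set M) = ⊤ := by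
    rw [← top_le_iff, ← ht]
    refine Submodule.span_le.2 fun m hm => ?_
    have h1 : Submodule.span R (s m : Set M) ≤
        (Submodule.span (MvPolynomial (Fin n) R) (S : Set M)).restrictScalars R :=
      Submodule.span_le.2 fun x hx =>
        Submodule.subset_span (Finset.mem_biUnion.2 ⟨m, hm, hx⟩)
    exact h1 (hs' m)
  set Z : Set ((Fin n →₀ ℕ) × (S : Set M)) := {p | a p.2 + (p.1.degree : ℕ) = b}
  have hZ : Z.Finite := by
    have h1 : ∀ x : (S : Set M), {μ : Fin n →₀ ℕ | a x + (μ.degree : ℕ) = b}.Finite := by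
      intro x
      by_cases hx : ∃ j : ℕ, a x + j = b
      · obtain ⟨j, hj⟩ := hx
        refine (Finsupp.finite_of_degree_le j).subset fun μ hμ => ?_
        rw [Set.mem_ofPred_eq, ← hj, add_right_inj, Nat.cast_inj] at hμ
        exact hμ.le
      · exact (Set.finite_empty).subset fun μ hμ => hx ⟨_, hμ⟩
    refine (Set.finite_iUnion fun x => (h1 x).prod (Set.finite_singleton x)).subset ?_
    rintro ⟨μ, x⟩ hp
    exact Set.mem_iUnion.2 ⟨x, hp, rfl⟩
  refine Module.Finite.iff_fg.2 ?_
  have h2 : weightSpace (eulerEnd n κ h M) b = Submodule.span R ((fun p =>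
      (MvPolynomial.monomial p.1 (1 : R) • p.2.1 : M)) '' Z) := by
    refine le_antisymm (fun m hm => mem_span_monomial_of_mem_weightSpace hT ha hm ?_)
      (Submodule.span_le.2 ?_)
    · rw [hspan]
      trivial
    · rintro _ ⟨⟨μ, x⟩, hp, rfl⟩
      have h3 := monomial_smul_mem_weightSpace (ha x) μ
      rwa [show a x + (μ.degree : ℕ) = b from hp] at h3
  rw [h2]
  exact Submodule.fg_span (hZ.image _)

end Finiteness

end Cherednik

namespace Cherednik

open IrrepClass FiniteGroupRep WeightSpace IsLocalRing

/-! ### Closure properties of category `O` -/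

section Closure

variable {d n : ℕ} {R : Type u} [CommRing R] [Algebra ℂ R]
  {κ : {k : ZMod d // k ≠ 0} → R} {h : R}

theorem mem_nilpotentPart_pi {J : Type*} {M : J → Type v} [∀ j, AddCommGroup (M j)]
    [∀ j, Module (Alg d n κ h) (M j)] [∀ j, Module R (M j)]
    [∀ j, IsScalarTower R (Alg d n κ h) (M j)] {r : ℕ} {m : ∀ j, M j}
    (hm : ∀ j, m j ∈ nilpotentPart n κ h (M j) r) : m ∈ nilpotentPart n κ h (∀ j, M j) r := by
  induction r generalizing m with
  | zero => exact funext fun j => mem_nilpotentPart_zero.1 (hm j)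
  | succ r ih => exact mem_nilpotentPart_succ.2 fun y => ih fun j => mem_nilpotentPart_succ.1 (hm j) y

theorem LocallyNilpotent.pi {J : Type*} [Finite J] {M : J → Type v} [∀ j, AddCommGroup (M j)]
    [∀ j, Module (Alg d n κ h) (M j)] [∀ j, Module R (M j)]
    [∀ j, IsScalarTower R (Alg d n κ h) (M j)] (hM : ∀ j, LocallyNilpotent n κ h (M j)) :
    LocallyNilpotent n κ h (∀ j, M j) := fun m => by
  have := Fintype.ofFinite J
  choose r hr using fun j => hM j (m j)
  exact ⟨Finset.univ.sup r, mem_nilpotentPart_pi fun j =>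
    nilpotentPart_mono (Finset.le_sup (Finset.mem_univ j)) (hr j)⟩

theorem categoryO_of_iff {M : Type u} [AddCommGroup M] [Module (Alg d n κ h) M] [Module R M]
    [IsScalarTower R (Alg d n κ h) M] : categoryO d n κ h (ModuleCat.of _ M) ↔
      Module.Finite (Alg d n κ h) M ∧ LocallyNilpotent n κ h M :=
  and_congr_right fun _ => forall_congr' fun _ => exists_congr fun _ => mem_nilpotentPart_iff.symm

theorem categoryO_iff {M : ModuleCat.{u} (Alg d n κ h)} : categoryO d n κ h M ↔
    Module.Finite (Alg d n κ h) M ∧ LocallyNilpotent n κ h M :=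
  categoryO_of_iff (M := M)

variable [NeZero d] [IsNoetherianRing R]

theorem categoryO_of_injective {X Y : ModuleCat.{u} (Alg d n κ h)} (hY : categoryO d n κ h Y)
    (f : X →ₗ[Alg d n κ h] Y) (hf : Function.Injective f) : categoryO d n κ h X := by
  obtain ⟨h1, h2⟩ := categoryO_iff.1 hY
  have := isNoetherian_of_locallyNilpotent h2 h1
  exact categoryO_iff.2 ⟨Module.Finite.of_injective f hf, h2.of_injective f hf⟩

omit [NeZero d] [IsNoetherianRing R] in
theorem categoryO_of_surjective {X Y : ModuleCat.{u} (Alg d n κ h)} (hX : categoryO d n κ h X)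
    (f : X →ₗ[Alg d n κ h] Y) (hf : Function.Surjective f) : categoryO d n κ h Y := by
  obtain ⟨h1, h2⟩ := categoryO_iff.1 hX
  exact categoryO_iff.2 ⟨Module.Finite.of_surjective f hf, h2.of_surjective f hf⟩

theorem containsZero_categoryO : (categoryO d n κ h).ContainsZero :=
  ⟨ModuleCat.of _ PUnit.{u + 1}, ModuleCat.isZero_of_subsingleton _,
    inferInstanceAs (Module.Finite (Alg d n κ h) PUnit.{u + 1}), fun _ => ⟨0, fun _ => rfl⟩⟩

theorem isClosedUnderSubobjects_categoryO : (categoryO d n κ h).IsClosedUnderSubobjects where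
  prop_of_mono f _ hY := categoryO_of_injective hY f.hom ((ModuleCat.mono_iff_injective f).1 ‹_›)

theorem isClosedUnderQuotients_categoryO : (categoryO d n κ h).IsClosedUnderQuotients where
  prop_of_epi f _ hX := categoryO_of_surjective hX f.hom ((ModuleCat.epi_iff_surjective f).1 ‹_›)

theorem isClosedUnderFiniteProducts_categoryO :
    (categoryO d n κ h).IsClosedUnderFiniteProducts where
  isClosedUnderLimitsOfShape J _ := ⟨by
    rintro X ⟨hX⟩
    let F : ModuleCat.of (Alg d n κ h) X ⟶
        ModuleCat.of (Alg d n κ h) (∀ j : J, hX.diag.obj ⟨j⟩) :=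
      ModuleCat.ofHom (LinearMap.pi fun j => (hX.π.app ⟨j⟩).hom)
    have hF : Mono F := ⟨fun {Z} a b hab => hX.isLimit.hom_ext fun ⟨j⟩ => by
      apply ModuleCat.hom_ext
      refine LinearMap.ext fun z => ?_
      exact congrFun (congrArg (fun φ => φ.hom z) hab) j⟩
    refine categoryO_of_injective (categoryO_of_iff.2 ⟨?_, ?_⟩) F.hom
      ((ModuleCat.mono_iff_injective F).1 hF)
    · have := fun j => (hX.prop_diag_obj ⟨j⟩).1
      exact Module.Finite.pi
    · exact .pi fun j => (categoryO_iff.1 (hX.prop_diag_obj ⟨j⟩)).2⟩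

end Closure

/-! ### Standard modules -/

section Standard

variable {d n : ℕ} [NeZero d] {R : Type u} [CommRing R] [Algebra ℂ R]
  {κ : {k : ZMod d // k ≠ 0} → R} {h : R} {E : Irr (W d n)}

theorem isEquivariant_standardIncl :
    IsEquivariant (moduleRep n κ h (standard κ h E)) E.rep (standardIncl κ h E) :=
  standardIncl_rep κ h E

theorem span_standardIncl :
    Submodule.span (Alg d n κ h) (Set.range (standardIncl κ h E)) = ⊤ := by
  refine eq_top_iff.2 fun m _ => ?_
  obtain ⟨t, rfl⟩ : ∃ t, standardMk κ h E t = m := Submodule.mkQ_surjective _ m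
  induction t with
  | zero => rw [map_zero]; exact Submodule.zero_mem _
  | add t t' ht ht' => rw [map_add]; exact Submodule.add_mem _ (ht trivial) (ht' trivial)
  | tmul x y =>
    induction y with
    | zero => rw [TensorProduct.tmul_zero, map_zero]; exact Submodule.zero_mem _
    | add y y' hy hy' =>
      rw [TensorProduct.tmul_add, map_add]
      exact Submodule.add_mem _ (hy trivial) (hy' trivial)
    | tmul r e =>
      rw [standardMk_tmul]
      exact Submodule.smul_mem _ _ (Submodule.subset_span ⟨e, rfl⟩)

/-- `Δ(E)` as a module over `R[V]`. -/
def standardPolyEquiv (κ : {k : ZMod d // k ≠ 0} → R) (h : R) (E : Irr (W d n)) :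
    Ind κ h (trivialVRep E.rep) ≃ₗ[MvPolynomial (Fin n) R] standard κ h E :=
  (standardEquiv κ h E).restrictScalars (MvPolynomial (Fin n) R)

theorem span_poly_standardIncl :
    Submodule.span (MvPolynomial (Fin n) R) (Set.range (standardIncl κ h E)) = ⊤ := by
  refine eq_top_iff.2 fun m _ => ?_
  obtain ⟨m, rfl⟩ := (standardPolyEquiv κ h E).surjective m
  induction m using ind_poly_induction with
  | h0 => rw [map_zero]; exact Submodule.zero_mem _
  | ha x y hx hy => rw [map_add]; exact Submodule.add_mem _ (hx trivial) (hy trivial)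
  | hm p x =>
    rw [map_smul]
    exact Submodule.smul_mem _ _ (Submodule.subset_span ⟨x, (standardEquiv_indIncl κ h E x).symm⟩)

instance : Module.Free (MvPolynomial (Fin n) R) (standard κ h E) :=
  Module.Free.of_equiv (standardPolyEquiv κ h E)

instance : Module.Projective R (standard κ h E) :=
  have : Module.Free R (standard κ h E) := Module.Free.trans (S := MvPolynomial (Fin n) R)
  inferInstance

/-- The `R`-span of `E` in `Δ(E)` is `R ⊗ E`. -/
theorem injective_liftBaseChange_standardIncl :
    Function.Injective ((standardIncl κ h E).liftBaseChange R) := by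
  have h1 : ∀ t : R ⊗[ℂ] E.rep.V, (standardIncl κ h E).liftBaseChange R t =
      standardEquiv κ h E ((Algebra.linearMap R (MvPolynomial (Fin n) R)).restrictScalars ℂ |>.rTensor
        E.rep.V t : MvPolynomial (Fin n) R ⊗[ℂ] E.rep.V) := by
    intro t
    induction t with
    | zero => rw [map_zero, map_zero]; exact (map_zero (standardEquiv κ h E)).symm
    | add t t' ht ht' =>
      rw [map_add, map_add, ht, ht']; exact (map_add (standardEquiv κ h E) _ _).symm
    | tmul r e =>
      rw [LinearMap.liftBaseChange_tmul, LinearMap.rTensor_tmul, ← standardEquiv_indIncl]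
      have h2 : (algebraMap R (MvPolynomial (Fin n) R) r ⊗ₜ[ℂ] e :
          MvPolynomial (Fin n) R ⊗[ℂ] E.rep.V) =
            (r • indIncl κ h (trivialVRep E.rep) e : Ind κ h (trivialVRep E.rep)) := by
        rw [Algebra.algebraMap_eq_smul_one]
        rfl
      refine Eq.trans ?_ (congrArg (standardEquiv κ h E) h2.symm)
      exact ((standardEquiv κ h E).toLinearMap.map_smul_of_tower r _).symm
  have h3 : Function.Injective (((Algebra.linearMap R (MvPolynomial (Fin n) R)).restrictScalars ℂ).rTensor
        E.rep.V) :=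
    Module.Flat.rTensor_preserves_injective_linearMap _ (MvPolynomial.C_injective _ _)
  intro t t' ht
  rw [h1, h1] at ht
  exact h3 ((standardEquiv κ h E).injective ht)

theorem standardIncl_mem_nilpotentPart (e : E.rep.V) :
    standardIncl κ h E e ∈ nilpotentPart n κ h (standard κ h E) 1 :=
  mem_nilpotentPart_one.2 fun y => vec_smul_standardIncl κ h E y e

theorem finite_standard : Module.Finite (Alg d n κ h) (standard κ h E) := by
  have := finite_W (d := d) (n := n)
  let b := Module.finBasis ℂ E.rep.V
  refine ⟨Submodule.fg_def.2 ⟨Set.range fun i => standardIncl κ h E (b i), Set.finite_range _, ?_⟩⟩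
  rw [← top_le_iff, ← span_standardIncl]
  refine Submodule.span_le.2 ?_
  rintro _ ⟨e, rfl⟩
  rw [← b.sum_repr e, map_sum]
  refine Submodule.sum_mem _ fun i _ => ?_
  rw [map_smul]
  exact Submodule.smul_of_tower_mem _ _ (Submodule.subset_span ⟨i, rfl⟩)

theorem locallyNilpotent_standard : LocallyNilpotent n κ h (standard κ h E) :=
  .of_span span_standardIncl (by rintro _ ⟨e, rfl⟩; exact ⟨1, standardIncl_mem_nilpotentPart e⟩)

theorem standard_mem_categoryO (κ : {k : ZMod d // k ≠ 0} → R) (h : R) (E : Irr (W d n)) :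
    categoryO d n κ h (standard κ h E) :=
  categoryO_iff.2 ⟨finite_standard, locallyNilpotent_standard⟩

variable [IsLocalRing R]

theorem mem_weightSpace_of_singular {M : Type v} [AddCommGroup M] [Module (Alg d n κ h) M]
    [Module R M] [IsScalarTower R (Alg d n κ h) M] [Module ℂ M] [IsScalarTower ℂ R M]
    [IsScalarTower ℂ (Alg d n κ h) M] {f : E.rep.V →ₗ[ℂ] M}
    (hf : IsEquivariant (moduleRep n κ h M) E.rep f) {e : E.rep.V}
    (hY : ∀ y : V n, (tautological κ h).Y y • f e = 0) :
    f e ∈ weightSpace (eulerEnd n κ h M) (lowestWeight κ h E) :=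
  mem_weightSpace_of_eigen (euler_smul_of_singular hf hY)

/-- `E` has weight `-c_E` in `Δ(E)`. -/
theorem standardIncl_mem_weightSpace (e : E.rep.V) : standardIncl κ h E e ∈
    weightSpace (eulerEnd n κ h (standard κ h E)) (lowestWeight κ h E) :=
  mem_weightSpace_of_singular isEquivariant_standardIncl
    fun y => vec_smul_standardIncl κ h E y e

/-- A nonzero image of `E` in `Δ(E')` is of weight `-c_E`, and the weights of `Δ(E')` are the
`-c_{E'} + j`. -/
theorem exists_of_standard_hom_ne_zero {E' : Irr (W d n)}
    (f : standard κ h E →ₗ[Alg d n κ h] standard κ h E') (hf : f ≠ 0) :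
    ∃ j : ℕ, lowestWeight κ h E = lowestWeight κ h E' + j := by
  have h1 : ∃ e, f (standardIncl κ h E e) ≠ 0 := by
    by_contra! h0
    exact hf (standard_ext h0)
  obtain ⟨e, he⟩ := h1
  refine exists_nat_add_of_mem_weightSpace (S := Set.range (standardIncl κ h E'))
    locallyNilpotent_standard.locallySplit ?_
    (map_mem_eulerWeightSpace f (standardIncl_mem_weightSpace e)) ?_ he
  · rintro _ ⟨e, rfl⟩
    exact standardIncl_mem_weightSpace e
  · rw [span_poly_standardIncl]
    trivial

/-- The preorder in terms of lowest weights; larger elements have lower weights. -/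
theorem irrPreorder_le_iff {E E' : Irr (W d n)} : (irrPreorder κ h).le E E' ↔
    ∃ j : ℕ, lowestWeight κ h E = lowestWeight κ h E' + j := by
  constructor
  · intro hle
    obtain ⟨j, hj⟩ := hle ⟨0, rfl⟩
    have hj' : lowestWeight κ h E' + j = lowestWeight κ h E + (0 : ℕ) := hj
    exact ⟨j, by rw [hj', Nat.cast_zero, add_zero]⟩
  · rintro ⟨j, hj⟩ _ ⟨k, rfl⟩
    refine ⟨j + k, ?_⟩
    change lowestWeight κ h E' + _ = lowestWeight κ h E + _
    rw [hj]
    push_cast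
    ring

theorem irrPreorder_lt_of_eq_sub {E E' : Irr (W d n)} {j : ℕ} (hj : 1 ≤ j)
    (hE : lowestWeight κ h E' = lowestWeight κ h E - j) : (irrPreorder κ h).lt E E' := by
  have := charZero_residueField R
  refine (irrPreorder κ h).lt_iff_le_not_ge E E' |>.2
    ⟨irrPreorder_le_iff.2 ⟨j, by rw [hE]; ring⟩, fun hle => ?_⟩
  obtain ⟨k, hk⟩ := irrPreorder_le_iff.1 hle
  have h1 : ((j + k : ℕ) : ResidueField R) = 0 := by
    push_cast
    linear_combination hE - hk
  rw [Nat.cast_eq_zero] at h1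
  lia

/-- A nonzero locally nilpotent module receives a nonzero map from a standard module. -/
theorem exists_standard_hom_ne_zero {M : Type v} [AddCommGroup M] [Module (Alg d n κ h) M]
    [Module R M] [IsScalarTower R (Alg d n κ h) M] [Module ℂ M] [IsScalarTower ℂ R M]
    [IsScalarTower ℂ (Alg d n κ h) M] [Nontrivial M] (hM : LocallyNilpotent n κ h M) :
    ∃ (E : Irr (W d n)) (f : standard κ h E →ₗ[Alg d n κ h] M), f ≠ 0 := by
  have := finite_W (d := d) (n := n)
  have hne : ∃ m ∈ nilpotentPart n κ h M 1, m ≠ 0 := by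
    by_contra! h0
    have h1 : ∀ r, ∀ m ∈ nilpotentPart n κ h M r, m = 0 := by
      intro r
      induction r with
      | zero => exact fun m hm => mem_nilpotentPart_zero.1 hm
      | succ r ih => exact fun m hm => h0 m (mem_nilpotentPart_one.2 fun y =>
          ih _ (mem_nilpotentPart_succ.1 hm y))
    obtain ⟨m, hm⟩ := exists_ne (0 : M)
    exact hm (h1 _ m (hM m).choose_spec)
  obtain ⟨m, hm, hm0⟩ := hne
  have : Nontrivial (singularPart n κ h M) :=
    ⟨⟨⟨m, hm⟩, 0, fun h0 => hm0 (congrArg Subtype.val h0)⟩⟩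
  obtain ⟨E, f, hf, hinj⟩ := exists_equivariant_injective (singularRep n κ h M)
  refine ⟨E, standardLift κ h E ((singularPart n κ h M).subtype ∘ₗ f)
    (fun g e => congrArg Subtype.val (hf g e)) (fun y e => mem_nilpotentPart_one.1 (f e).2 y), ?_⟩
  intro h0
  obtain ⟨e, he⟩ := exists_ne (0 : E.rep.V)
  refine he (hinj (Subtype.ext ?_))
  have h2 := LinearMap.congr_fun h0 (standardIncl κ h E e)
  rw [map_zero]
  exact (standardLift_standardIncl κ h E _ _ _ e).symm.trans h2

/-- An endomorphism of `Δ(E)` maps `E` to the lowest weight space `R ⊗ E`, equivariantly, hence is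
multiplication by an element of `R` by Schur's lemma. -/
theorem end_standard_bijective (κ : {k : ZMod d // k ≠ 0} → R) (h : R) (E : Irr (W d n)) :
    Function.Bijective (algebraMap R (End (standard κ h E))) := by
  have := finite_W (d := d) (n := n)
  have hsm : ∀ (r : R) m, (algebraMap R (End (standard κ h E)) r).hom m = r • m := by
    intro r m
    rw [Algebra.algebraMap_eq_smul_one]
    rfl
  constructor
  · intro r r' hr
    obtain ⟨e, he⟩ := exists_ne (0 : E.rep.V)
    have h1 : r • standardIncl κ h E e = r' • standardIncl κ h E e := by
      rw [← hsm, ← hsm, hr]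
    have h2 : r ⊗ₜ[ℂ] e = r' ⊗ₜ[ℂ] e := injective_liftBaseChange_standardIncl (κ := κ) (h := h) <| by
      rw [LinearMap.liftBaseChange_tmul, LinearMap.liftBaseChange_tmul, h1]
    obtain ⟨l, hl⟩ := (LinearMap.toSpanSingleton ℂ E.rep.V e).exists_leftInverse_of_injective
      (LinearMap.ker_toSpanSingleton ℂ he)
    have hl' : l e = 1 := by
      have := LinearMap.congr_fun hl 1
      rwa [LinearMap.comp_apply, LinearMap.toSpanSingleton_apply, one_smul] at this
    have h3 := congrArg (fun t => TensorProduct.rid ℂ R (l.lTensor R t)) h2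
    simpa only [LinearMap.lTensor_tmul, hl', TensorProduct.rid_tmul, one_smul] using h3
  · intro φ
    let f : standard κ h E →ₗ[Alg d n κ h] standard κ h E := φ.hom
    have h1 : ∀ e, ∃ t, (standardIncl κ h E).liftBaseChange R t = f (standardIncl κ h E e) := by
      intro e
      have h2 := mem_span_of_mem_lowest_weightSpace (S := Set.range (standardIncl κ h E))
        locallyNilpotent_standard.locallySplit
        (by rintro _ ⟨e, rfl⟩; exact standardIncl_mem_weightSpace e)
        (map_mem_eulerWeightSpace f (standardIncl_mem_weightSpace e))
        (by rw [span_poly_standardIncl]; trivial)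
      have h3 : Submodule.span R (Set.range (standardIncl κ h E)) ≤
          LinearMap.range ((standardIncl κ h E).liftBaseChange R) := by
        refine Submodule.span_le.2 ?_
        rintro _ ⟨e, rfl⟩
        exact ⟨1 ⊗ₜ e, by rw [LinearMap.liftBaseChange_tmul, one_smul]⟩
      exact h3 h2
    choose t ht using h1
    have hinj := injective_liftBaseChange_standardIncl (κ := κ) (h := h) (E := E)
    let T : E.rep.V →ₗ[ℂ] R ⊗[ℂ] E.rep.V :=
      { toFun := t
        map_add' := fun e e' => hinj (by rw [map_add, ht, ht, ht, map_add, map_add])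
        map_smul' := fun c e => hinj (by
          rw [RingHom.id_apply, ← algebraMap_smul R c (t e), map_smul, ht, ht, map_smul,
            algebraMap_smul]
          exact f.map_smul_of_tower c _) }
    obtain ⟨r, hr⟩ := exists_scalar_of_equivariant_baseChange (f := T) (fun g e => hinj (by
      have h2 : ∀ x : R ⊗[ℂ] E.rep.V, (standardIncl κ h E).liftBaseChange R
          ((E.rep.ρ g).baseChange R x) =
            (tautological κ h).G g • (standardIncl κ h E).liftBaseChange R x := by
        intro x
        induction x with
        | zero => rw [map_zero, map_zero, smul_zero]
        | add x x' hx hx' => rw [map_add, map_add, map_add, smul_add, hx, hx']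
        | tmul r e =>
          rw [LinearMap.baseChange_tmul, LinearMap.liftBaseChange_tmul,
            LinearMap.liftBaseChange_tmul, standardIncl_rep, smul_comm]
      rw [h2]
      change (standardIncl κ h E).liftBaseChange R (t _) =
        _ • (standardIncl κ h E).liftBaseChange R (t e)
      rw [ht, ht, standardIncl_rep, map_smul]))
    refine ⟨r, ?_⟩
    apply ModuleCat.hom_ext
    refine standard_ext fun e => ?_
    rw [hsm]
    change _ = f (standardIncl κ h E e)
    rw [← ht, show t e = r ⊗ₜ e from hr e, LinearMap.liftBaseChange_tmul]

end Standard

end Cherednik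

namespace Cherednik

open IrrepClass FiniteGroupRep WeightSpace IsLocalRing

/-! ### Truncated symmetric algebras -/

section Truncation

variable {d n : ℕ}

/-- A vector as an element of `S(V)`. -/
def vecForm : V n →ₗ[ℂ] MvPolynomial (Fin n) ℂ :=
  ∑ i, (LinearMap.toSpanSingleton ℂ (MvPolynomial (Fin n) ℂ) (MvPolynomial.X i)) ∘ₗ
    LinearMap.proj i

theorem vecForm_apply (y : V n) :
    vecForm y = ∑ i, y i • (MvPolynomial.X i : MvPolynomial (Fin n) ℂ) := by
  simp [vecForm]

theorem vecForm_single (i : Fin n) : vecForm (Pi.single i 1) = MvPolynomial.X i := by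
  rw [vecForm_apply, Finset.sum_eq_single i]
  · simp
  · intro j _ hj
    simp [hj]
  · simp

theorem vecForm_mem (y : V n) : vecForm y ∈ MvPolynomial.idealOfVars (Fin n) ℂ := by
  rw [vecForm_apply]
  refine Submodule.sum_mem _ fun i _ => Submodule.smul_of_tower_mem _ _ ?_
  exact Ideal.subset_span ⟨i, rfl⟩

/-- The action of `g ∈ W` on `S(V)`. -/
def vecSubst (g : W d n) : MvPolynomial (Fin n) ℂ →ₐ[ℂ] MvPolynomial (Fin n) ℂ :=
  MvPolynomial.aeval fun i => vecForm ((g : V n ≃ₗ[ℂ] V n) (Pi.single i 1))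

theorem vecSubst_vecForm (g : W d n) (y : V n) :
    vecSubst g (vecForm y) = vecForm ((g : V n ≃ₗ[ℂ] V n) y) := by
  conv_rhs => rw [vec_eq_sum y]
  rw [vecForm_apply, map_sum, map_sum, map_sum]
  refine Finset.sum_congr rfl fun i _ => ?_
  rw [map_smul, map_smul, map_smul, vecSubst, MvPolynomial.aeval_X]

theorem vecSubst_mul (g g' : W d n) : vecSubst (g * g') = (vecSubst g).comp (vecSubst g') := by
  refine MvPolynomial.algHom_ext fun i => ?_
  rw [AlgHom.comp_apply, ← vecForm_single, vecSubst_vecForm, vecSubst_vecForm, vecSubst_vecForm]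
  rfl

theorem vecSubst_one : vecSubst (1 : W d n) = AlgHom.id ℂ _ := by
  refine MvPolynomial.algHom_ext fun i => ?_
  rw [← vecForm_single, vecSubst_vecForm]
  rfl

variable (n) in
/-- The `k`-th power of the augmentation ideal of `S(V)`. -/
def augPow (k : ℕ) : Submodule ℂ (MvPolynomial (Fin n) ℂ) :=
  (MvPolynomial.idealOfVars (Fin n) ℂ ^ k).restrictScalars ℂ

theorem augPow_le_comap_vecSubst (k : ℕ) (g : W d n) :
    augPow n k ≤ (augPow n k).comap (vecSubst g).toLinearMap := by
  intro p hp
  have h1 : (MvPolynomial.idealOfVars (Fin n) ℂ).map (vecSubst g) ≤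
      MvPolynomial.idealOfVars (Fin n) ℂ := by
    refine Ideal.map_le_iff_le_comap.2 (Ideal.span_le.2 ?_)
    rintro _ ⟨i, rfl⟩
    change vecSubst g (MvPolynomial.X i) ∈ MvPolynomial.idealOfVars (Fin n) ℂ
    rw [← vecForm_single, vecSubst_vecForm]
    exact vecForm_mem _
  have h2 := Ideal.mem_map_of_mem (vecSubst g) hp
  rw [Ideal.map_pow] at h2
  exact Ideal.pow_right_mono h1 k h2

theorem augPow_le_comap_mul (k : ℕ) (q : MvPolynomial (Fin n) ℂ) :
    augPow n k ≤ (augPow n k).comap (LinearMap.mulLeft ℂ q) := fun _ hp =>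
  Ideal.mul_mem_left _ q hp

/-- Multiplication by `y ∈ V` on a truncated symmetric algebra. -/
def truncMul (k : ℕ) : V n →ₗ[ℂ] Module.End ℂ (MvPolynomial (Fin n) ℂ ⧸ augPow n k) where
  toFun y := (augPow n k).mapQ _ (LinearMap.mulLeft ℂ (vecForm y)) (augPow_le_comap_mul k _)
  map_add' y y' := by
    refine Submodule.linearMap_qext _ (LinearMap.ext fun p => ?_)
    simp [add_mul]
  map_smul' c y := by
    refine Submodule.linearMap_qext _ (LinearMap.ext fun p => ?_)
    simp

theorem truncMul_mk (k : ℕ) (y : V n) (p : MvPolynomial (Fin n) ℂ) :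
    truncMul k y ((augPow n k).mkQ p) = (augPow n k).mkQ (vecForm y * p) := rfl

/-- The action of `W` on a truncated symmetric algebra. -/
def truncAct (k : ℕ) : Representation ℂ (W d n) (MvPolynomial (Fin n) ℂ ⧸ augPow n k) where
  toFun g := (augPow n k).mapQ _ (vecSubst g).toLinearMap (augPow_le_comap_vecSubst k g)
  map_one' := by
    refine Submodule.linearMap_qext _ (LinearMap.ext fun p => ?_)
    simp [vecSubst_one]
  map_mul' g g' := by
    refine Submodule.linearMap_qext _ (LinearMap.ext fun p => ?_)
    simp [vecSubst_mul]

theorem truncAct_mk (k : ℕ) (g : W d n) (p : MvPolynomial (Fin n) ℂ) :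
    truncAct k g ((augPow n k).mkQ p) = (augPow n k).mkQ (vecSubst g p) := rfl

/-- The representation `(S(V) / S(V)_{≥ k}) ⊗ E` of `S(V) ♯ W`. -/
def truncRep (E : Rep.{0} ℂ (W d n)) (k : ℕ) :
    VRep d n ((MvPolynomial (Fin n) ℂ ⧸ augPow n k) ⊗[ℂ] E.V) where
  ρ := (truncAct k).tprod E.ρ
  act := LinearMap.rTensorHom E.V ∘ₗ truncMul k
  act_comm y y' := by
    refine TensorProduct.ext' fun p e => ?_
    obtain ⟨p, rfl⟩ := (augPow n k).mkQ_surjective p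
    change (truncMul k y (truncMul k y' _)) ⊗ₜ e = (truncMul k y' (truncMul k y _)) ⊗ₜ e
    rw [truncMul_mk, truncMul_mk, truncMul_mk, truncMul_mk, mul_left_comm]
  ρ_act g y := by
    refine TensorProduct.ext' fun p e => ?_
    obtain ⟨p, rfl⟩ := (augPow n k).mkQ_surjective p
    change (truncAct k g (truncMul k y _)) ⊗ₜ E.ρ g e =
      (truncMul k ((g : V n ≃ₗ[ℂ] V n) y) (truncAct k g _)) ⊗ₜ E.ρ g e
    rw [truncMul_mk, truncAct_mk, truncAct_mk, truncMul_mk, map_mul, vecSubst_vecForm]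

theorem truncRep_act (E : Rep.{0} ℂ (W d n)) (k : ℕ) (y : V n) (p : MvPolynomial (Fin n) ℂ)
    (e : E.V) : (truncRep E k).act y ((augPow n k).mkQ p ⊗ₜ e) =
      (augPow n k).mkQ (vecForm y * p) ⊗ₜ e := rfl

theorem truncRep_ρ (E : Rep.{0} ℂ (W d n)) (k : ℕ) (g : W d n) (p : MvPolynomial (Fin n) ℂ)
    (e : E.V) : (truncRep E k).ρ g ((augPow n k).mkQ p ⊗ₜ e) =
      (augPow n k).mkQ (vecSubst g p) ⊗ₜ E.ρ g e := rfl

end Truncation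

/-! ### Modules induced from truncated symmetric algebras -/

section Induced

variable {d n : ℕ} [NeZero d] {R : Type u} [CommRing R] [Algebra ℂ R]
  {κ : {k : ZMod d // k ≠ 0} → R} {h : R} {E : Rep.{0} ℂ (W d n)} {k : ℕ}

variable (κ h E k) in
/-- The inclusion of `E` in the module induced from `(S(V) / S(V)_{≥ k}) ⊗ E`. -/
def truncGen : E.V →ₗ[ℂ] Ind κ h (truncRep E k) :=
  indIncl κ h (truncRep E k) ∘ₗ TensorProduct.mk ℂ _ E.V ((augPow n k).mkQ 1)

theorem truncGen_ρ (g : W d n) (e : E.V) : truncGen κ h E k (E.ρ g e) =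
    (tautological (d := d) (n := n) κ h).G g • truncGen κ h E k e := by
  refine Eq.trans ?_ (grp_smul_indIncl g _).symm
  refine congrArg (indIncl κ h (truncRep E k)) (?_ :
    (augPow n k).mkQ 1 ⊗ₜ E.ρ g e = (truncRep E k).ρ g ((augPow n k).mkQ 1 ⊗ₜ e))
  rw [truncRep_ρ, map_one (vecSubst g)]

theorem truncGen_mem_nilpotentPart (e : E.V) :
    truncGen κ h E k e ∈ nilpotentPart n κ h (Ind κ h (truncRep E k)) k := by
  have h1 : ∀ r j : ℕ, r + j = k → ∀ p ∈ augPow n j,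
      indIncl κ h (truncRep E k) ((augPow n k).mkQ p ⊗ₜ e) ∈
        nilpotentPart n κ h (Ind κ h (truncRep E k)) r := by
    intro r
    induction r with
    | zero =>
      intro j hj p hp
      have h2 : (augPow n k).mkQ p = 0 := by
        rw [Submodule.mkQ_apply, Submodule.Quotient.mk_eq_zero, ← hj, zero_add]
        exact hp
      rw [h2, TensorProduct.zero_tmul, map_zero]
      exact Submodule.zero_mem _
    | succ r ih =>
      intro j hj p hp
      refine mem_nilpotentPart_succ.2 fun y => ?_
      rw [vec_smul_indIncl, truncRep_act]
      refine ih (j + 1) (by lia) _ ?_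
      change _ ∈ MvPolynomial.idealOfVars (Fin n) ℂ ^ (j + 1)
      rw [pow_succ']
      exact Ideal.mul_mem_mul (vecForm_mem y) hp
  refine h1 k 0 rfl 1 ?_
  change (1 : MvPolynomial (Fin n) ℂ) ∈ MvPolynomial.idealOfVars (Fin n) ℂ ^ 0
  rw [pow_zero, Ideal.one_eq_top]
  trivial

/-- The module induced from `S(V)/S(V)_{≥ k} ⊗ E` is generated by the classes `1 ⊗ e`. -/
theorem span_truncGen :
    Submodule.span (Alg d n κ h) (Set.range (truncGen κ h E k)) = ⊤ := by
  have h1 : ∀ (p : MvPolynomial (Fin n) ℂ) (e : E.V),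
      indIncl κ h (truncRep E k) ((augPow n k).mkQ p ⊗ₜ e) ∈
        Submodule.span (Alg d n κ h) (Set.range (truncGen κ h E k)) := by
    intro p e
    induction p using MvPolynomial.induction_on with
    | C c =>
      have h2 : (augPow n k).mkQ (MvPolynomial.C c) ⊗ₜ[ℂ] e = c • ((augPow n k).mkQ 1 ⊗ₜ[ℂ] e) := by
        rw [TensorProduct.smul_tmul', ← map_smul, ← MvPolynomial.algebraMap_eq,
          Algebra.algebraMap_eq_smul_one]
      rw [h2, map_smul]
      exact Submodule.smul_of_tower_mem _ _ (Submodule.subset_span ⟨e, rfl⟩)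
    | add p q hp hq =>
      rw [map_add, TensorProduct.add_tmul, map_add]
      exact Submodule.add_mem _ hp hq
    | mul_X p i hp =>
      rw [mul_comm, ← vecForm_single, ← truncRep_act, ← vec_smul_indIncl]
      exact Submodule.smul_mem _ _ hp
  refine eq_top_iff.2 fun m _ => ?_
  induction m using ind_poly_induction with
  | h0 => exact Submodule.zero_mem _
  | ha x y hx hy => exact Submodule.add_mem _ (hx trivial) (hy trivial)
  | hm f x =>
    rw [poly_smul_eq (κ := κ) (h := h)]
    refine Submodule.smul_mem _ _ ?_
    induction x with
    | zero => rw [map_zero]; exact Submodule.zero_mem _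
    | add x y hx hy => rw [map_add]; exact Submodule.add_mem _ (hx trivial) (hy trivial)
    | tmul p e =>
      obtain ⟨p, rfl⟩ := (augPow n k).mkQ_surjective p
      exact h1 p e

theorem locallyNilpotent_truncInd : LocallyNilpotent n κ h (Ind κ h (truncRep E k)) :=
  .of_span span_truncGen (by rintro _ ⟨e, rfl⟩; exact ⟨k, truncGen_mem_nilpotentPart e⟩)

variable (κ h) in
/-- The homomorphism `S(V) → H_R(κ, h)`. -/
def vecHom : MvPolynomial (Fin n) ℂ →ₐ[ℂ] Alg d n κ h :=
  MvPolynomial.commAeval (fun i => (tautological κ h).Y (Pi.single i 1))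
    fun _ _ => (tautological κ h).vec_comm _ _

theorem vecHom_vecForm (y : V n) :
    vecHom (d := d) κ h (vecForm y) = (tautological (d := d) κ h).Y y := by
  conv_rhs => rw [vec_eq_sum y]
  rw [vecForm_apply, map_sum, map_sum]
  refine Finset.sum_congr rfl fun i _ => ?_
  rw [map_smul, map_smul, vecHom, MvPolynomial.commAeval_X]

theorem vecHom_vecSubst (g : W d n) (p : MvPolynomial (Fin n) ℂ) :
    vecHom κ h (vecSubst g p) * (tautological (d := d) κ h).G g =
      (tautological (d := d) κ h).G g * vecHom κ h p := by
  induction p using MvPolynomial.induction_on with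
  | C c =>
    rw [← MvPolynomial.algebraMap_eq, AlgHom.commutes, AlgHom.commutes, Algebra.commutes]
  | add p q hp hq => rw [map_add, map_add, map_add, add_mul, mul_add, hp, hq]
  | mul_X p i hp =>
    rw [map_mul, map_mul, map_mul, ← mul_assoc, ← hp, mul_assoc, mul_assoc, ← vecForm_single,
      vecSubst_vecForm, vecHom_vecForm, vecHom_vecForm, (tautological (d := d) κ h).grp_vec]

variable {M : Type v} [AddCommGroup M] [Module (Alg d n κ h) M] [Module R M]
  [IsScalarTower R (Alg d n κ h) M] [Module ℂ M] [IsScalarTower ℂ R M]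
  [IsScalarTower ℂ (Alg d n κ h) M]

theorem vecHom_smul_mem_nilpotentPart {r : ℕ} {m : M} (hm : m ∈ nilpotentPart n κ h M r)
    (p : MvPolynomial (Fin n) ℂ) : vecHom κ h p • m ∈ nilpotentPart n κ h M r := by
  induction p using MvPolynomial.induction_on generalizing m with
  | C c =>
    rw [← MvPolynomial.algebraMap_eq, AlgHom.commutes, Algebra.algebraMap_eq_smul_one,
      complex_smul_smul, one_smul]
    exact Submodule.smul_mem _ _ hm
  | add p q hp hq => rw [map_add, add_smul]; exact add_mem (hp hm) (hq hm)
  | mul_X p i hp =>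
    rw [map_mul, mul_smul, ← vecForm_single, vecHom_vecForm]
    exact hp (vec_smul_mem_nilpotentPart hm _)

/-- Polynomials of order at least `r` in `V` kill the vectors of nilpotency `r`. -/
theorem vecHom_smul_eq_zero {r : ℕ} {m : M} (hm : m ∈ nilpotentPart n κ h M r)
    {p : MvPolynomial (Fin n) ℂ} (hp : p ∈ augPow n r) : vecHom κ h p • m = 0 := by
  induction r generalizing m p with
  | zero => rw [mem_nilpotentPart_zero.1 hm, smul_zero]
  | succ r ih =>
    replace hp : p ∈ MvPolynomial.idealOfVars (Fin n) ℂ ^ (r + 1) := hp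
    rw [pow_succ] at hp
    induction hp using Submodule.mul_induction_on' with
    | mem_mul_mem p hp q hq =>
      rw [map_mul, mul_smul]
      refine ih ?_ hp
      induction hq using Submodule.span_induction with
      | mem q hq =>
        obtain ⟨i, rfl⟩ := hq
        rw [← vecForm_single, vecHom_vecForm]
        exact mem_nilpotentPart_succ.1 hm _
      | zero => rw [map_zero, zero_smul]; exact Submodule.zero_mem _
      | add x y _ _ hx hy => rw [map_add, add_smul]; exact Submodule.add_mem _ hx hy
      | smul a x _ hx =>
        rw [smul_eq_mul, map_mul, mul_smul]
        exact vecHom_smul_mem_nilpotentPart hx a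
    | add x _ y _ hx hy => rw [map_add, add_smul, hx, hy, add_zero]

variable (n κ h M) in
/-- A module over the rational Cherednik algebra as a module over `R[V]`. -/
@[reducible]
def polyModule : Module (MvPolynomial (Fin n) R) M := Module.compHom M (polyHom κ h).toRingHom

variable (n κ h M) in
theorem isScalarTower_polyModule : letI := polyModule n κ h M
    IsScalarTower (MvPolynomial (Fin n) R) (Alg d n κ h) M :=
  letI := polyModule n κ h M
  ⟨fun p a m => by rw [poly_smul_def, mul_smul]; rfl⟩

variable (n κ h M) in
theorem isScalarTower_polyModule_left : letI := polyModule n κ h M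
    IsScalarTower R (MvPolynomial (Fin n) R) M :=
  letI := polyModule n κ h M
  ⟨fun r p m => by
    change polyHom κ h (r • p) • m = r • polyHom κ h p • m
    rw [map_smul, smul_assoc]⟩

variable (f : E.V →ₗ[ℂ] M)
  (hG : ∀ g e, f (E.ρ g e) = (tautological (d := d) (n := n) κ h).G g • f e)
  (hf : ∀ e, f e ∈ nilpotentPart n κ h M k)

/-- The `S(V) ♯ W`-linear extension of a `W`-equivariant map with values in vectors of
nilpotency `k`. -/
def truncExtend : (MvPolynomial (Fin n) ℂ ⧸ augPow n k) ⊗[ℂ] E.V →ₗ[ℂ] M :=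
  TensorProduct.lift <| (augPow n k).liftQ
    (LinearMap.mk₂ ℂ (fun p e => vecHom (d := d) κ h p • f e)
      (fun p q e => by rw [map_add, add_smul]) (fun c p e => by rw [map_smul, smul_assoc])
      (fun p e e' => by rw [map_add, smul_add]) (fun c p e => by rw [map_smul, smul_comm]))
    fun _ hp => LinearMap.ext fun e => vecHom_smul_eq_zero (hf e) hp

theorem truncExtend_tmul (p : MvPolynomial (Fin n) ℂ) (e : E.V) :
    truncExtend f hf ((augPow n k).mkQ p ⊗ₜ e) = vecHom (d := d) κ h p • f e := rfl

/-- The homomorphism out of the module induced from `(S(V) / S(V)_{≥ k}) ⊗ E` given by a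
`W`-equivariant map with values in vectors of nilpotency `k`. -/
def truncLift : Ind κ h (truncRep E k) →ₗ[Alg d n κ h] M :=
  letI := polyModule n κ h M
  haveI := isScalarTower_polyModule n κ h M
  haveI := isScalarTower_polyModule_left n κ h M
  indLift (truncExtend f hf)
    (fun g x => by
      induction x with
      | zero => rw [map_zero, map_zero, smul_zero]
      | add x y hx hy => rw [map_add, map_add, map_add, smul_add, hx, hy]
      | tmul p e =>
        obtain ⟨p, rfl⟩ := (augPow n k).mkQ_surjective p
        rw [truncRep_ρ, truncExtend_tmul, truncExtend_tmul, hG, ← mul_smul, vecHom_vecSubst,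
          mul_smul])
    (fun y x => by
      induction x with
      | zero => rw [map_zero, map_zero, smul_zero]
      | add x y hx hy => rw [map_add, map_add, map_add, smul_add, hx, hy]
      | tmul p e =>
        obtain ⟨p, rfl⟩ := (augPow n k).mkQ_surjective p
        rw [truncRep_act, truncExtend_tmul, truncExtend_tmul, map_mul, vecHom_vecForm, mul_smul])

theorem truncLift_truncGen (e : E.V) : truncLift f hG hf (truncGen κ h E k e) = f e := by
  let _ := polyModule n κ h M
  have := isScalarTower_polyModule n κ h M
  have := isScalarTower_polyModule_left n κ h M
  refine (indLift_indIncl _ _ _ _).trans ?_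
  change truncExtend f hf ((augPow n k).mkQ 1 ⊗ₜ e) = f e
  rw [truncExtend_tmul, map_one, one_smul]

end Induced

end Cherednik

namespace Cherednik

open IrrepClass FiniteGroupRep WeightSpace IsLocalRing

/-! ### Projective objects of category `O` -/

section Projective

variable {d n : ℕ} [NeZero d] {R : Type u} [CommRing R] [Algebra ℂ R] [IsLocalRing R]
  {κ : {k : ZMod d // k ≠ 0} → R} {h : R}

variable (n κ h) in
/-- Only finitely many possible weights lie below a given weight: there are finitely many lowest
weights, and the residue field has characteristic zero. -/
theorem exists_forall_sub_notMem_possibleWeights (a : ResidueField R) :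
    ∃ k : ℕ, ∀ j ≥ k, a - j ∉ possibleWeights d n κ h := by
  classical
  have := charZero_residueField R
  have := finite_W (d := d) (n := n)
  have := finite_irr (G := W d n)
  have := Fintype.ofFinite (Irr (W d n))
  have h1 : ∀ E : Irr (W d n), ∃ k : ℕ, ∀ j ≥ k, ∀ i : ℕ, a - j ≠ lowestWeight κ h E + i := by
    intro E
    by_cases hE : ∃ N : ℕ, a = lowestWeight κ h E + N
    · obtain ⟨N, hN⟩ := hE
      refine ⟨N + 1, fun j hj i hi => ?_⟩
      have h2 : ((N : ℕ) : ResidueField R) = ((i + j : ℕ) : ResidueField R) := by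
        push_cast
        linear_combination hi - hN
      rw [Nat.cast_inj] at h2
      lia
    · exact ⟨0, fun j _ i hi => hE ⟨i + j, by push_cast; linear_combination hi⟩⟩
  choose k hk using h1
  refine ⟨Finset.univ.sup k, fun j hj ⟨E, i, hi⟩ => hk E j ?_ i hi⟩
  exact (Finset.le_sup (Finset.mem_univ E)).trans hj

variable (n κ h) in
/-- A bound on the nilpotency of vectors of weight `a`. -/
def depth (a : ResidueField R) : ℕ := (exists_forall_sub_notMem_possibleWeights n κ h a).choose

theorem sub_notMem_possibleWeights {a : ResidueField R} {j : ℕ} (hj : depth n κ h a ≤ j) :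
    a - j ∉ possibleWeights d n κ h :=
  (exists_forall_sub_notMem_possibleWeights n κ h a).choose_spec j hj

section Module

variable {M : Type v} [AddCommGroup M] [Module (Alg d n κ h) M] [Module R M]
  [IsScalarTower R (Alg d n κ h) M] [Module ℂ M] [IsScalarTower ℂ R M]
  [IsScalarTower ℂ (Alg d n κ h) M]

/-- `V` lowers the weight by one, so that after `depth` steps no possible weight is left. The bound
depends on the weight only, not on the module. -/
theorem LocallyNilpotent.mem_nilpotentPart_depth (hM : LocallyNilpotent n κ h M)
    {a : ResidueField R} {m : M} (hm : m ∈ weightSpace (eulerEnd n κ h M) a) :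
    m ∈ nilpotentPart n κ h M (depth n κ h a) := by
  have h1 : ∀ r j : ℕ, r + j = depth n κ h a → ∀ m ∈ weightSpace (eulerEnd n κ h M) (a - j),
      m ∈ nilpotentPart n κ h M r := by
    intro r
    induction r with
    | zero =>
      intro j hj m hm
      exact mem_nilpotentPart_zero.2
        (hM.eq_zero_of_mem_weightSpace (sub_notMem_possibleWeights (by lia)) hm)
    | succ r ih =>
      intro j hj m hm
      refine mem_nilpotentPart_succ.2 fun y => ih (j + 1) (by lia) _ ?_
      rw [Nat.cast_succ, ← sub_sub]
      exact vec_smul_mem_weightSpace hm y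
  exact h1 _ 0 (add_zero _) m (by rwa [Nat.cast_zero, sub_zero])

theorem grp_smul_weightProj (hT : LocallySplit (eulerEnd n κ h M)) (a : ResidueField R) (g : W d n)
    (m : M) : (tautological (d := d) κ h).G g • weightProj hT a m =
      weightProj hT a ((tautological (d := d) κ h).G g • m) :=
  map_weightProj (f := Algebra.lsmul R R M ((tautological (d := d) κ h).G g)) hT hT
    (eulerEnd_grp g) a m

theorem hom_weightProj {M' : Type w} [AddCommGroup M']
    [Module (Alg d n κ h) M'] [Module R M'] [IsScalarTower R (Alg d n κ h) M']
    (hT : LocallySplit (eulerEnd n κ h M)) (hT' : LocallySplit (eulerEnd n κ h M'))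
    (f : M →ₗ[Alg d n κ h] M') (a : ResidueField R) (m : M) :
    f (weightProj hT a m) = weightProj hT' a (f m) :=
  map_weightProj (f := f.restrictScalars R) hT hT'
    (fun m => (f.map_smul (euler (d := d) (n := n) κ h) m).symm) a m

end Module

variable (κ h) (E : Irr (W d n))

/-- The module that represents vectors of nilpotency `depth` in an `E`-isotypic component. -/
abbrev CoverInd : Type u := Ind κ h (truncRep E.rep (depth n κ h (lowestWeight κ h E)))

/-- The inclusion of `E` in the generating subspace. -/
abbrev coverGen : E.rep.V →ₗ[ℂ] CoverInd κ h E := truncGen κ h E.rep _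

/-- The projection of the inclusion of `E` to the lowest weight of `Δ(E)`. -/
def coverWeightGen : E.rep.V →ₗ[ℂ] CoverInd κ h E :=
  (weightProj (locallyNilpotent_truncInd (κ := κ) (h := h)).locallySplit
    (lowestWeight κ h E)).restrictScalars ℂ ∘ₗ coverGen κ h E

theorem coverWeightGen_apply (e : E.rep.V) : coverWeightGen κ h E e =
    weightProj (locallyNilpotent_truncInd (κ := κ) (h := h)).locallySplit
      (lowestWeight κ h E) (coverGen κ h E e) := rfl

theorem coverWeightGen_mem (e : E.rep.V) : coverWeightGen κ h E e ∈
    weightSpace (eulerEnd n κ h (CoverInd κ h E)) (lowestWeight κ h E) :=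
  weightProj_mem locallyNilpotent_truncInd.locallySplit _ _

theorem coverWeightGen_rep (g : W d n) (e : E.rep.V) : coverWeightGen κ h E (E.rep.ρ g e) =
    (tautological (d := d) (n := n) κ h).G g • coverWeightGen κ h E e := by
  rw [coverWeightGen_apply, coverWeightGen_apply, truncGen_ρ]
  exact (grp_smul_weightProj locallyNilpotent_truncInd.locallySplit _ g _).symm

/-- The idempotent endomorphism with image the projective object `P(E)`. -/
def coverProj : CoverInd κ h E →ₗ[Alg d n κ h] CoverInd κ h E :=
  truncLift (coverWeightGen κ h E) (coverWeightGen_rep κ h E) fun e =>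
    locallyNilpotent_truncInd.mem_nilpotentPart_depth (coverWeightGen_mem κ h E e)

theorem coverProj_coverGen (e : E.rep.V) :
    coverProj κ h E (coverGen κ h E e) = coverWeightGen κ h E e :=
  truncLift_truncGen _ _ _ _

theorem coverProj_coverWeightGen (e : E.rep.V) :
    coverProj κ h E (coverWeightGen κ h E e) = coverWeightGen κ h E e := by
  rw [coverWeightGen_apply, hom_weightProj _ locallyNilpotent_truncInd.locallySplit,
    coverProj_coverGen, ← coverWeightGen_apply]
  exact weightProj_of_mem _ (coverWeightGen_mem κ h E e)

theorem coverInd_ext {M : Type v} [AddCommGroup M] [Module (Alg d n κ h) M]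
    {f g : CoverInd κ h E →ₗ[Alg d n κ h] M}
    (hfg : ∀ e, f (coverGen κ h E e) = g (coverGen κ h E e)) : f = g :=
  LinearMap.ext_on_range span_truncGen hfg

theorem coverProj_comp_coverProj : coverProj κ h E ∘ₗ coverProj κ h E = coverProj κ h E :=
  coverInd_ext κ h E fun e => by
    rw [LinearMap.comp_apply, coverProj_coverGen, coverProj_coverWeightGen]

/-- The projective object `P(E)`: it represents the functor sending a module to the space of
equivariant maps from `E` to its weight space at the lowest weight of `Δ(E)`. -/
abbrev Cover : Type u := LinearMap.range (coverProj κ h E)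

/-- The generating subspace of `P(E)`. -/
def coverIncl : E.rep.V →ₗ[ℂ] Cover κ h E :=
  ((coverProj κ h E).rangeRestrict.restrictScalars ℂ) ∘ₗ coverGen κ h E

theorem coe_coverIncl (e : E.rep.V) :
    (coverIncl κ h E e : CoverInd κ h E) = coverWeightGen κ h E e :=
  coverProj_coverGen κ h E e

theorem span_coverIncl :
    Submodule.span (Alg d n κ h) (Set.range (coverIncl κ h E)) = ⊤ := by
  have h1 : Set.range (coverIncl κ h E) =
      (coverProj κ h E).rangeRestrict '' Set.range (coverGen κ h E) := by
    rw [← Set.range_comp]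
    rfl
  rw [h1, ← Submodule.map_span, span_truncGen, Submodule.map_top, LinearMap.range_rangeRestrict]

theorem cover_ext {M : Type v} [AddCommGroup M] [Module (Alg d n κ h) M]
    {f g : Cover κ h E →ₗ[Alg d n κ h] M}
    (hfg : ∀ e, f (coverIncl κ h E e) = g (coverIncl κ h E e)) : f = g :=
  LinearMap.ext_on_range (span_coverIncl κ h E) hfg

theorem coverIncl_rep (g : W d n) (e : E.rep.V) : coverIncl κ h E (E.rep.ρ g e) =
    (tautological (d := d) (n := n) κ h).G g • coverIncl κ h E e :=
  Subtype.ext <| by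
    rw [coe_coverIncl, coverWeightGen_rep]
    change _ = (tautological (d := d) (n := n) κ h).G g • (coverIncl κ h E e : CoverInd κ h E)
    rw [coe_coverIncl]

theorem locallyNilpotent_cover : LocallyNilpotent n κ h (Cover κ h E) :=
  locallyNilpotent_truncInd.of_injective (Submodule.subtype _) Subtype.val_injective

theorem coverIncl_mem (e : E.rep.V) : coverIncl κ h E e ∈
    weightSpace (eulerEnd n κ h (Cover κ h E)) (lowestWeight κ h E) := by
  have h1 : coverIncl κ h E e = (coverProj κ h E).rangeRestrict (coverWeightGen κ h E e) :=
    Subtype.ext (by rw [coe_coverIncl]; exact (coverProj_coverWeightGen κ h E e).symm)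
  rw [h1]
  exact map_mem_eulerWeightSpace _ (coverWeightGen_mem κ h E e)

theorem finite_cover : Module.Finite (Alg d n κ h) (Cover κ h E) := by
  have := finite_W (d := d) (n := n)
  let b := Module.finBasis ℂ E.rep.V
  refine ⟨Submodule.fg_def.2 ⟨Set.range fun i => coverIncl κ h E (b i), Set.finite_range _, ?_⟩⟩
  rw [← top_le_iff, ← span_coverIncl]
  refine Submodule.span_le.2 ?_
  rintro _ ⟨e, rfl⟩
  rw [← b.sum_repr e, map_sum]
  refine Submodule.sum_mem _ fun i _ => ?_
  rw [map_smul]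
  exact Submodule.smul_of_tower_mem _ _ (Submodule.subset_span ⟨i, rfl⟩)

instance : Module.Projective (MvPolynomial (Fin n) R) (Cover κ h E) :=
  Module.Projective.of_split
    ((LinearMap.range (coverProj κ h E)).subtype.restrictScalars (MvPolynomial (Fin n) R))
    ((coverProj κ h E).rangeRestrict.restrictScalars (MvPolynomial (Fin n) R))
    (LinearMap.ext fun m => Subtype.ext <| by
      obtain ⟨_, m, rfl⟩ := m
      exact LinearMap.congr_fun (coverProj_comp_coverProj κ h E) m)

section UniversalProperty

variable {κ h E} {M : Type v} [AddCommGroup M] [Module (Alg d n κ h) M] [Module R M]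
  [IsScalarTower R (Alg d n κ h) M] [Module ℂ M] [IsScalarTower ℂ R M]
  [IsScalarTower ℂ (Alg d n κ h) M] (hM : LocallyNilpotent n κ h M)
  (f : E.rep.V →ₗ[ℂ] M)
  (hG : ∀ g e, f (E.rep.ρ g e) = (tautological (d := d) (n := n) κ h).G g • f e)
  (hf : ∀ e, f e ∈ weightSpace (eulerEnd n κ h M) (lowestWeight κ h E))

/-- The homomorphism out of `P(E)` given by an equivariant map of the lowest weight of `Δ(E)`. -/
def coverLift : Cover κ h E →ₗ[Alg d n κ h] M :=
  truncLift f hG (fun e => hM.mem_nilpotentPart_depth (hf e)) ∘ₗ Submodule.subtype _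

theorem coverLift_coverIncl (e : E.rep.V) : coverLift hM f hG hf (coverIncl κ h E e) = f e := by
  change truncLift f hG (fun e => hM.mem_nilpotentPart_depth (hf e))
    (coverIncl κ h E e : CoverInd κ h E) = f e
  rw [coe_coverIncl, coverWeightGen_apply, hom_weightProj _ hM.locallySplit, truncLift_truncGen]
  exact weightProj_of_mem _ (hf e)

/-- The objects `P(E)` are projective in category `O`. -/
theorem exists_cover_lift {M' : Type w} [AddCommGroup M'] [Module (Alg d n κ h) M'] [Module R M']
    [IsScalarTower R (Alg d n κ h) M'] [Module ℂ M'] [IsScalarTower ℂ R M']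
    [IsScalarTower ℂ (Alg d n κ h) M'] (hM : LocallyNilpotent n κ h M)
    (p : M →ₗ[Alg d n κ h] M') (hp : Function.Surjective p) (φ : Cover κ h E →ₗ[Alg d n κ h] M') :
    ∃ ψ : Cover κ h E →ₗ[Alg d n κ h] M, p ∘ₗ ψ = φ := by
  have := finite_W (d := d) (n := n)
  have hM' := hM.of_surjective p hp
  obtain ⟨f, hf, hfp⟩ := exists_equivariant_lift (σ := moduleRep n κ h M)
    (σ' := moduleRep n κ h M') (E := E.rep) (f := φ.restrictScalars ℂ ∘ₗ coverIncl κ h E)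
    (p.restrictScalars ℂ) (fun g m => map_smul p _ m) hp
    (fun g e => by
      rw [LinearMap.comp_apply, LinearMap.comp_apply, coverIncl_rep]
      exact map_smul φ _ _)
  let f' : E.rep.V →ₗ[ℂ] M :=
    (weightProj hM.locallySplit (lowestWeight κ h E)).restrictScalars ℂ ∘ₗ f
  have hG' : ∀ g e, f' (E.rep.ρ g e) = (tautological (d := d) (n := n) κ h).G g • f' e := by
    intro g e
    have h1 : f (E.rep.ρ g e) = (tautological (d := d) (n := n) κ h).G g • f e := hf g e
    change weightProj hM.locallySplit _ (f (E.rep.ρ g e)) =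
      (tautological (d := d) (n := n) κ h).G g • weightProj hM.locallySplit _ (f e)
    rw [h1, grp_smul_weightProj]
  have hf' : ∀ e, f' e ∈ weightSpace (eulerEnd n κ h M) (lowestWeight κ h E) := fun e =>
    weightProj_mem hM.locallySplit _ _
  refine ⟨coverLift hM f' hG' hf', cover_ext κ h E fun e => ?_⟩
  rw [LinearMap.comp_apply, coverLift_coverIncl]
  change p (weightProj hM.locallySplit _ (f e)) = _
  rw [hom_weightProj _ hM'.locallySplit, show p (f e) = φ (coverIncl κ h E e) from hfp e]
  exact weightProj_of_mem _ (map_mem_eulerWeightSpace φ (coverIncl_mem κ h E e))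

end UniversalProperty

end Projective

/-! ### The kernel of `P(E) → Δ(E)` -/

section Kernel

variable {d n : ℕ} [NeZero d] {R : Type u} [CommRing R] [Algebra ℂ R] [IsLocalRing R]
  {κ : {k : ZMod d // k ≠ 0} → R} {h : R} {E : Irr (W d n)}
  {P : Type v} [AddCommGroup P] [Module (Alg d n κ h) P]
  [Module R P] [IsScalarTower R (Alg d n κ h) P] [Module ℂ P] [IsScalarTower ℂ R P]
  [IsScalarTower ℂ (Alg d n κ h) P] [Module (MvPolynomial (Fin n) R) P]
  [IsScalarTower (MvPolynomial (Fin n) R) (Alg d n κ h) P]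
  [IsScalarTower R (MvPolynomial (Fin n) R) P]
  [IsScalarTower ℂ (MvPolynomial (Fin n) R) P]

/-- The `R[V]`-linear map from `Δ(E)` given by a linear map on `E`. -/
def standardPolyLift (f : E.rep.V →ₗ[ℂ] P) : standard κ h E →ₗ[MvPolynomial (Fin n) R] P :=
  f.liftBaseChange (MvPolynomial (Fin n) R) ∘ₗ (standardPolyEquiv κ h E).symm.toLinearMap

omit [Module (Alg d n κ h) P] [Module R P] [IsScalarTower R (Alg d n κ h) P] [IsScalarTower ℂ R P]
  [IsScalarTower ℂ (Alg d n κ h) P] [IsScalarTower (MvPolynomial (Fin n) R) (Alg d n κ h) P]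
  [IsScalarTower R (MvPolynomial (Fin n) R) P] in
theorem standardPolyLift_standardIncl (f : E.rep.V →ₗ[ℂ] P) (e : E.rep.V) :
    standardPolyLift (κ := κ) (h := h) f (standardIncl κ h E e) = f e := by
  have h1 : (standardPolyEquiv κ h E).symm (standardIncl κ h E e) =
      indIncl κ h (trivialVRep E.rep) e := by
    rw [LinearEquiv.symm_apply_eq]
    exact (standardEquiv_indIncl κ h E e).symm
  change f.liftBaseChange (MvPolynomial (Fin n) R)
    ((standardPolyEquiv κ h E).symm (standardIncl κ h E e)) = _
  rw [h1]
  change f.liftBaseChange (MvPolynomial (Fin n) R) (1 ⊗ₜ[ℂ] e) = _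
  rw [LinearMap.liftBaseChange_tmul, one_smul]

variable (q : P →ₗ[Alg d n κ h] standard κ h E) (w : E.rep.V →ₗ[ℂ] P)

variable {q w} in
theorem apply_standardPolyLift (hq : ∀ e, q (w e) = standardIncl κ h E e) (m : standard κ h E) :
    q (standardPolyLift w m) = m := by
  have h1 : q.restrictScalars (MvPolynomial (Fin n) R) ∘ₗ standardPolyLift w = LinearMap.id :=
    LinearMap.ext_on_range span_poly_standardIncl fun e => by
      rw [LinearMap.comp_apply, standardPolyLift_standardIncl]
      exact hq e
  exact LinearMap.congr_fun h1 m

variable {q w} in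
/-- The projection to the kernel of a homomorphism to `Δ(E)` given by an `R[V]`-linear section. -/
def kerProj (hq : ∀ e, q (w e) = standardIncl κ h E e) :
    P →ₗ[MvPolynomial (Fin n) R] LinearMap.ker q where
  toFun m := ⟨m - standardPolyLift w (q m), by
    rw [LinearMap.mem_ker, map_sub, apply_standardPolyLift hq, sub_self]⟩
  map_add' m m' := Subtype.ext <| by
    change m + m' - standardPolyLift w (q (m + m')) =
      m - standardPolyLift w (q m) + (m' - standardPolyLift w (q m'))
    rw [map_add, map_add]
    abel
  map_smul' p m := Subtype.ext <| by
    change p • m - standardPolyLift w (q (p • m)) = p • (m - standardPolyLift w (q m))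
    rw [map_poly_smul, map_smul, smul_sub]

theorem kerProj_coe (hq : ∀ e, q (w e) = standardIncl κ h E e) (m : LinearMap.ker q) :
    kerProj hq m.1 = m :=
  Subtype.ext <| by
    change m.1 - standardPolyLift w (q m.1) = m.1
    rw [LinearMap.mem_ker.1 m.2, map_zero, sub_zero]

/-- The surjection `q` splits over `R[V]`, so that its kernel is a direct summand. -/
theorem projective_ker [Module.Projective (MvPolynomial (Fin n) R) P]
    (hq : ∀ e, q (w e) = standardIncl κ h E e) :
    Module.Projective (MvPolynomial (Fin n) R) (LinearMap.ker q) :=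
  Module.Projective.of_split ((LinearMap.ker q).subtype.restrictScalars (MvPolynomial (Fin n) R))
    (kerProj hq) (LinearMap.ext fun m => kerProj_coe q w hq m)

theorem finite_poly_ker [Module.Finite (MvPolynomial (Fin n) R) P]
    (hq : ∀ e, q (w e) = standardIncl κ h E e) :
    Module.Finite (MvPolynomial (Fin n) R) (LinearMap.ker q) :=
  Module.Finite.of_surjective (kerProj hq) fun m => ⟨m.1, kerProj_coe q w hq m⟩

/-- The kernel of `P(E) → Δ(E)` is generated over `R[V]` in weights strictly below the lowest weight
of `Δ(E)`. -/
theorem span_weightSpace_ker (hq : ∀ e, q (w e) = standardIncl κ h E e)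
    (hw : Submodule.span (Alg d n κ h) (Set.range w) = ⊤)
    (hG : ∀ g e, w (E.rep.ρ g e) = (tautological (d := d) (n := n) κ h).G g • w e)
    (hwt : ∀ e, w e ∈ weightSpace (eulerEnd n κ h P) (lowestWeight κ h E)) :
    Submodule.span (MvPolynomial (Fin n) R)
      {m | ∃ j : ℕ, m ∈ weightSpace (eulerEnd n κ h (LinearMap.ker q))
        (lowestWeight κ h E - (j + 1 : ℕ))} = ⊤ := by
  set a := lowestWeight κ h E
  set U : Set (LinearMap.ker q) :=
    {m | ∃ j : ℕ, m ∈ weightSpace (eulerEnd n κ h (LinearMap.ker q)) (a - (j + 1 : ℕ))}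
  have hU : ∀ {m : P} (hm : q m = 0) (j : ℕ),
      m ∈ weightSpace (eulerEnd n κ h P) (a - (j + 1 : ℕ)) →
        (⟨m, hm⟩ : LinearMap.ker q) ∈ U := by
    intro m hm j hmj
    exact ⟨j, mem_weightSpace_of_injective (T' := eulerEnd n κ h P)
      (f := (LinearMap.ker q).subtype.restrictScalars R) (fun _ => rfl) Subtype.val_injective hmj⟩
  let D : Set P := Set.range w ∪ {m | ∃ hm : q m = 0, (⟨m, hm⟩ : LinearMap.ker q) ∈ U}
  have hD : Submodule.span (MvPolynomial (Fin n) R) D = ⊤ := by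
    refine span_poly_eq_top (κ := κ) (h := h) (S := Set.range w) ?_ ?_
      (fun m hm => Submodule.subset_span (Or.inl hm)) hw
    · rintro y _ (⟨e, rfl⟩ | ⟨hm, hm'⟩)
      · have h1 : q ((tautological κ h).Y y • w e) = 0 := by
          rw [map_smul, hq, vec_smul_standardIncl]
        refine Submodule.subset_span (Or.inr ⟨h1, hU h1 0 ?_⟩)
        rw [zero_add, Nat.cast_one]
        exact vec_smul_mem_weightSpace (hwt e) y
      · obtain ⟨j, hj⟩ := hm'
        refine Submodule.subset_span (Or.inr ⟨by rw [map_smul, hm, smul_zero], j + 1, ?_⟩)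
        rw [Nat.cast_succ, ← sub_sub]
        exact vec_smul_mem_weightSpace hj y
    · rintro g _ (⟨e, rfl⟩ | ⟨hm, hm'⟩)
      · exact Submodule.subset_span (Or.inl ⟨_, hG g e⟩)
      · obtain ⟨j, hj⟩ := hm'
        exact Submodule.subset_span (Or.inr ⟨by rw [map_smul, hm, smul_zero], j,
          grp_smul_mem_weightSpace hj g⟩)
  have hmap := congrArg (Submodule.map (kerProj hq)) hD
  rw [Submodule.map_span, Submodule.map_top, LinearMap.range_eq_top.2 fun m =>
    ⟨m.1, kerProj_coe q w hq m⟩] at hmap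
  rw [← top_le_iff, ← hmap]
  refine Submodule.span_le.2 ?_
  rintro _ ⟨_, ⟨e, rfl⟩ | ⟨hm, hm'⟩, rfl⟩
  · have h1 : kerProj hq (w e) = 0 := Subtype.ext <| by
      change w e - standardPolyLift w (q (w e)) = 0
      rw [hq, standardPolyLift_standardIncl, sub_self]
    rw [h1]
    exact Submodule.zero_mem _
  · have h1 := kerProj_coe q w hq ⟨_, hm⟩
    rw [h1]
    exact Submodule.subset_span hm'

end Kernel

/-! ### The projection from `P(E)` to `Δ(E)` -/

section CoverToStandard

variable {d n : ℕ} [NeZero d] {R : Type u} [CommRing R] [Algebra ℂ R] [IsLocalRing R]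
  (κ : {k : ZMod d // k ≠ 0} → R) (h : R) (E : Irr (W d n))

/-- The projection from `P(E)` to `Δ(E)`. -/
def coverToStandard : Cover κ h E →ₗ[Alg d n κ h] standard κ h E :=
  coverLift locallyNilpotent_standard (standardIncl κ h E) (standardIncl_rep κ h E)
    standardIncl_mem_weightSpace

theorem coverToStandard_coverIncl (e : E.rep.V) :
    coverToStandard κ h E (coverIncl κ h E e) = standardIncl κ h E e :=
  coverLift_coverIncl _ _ _ _ _

theorem coverToStandard_surjective : Function.Surjective (coverToStandard κ h E) := by
  rw [← LinearMap.range_eq_top, ← top_le_iff, ← span_standardIncl]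
  refine Submodule.span_le.2 ?_
  rintro _ ⟨e, rfl⟩
  exact ⟨_, coverToStandard_coverIncl κ h E e⟩

end CoverToStandard

end Cherednik

namespace MvPolynomial

/-! ### Reduction modulo the variables -/

section ModVars

variable (σ R : Type*) [CommRing R] (M : Type*) [AddCommGroup M] [Module R M]
  [Module (MvPolynomial σ R) M] [IsScalarTower R (MvPolynomial σ R) M]

/-- The submodule generated by the multiples of the variables. -/
def varsPart : Submodule R M :=
  (idealOfVars σ R • (⊤ : Submodule (MvPolynomial σ R) M)).restrictScalars R

variable {σ R M}

theorem mem_varsPart_iff {m : M} :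
    m ∈ varsPart σ R M ↔ m ∈ idealOfVars σ R • (⊤ : Submodule (MvPolynomial σ R) M) := Iff.rfl

theorem smul_mem_varsPart {p : MvPolynomial σ R} (hp : p ∈ idealOfVars σ R) (m : M) :
    p • m ∈ varsPart σ R M :=
  mem_varsPart_iff.2 (Submodule.smul_mem_smul hp Submodule.mem_top)

theorem mkQ_varsPart_smul (p : MvPolynomial σ R) (m : M) :
    (varsPart σ R M).mkQ (p • m) = constantCoeff p • (varsPart σ R M).mkQ m := by
  rw [← sub_eq_zero, ← map_smul, ← map_sub, Submodule.mkQ_apply, Submodule.Quotient.mk_eq_zero,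
    ← algebraMap_smul (MvPolynomial σ R) (constantCoeff p) m, ← sub_smul]
  exact smul_mem_varsPart (sub_C_constantCoeff_mem p) m

theorem finite_quotient_varsPart [Module.Finite (MvPolynomial σ R) M] :
    Module.Finite R (M ⧸ varsPart σ R M) := by
  obtain ⟨s, hs⟩ := Module.Finite.fg_top (R := MvPolynomial σ R) (M := M)
  refine ⟨Submodule.fg_def.2 ⟨(varsPart σ R M).mkQ '' s, s.finite_toSet.image _, ?_⟩⟩
  refine eq_top_iff.2 fun x _ => ?_
  obtain ⟨m, rfl⟩ := (varsPart σ R M).mkQ_surjective x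
  have hm : m ∈ Submodule.span (MvPolynomial σ R) (s : Set M) := by rw [hs]; trivial
  induction hm using Submodule.span_induction with
  | mem m hm => exact Submodule.subset_span ⟨m, hm, rfl⟩
  | zero => rw [map_zero]; exact Submodule.zero_mem _
  | add m m' _ _ hm hm' => rw [map_add]; exact Submodule.add_mem _ (hm trivial) (hm' trivial)
  | smul p m _ hm => rw [mkQ_varsPart_smul]; exact Submodule.smul_mem _ _ (hm trivial)

/-- A splitting of a free cover over `R[V]` induces one over `R` modulo the variables. -/
theorem projective_quotient_varsPart [Module.Projective (MvPolynomial σ R) M] :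
    Module.Projective R (M ⧸ varsPart σ R M) := by
  obtain ⟨s, hs⟩ := Module.projective_def'.1 ‹Module.Projective (MvPolynomial σ R) M›
  let t₀ : M →ₗ[R] (M →₀ R) :=
    { toFun := fun m => (s m).mapRange (constantCoeff (σ := σ) (R := R)) (map_zero _)
      map_add' := fun m m' => by ext; simp
      map_smul' := fun r m => by
        ext
        simp only [LinearMap.map_smul_of_tower, Finsupp.mapRange_apply, Finsupp.smul_apply,
          RingHom.id_apply, smul_eq_mul]
        rw [smul_eq_C_mul, map_mul, constantCoeff_C] }
  have ht₀ : varsPart σ R M ≤ LinearMap.ker t₀ := by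
    intro m hm
    rw [mem_varsPart_iff] at hm
    induction hm using Submodule.smul_induction_on' with
    | smul p hp m _ =>
      ext
      change constantCoeff (s (p • m) _) = 0
      rw [map_smul, Finsupp.smul_apply, smul_eq_mul, map_mul, mem_idealOfVars_iff.1 hp, zero_mul]
    | add x _ y _ hx hy => exact Submodule.add_mem _ hx hy
  refine Module.Projective.of_split ((varsPart σ R M).liftQ t₀ ht₀)
    (Finsupp.linearCombination R fun m : M => (varsPart σ R M).mkQ m) ?_
  refine Submodule.linearMap_qext _ (LinearMap.ext fun m => ?_)
  change Finsupp.linearCombination R (fun m : M => (varsPart σ R M).mkQ m) (t₀ m) =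
    (varsPart σ R M).mkQ m
  have h1 := LinearMap.congr_fun hs m
  conv_rhs => rw [← show _ = m from h1]
  rw [LinearMap.comp_apply, Finsupp.linearCombination_apply, Finsupp.linearCombination_apply]
  change ((s m).mapRange (constantCoeff (σ := σ) (R := R)) (map_zero _)).sum _ = _
  refine (Finsupp.sum_mapRange_index (h := fun m r => r • (varsPart σ R M).mkQ m)
    fun m => zero_smul _ _).trans ?_
  rw [Finsupp.sum, Finsupp.sum, map_sum]
  exact Finset.sum_congr rfl fun x _ => (mkQ_varsPart_smul _ _).symm

variable [Algebra ℂ R] {N : Type*} [AddCommGroup N] [Module ℂ N]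

/-- Modulo the variables, `R[V] ⊗ N` is spanned by the image of `R ⊗ N`. -/
theorem exists_sub_mem_varsPart (x : MvPolynomial σ R ⊗[ℂ] N) : ∃ c : R ⊗[ℂ] N,
    x - ((Algebra.linearMap R (MvPolynomial σ R)).restrictScalars ℂ).rTensor N c ∈
      idealOfVars σ R • (⊤ : Submodule (MvPolynomial σ R) (MvPolynomial σ R ⊗[ℂ] N)) := by
  induction x with
  | zero => exact ⟨0, by rw [map_zero, sub_zero]; exact Submodule.zero_mem _⟩
  | add x y hx hy =>
    obtain ⟨c, hc⟩ := hx
    obtain ⟨c', hc'⟩ := hy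
    exact ⟨c + c', by rw [map_add, add_sub_add_comm]; exact Submodule.add_mem _ hc hc'⟩
  | tmul p e =>
    refine ⟨constantCoeff p ⊗ₜ e, ?_⟩
    have h1 : p ⊗ₜ[ℂ] e - C (constantCoeff p) ⊗ₜ[ℂ] e =
        (p - C (constantCoeff p)) • ((1 : MvPolynomial σ R) ⊗ₜ[ℂ] e) := by
      rw [TensorProduct.smul_tmul', smul_eq_mul, mul_one, TensorProduct.sub_tmul]
    rw [LinearMap.rTensor_tmul]
    exact h1 ▸ Submodule.smul_mem_smul (sub_C_constantCoeff_mem p) Submodule.mem_top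

theorem liftBaseChange_rTensor [Module ℂ M] [IsScalarTower ℂ R M]
    [IsScalarTower ℂ (MvPolynomial σ R) M] (f : N →ₗ[ℂ] M) (c : R ⊗[ℂ] N) :
    f.liftBaseChange (MvPolynomial σ R)
      (((Algebra.linearMap R (MvPolynomial σ R)).restrictScalars ℂ).rTensor N c) =
        f.liftBaseChange R c := by
  induction c with
  | zero => rw [map_zero, map_zero, map_zero]
  | add x y hx hy => rw [map_add, map_add, map_add, hx, hy]
  | tmul r e =>
    rw [LinearMap.rTensor_tmul, LinearMap.liftBaseChange_tmul, LinearMap.liftBaseChange_tmul]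
    exact algebraMap_smul (MvPolynomial σ R) r (f e)

end ModVars

end MvPolynomial

namespace Cherednik

open IrrepClass FiniteGroupRep WeightSpace IsLocalRing MvPolynomial

/-! ### Reduction of modules over the Cherednik algebra modulo the variables -/

section Reduction

variable {d n : ℕ} [NeZero d] {R : Type u} [CommRing R] [Algebra ℂ R]
  {κ : {k : ZMod d // k ≠ 0} → R} {h : R}
  {K : Type v} [AddCommGroup K] [Module (Alg d n κ h) K]
  [Module R K] [IsScalarTower R (Alg d n κ h) K] [Module ℂ K] [IsScalarTower ℂ R K]
  [IsScalarTower ℂ (Alg d n κ h) K] [Module (MvPolynomial (Fin n) R) K]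
  [IsScalarTower (MvPolynomial (Fin n) R) (Alg d n κ h) K]
  [IsScalarTower R (MvPolynomial (Fin n) R) K]
  [IsScalarTower ℂ (MvPolynomial (Fin n) R) K]

theorem cov_smul_mem_varsPart (ξ : Module.Dual ℂ (V n)) (m : K) :
    (tautological (d := d) (n := n) κ h).X ξ • m ∈ varsPart (Fin n) R K := by
  rw [← linearForm_smul, linearForm_apply, Finset.sum_smul]
  refine Submodule.sum_mem _ fun i _ => ?_
  refine smul_mem_varsPart ?_ m
  exact Submodule.smul_of_tower_mem _ _ (Ideal.subset_span ⟨i, rfl⟩)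

/-- An `R`-linear endomorphism that maps multiples of the variables to such preserves
`varsPart`. -/
theorem varsPart_le_comap {f : K →ₗ[R] K}
    (hf : ∀ (i : Fin n) (m : K), f ((X i : MvPolynomial (Fin n) R) • m) ∈ varsPart (Fin n) R K) :
    varsPart (Fin n) R K ≤ (varsPart (Fin n) R K).comap f := by
  intro m hm
  obtain ⟨c, rfl⟩ := exists_sum_of_mem_idealOfVars_smul_top (mem_varsPart_iff.1 hm)
  rw [Submodule.mem_comap, map_sum]
  exact Submodule.sum_mem _ fun i _ => hf i _

theorem varsPart_le_comap_grp (g : W d n) : varsPart (Fin n) R K ≤ (varsPart (Fin n) R K).comap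
    (Algebra.lsmul R R K ((tautological (d := d) κ h).G g)) :=
  varsPart_le_comap fun i m => by
    rw [X_smul (d := d) (κ := κ) (h := h)]
    change (tautological (d := d) (n := n) κ h).G g •
      (tautological (d := d) (n := n) κ h).X _ • m ∈ _
    rw [← mul_smul, (tautological (d := d) κ h).grp_cov, mul_smul]
    exact cov_smul_mem_varsPart _ _

theorem varsPart_le_comap_euler : varsPart (Fin n) R K ≤ (varsPart (Fin n) R K).comap
    (eulerEnd n κ h K) :=
  varsPart_le_comap fun i m => by
    rw [X_smul (d := d) (κ := κ) (h := h)]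
    have h1 : eulerEnd n κ h K ((tautological (d := d) (n := n) κ h).X (LinearMap.proj i) • m) =
        (tautological (d := d) (n := n) κ h).X (LinearMap.proj i) • eulerEnd n κ h K m +
          (tautological (d := d) (n := n) κ h).X (LinearMap.proj i) • m :=
      (eulerEnd_cov (LinearMap.proj i) m).trans (by rw [one_smul]; rfl)
    rw [h1]
    exact add_mem (cov_smul_mem_varsPart _ _) (cov_smul_mem_varsPart _ _)

variable (n κ h K) in
/-- The action of the Euler element modulo the variables. -/
def redEuler : Module.End R (K ⧸ varsPart (Fin n) R K) :=
  (varsPart (Fin n) R K).mapQ _ (eulerEnd n κ h K) varsPart_le_comap_euler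

variable (n κ h K) in
/-- The action of `W` modulo the variables. -/
def redRep : Representation ℂ (W d n) (K ⧸ varsPart (Fin n) R K) where
  toFun g := ((varsPart (Fin n) R K).mapQ _ (Algebra.lsmul R R K ((tautological (d := d) κ h).G g))
    (varsPart_le_comap_grp g)).restrictScalars ℂ
  map_one' := by
    refine LinearMap.ext fun x => ?_
    obtain ⟨m, rfl⟩ := (varsPart (Fin n) R K).mkQ_surjective x
    change (varsPart (Fin n) R K).mkQ ((tautological (d := d) (n := n) κ h).G 1 • m) = _
    rw [map_one, one_smul]
    rfl
  map_mul' g g' := by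
    refine LinearMap.ext fun x => ?_
    obtain ⟨m, rfl⟩ := (varsPart (Fin n) R K).mkQ_surjective x
    change (varsPart (Fin n) R K).mkQ ((tautological (d := d) (n := n) κ h).G (g * g') • m) = _
    rw [map_mul, mul_smul]
    rfl

theorem redRep_mkQ (g : W d n) (m : K) :
    redRep n κ h K g ((varsPart (Fin n) R K).mkQ m) =
      (varsPart (Fin n) R K).mkQ ((tautological (d := d) κ h).G g • m) := rfl

theorem redRep_smul (g : W d n) (r : R) (x : K ⧸ varsPart (Fin n) R K) :
    redRep n κ h K g (r • x) = r • redRep n κ h K g x :=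
  map_smul ((varsPart (Fin n) R K).mapQ _ (Algebra.lsmul R R K ((tautological (d := d) κ h).G g))
    (varsPart_le_comap_grp g)) r x

theorem redEuler_mkQ (m : K) : redEuler n κ h K ((varsPart (Fin n) R K).mkQ m) =
      (varsPart (Fin n) R K).mkQ (eulerEnd n κ h K m) := rfl

theorem redEuler_redRep (g : W d n) (x : K ⧸ varsPart (Fin n) R K) :
    redEuler n κ h K (redRep n κ h K g x) = redRep n κ h K g (redEuler n κ h K x) := by
  obtain ⟨m, rfl⟩ := (varsPart (Fin n) R K).mkQ_surjective x
  rw [redRep_mkQ, redEuler_mkQ, redEuler_mkQ, redRep_mkQ]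
  exact congrArg _ (eulerEnd_grp g m)

variable [IsLocalRing R]

theorem locallySplit_redEuler (hT : LocallySplit (eulerEnd n κ h K)) :
    LocallySplit (redEuler n κ h K) :=
  hT.of_surjective (varsPart (Fin n) R K).mkQ (fun m => redEuler_mkQ m)
    (varsPart (Fin n) R K).mkQ_surjective

variable (n κ h K) in
/-- The action of `W` on a weight space of the reduction modulo the variables. -/
def redWeightRep (b : ResidueField R) :
    Representation ℂ (W d n) (weightSpace (redEuler n κ h K) b) where
  toFun g := ((redRep n κ h K g).restrict (p := (weightSpace (redEuler n κ h K) b).restrictScalars ℂ)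
    (q := (weightSpace (redEuler n κ h K) b).restrictScalars ℂ) fun _ hx =>
      map_mem_weightSpace (f := (varsPart (Fin n) R K).mapQ _
        (Algebra.lsmul R R K ((tautological (d := d) κ h).G g)) (varsPart_le_comap_grp g))
        (redEuler_redRep g) hx)
  map_one' := LinearMap.ext fun x => Subtype.ext
    (LinearMap.congr_fun (map_one (redRep n κ h K)) x.1)
  map_mul' g g' := LinearMap.ext fun x => Subtype.ext
    (LinearMap.congr_fun (map_mul (redRep n κ h K) g g') x.1)

theorem weightProj_X_smul (hT : LocallySplit (eulerEnd n κ h K)) (b : ResidueField R) (i : Fin n)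
    (m : K) : weightProj hT (b + 1) ((X i : MvPolynomial (Fin n) R) • m) =
      (X i : MvPolynomial (Fin n) R) • weightProj hT b m := by
  rw [X_smul (d := d) (κ := κ) (h := h), X_smul (d := d) (κ := κ) (h := h), ← map_one (residue R)]
  exact (map_weightProj_add (f := Algebra.lsmul R R K ((tautological (d := d) κ h).X _)) hT hT
    (eulerEnd_cov _) b m).symm

/-- Elements of a weight space that vanish modulo the variables are combinations of products of a
variable and a vector of weight one less. -/
theorem exists_sum_of_mem_varsPart (hT : LocallySplit (eulerEnd n κ h K)) {b : ResidueField R}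
    {m : K} (hm : m ∈ varsPart (Fin n) R K) : ∃ f : Fin n → K,
      (∀ i, f i ∈ weightSpace (eulerEnd n κ h K) (b - 1)) ∧
        weightProj hT b m = ∑ i, (X i : MvPolynomial (Fin n) R) • f i := by
  obtain ⟨c, rfl⟩ := exists_sum_of_mem_idealOfVars_smul_top (mem_varsPart_iff.1 hm)
  refine ⟨fun i => weightProj hT (b - 1) (c i), fun i => weightProj_mem hT _ _, ?_⟩
  rw [map_sum]
  refine Finset.sum_congr rfl fun i _ => ?_
  rw [← weightProj_X_smul hT, sub_add_cancel]

/-- A weight space is generated modulo the variables, freely in each isotypic component, by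
equivariant maps from irreducible representations. -/
theorem exists_weight_generators (hT : LocallySplit (eulerEnd n κ h K))
    [Module.Finite (MvPolynomial (Fin n) R) K] [Module.Projective (MvPolynomial (Fin n) R) K]
    (b : ResidueField R) : ∃ (m : ℕ) (E : Fin m → Irr (W d n)) (φ : ∀ i, (E i).rep.V →ₗ[ℂ] K),
      (∀ i g e, φ i ((E i).rep.ρ g e) = (tautological (d := d) κ h).G g • φ i e) ∧
      (∀ i e, φ i e ∈ weightSpace (eulerEnd n κ h K) b) ∧
      (∀ x ∈ weightSpace (eulerEnd n κ h K) b, ∃ c : ∀ i, R ⊗[ℂ] (E i).rep.V,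
        x - ∑ i, (φ i).liftBaseChange R (c i) ∈ varsPart (Fin n) R K) ∧
      ∀ c : ∀ i, R ⊗[ℂ] (E i).rep.V,
        ∑ i, (φ i).liftBaseChange R (c i) ∈ varsPart (Fin n) R K → ∀ i, c i = 0 := by
  have := finite_W (d := d) (n := n)
  have hL := locallySplit_redEuler hT
  have := finite_quotient_varsPart (σ := Fin n) (R := R) (M := K)
  have := projective_quotient_varsPart (σ := Fin n) (R := R) (M := K)
  have := finite_weightSpace hL b
  have := projective_weightSpace hL b
  obtain ⟨m, E, f, hf, hspan, hinj⟩ := exists_decomposition (R := R) (redWeightRep n κ h K b)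
    (fun g r x => Subtype.ext (redRep_smul g r x.1))
  set Q := varsPart (Fin n) R K with hQ
  have hlift : ∀ i, ∃ φ : (E i).rep.V →ₗ[ℂ] K,
      (∀ g e, φ ((E i).rep.ρ g e) = (tautological (d := d) κ h).G g • φ e) ∧
      (∀ e, φ e ∈ weightSpace (eulerEnd n κ h K) b) ∧ ∀ e, Q.mkQ (φ e) = (f i e).1 := by
    intro i
    obtain ⟨φ, hφ, hφf⟩ := exists_equivariant_lift (σ := moduleRep n κ h K)
      (σ' := redRep n κ h K) (E := (E i).rep)
      (f := ((weightSpace (redEuler n κ h K) b).subtype.restrictScalars ℂ) ∘ₗ f i)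
      (Q.mkQ.restrictScalars ℂ) (fun g m => rfl) Q.mkQ_surjective
      (fun g e => congrArg Subtype.val (hf i g e))
    refine ⟨(weightProj hT b).restrictScalars ℂ ∘ₗ φ, fun g e => ?_,
      fun e => weightProj_mem hT _ _, fun e => ?_⟩
    · have h1 : φ ((E i).rep.ρ g e) = (tautological (d := d) (n := n) κ h).G g • φ e := hφ g e
      change weightProj hT b (φ ((E i).rep.ρ g e)) =
        (tautological (d := d) (n := n) κ h).G g • weightProj hT b (φ e)
      rw [h1, grp_smul_weightProj]
    · change Q.mkQ (weightProj hT b (φ e)) = _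
      rw [map_weightProj hT hL (fun m => redEuler_mkQ m), show Q.mkQ (φ e) = (f i e).1 from hφf e]
      exact weightProj_of_mem hL (f i e).2
  choose φ hφG hφb hφf using hlift
  have hφc : ∀ i (c : R ⊗[ℂ] (E i).rep.V),
      Q.mkQ ((φ i).liftBaseChange R c) = ((f i).liftBaseChange R c).1 := by
    intro i c
    induction c with
    | zero => rw [map_zero, map_zero, map_zero]; rfl
    | add x y hx hy => rw [map_add, map_add, map_add, hx, hy]; rfl
    | tmul r e =>
      rw [LinearMap.liftBaseChange_tmul, LinearMap.liftBaseChange_tmul, map_smul, hφf]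
      rfl
  have hsum : ∀ c : ∀ i, R ⊗[ℂ] (E i).rep.V, Q.mkQ (∑ i, (φ i).liftBaseChange R (c i)) =
      (∑ i, (f i).liftBaseChange R (c i) : weightSpace (redEuler n κ h K) b).1 := by
    intro c
    rw [map_sum, AddSubmonoidClass.coe_finsetSum]
    exact Finset.sum_congr rfl fun i _ => hφc i (c i)
  refine ⟨m, E, φ, hφG, hφb, fun x hx => ?_, fun c hc => hinj c (Subtype.ext ?_)⟩
  · obtain ⟨c, hc⟩ := hspan ⟨Q.mkQ x, map_mem_weightSpace (fun m => redEuler_mkQ m) hx⟩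
    refine ⟨c, ?_⟩
    rw [← Submodule.Quotient.mk_eq_zero, ← Submodule.mkQ_apply, map_sub, hsum, ← hc, sub_self]
  · rw [← hsum]
    exact (Submodule.Quotient.mk_eq_zero Q).2 hc

end Reduction

end Cherednik

/-! ### Auxiliary facts on finite families -/

/-- A finite family can be enumerated by decreasing degree. -/
theorem exists_equiv_fin_antitone {ι : Type*} [Fintype ι] (deg : ι → ℕ) :
    ∃ e : ι ≃ Fin (Fintype.card ι), ∀ i i', deg i < deg i' → e i' < e i := by
  let e₀ := Fintype.equivFin ι
  let f : Fin (Fintype.card ι) → ℕᵒᵈ := fun t => OrderDual.toDual (deg (e₀.symm t))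
  refine ⟨e₀.trans (Tuple.sort f).symm, fun i i' hi => ?_⟩
  by_contra! hle
  have h1 := Tuple.monotone_sort f hle
  simp only [Function.comp_apply, Equiv.trans_apply, Equiv.apply_symm_apply, f,
    Equiv.symm_apply_apply, OrderDual.toDual_le_toDual] at h1
  lia

theorem Submodule.mem_ideal_smul_top_pi {S ι : Type*} [CommRing S] [Finite ι] {N : ι → Type*}
    [∀ i, AddCommGroup (N i)] [∀ i, Module S (N i)] {I : Ideal S} {y : ∀ i, N i}
    (hy : ∀ i, y i ∈ I • (⊤ : Submodule S (N i))) : y ∈ I • (⊤ : Submodule S (∀ i, N i)) := by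
  classical
  have := Fintype.ofFinite ι
  rw [← Finset.univ_sum_single y]
  refine Submodule.sum_mem _ fun i _ => ?_
  have h1 := Submodule.mem_map_of_mem (f := LinearMap.single S N i) (hy i)
  rw [Submodule.map_smul''] at h1
  exact Submodule.smul_mono le_rfl le_top h1

theorem LinearMap.liftBaseChange_mem {S M N : Type*} [CommRing S] [Algebra ℂ S] [AddCommGroup M]
    [Module ℂ M] [Module S M] [IsScalarTower ℂ S M] [AddCommGroup N] [Module ℂ N]
    (f : N →ₗ[ℂ] M) {P : Submodule S M} (hf : ∀ e, f e ∈ P) (c : S ⊗[ℂ] N) :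
    f.liftBaseChange S c ∈ P := by
  induction c with
  | zero => rw [map_zero]; exact P.zero_mem
  | add x y hx hy => rw [map_add]; exact P.add_mem hx hy
  | tmul r e => rw [LinearMap.liftBaseChange_tmul]; exact P.smul_mem _ (hf e)

theorem LinearMap.sum_liftBaseChange_single {S M ι : Type*} [CommRing S] [Algebra ℂ S]
    [AddCommGroup M] [Module ℂ M] [Module S M] [IsScalarTower ℂ S M] [Fintype ι] [DecidableEq ι]
    {N : ι → Type*} [∀ i, AddCommGroup (N i)] [∀ i, Module ℂ (N i)] (f : ∀ i, N i →ₗ[ℂ] M) (i : ι)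
    (c : S ⊗[ℂ] N i) : ∑ j, (f j).liftBaseChange S (Pi.single (M := fun i => S ⊗[ℂ] N i) i c j) =
      (f i).liftBaseChange S c := by
  rw [Fintype.sum_eq_single i fun j hj => by rw [Pi.single_eq_of_ne hj, map_zero],
    Pi.single_eq_same]

namespace Cherednik

open IrrepClass FiniteGroupRep WeightSpace IsLocalRing MvPolynomial

/-! ### Filtrations by standard modules -/

section Graded

variable {d n : ℕ} [NeZero d] {R : Type u} [CommRing R] [Algebra ℂ R] [IsLocalRing R]
  {κ : {k : ZMod d // k ≠ 0} → R} {h : R}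
  {K : Type v} [AddCommGroup K] [Module (Alg d n κ h) K]
  [Module R K] [IsScalarTower R (Alg d n κ h) K] [Module ℂ K] [IsScalarTower ℂ R K]
  [IsScalarTower ℂ (Alg d n κ h) K] [Module (MvPolynomial (Fin n) R) K]
  [IsScalarTower (MvPolynomial (Fin n) R) (Alg d n κ h) K]
  [IsScalarTower R (MvPolynomial (Fin n) R) K]
  [IsScalarTower ℂ (MvPolynomial (Fin n) R) K]

theorem weightProj_mem_varsPart (hT : LocallySplit (eulerEnd n κ h K)) (b : ResidueField R) {m : K}
    (hm : m ∈ varsPart (Fin n) R K) : weightProj hT b m ∈ varsPart (Fin n) R K := by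
  obtain ⟨f, -, hf⟩ := exists_sum_of_mem_varsPart hT (b := b) hm
  rw [hf]
  exact Submodule.sum_mem _ fun i _ => smul_mem_varsPart (Ideal.subset_span ⟨i, rfl⟩) _

/-- The weight spaces strictly below `a` are generated modulo the variables, freely, by finitely
many equivariant maps from irreducible representations; `deg i + 1` is the distance of the weight of
the `i`-th map from `a`. -/
theorem exists_graded_generators (hK : LocallyNilpotent n κ h K)
    [Module.Finite (MvPolynomial (Fin n) R) K] [Module.Projective (MvPolynomial (Fin n) R) K]
    (a : ResidueField R) : ∃ (ι : Type) (_ : Fintype ι) (deg : ι → ℕ) (E : ι → Irr (W d n))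
      (φ : ∀ i, (E i).rep.V →ₗ[ℂ] K),
      (∀ i g e, φ i ((E i).rep.ρ g e) = (tautological (d := d) (n := n) κ h).G g • φ i e) ∧
      (∀ i e, φ i e ∈ weightSpace (eulerEnd n κ h K) (a - (deg i + 1 : ℕ))) ∧
      (∀ (l : ℕ), ∀ x ∈ weightSpace (eulerEnd n κ h K) (a - (l + 1 : ℕ)),
        ∃ y ∈ Submodule.span R {y | ∃ i e, deg i = l ∧ y = φ i e}, x - y ∈ varsPart (Fin n) R K) ∧
      ∀ c : ∀ i, R ⊗[ℂ] (E i).rep.V,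
        ∑ i, (φ i).liftBaseChange R (c i) ∈ varsPart (Fin n) R K → ∀ i, c i = 0 := by
  have hT := hK.locallySplit
  have := charZero_residueField R
  choose m E φ hG hφ hspan hind using fun j : Fin (depth n κ h a) =>
    exists_weight_generators hT (a - (j + 1 : ℕ))
  refine ⟨Σ j : Fin (depth n κ h a), Fin (m j), inferInstance, fun i => i.1, fun i => E i.1 i.2,
    fun i => φ i.1 i.2, fun i => hG i.1 i.2, fun i => hφ i.1 i.2, fun l x hx => ?_, fun c hc => ?_⟩
  · by_cases hl : l < depth n κ h a
    · obtain ⟨c, hc⟩ := hspan ⟨l, hl⟩ x hx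
      refine ⟨∑ i, (φ ⟨l, hl⟩ i).liftBaseChange R (c i), Submodule.sum_mem _ fun i _ => ?_, hc⟩
      refine LinearMap.liftBaseChange_mem _ (fun e => Submodule.subset_span ?_) _
      exact ⟨⟨⟨l, hl⟩, i⟩, e, rfl, rfl⟩
    · refine ⟨0, Submodule.zero_mem _, ?_⟩
      rw [hK.eq_zero_of_mem_weightSpace (sub_notMem_possibleWeights (by lia)) hx, sub_zero]
      exact Submodule.zero_mem _
  · rintro ⟨j, i⟩
    -- The weight projections separate the contributions of the different weights.
    have h1 := weightProj_mem_varsPart hT (a - ((j : ℕ) + 1 : ℕ)) hc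
    rw [map_sum, Fintype.sum_sigma, Finset.sum_eq_single j, Finset.sum_congr rfl fun i _ =>
      weightProj_of_mem hT (LinearMap.liftBaseChange_mem _ (hφ j i) (c ⟨j, i⟩))] at h1
    · exact hind j (fun i => c ⟨j, i⟩) h1 i
    · intro j' _ hj'
      refine Finset.sum_eq_zero fun i _ => weightProj_of_mem_ne hT ?_
        (LinearMap.liftBaseChange_mem _ (hφ j' i) (c ⟨j', i⟩))
      intro hjj
      refine hj' (Fin.ext ?_)
      have h2 := sub_right_injective hjj
      rw [Nat.cast_inj] at h2
      lia
    · intro hj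
      exact absurd (Finset.mem_univ j) hj

/-- Generators modulo the variables of the weight spaces generate them over `R[V]`, the weights of
the generators needed being at most the given one. -/
theorem mem_span_graded_generators (hK : LocallyNilpotent n κ h K) {a : ResidueField R} {ι : Type}
    {deg : ι → ℕ} {E : ι → Irr (W d n)} {φ : ∀ i, (E i).rep.V →ₗ[ℂ] K}
    (hφ : ∀ i e, φ i e ∈ weightSpace (eulerEnd n κ h K) (a - (deg i + 1 : ℕ)))
    (hgen : ∀ (l : ℕ), ∀ x ∈ weightSpace (eulerEnd n κ h K) (a - (l + 1 : ℕ)),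
      ∃ y ∈ Submodule.span R {y | ∃ i e, deg i = l ∧ y = φ i e}, x - y ∈ varsPart (Fin n) R K)
    (l : ℕ) {x : K} (hx : x ∈ weightSpace (eulerEnd n κ h K) (a - (l + 1 : ℕ))) :
    x ∈ Submodule.span (MvPolynomial (Fin n) R) {y | ∃ i e, l ≤ deg i ∧ y = φ i e} := by
  have hT := hK.locallySplit
  -- Descending induction on the weight; the weights below `a - depth` do not occur.
  have h1 : ∀ r l : ℕ, depth n κ h a ≤ l + r →
      ∀ x ∈ weightSpace (eulerEnd n κ h K) (a - (l + 1 : ℕ)),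
        x ∈ Submodule.span (MvPolynomial (Fin n) R) {y | ∃ i e, l ≤ deg i ∧ y = φ i e} := by
    intro r
    induction r with
    | zero =>
      intro l hl x hx
      rw [hK.eq_zero_of_mem_weightSpace (sub_notMem_possibleWeights (by lia)) hx]
      exact Submodule.zero_mem _
    | succ r ih =>
      intro l hl x hx
      obtain ⟨y, hy, hxy⟩ := hgen l x hx
      have hyw : y ∈ weightSpace (eulerEnd n κ h K) (a - (l + 1 : ℕ)) := by
        refine Submodule.span_le.2 ?_ hy
        rintro _ ⟨i, e, rfl, rfl⟩
        exact hφ i e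
      obtain ⟨f, hf, hs⟩ := exists_sum_of_mem_varsPart hT (b := a - (l + 1 : ℕ)) hxy
      rw [weightProj_of_mem hT (sub_mem hx hyw)] at hs
      rw [← sub_add_cancel x y, hs]
      refine Submodule.add_mem _ (Submodule.sum_mem _ fun i _ => Submodule.smul_mem _ _ ?_) ?_
      · have h2 := hf i
        rw [sub_sub, ← Nat.cast_succ] at h2
        refine Submodule.span_mono ?_ (ih (l + 1) (by lia) _ h2)
        rintro _ ⟨i, e, hi, rfl⟩
        exact ⟨i, e, by lia, rfl⟩
      · refine Submodule.span_le_restrictScalars R (MvPolynomial (Fin n) R) _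
          (Submodule.span_mono ?_ hy)
        rintro _ ⟨i, e, rfl, rfl⟩
        exact ⟨i, e, le_rfl, rfl⟩
  exact h1 (depth n κ h a) l (by lia) x hx

end Graded

section Standard

variable {d n : ℕ} [NeZero d] {R : Type u} [CommRing R] [Algebra ℂ R] [IsLocalRing R]
  {κ : {k : ZMod d // k ≠ 0} → R} {h : R} {E : Irr (W d n)}
  {Q : Type v} [AddCommGroup Q] [Module (Alg d n κ h) Q]
  [Module R Q] [IsScalarTower R (Alg d n κ h) Q] [Module ℂ Q] [IsScalarTower ℂ R Q]
  [IsScalarTower ℂ (Alg d n κ h) Q] [Module (MvPolynomial (Fin n) R) Q]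
  [IsScalarTower (MvPolynomial (Fin n) R) (Alg d n κ h) Q]
  [IsScalarTower R (MvPolynomial (Fin n) R) Q]
  [IsScalarTower ℂ (MvPolynomial (Fin n) R) Q]

/-- A module generated by singular vectors forming a copy of `E` is isomorphic to `Δ(E)` as soon as
it is free over `R[V]` on `E`. -/
theorem nonempty_equiv_standard {f : E.rep.V →ₗ[ℂ] Q}
    (hG : ∀ g e, f (E.rep.ρ g e) = (tautological (d := d) (n := n) κ h).G g • f e)
    (hY : ∀ y e, (tautological (d := d) (n := n) κ h).Y y • f e = 0)
    (hspan : Submodule.span (MvPolynomial (Fin n) R) (Set.range f) = ⊤)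
    (hinj : Function.Injective (f.liftBaseChange (MvPolynomial (Fin n) R))) :
    Nonempty (Q ≃ₗ[Alg d n κ h] standard κ h E) := by
  let q := standardLift κ h E f hG hY
  have hq : q.restrictScalars (MvPolynomial (Fin n) R) = standardPolyLift f :=
    LinearMap.ext_on_range span_poly_standardIncl fun e => by
      rw [standardPolyLift_standardIncl]
      exact standardLift_standardIncl κ h E f hG hY e
  refine ⟨(LinearEquiv.ofBijective q ⟨?_, ?_⟩).symm⟩
  · change Function.Injective (q.restrictScalars (MvPolynomial (Fin n) R))
    rw [hq]
    exact hinj.comp (standardPolyEquiv κ h E).symm.injective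
  · change Function.Surjective (q.restrictScalars (MvPolynomial (Fin n) R))
    rw [← LinearMap.range_eq_top, ← top_le_iff, ← hspan]
    refine Submodule.span_le.2 ?_
    rintro _ ⟨e, rfl⟩
    exact ⟨standardIncl κ h E e, standardLift_standardIncl κ h E f hG hY e⟩

end Standard

section Filtration

variable {d n : ℕ} [NeZero d] {R : Type u} [CommRing R] [Algebra ℂ R] [IsLocalRing R]
  {κ : {k : ZMod d // k ≠ 0} → R} {h : R}
  {K : Type u} [AddCommGroup K] [Module (Alg d n κ h) K]
  [Module R K] [IsScalarTower R (Alg d n κ h) K] [Module ℂ K] [IsScalarTower ℂ R K]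
  [IsScalarTower ℂ (Alg d n κ h) K] [Module (MvPolynomial (Fin n) R) K]
  [IsScalarTower (MvPolynomial (Fin n) R) (Alg d n κ h) K]
  [IsScalarTower R (MvPolynomial (Fin n) R) K]
  [IsScalarTower ℂ (MvPolynomial (Fin n) R) K]

omit [IsLocalRing R] [Module (Alg d n κ h) K] [IsScalarTower R (Alg d n κ h) K]
  [IsScalarTower ℂ (Alg d n κ h) K] [IsScalarTower (MvPolynomial (Fin n) R) (Alg d n κ h) K] in
/-- Maps which are jointly free modulo the variables are jointly free over `R[V]` if they generate a
projective module. -/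
theorem injective_graded_generators {ι : Type} [Fintype ι]
    [Module.Projective (MvPolynomial (Fin n) R) K] {E : ι → Irr (W d n)}
    {φ : ∀ i, (E i).rep.V →ₗ[ℂ] K}
    (hind : ∀ c : ∀ i, R ⊗[ℂ] (E i).rep.V,
        ∑ i, (φ i).liftBaseChange R (c i) ∈ varsPart (Fin n) R K → ∀ i, c i = 0)
    (hspan : Submodule.span (MvPolynomial (Fin n) R) {y | ∃ i e, y = φ i e} = ⊤) :
    Function.Injective fun y : ∀ i, MvPolynomial (Fin n) R ⊗[ℂ] (E i).rep.V =>
      ∑ i, (φ i).liftBaseChange (MvPolynomial (Fin n) R) (y i) := by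
  classical
  have := finite_W (d := d) (n := n)
  let Ψ : (∀ i, MvPolynomial (Fin n) R ⊗[ℂ] (E i).rep.V) →ₗ[MvPolynomial (Fin n) R] K :=
    ∑ i, (φ i).liftBaseChange (MvPolynomial (Fin n) R) ∘ₗ LinearMap.proj i
  have hΨ : ∀ y, Ψ y = ∑ i, (φ i).liftBaseChange (MvPolynomial (Fin n) R) (y i) := fun y => by
    simp only [Ψ, LinearMap.sum_apply, LinearMap.comp_apply, LinearMap.proj_apply]
  suffices Function.Injective Ψ from fun y y' hy => this (by rw [hΨ, hΨ]; exact hy)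
  refine injective_of_injective_mod_vars Ψ ?_ fun y hy => ?_
  · rw [← LinearMap.range_eq_top, ← top_le_iff, ← hspan]
    refine Submodule.span_le.2 ?_
    rintro _ ⟨i, e, rfl⟩
    refine ⟨Pi.single i (1 ⊗ₜ e), ?_⟩
    rw [hΨ, LinearMap.sum_liftBaseChange_single, LinearMap.liftBaseChange_tmul, one_smul]
  · choose c hc using fun i => exists_sub_mem_varsPart (y i)
    have h1 := Submodule.mem_map_of_mem (f := Ψ) (Submodule.mem_ideal_smul_top_pi hc)
    rw [Submodule.map_smul''] at h1
    have h2 := Submodule.sub_mem _ hy (Submodule.smul_mono le_rfl le_top h1)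
    rw [hΨ, hΨ, ← Finset.sum_sub_distrib] at h2
    have h3 : ∑ i, (φ i).liftBaseChange R (c i) ∈ varsPart (Fin n) R K := by
      refine mem_varsPart_iff.2 ?_
      convert h2 using 1
      refine Finset.sum_congr rfl fun i _ => ?_
      rw [map_sub, sub_sub_cancel, liftBaseChange_rTensor]
    refine Submodule.mem_ideal_smul_top_pi fun i => ?_
    have h4 := hc i
    rwa [hind c h3 i, map_zero, sub_zero] at h4

/-- A finitely generated locally nilpotent module which is projective over `R[V]` and generated over
`R[V]` in weights strictly below `a` has a finite filtration by standard modules whose lowest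
weights are strictly below `a`. -/
theorem hasFiniteFiltration (hK : LocallyNilpotent n κ h K)
    [Module.Finite (MvPolynomial (Fin n) R) K] [Module.Projective (MvPolynomial (Fin n) R) K]
    {a : ResidueField R}
    (hspan : Submodule.span (MvPolynomial (Fin n) R)
      {m : K | ∃ j : ℕ, m ∈ weightSpace (eulerEnd n κ h K) (a - (j + 1 : ℕ))} = ⊤) :
    HighestWeight.HasFiniteFiltration (standard (d := d) (n := n) κ h)
      {E : Irr (W d n) | ∃ j : ℕ, 1 ≤ j ∧ lowestWeight κ h E = a - j} K := by
  have := finite_W (d := d) (n := n)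
  obtain ⟨ι, _, deg, E, φ, hG, hφ, hgen, hind⟩ := exists_graded_generators hK a
  have hgen' := fun l x => mem_span_graded_generators hK hφ hgen l (x := x)
  obtain ⟨e, he⟩ := exists_equiv_fin_antitone deg
  let U : ℕ → Set K := fun t => {x | ∃ i v, (e i : ℕ) < t ∧ x = φ i v}
  have hUmono : Monotone U := by
    rintro t t' htt _ ⟨i, v, hi, rfl⟩
    exact ⟨i, v, hi.trans_le htt, rfl⟩
  have hUY : ∀ y i v, (tautological (d := d) (n := n) κ h).Y y • φ i v ∈
      Submodule.span (MvPolynomial (Fin n) R) (U (e i)) := by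
    intro y i v
    have h1 := vec_smul_mem_weightSpace (hφ i v) y
    rw [sub_sub, ← Nat.cast_succ] at h1
    refine Submodule.span_mono ?_ (hgen' _ _ h1)
    rintro _ ⟨i', v', hi', rfl⟩
    exact ⟨i', v', he i i' (by lia), rfl⟩
  have hF := fun t => span_poly_stable (d := d) (κ := κ) (h := h) (M := K) (U := U t) rfl
    (by
      rintro y _ ⟨i, v, hi, rfl⟩
      exact Submodule.span_mono (hUmono hi.le) (hUY y i v))
    (by
      rintro g _ ⟨i, v, hi, rfl⟩
      exact Submodule.subset_span ⟨i, _, hi, (hG i g v).symm⟩)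
  choose F hF using hF
  have hUtop : Submodule.span (MvPolynomial (Fin n) R) {y | ∃ i v, y = φ i v} = ⊤ := by
    rw [← top_le_iff, ← hspan]
    refine Submodule.span_le.2 ?_
    rintro x ⟨j, hj⟩
    refine Submodule.span_mono ?_ (hgen' j x hj)
    rintro _ ⟨i, v, -, rfl⟩
    exact ⟨i, v, rfl⟩
  have hΨ := injective_graded_generators hind hUtop
  -- Elements of `F t` involve only the generators with index less than `t`.
  have hFt : ∀ t, ∀ x ∈ F t, ∃ y : ∀ i, MvPolynomial (Fin n) R ⊗[ℂ] (E i).rep.V,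
      (∀ i, t ≤ e i → y i = 0) ∧
        ∑ i, (φ i).liftBaseChange (MvPolynomial (Fin n) R) (y i) = x := by
    classical
    intro t x hx
    rw [hF] at hx
    induction hx using Submodule.span_induction with
    | mem x hx =>
      obtain ⟨i, v, hi, rfl⟩ := hx
      refine ⟨Pi.single i (1 ⊗ₜ v), fun j hj => Pi.single_eq_of_ne (by rintro rfl; lia) _, ?_⟩
      rw [LinearMap.sum_liftBaseChange_single, LinearMap.liftBaseChange_tmul, one_smul]
    | zero => exact ⟨0, fun _ _ => rfl, Finset.sum_eq_zero fun i _ => map_zero _⟩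
    | add x x' _ _ hx hx' =>
      obtain ⟨y, hy, rfl⟩ := hx
      obtain ⟨y', hy', rfl⟩ := hx'
      refine ⟨y + y', fun i hi => ?_, ?_⟩
      · rw [Pi.add_apply, hy i hi, hy' i hi, add_zero]
      · rw [← Finset.sum_add_distrib]
        exact Finset.sum_congr rfl fun i _ => map_add _ _ _
    | smul p x _ hx =>
      obtain ⟨y, hy, rfl⟩ := hx
      refine ⟨p • y, fun i hi => ?_, ?_⟩
      · rw [Pi.smul_apply, hy i hi, smul_zero]
      · rw [Finset.smul_sum]
        exact Finset.sum_congr rfl fun i _ =>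
          map_smul ((φ i).liftBaseChange (MvPolynomial (Fin n) R)) p (y i)
  have hFmono : Monotone F := fun t t' htt x hx =>
    (hF t' x).2 (Submodule.span_mono (hUmono htt) ((hF t x).1 hx))
  refine ⟨Fintype.card ι, F, hFmono, ?_, ?_, fun t ht => ?_⟩
  · rw [eq_bot_iff]
    intro x hx
    obtain ⟨y, hy, rfl⟩ := hFt 0 x hx
    exact Finset.sum_eq_zero fun i _ => by rw [hy i (Nat.zero_le _), map_zero]
  · rw [eq_top_iff]
    intro x _
    rw [hF]
    have hx : x ∈ Submodule.span (MvPolynomial (Fin n) R) {y | ∃ i v, y = φ i v} := by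
      rw [hUtop]
      trivial
    refine Submodule.span_mono ?_ hx
    rintro _ ⟨i, v, rfl⟩
    exact ⟨i, v, (e i).2, rfl⟩
  · obtain ⟨i, hi⟩ : ∃ i, (e i : ℕ) = t := ⟨e.symm ⟨t, ht⟩, by rw [Equiv.apply_symm_apply]⟩
    have hmem : ∀ v, φ i v ∈ F (t + 1) := fun v =>
      (hF _ _).2 (Submodule.subset_span ⟨i, v, by lia, rfl⟩)
    let N := (F t).submoduleOf (F (t + 1))
    let f : (E i).rep.V →ₗ[ℂ] (F (t + 1) ⧸ N) :=
      (N.mkQ.restrictScalars ℂ) ∘ₗ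
        (φ i).codRestrict ((F (t + 1)).restrictScalars ℂ) hmem
    have hfG : ∀ g v, f ((E i).rep.ρ g v) = (tautological (d := d) (n := n) κ h).G g • f v :=
      fun g v => congrArg N.mkQ (Subtype.ext (hG i g v))
    have hfY : ∀ y v, (tautological (d := d) (n := n) κ h).Y y • f v = 0 := fun y v =>
      (Submodule.Quotient.mk_eq_zero N).2 ((hF t _).2 (hi ▸ hUY y i v))
    have hfc : ∀ c : MvPolynomial (Fin n) R ⊗[ℂ] (E i).rep.V, ∃ hc,
        f.liftBaseChange (MvPolynomial (Fin n) R) c =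
          N.mkQ ⟨(φ i).liftBaseChange (MvPolynomial (Fin n) R) c, hc⟩ := by
      intro c
      induction c with
      | zero => exact ⟨by rw [map_zero]; exact Submodule.zero_mem _, by simp only [map_zero]; rfl⟩
      | add x y hx hy =>
        obtain ⟨hx, hx'⟩ := hx
        obtain ⟨hy, hy'⟩ := hy
        refine ⟨by rw [map_add]; exact Submodule.add_mem _ hx hy, ?_⟩
        rw [map_add, hx', hy', ← map_add]
        exact congrArg N.mkQ (Subtype.ext (map_add _ _ _).symm)
      | tmul p v =>
        refine ⟨?_, ?_⟩
        · rw [LinearMap.liftBaseChange_tmul, hF]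
          exact Submodule.smul_mem _ _ ((hF _ _).1 (hmem v))
        · rw [LinearMap.liftBaseChange_tmul]
          exact congrArg N.mkQ (Subtype.ext (LinearMap.liftBaseChange_tmul _ _ _ _).symm)
    have hfinj : Function.Injective (f.liftBaseChange (MvPolynomial (Fin n) R)) := by
      classical
      rw [injective_iff_map_eq_zero]
      intro c hc
      obtain ⟨h1, h2⟩ := hfc c
      rw [h2] at hc
      obtain ⟨y, hy, hyc⟩ := hFt t _ ((Submodule.Quotient.mk_eq_zero N).1 hc)
      have h3 : y = Pi.single i c :=
        hΨ (hyc.trans (LinearMap.sum_liftBaseChange_single φ i c).symm)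
      have h4 := hy i hi.ge
      rwa [h3, Pi.single_eq_same] at h4
    have hfspan : Submodule.span (MvPolynomial (Fin n) R) (Set.range f) = ⊤ := by
      rw [eq_top_iff]
      intro z _
      obtain ⟨⟨x, hx⟩, rfl⟩ := N.mkQ_surjective z
      obtain ⟨y, hy, hyx⟩ := hFt (t + 1) x hx
      obtain ⟨h1, h2⟩ := hfc (y i)
      have h3 : N.mkQ ⟨x, hx⟩ = f.liftBaseChange (MvPolynomial (Fin n) R) (y i) := by
        rw [h2, ← sub_eq_zero, ← map_sub]
        refine (Submodule.Quotient.mk_eq_zero N).2 ?_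
        change x - (φ i).liftBaseChange (MvPolynomial (Fin n) R) (y i) ∈ F t
        classical
        rw [← hyx, ← Finset.add_sum_erase _ _ (Finset.mem_univ i), add_sub_cancel_left]
        refine Submodule.sum_mem _ fun j hj => ?_
        by_cases hjt : (e j : ℕ) < t
        · rw [hF]
          refine LinearMap.liftBaseChange_mem _ (fun v => Submodule.subset_span ?_) _
          exact ⟨j, v, hjt, rfl⟩
        · have h4 : e j ≠ e i := e.injective.ne (Finset.ne_of_mem_erase hj)
          have h5 : (e j : ℕ) ≠ e i := fun h => h4 (Fin.ext h)
          rw [hy j (by lia), map_zero]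
          exact Submodule.zero_mem _
      rw [h3]
      exact LinearMap.liftBaseChange_mem _ (fun v => Submodule.subset_span (Set.mem_range_self v)) _
    refine ⟨E i, ⟨deg i + 1, by lia, ?_⟩, nonempty_equiv_standard hfG hfY hfspan hfinj⟩
    -- The weight of the generating vectors in the subquotient determines the lowest weight.
    obtain ⟨v, hv⟩ := exists_ne (0 : (E i).rep.V)
    have hfv : f v ≠ 0 := fun h0 => hv <|
      Module.FaithfullyFlat.tensorProduct_mk_injective (A := ℂ) (B := MvPolynomial (Fin n) R)
        (E i).rep.V <| hfinj <| by
          rw [TensorProduct.mk_apply, LinearMap.liftBaseChange_tmul, one_smul, h0, map_zero,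
            map_zero]
    refine eq_of_mem_weightSpace hfv (mem_weightSpace_of_singular hfG fun y => hfY y v) ?_
    have h1 : (⟨φ i v, hmem v⟩ : F (t + 1)) ∈ weightSpace (eulerEnd n κ h (F (t + 1)))
        (a - (deg i + 1 : ℕ)) :=
      mem_weightSpace_of_injective (T' := eulerEnd n κ h K)
        (f := (F (t + 1)).subtype.restrictScalars R) (fun _ => rfl) Subtype.val_injective (hφ i v)
    exact map_mem_eulerWeightSpace N.mkQ h1

end Filtration

end Cherednik

namespace ProjectiveGenerator

variable (R : Type u) [CommRing R] {H : Type u} [Ring H] [Algebra R H]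

/-- The morphisms of the module category, as linear maps. The `R`-module structure on the former is
that of the `R`-linear category. -/
def homLinearEquiv (P : ModuleCat.{u} H) (X : Type u) [AddCommGroup X] [Module H X] [Module R X]
    [IsScalarTower R H X] :
    letI : Module R (P ⟶ ModuleCat.of H X) := Linear.homModule _ _
    (P →ₗ[H] X) ≃ₗ[R] (P ⟶ ModuleCat.of H X) :=
  letI : Module R (P ⟶ ModuleCat.of H X) := Linear.homModule _ _
  { toFun := ModuleCat.ofHom
    invFun := ModuleCat.Hom.hom
    left_inv := fun _ => rfl
    right_inv := fun _ => rfl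
    map_add' := fun _ _ => rfl
    map_smul' := fun r f => ModuleCat.hom_ext <| LinearMap.ext fun p =>
      (algebraMap_smul H r (f p)).symm }

variable {R} {P : ModuleCat.{u} H} {X : Type u} [AddCommGroup X] [Module H X] [Module R X]
  [IsScalarTower R H X]

theorem finite_hom (hfin : Module.Finite R (P →ₗ[H] X)) :
    letI : Module R (P ⟶ ModuleCat.of H X) := Linear.homModule _ _
    Module.Finite R (P ⟶ ModuleCat.of H X) :=
  letI : Module R (P ⟶ ModuleCat.of H X) := Linear.homModule _ _
  Module.Finite.equiv (homLinearEquiv R P X)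

theorem projective_hom (hproj : Module.Projective R (P →ₗ[H] X)) :
    letI : Module R (P ⟶ ModuleCat.of H X) := Linear.homModule _ _
    Module.Projective R (P ⟶ ModuleCat.of H X) :=
  letI : Module R (P ⟶ ModuleCat.of H X) := Linear.homModule _ _
  Module.Projective.of_equiv (homLinearEquiv R P X)

end ProjectiveGenerator

namespace Cherednik

open IrrepClass FiniteGroupRep WeightSpace IsLocalRing

/-! ### The filtration of the kernel of `P(E) → Δ(E)` -/

section KernelFiltration

variable {d n : ℕ} [NeZero d] {R : Type u} [CommRing R] [Algebra ℂ R] [IsLocalRing R]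
  {κ : {k : ZMod d // k ≠ 0} → R} {h : R} {E : Irr (W d n)}

/-- A surjection to `Δ(E)` from a module that is generated by a copy of `E` of weight `-c_E` and
projective over `R[V]` has a kernel filtered by larger standard modules. -/
theorem hasFiniteFiltration_ker {P : Type u} [AddCommGroup P] [Module (Alg d n κ h) P]
    [Module R P] [IsScalarTower R (Alg d n κ h) P] [Module ℂ P] [IsScalarTower ℂ R P]
    [IsScalarTower ℂ (Alg d n κ h) P] [Module (MvPolynomial (Fin n) R) P]
    [IsScalarTower (MvPolynomial (Fin n) R) (Alg d n κ h) P]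
    [IsScalarTower R (MvPolynomial (Fin n) R) P] [IsScalarTower ℂ (MvPolynomial (Fin n) R) P]
    [Module.Finite (MvPolynomial (Fin n) R) P] [Module.Projective (MvPolynomial (Fin n) R) P]
    (hP : LocallyNilpotent n κ h P) (q : P →ₗ[Alg d n κ h] standard κ h E) (w : E.rep.V →ₗ[ℂ] P)
    (hq : ∀ e, q (w e) = standardIncl κ h E e)
    (hw : Submodule.span (Alg d n κ h) (Set.range w) = ⊤)
    (hG : ∀ g e, w (E.rep.ρ g e) = (tautological (d := d) (n := n) κ h).G g • w e)
    (hwt : ∀ e, w e ∈ weightSpace (eulerEnd n κ h P) (lowestWeight κ h E)) :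
    HighestWeight.HasFiniteFiltration (standard (d := d) (n := n) κ h)
      {E' | (irrPreorder κ h).lt E E'} (LinearMap.ker q) := by
  have := projective_ker q w hq
  have := finite_poly_ker q w hq
  obtain ⟨m, F, hF, h0, hm, hquot⟩ := hasFiniteFiltration
    (hP.of_injective (LinearMap.ker q).subtype Subtype.val_injective)
    (span_weightSpace_ker q w hq hw hG hwt)
  refine ⟨m, F, hF, h0, hm, fun i hi => ?_⟩
  obtain ⟨E', ⟨j, hj, hE'⟩, hiso⟩ := hquot i hi
  exact ⟨E', irrPreorder_lt_of_eq_sub hj hE', hiso⟩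

variable (κ h E)

instance finite_poly_cover : Module.Finite (MvPolynomial (Fin n) R) (Cover κ h E) :=
  finite_poly_of_locallyNilpotent (locallyNilpotent_cover κ h E) (finite_cover κ h E)

theorem hasFiniteFiltration_ker_coverToStandard :
    HighestWeight.HasFiniteFiltration (standard (d := d) (n := n) κ h)
      {E' | (irrPreorder κ h).lt E E'} (LinearMap.ker (coverToStandard κ h E)) :=
  hasFiniteFiltration_ker (locallyNilpotent_cover κ h E) (coverToStandard κ h E) (coverIncl κ h E)
    (coverToStandard_coverIncl κ h E) (span_coverIncl κ h E) (coverIncl_rep κ h E)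
    (coverIncl_mem κ h E)

theorem cover_mem_categoryO : categoryO d n κ h (ModuleCat.of _ (Cover κ h E)) :=
  categoryO_of_iff.2 ⟨finite_cover κ h E, locallyNilpotent_cover κ h E⟩

end KernelFiltration

/-! ### Homomorphisms from `P(E)` -/

section Hom

variable {d n : ℕ} [NeZero d] {R : Type u} [CommRing R] [Algebra ℂ R] [IsLocalRing R]
  {κ : {k : ZMod d // k ≠ 0} → R} {h : R}
  {X : Type u} [AddCommGroup X] [Module (Alg d n κ h) X]
  [Module R X] [IsScalarTower R (Alg d n κ h) X] [Module ℂ X] [IsScalarTower ℂ R X]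
  [IsScalarTower ℂ (Alg d n κ h) X]

variable (n κ h X) in
/-- The action of `W` on a weight space. -/
def weightRep (a : ResidueField R) : Representation ℂ (W d n) (weightSpace (eulerEnd n κ h X) a) where
  toFun g := (moduleRep n κ h X g).restrict
    (p := (weightSpace (eulerEnd n κ h X) a).restrictScalars ℂ)
    (q := (weightSpace (eulerEnd n κ h X) a).restrictScalars ℂ)
    fun _ hx => grp_smul_mem_weightSpace hx g
  map_one' := LinearMap.ext fun x => Subtype.ext
    (LinearMap.congr_fun (map_one (moduleRep n κ h X)) x.1)
  map_mul' g g' := LinearMap.ext fun x => Subtype.ext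
    (LinearMap.congr_fun (map_mul (moduleRep n κ h X) g g') x.1)

theorem weightRep_smul (a : ResidueField R) (g : W d n) (r : R)
    (x : weightSpace (eulerEnd n κ h X) a) :
    weightRep n κ h X a g (r • x) = r • weightRep n κ h X a g x :=
  Subtype.ext (smul_comm ((tautological (d := d) (n := n) κ h).G g) r x.1)

variable {N : ℕ} (E : Fin N → Irr (W d n))

variable (κ h) in
/-- A finite direct sum of objects `P(E)`. -/
abbrev coverSum : ModuleCat.{u} (Alg d n κ h) := ModuleCat.of _ (∀ i, Cover κ h (E i))

variable (κ h) in
theorem coverSum_mem_categoryO : categoryO d n κ h (coverSum κ h E) :=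
  categoryO_of_iff.2 ⟨haveI := fun i => finite_cover κ h (E i); Module.Finite.pi,
    .pi fun i => locallyNilpotent_cover κ h (E i)⟩

theorem projective_pi {S J : Type*} [CommRing S] [Finite J] (M : J → Type*)
    [∀ j, AddCommGroup (M j)] [∀ j, Module S (M j)] [∀ j, Module.Projective S (M j)] :
    Module.Projective S (∀ j, M j) := by
  classical
  have := Fintype.ofFinite J
  exact Module.Projective.of_equiv (DFinsupp.linearEquivFunOnFintype (R := S) (M := M))

instance (E : Irr (W d n)) : Module.Projective R (Cover κ h E) := by
  have : Module.Free R (CoverInd κ h E) := Module.Free.trans (S := MvPolynomial (Fin n) R)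
  exact Module.Projective.of_split
    ((LinearMap.range (coverProj κ h E)).subtype.restrictScalars R)
    ((coverProj κ h E).rangeRestrict.restrictScalars R)
    (LinearMap.ext fun m => Subtype.ext <| by
      obtain ⟨_, m, rfl⟩ := m
      exact LinearMap.congr_fun (coverProj_comp_coverProj κ h E) m)

variable (κ h) in
/-- The generators of a summand of a sum of objects `P(E)`. -/
def coverSumIncl (i : Fin N) : (E i).rep.V →ₗ[ℂ] coverSum κ h E :=
  (LinearMap.single (Alg d n κ h) (fun i => Cover κ h (E i)) i).restrictScalars ℂ ∘ₗ
    coverIncl κ h (E i)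

theorem hom_coverSumIncl_mem (f : coverSum κ h E →ₗ[Alg d n κ h] X) (i : Fin N) (e : (E i).rep.V) :
    f (coverSumIncl κ h E i e) ∈ weightSpace (eulerEnd n κ h X) (lowestWeight κ h (E i)) :=
  map_mem_eulerWeightSpace (f ∘ₗ LinearMap.single (Alg d n κ h) (fun i => Cover κ h (E i)) i)
    (coverIncl_mem κ h (E i) e)

theorem hom_coverSumIncl_rep (f : coverSum κ h E →ₗ[Alg d n κ h] X) (i : Fin N) (g : W d n)
    (e : (E i).rep.V) : f (coverSumIncl κ h E i ((E i).rep.ρ g e)) =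
      (tautological (d := d) (n := n) κ h).G g • f (coverSumIncl κ h E i e) := by
  let f' := f ∘ₗ LinearMap.single (Alg d n κ h) (fun i => Cover κ h (E i)) i
  change f' (coverIncl κ h (E i) ((E i).rep.ρ g e)) =
    (tautological (d := d) (n := n) κ h).G g • f' (coverIncl κ h (E i) e)
  rw [coverIncl_rep, map_smul]

/-- A homomorphism from a sum of objects `P(E)` amounts to equivariant maps from the `E` to the
weight spaces at the lowest weights of the `Δ(E)`. -/
def coverSumHomEval : (coverSum κ h E →ₗ[Alg d n κ h] X) →ₗ[R]
    ∀ i, equivariantHom (weightRep n κ h X (lowestWeight κ h (E i))) (weightRep_smul _)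
      (E i).rep where
  toFun f i := ⟨
    { toFun := fun e => ⟨f (coverSumIncl κ h E i e), hom_coverSumIncl_mem E f i e⟩
      map_add' := fun e e' => Subtype.ext <| by
        change f _ = f _ + f _
        rw [map_add, map_add]
      map_smul' := fun c e => Subtype.ext <| by
        change f _ = c • f _
        rw [map_smul]
        exact f.map_smul_of_tower c _ },
    fun g e => Subtype.ext (hom_coverSumIncl_rep E f i g e)⟩
  map_add' _ _ := rfl
  map_smul' _ _ := rfl

theorem coverSumHomEval_apply (f : coverSum κ h E →ₗ[Alg d n κ h] X) (i : Fin N)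
    (e : (E i).rep.V) : ((coverSumHomEval E f i).1 e : X) = f (coverSumIncl κ h E i e) := rfl

/-- `⊕ P(E_i)` represents the functor sending a module to the sum of the equivariant maps from the
`E_i` to the weight spaces of the weights `-c_{E_i}`. -/
theorem coverSumHomEval_bijective (hX : LocallyNilpotent n κ h X) :
    Function.Bijective (coverSumHomEval (κ := κ) (h := h) (X := X) E) := by
  constructor
  · intro f f' hff
    refine LinearMap.pi_ext' fun i => cover_ext κ h (E i) fun e => ?_
    exact congrArg (fun φ => ((φ i).1 e : X)) hff
  · intro φ
    let ψ := fun i => coverLift hX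
      ((weightSpace (eulerEnd n κ h X) (lowestWeight κ h (E i))).subtype.restrictScalars ℂ ∘ₗ
        (φ i).1) (fun g e => congrArg Subtype.val ((φ i).2 g e)) fun e => ((φ i).1 e).2
    refine ⟨LinearMap.lsum (Alg d n κ h) (fun i => Cover κ h (E i)) ℕ ψ, ?_⟩
    refine funext fun i => Subtype.ext <| LinearMap.ext fun e => Subtype.ext ?_
    rw [coverSumHomEval_apply]
    refine (LinearMap.lsum_piSingle (Alg d n κ h) _ ℕ ψ i (coverIncl κ h (E i) e)).trans ?_
    exact coverLift_coverIncl hX _ _ _ e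

theorem finite_coverSum_hom (hX : LocallyNilpotent n κ h X)
    (hfin : ∀ a, Module.Finite R (weightSpace (eulerEnd n κ h X) a)) :
    Module.Finite R (coverSum κ h E →ₗ[Alg d n κ h] X) := by
  have := finite_W (d := d) (n := n)
  have := fun i => finite_equivariantHom (weightRep n κ h X (lowestWeight κ h (E i)))
    (weightRep_smul _) (E i)
  exact Module.Finite.equiv (LinearEquiv.ofBijective _ (coverSumHomEval_bijective E hX)).symm

theorem projective_coverSum_hom (hX : LocallyNilpotent n κ h X) [Module.Projective R X] :
    Module.Projective R (coverSum κ h E →ₗ[Alg d n κ h] X) := by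
  have := finite_W (d := d) (n := n)
  have := fun a => projective_weightSpace hX.locallySplit a
  have := fun i => projective_equivariantHom (weightRep n κ h X (lowestWeight κ h (E i)))
    (weightRep_smul _) (E i)
  have := projective_pi (S := R) fun i =>
    equivariantHom (weightRep n κ h X (lowestWeight κ h (E i))) (weightRep_smul _) (E i).rep
  exact Module.Projective.of_equiv (LinearEquiv.ofBijective _ (coverSumHomEval_bijective E hX)).symm

theorem liftsThrough_coverSum :
    ProjectiveGenerator.LiftsThrough (categoryO d n κ h) (coverSum κ h E) := by
  intro X Y hX _ f hf g
  choose ψ hψ using fun i => exists_cover_lift (categoryO_iff.1 hX).2 f hf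
    (g ∘ₗ LinearMap.single (Alg d n κ h) (fun i => Cover κ h (E i)) i)
  refine ⟨LinearMap.lsum (Alg d n κ h) (fun i => Cover κ h (E i)) ℕ ψ,
    LinearMap.pi_ext' fun i => ?_⟩
  rw [← hψ, LinearMap.comp_assoc]
  congr 1
  exact LinearMap.ext fun x => LinearMap.lsum_piSingle _ _ ℕ ψ i x

/-- The maps from the objects `P(E)` generate each locally nilpotent module `X`: otherwise the
quotient of `X` by their images would receive a nonzero map from some `Δ(E)`, and the induced map
from `P(E)` would lift to `X`. -/
theorem iSup_range_coverSum_hom (hE : Function.Surjective E) (hX : LocallyNilpotent n κ h X) :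
    ⨆ g : coverSum κ h E →ₗ[Alg d n κ h] X, LinearMap.range g = ⊤ := by
  set S : Submodule (Alg d n κ h) X :=
    ⨆ g : coverSum κ h E →ₗ[Alg d n κ h] X, LinearMap.range g with hS
  by_contra hS'
  have : Nontrivial (X ⧸ S) := Submodule.Quotient.nontrivial_iff.2 hS'
  obtain ⟨E', f, hf⟩ := exists_standard_hom_ne_zero (hX.of_surjective S.mkQ S.mkQ_surjective)
  obtain ⟨i, rfl⟩ := hE E'
  obtain ⟨ψ, hψ⟩ := exists_cover_lift hX S.mkQ S.mkQ_surjective (f ∘ₗ coverToStandard κ h (E i))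
  refine hf (LinearMap.ext fun m => ?_)
  obtain ⟨x, rfl⟩ := coverToStandard_surjective κ h (E i) m
  refine (LinearMap.congr_fun hψ x).symm.trans ((Submodule.Quotient.mk_eq_zero S).2 ?_)
  rw [hS]
  refine Submodule.mem_iSup_of_mem
    (ψ ∘ₗ LinearMap.proj (R := Alg d n κ h) (φ := fun i => Cover κ h (E i)) i) ⟨Pi.single i x, ?_⟩
  rw [LinearMap.comp_apply, LinearMap.proj_apply, Pi.single_eq_same]

theorem generates_of_iSup_range {A : Type u} [Ring A] (C : ObjectProperty (ModuleCat.{u} A))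
    (P : ModuleCat.{u} A) (hfin : ∀ X, C X → Module.Finite A X)
    (hP : ∀ X, C X → ⨆ g : P →ₗ[A] X, LinearMap.range g = ⊤) :
    ProjectiveGenerator.Generates C P := by
  classical
  intro X hX
  obtain ⟨t, ht⟩ := CompleteLattice.IsCompactElement.exists_finset_of_le_iSup _
    ((Submodule.fg_iff_compact _).1 (hfin X hX).fg_top) _ (hP X hX).ge
  refine ⟨t.card, fun i => (t.equivFin.symm i).1, fun x => ?_⟩
  obtain ⟨μ, hμ⟩ := (Submodule.mem_iSup_finset_iff_exists_sum _ _).1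
    (ht (Submodule.mem_top (x := x)))
  choose p hp using fun g => (μ g).2
  refine ⟨fun i => p (t.equivFin.symm i).1, ?_⟩
  rw [← hμ, ← Finset.sum_coe_sort t fun g => (μ g : X), ← t.equivFin.symm.sum_comp]
  exact Finset.sum_congr rfl fun i _ => (hp _).symm

end Hom

/-! ### Category `O` is a highest weight category -/

section Main

variable {d n : ℕ} [NeZero d] {R : Type u} [CommRing R] [Algebra ℂ R] [IsLocalRing R]
  (κ : {k : ZMod d // k ≠ 0} → R) (h : R)

/-- `P(E)` as an object of category `O`. -/
def coverObj (E : Irr (W d n)) : (categoryO d n κ h).FullSubcategory :=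
  ⟨ModuleCat.of _ (Cover κ h E), cover_mem_categoryO κ h E⟩

/-- Category `O` is closed under quotients, so that epimorphisms are surjective. -/
theorem surjective_of_epi_categoryO {X Y : (categoryO d n κ h).FullSubcategory} (f : X ⟶ Y)
    [Epi f] : Function.Surjective f.hom.hom := by
  let Q : (categoryO d n κ h).FullSubcategory :=
    ⟨ModuleCat.of _ (Y.obj ⧸ LinearMap.range f.hom.hom), categoryO_of_surjective Y.property
      (LinearMap.range f.hom.hom).mkQ (Submodule.mkQ_surjective _)⟩
  let g : Y ⟶ Q := ObjectProperty.homMk (ModuleCat.ofHom (LinearMap.range f.hom.hom).mkQ)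
  let g' : Y ⟶ Q := ObjectProperty.homMk (ModuleCat.ofHom 0)
  have h1 : g = g' := (cancel_epi f).1 <| by
    apply ObjectProperty.hom_ext
    apply ModuleCat.hom_ext
    exact LinearMap.ext fun x => (Submodule.Quotient.mk_eq_zero _).2 ⟨x, rfl⟩
  intro y
  have h2 : (LinearMap.range f.hom.hom).mkQ y = 0 := congrArg (fun k : Y ⟶ Q => k.hom.hom y) h1
  exact (Submodule.Quotient.mk_eq_zero _).1 h2

theorem projective_coverObj (E : Irr (W d n)) : Projective (coverObj κ h E) where
  factors {Y X} f e _ := by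
    obtain ⟨ψ, hψ⟩ := exists_cover_lift (categoryO_iff.1 Y.property).2 e.hom.hom
      (surjective_of_epi_categoryO κ h e) f.hom.hom
    refine ⟨ObjectProperty.homMk (ModuleCat.ofHom ψ), ?_⟩
    apply ObjectProperty.hom_ext
    apply ModuleCat.hom_ext
    exact hψ

variable [IsNoetherianRing R]

/-- The sum `P` of the objects `P(E)` is a projective generator of category `O`, and `B =
End(P)ᵒᵖ`. -/
theorem exists_equivalence_categoryO : ∃ (B : Type u) (_ : Ring B) (_ : Algebra R B),
    Module.Finite R B ∧ Module.Projective R B ∧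
      ∃ e : (categoryO d n κ h).FullSubcategory ≌ FGModuleCat.{u} B, e.functor.Linear R ∧
        ∀ E, letI := HighestWeight.restrictModule R
              (e.functor.obj ⟨standard κ h E, standard_mem_categoryO κ h E⟩).obj
          Module.Projective R
            (e.functor.obj ⟨standard κ h E, standard_mem_categoryO κ h E⟩).obj := by
  have := finite_W (d := d) (n := n)
  have := finite_irr (G := W d n)
  obtain ⟨N, ⟨E⟩⟩ := Finite.exists_equiv_fin (Irr (W d n))
  have hP := coverSum_mem_categoryO κ h E.symm
  refine ProjectiveGenerator.exists_equivalence (standard κ h) (standard_mem_categoryO κ h)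
    (generates_of_iSup_range _ _ (fun _ hX => hX.1) fun _ hX =>
      iSup_range_coverSum_hom E.symm E.symm.surjective (categoryO_iff.1 hX).2)
    (liftsThrough_coverSum E.symm) hP
    (fun _ _ hY f hf => categoryO_of_injective hY f hf)
    (fun _ _ hX f hf => categoryO_of_surjective hX f hf) (fun m => ?_) (fun X hX => ?_) ?_
    fun E' => ?_
  · have hP' := categoryO_iff.1 hP
    have := hP'.1
    exact categoryO_of_iff.2 ⟨Module.Finite.pi,
      .pi fun _ => .pi fun i => locallyNilpotent_cover κ h (E.symm i)⟩
  · obtain ⟨hfin, hnil⟩ := categoryO_iff.1 hX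
    have := finite_poly_of_locallyNilpotent hnil hfin
    exact ProjectiveGenerator.finite_hom (finite_coverSum_hom E.symm hnil
      fun a => finite_weightSpace_of_finite_poly hnil.locallySplit a)
  · have := projective_pi (S := R) fun i => Cover κ h (E.symm i)
    exact ProjectiveGenerator.projective_hom
      (projective_coverSum_hom E.symm (.pi fun i => locallyNilpotent_cover κ h (E.symm i)))
  · have h1 : ∀ Y : ModuleCat.{u} (Alg d n κ h), LocallyNilpotent n κ h Y → Module.Projective R Y →
        Module.Projective R (coverSum κ h E.symm ⟶ Y) := fun Y hY _ =>
      ProjectiveGenerator.projective_hom (projective_coverSum_hom E.symm hY)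
    exact h1 _ locallyNilpotent_standard inferInstance

theorem isSplitHighestWeight_categoryO : HighestWeight.IsSplitHighestWeight R
    (categoryO d n κ h) (irrPreorder κ h) (standard κ h) (standard_mem_categoryO κ h) where
  finite := have := finite_W (d := d) (n := n); finite_irr
  containsZero := containsZero_categoryO
  closedProducts := isClosedUnderFiniteProducts_categoryO
  closedKernels := have := isClosedUnderSubobjects_categoryO (κ := κ) (h := h) (n := n); inferInstance
  closedCokernels := have := isClosedUnderQuotients_categoryO (κ := κ) (h := h) (n := n); inferInstance
  projective_standard E := inferInstanceAs (Module.Projective R (standard κ h E))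
  le_of_hom_ne_zero E E' f hf := irrPreorder_le_iff.2
    (exists_of_standard_hom_ne_zero f.hom fun h0 => hf (ModuleCat.hom_ext h0))
  isZero_of_hom_eq_zero N hN hhom := by
    by_contra hN0
    have : Nontrivial N := by
      by_contra hnt
      have := not_nontrivial_iff_subsingleton.1 hnt
      exact hN0 (ModuleCat.isZero_of_subsingleton N)
    obtain ⟨E, f, hf⟩ := exists_standard_hom_ne_zero (categoryO_iff.1 hN).2
    exact hf (congrArg ModuleCat.Hom.hom (hhom E (ModuleCat.ofHom f)))
  exists_projective E := ⟨coverObj κ h E,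
    ObjectProperty.homMk (ModuleCat.ofHom (coverToStandard κ h E)), projective_coverObj κ h E,
    coverToStandard_surjective κ h E, hasFiniteFiltration_ker_coverToStandard κ h E⟩
  exists_equivalence := exists_equivalence_categoryO κ h
  end_standard := end_standard_bijective κ h

end Main

end Cherednik

end

theorem mainTheorem3 (d n : ℕ) [NeZero d] (R : Type u) [CommRing R] [Algebra ℂ R]
    [IsRegularLocalRing R] (κ : {k : ZMod d // k ≠ 0} → R) (h : R) :
    ∃ mem : ∀ E : IrrepClass.Irr (Cherednik.W d n),
        Cherednik.categoryO d n κ h (Cherednik.standard κ h E),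
      HighestWeight.IsSplitHighestWeight R (Cherednik.categoryO d n κ h)
        (Cherednik.irrPreorder κ h) (Cherednik.standard κ h) mem := by
  exact ⟨Cherednik.standard_mem_categoryO κ h, Cherednik.isSplitHighestWeight_categoryO κ h⟩
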